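/- Let $M$ be a smooth manifold (Hausdorff, second countable), let $(E,g)$ be a real vector bundle over $M$ of even **positive** rank with a pseudo-Euclidean metric $g$, by which $E\cong E^*$, and let $S$ be a spinor bundle: a complex vector bundle with a smooth isomorphism of algebra bundles $\mathrm{Cl}(E)\otimes\mathbb C\cong\operatorname{End}S$, where $\xi\eta+\eta\xi=2g(\xi,\eta)$ in $\mathrm{Cl}(E)$. Write $\gamma(\xi)$ for the action of $\xi\in\Gamma(E)$ on $\Gamma(S)$. *The graded algebra.* A pair of connections $(\nabla^E,\nabla^S)$ on $E$ and $S$ is compatible if $\nabla^E g=0$ and $[\nabla^S_X,\gamma(\xi)]=\gamma(\nabla^E_X\xi)$ for all vector fields $X$ and all $\xi\in\Gamma(E)$. Let $\mathcal D(M,S)$ be the algebra of differential operators on $S$, generated by $\Gamma(\operatorname{End}S)$ and covariant derivatives, with the $\mathbb Z_2$-grading for which the operators $\nabla^S_X$ of compatible pairs are even and even (odd) sections of the Clifford bundle are even (odd); $[\cdot,\cdot]$ is the graded commutator. Put $\mathcal D_{-1}=0$ and $\mathcal D_k=\{D\in\mathcal D(M,S)\mid [D,\gamma(\xi)]\in\mathcal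 D_{k-1}\ \forall\xi\in\Gamma(E)\}$ for $k\ge 0$. Let $\mathrm{Gr}\,\mathcal D(M,S)=\bigoplus_{k\ge0}\mathcal D_k/\mathcal D_{k-1}$, with the bracket of degree $-2$ induced by $[\mathcal D_k,\mathcal D_l]\subseteq\mathcal D_{k+l-2}$. *The graded manifold.* Let $\mathcal M=T^*[2]E[1]\times_{(E\oplus E^*)[1]}E[1]$, the fibre product over $\psi\mapsto\psi\oplus\frac12 g(\psi,\cdot)$, with the Poisson bracket of degree $-2$ it inherits as a symplectic submanifold $i_{\mathcal M}:\mathcal M\hookrightarrow T^*[2]E[1]$. Let $\mathcal O^{\mathbb C}(\mathcal M)=\mathcal O(\mathcal M)\otimes\mathbb C$ be its graded algebra of complex-valued functions. *The maps.* Let $(\nabla^E,\nabla^S)$ be a compatible pair. Let $\Xi_\nabla=(\pi_\nabla\circ i_{\mathcal M})\oplus\pi:\mathcal M\to T^*[2]M\oplus E[1]$, where $\pi:\mathcal M\to E[1]$ is the projection and $\pi_\nabla:T^*[2]E[1]\to T^*[2]M$ is dual to the horizontal lift of $\nabla^E$: the pullback $\pi_\nabla^*X$ of a vector field $X$ on $M$,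 seen as a fibrewise linear function, is the fibrewise linear function of the vector field $\nabla^E_X$ on $E[1]$. Let $\mathfrak S_\nabla:\mathrm{Gr}\,\mathcal D(M,S)\to\mathcal O^{\mathbb C}(T^*[2]M\oplus E[1])$ be the symbol isomorphism, i.e. the unique isomorphism of algebras that sends the classes of $f\in C^\infty(M)$ in degree $0$, of $\frac1{\sqrt2}\gamma(\xi)$, $\xi\in\Gamma(E)$, in degree $1$, and of $\nabla^S_X$, $X\in\mathfrak X(M)$, in degree $2$ to $f$, $\xi$ and $X$ respectively. **Proposition.** The bracket of $\mathrm{Gr}\,\mathcal D(M,S)$ is a well-defined graded Poisson bracket, the bracket of $\mathcal O(\mathcal M)$ exists and is a graded Poisson bracket, and each is uniquely determined by its description above. Compatible pairs exist, and for each of them $\mathfrak S_\nabla$ exists and is unique. The map $(\Xi_\nabla)^*\circ\mathfrak S_\nabla:\mathrm{Gr}\,\mathcal D(M,S)\to\mathcal O^{\mathbb C}(\mathcal M)$ is an isomorphism of graded Poisson algebras, and it is the same for all compatible pairs $(\nabla^E,\nabla^S)$. -/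

import Mathlib

open Bundle
open scoped Manifold ContDiff TensorProduct DirectSum

noncomputable section

namespace SpinGr

/-! ## Graded Poisson brackets of degree `-2` -/

/-- A graded Poisson bracket of degree `-2` on an algebra `B` with graded pieces `𝒜 k`, `k ∈ ℕ`. -/
structure IsPoissonBracket {𝕜 B : Type*} [Field 𝕜] [Ring B] [Algebra 𝕜 B]
    (𝒜 : ℕ → Submodule 𝕜 B) (b : B →ₗ[𝕜] B →ₗ[𝕜] B) : Prop where
  degree : ∀ k l m x y, x ∈ 𝒜 k → y ∈ 𝒜 l → k + l = m + 2 → b x y ∈ 𝒜 m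
  degree_lt : ∀ k l x y, x ∈ 𝒜 k → y ∈ 𝒜 l → k + l < 2 → b x y = 0
  skew : ∀ k l x y, x ∈ 𝒜 k → y ∈ 𝒜 l → b x y = -((-1 : 𝕜) ^ (k * l) • b y x)
  leibniz : ∀ k l x y z, x ∈ 𝒜 k → y ∈ 𝒜 l →
    b x (y * z) = b x y * z + (-1 : 𝕜) ^ (k * l) • (y * b x z)
  jacobi : ∀ k l x y z, x ∈ 𝒜 k → y ∈ 𝒜 l →
    b x (b y z) = b (b x y) z + (-1 : 𝕜) ^ (k * l) • b y (b x z)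

/-! ## Connections -/

/-- A (Koszul) connection on the `A`-module `P` of sections of a real (`𝕂 = ℝ`) or complex
(`𝕂 = ℂ`) vector bundle, where `A` is the algebra of smooth functions; vector fields are
derivations of `A`. -/
structure Connection (𝕂 A P : Type*) [Field 𝕂] [CommRing A] [Algebra ℝ A]
    [AddCommGroup P] [Module 𝕂 P] [Module A P] where
  toFun : Derivation ℝ A A → Module.End 𝕂 P
  map_add : ∀ X Y, toFun (X + Y) = toFun X + toFun Y
  map_smul : ∀ (f : A) X s, toFun (f • X) s = f • toFun X s
  leibniz : ∀ X (f : A) s, toFun X (f • s) = X f • s + f • toFun X s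

/-- `∇` preserves the bilinear form `g`. -/
def Connection.IsMetric {A P : Type*} [CommRing A] [Algebra ℝ A]
    [AddCommGroup P] [Module ℝ P] [Module A P] (nabla : Connection ℝ A P)
    (g : LinearMap.BilinForm A P) : Prop :=
  ∀ X ξ η, X (g ξ η) = g (nabla.toFun X ξ) η + g ξ (nabla.toFun X η)

/-! ## The graded manifolds `E[1]`, `T*[2]E[1]`, `𝓜` and `T*[2]M ⊕ E[1]`

Here `A` is the algebra of smooth functions on the base `M`, `P` is the `A`-module of sections of
the vector bundle `E`, and `g` is the metric of `E`, by means of which `E` and `E*` are identified.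
-/

section GradedManifolds

variable (A : Type*) [CommRing A] [Algebra ℝ A]
  (P : Type*) [AddCommGroup P] [Module ℝ P] [Module A P] [IsScalarTower ℝ A P]

/-- Functions on `E[1]`: the exterior algebra of the sections of `E` over the smooth functions. As
the module of sections is finitely generated and projective, this is the algebra of sections of the
exterior bundle of `E`. -/
abbrev ShiftFun := ExteriorAlgebra A P

/-- Functions of degree `i` on `E[1]`. -/
def shiftDeg (i : ℕ) : Submodule ℝ (ShiftFun A P) :=
  (⋀[A]^i P).restrictScalars ℝ

/-- Homogeneous vector fields on `E[1]`, i.e. graded derivations of its algebra of functions. The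
index is `d = degree + 2`, which is the degree of the associated fibrewise linear function on
`T*[2]E[1]`. -/
def vectorField (d : ℕ) : Submodule ℝ (Module.End ℝ (ShiftFun A P)) where
  carrier := {V |
    (∀ i k r, r ∈ shiftDeg A P i → i + d = k + 2 → V r ∈ shiftDeg A P k) ∧
    (∀ i r, r ∈ shiftDeg A P i → i + d < 2 → V r = 0) ∧
    (∀ i r s, r ∈ shiftDeg A P i → V (r * s) = V r * s + (-1 : ℝ) ^ (i * d) • (r * V s))}
  zero_mem' := by
    refine ⟨fun i k r _ _ => ?_, fun i r _ _ => rfl, fun i r s _ => ?_⟩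
    · simp
    · simp
  add_mem' := by
    rintro V W ⟨h1, h2, h3⟩ ⟨h1', h2', h3'⟩
    refine ⟨fun i k r hr h => ?_, fun i r hr h => ?_, fun i r s hr => ?_⟩
    · exact Submodule.add_mem _ (h1 i k r hr h) (h1' i k r hr h)
    · simp [h2 i r hr h, h2' i r hr h]
    · simp only [LinearMap.add_apply, h3 i r s hr, h3' i r s hr, add_mul, mul_add, smul_add]
      abel
  smul_mem' := by
    rintro c V ⟨h1, h2, h3⟩
    refine ⟨fun i k r hr h => ?_, fun i r hr h => ?_, fun i r s hr => ?_⟩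
    · exact Submodule.smul_mem _ c (h1 i k r hr h)
    · simp [h2 i r hr h]
    · simp only [LinearMap.smul_apply, h3 i r s hr, smul_add, smul_mul_assoc, mul_smul_comm]
      rw [smul_comm]

/-- Generators of the functions on `T*[2]E[1]`: the functions on `E[1]`, and the fibrewise linear
functions given by the homogeneous vector fields on `E[1]`. -/
inductive CotGen
  | fn (r : ShiftFun A P) : CotGen
  | mom (d : ℕ) (V : vectorField A P d) : CotGen

/-- The relations of the graded symmetric algebra, over the functions on `E[1]`, of the module of
vector fields on `E[1]` shifted by `2`. -/
inductive CotRel : FreeAlgebra ℝ (CotGen A P) → FreeAlgebra ℝ (CotGen A P) → Prop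
  | fn_add (r s) : CotRel (FreeAlgebra.ι ℝ (.fn (r + s)))
      (FreeAlgebra.ι ℝ (.fn r) + FreeAlgebra.ι ℝ (.fn s))
  | fn_mul (r s) : CotRel (FreeAlgebra.ι ℝ (.fn (r * s)))
      (FreeAlgebra.ι ℝ (.fn r) * FreeAlgebra.ι ℝ (.fn s))
  | fn_const (c : ℝ) : CotRel (FreeAlgebra.ι ℝ (.fn (algebraMap ℝ (ShiftFun A P) c)))
      (algebraMap ℝ (FreeAlgebra ℝ (CotGen A P)) c)
  | mom_add (d) (V W : vectorField A P d) : CotRel (FreeAlgebra.ι ℝ (.mom d (V + W)))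
      (FreeAlgebra.ι ℝ (.mom d V) + FreeAlgebra.ι ℝ (.mom d W))
  | mom_smul (i d e) (r : ShiftFun A P) (V : vectorField A P d) (W : vectorField A P e)
      (hr : r ∈ shiftDeg A P i) (he : e = i + d) (hW : ∀ s, W.1 s = r * V.1 s) :
      CotRel (FreeAlgebra.ι ℝ (.mom e W))
        (FreeAlgebra.ι ℝ (.fn r) * FreeAlgebra.ι ℝ (.mom d V))
  | mom_fn (i d) (r : ShiftFun A P) (V : vectorField A P d) (hr : r ∈ shiftDeg A P i) :
      CotRel (FreeAlgebra.ι ℝ (.mom d V) * FreeAlgebra.ι ℝ (.fn r))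
        ((-1 : ℝ) ^ (d * i) • (FreeAlgebra.ι ℝ (.fn r) * FreeAlgebra.ι ℝ (.mom d V)))
  | mom_mom (d e) (V : vectorField A P d) (W : vectorField A P e) :
      CotRel (FreeAlgebra.ι ℝ (.mom d V) * FreeAlgebra.ι ℝ (.mom e W))
        ((-1 : ℝ) ^ (d * e) • (FreeAlgebra.ι ℝ (.mom e W) * FreeAlgebra.ι ℝ (.mom d V)))

/-- The algebra of functions on the shifted cotangent bundle `T*[2]E[1]`. -/
def CotFun := RingQuot (CotRel A P)

instance : Ring (CotFun A P) := inferInstanceAs (Ring (RingQuot (CotRel A P)))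

instance : Algebra ℝ (CotFun A P) := inferInstanceAs (Algebra ℝ (RingQuot (CotRel A P)))

/-- The quotient map from the free algebra. -/
def CotFun.mk : FreeAlgebra ℝ (CotGen A P) →ₐ[ℝ] CotFun A P := RingQuot.mkAlgHom ℝ (CotRel A P)

variable {A P}

/-- The pullback to `T*[2]E[1]` of a function on `E[1]`. -/
def CotFun.fn (r : ShiftFun A P) : CotFun A P :=
  CotFun.mk A P (FreeAlgebra.ι ℝ (.fn r))

/-- The fibrewise linear function on `T*[2]E[1]` given by a vector field on `E[1]`. -/
def CotFun.mom {d : ℕ} (V : vectorField A P d) : CotFun A P :=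
  CotFun.mk A P (FreeAlgebra.ι ℝ (.mom d V))

/-- Products of generators of `CotFun A P`, with their degrees. -/
inductive CotMonomial : ℕ → CotFun A P → Prop
  | fn (i r) (hr : r ∈ shiftDeg A P i) : CotMonomial i (CotFun.fn r)
  | mom (d) (V : vectorField A P d) : CotMonomial d (CotFun.mom V)
  | mul (k l x y) (hx : CotMonomial k x) (hy : CotMonomial l y) : CotMonomial (k + l) (x * y)

variable (A P) in
/-- Functions of degree `k` on `T*[2]E[1]`. -/
def cotDeg (k : ℕ) : Submodule ℝ (CotFun A P) :=
  Submodule.span ℝ {x | CotMonomial k x}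

/-- `b` is the Poisson bracket of the canonical symplectic form of `T*[2]E[1]`. -/
structure IsCanonicalBracket (b : CotFun A P →ₗ[ℝ] CotFun A P →ₗ[ℝ] CotFun A P) : Prop where
  poisson : IsPoissonBracket (cotDeg A P) b
  fn_fn : ∀ r s, b (CotFun.fn r) (CotFun.fn s) = 0
  mom_fn : ∀ (d) (V : vectorField A P d) (r), b (CotFun.mom V) (CotFun.fn r) = CotFun.fn (V.1 r)
  mom_mom : ∀ (d e m) (V : vectorField A P d) (W : vectorField A P e) (U : vectorField A P m),
    d + e = m + 2 → (∀ r, U.1 r = V.1 (W.1 r) - (-1 : ℝ) ^ (d * e) • W.1 (V.1 r)) →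
    b (CotFun.mom V) (CotFun.mom W) = CotFun.mom U

variable (g : LinearMap.BilinForm A P)

/-- The equations of the fibre product `𝓜 = T*[2]E[1] ×_{(E ⊕ E*)[1]} E[1]` inside `T*[2]E[1]`,
with respect to `E[1] → (E ⊕ E*)[1]`, `ψ ↦ ψ ⊕ ½ g(ψ, ·)`. A section `ξ` of `E`, viewed as a linear
function on `E*[1]`, pulls back to `T*[2]E[1]` as the fibrewise linear function of the contraction
`ι_ξ`, and to `E[1]` as `½ g(ξ, ·) = ½ ξ`. -/
inductive SubRel : CotFun A P → CotFun A P → Prop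
  | contract (ξ : P) (V : vectorField A P 1)
      (hV : ∀ η : P, V.1 (ExteriorAlgebra.ι A η) = algebraMap A (ShiftFun A P) (g ξ η)) :
      SubRel (CotFun.mom V) ((1 / 2 : ℝ) • CotFun.fn (ExteriorAlgebra.ι A ξ))

/-- The algebra of functions on the fibre product `𝓜`. -/
def RoyFun := RingQuot (SubRel g)

instance : Ring (RoyFun g) := inferInstanceAs (Ring (RingQuot (SubRel g)))

instance : Algebra ℝ (RoyFun g) := inferInstanceAs (Algebra ℝ (RingQuot (SubRel g)))

/-- Restriction of functions from `T*[2]E[1]` to `𝓜`. -/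
def restrict : CotFun A P →ₐ[ℝ] RoyFun g := RingQuot.mkAlgHom ℝ (SubRel g)

/-- Functions of degree `k` on `𝓜`. -/
def royDeg (k : ℕ) : Submodule ℝ (RoyFun g) := (cotDeg A P k).map (restrict g).toLinearMap

/-- `b` is the Poisson bracket of the symplectic submanifold `𝓜` of `T*[2]E[1]`: the bracket of
two functions on `𝓜` is the restriction of the ambient bracket `bT` of extensions of them whose
Hamiltonian vector fields are tangent to `𝓜`, i.e. preserve the ideal of `𝓜`. -/
def IsRestrictedBracket (bT : CotFun A P →ₗ[ℝ] CotFun A P →ₗ[ℝ] CotFun A P)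
    (b : RoyFun g →ₗ[ℝ] RoyFun g →ₗ[ℝ] RoyFun g) : Prop :=
  ∀ x y : CotFun A P,
    (∀ z, restrict g z = 0 → restrict g (bT x z) = 0) →
    (∀ z, restrict g z = 0 → restrict g (bT y z) = 0) →
    b (restrict g x) (restrict g y) = restrict g (bT x y)

variable (A P) in
/-- Functions on `T*[2]M ⊕ E[1]`: the tensor product over the smooth functions of the functions on
`E[1]` and of the symmetric algebra of the vector fields on `M`, which are functions of degree
`2` on `T*[2]M`. -/
abbrev SplitFun := ExteriorAlgebra A P ⊗[A] SymmetricAlgebra A (Derivation ℝ A A)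

/-- The function on `T*[2]M ⊕ E[1]` given by a function on `E[1]`. -/
def SplitFun.ext (r : ShiftFun A P) : SplitFun A P := r ⊗ₜ[A] 1

/-- The fibrewise linear function on `T*[2]M ⊕ E[1]` given by a vector field on `M`. -/
def SplitFun.mom (X : Derivation ℝ A A) : SplitFun A P :=
  1 ⊗ₜ[A] SymmetricAlgebra.ι A (Derivation ℝ A A) X

/-- `V` is the vector field on `E[1]` which is the horizontal lift of `X` with respect to `∇`: it
acts on the functions on `E[1]` as the covariant derivative along `X`. -/
def IsHorizontalLift (nabla : Connection ℝ A P) (X : Derivation ℝ A A)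
    (V : vectorField A P 2) : Prop :=
  (∀ f : A, V.1 (algebraMap A (ShiftFun A P) f) = algebraMap A (ShiftFun A P) (X f)) ∧
  ∀ ξ : P, V.1 (ExteriorAlgebra.ι A ξ) = ExteriorAlgebra.ι A (nabla.toFun X ξ)

/-- `Φ` is the pullback by `Ξ_∇ = (π_∇ ∘ i_𝓜) ⊕ π : 𝓜 → T*[2]M ⊕ E[1]`. Here `π : 𝓜 → E[1]` is the
projection, `i_𝓜 : 𝓜 → T*[2]E[1]` the inclusion, and `π_∇ : T*[2]E[1] → T*[2]M` is dual to the
horizontal lift. -/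
def IsXiPullback (nabla : Connection ℝ A P) (Φ : SplitFun A P →ₐ[ℝ] RoyFun g) : Prop :=
  (∀ r, Φ (SplitFun.ext r) = restrict g (CotFun.fn r)) ∧
  ∀ X, ∃ V, IsHorizontalLift nabla X V ∧ Φ (SplitFun.mom X) = restrict g (CotFun.mom V)

/-- Extension of scalars of a function from `ℝ` to `ℂ`. -/
def complexify {B : Type*} [Ring B] [Algebra ℝ B] (x : B) : ℂ ⊗[ℝ] B := 1 ⊗ₜ[ℝ] x

end GradedManifolds

/-! ## The graded algebra of a filtered algebra -/

/-- An increasing algebra filtration `D₀ ⊆ D₁ ⊆ ⋯` of (a subalgebra of) `B`. The index is shifted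
by one: `W (k + 1) = D_k`, and `W 0 = D_{-1}`. -/
structure Filt (𝕜 B : Type*) [Field 𝕜] [Ring B] [Algebra 𝕜 B] where
  W : ℕ → Submodule 𝕜 B
  mono : ∀ k, W k ≤ W (k + 1)
  one_mem : (1 : B) ∈ W 1
  mul_mem : ∀ i j a b, a ∈ W (i + 1) → b ∈ W (j + 1) → a * b ∈ W (i + j + 1)
  mul_mem_left : ∀ i j a b, a ∈ W i → b ∈ W (j + 1) → a * b ∈ W (i + j)
  mul_mem_right : ∀ i j a b, a ∈ W (i + 1) → b ∈ W j → a * b ∈ W (i + j)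

namespace Filt

variable {𝕜 B : Type*} [Field 𝕜] [Ring B] [Algebra 𝕜 B] (D : Filt 𝕜 B)

/-- `D_k / D_{k-1}`. -/
def Piece (k : ℕ) := D.W (k + 1) ⧸ (D.W k).submoduleOf (D.W (k + 1))

instance (k : ℕ) : AddCommGroup (D.Piece k) :=
  inferInstanceAs (AddCommGroup (D.W (k + 1) ⧸ (D.W k).submoduleOf (D.W (k + 1))))

instance (k : ℕ) : Module 𝕜 (D.Piece k) :=
  inferInstanceAs (Module 𝕜 (D.W (k + 1) ⧸ (D.W k).submoduleOf (D.W (k + 1))))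

/-- The class in `D_k / D_{k-1}` of an element of `D_k`. -/
def pieceMk (k : ℕ) : D.W (k + 1) →ₗ[𝕜] D.Piece k :=
  ((D.W k).submoduleOf (D.W (k + 1))).mkQ

theorem pieceMk_eq (k : ℕ) (a b : D.W (k + 1)) :
    D.pieceMk k a = D.pieceMk k b ↔ (a - b : B) ∈ D.W k := by
  exact Submodule.Quotient.eq _

/-- The product `D_i / D_{i-1} × D_j / D_{j-1} → D_{i+j} / D_{i+j-1}`. -/
def pieceMul (i j : ℕ) (x : D.Piece i) (y : D.Piece j) : D.Piece (i + j) :=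
  Quotient.liftOn₂' x y
    (fun a b => D.pieceMk (i + j) ⟨a.1 * b.1, D.mul_mem i j _ _ a.2 b.2⟩)
    (by
      intro a b a' b' ha hb
      have ha' : (a.1 - a'.1 : B) ∈ D.W i := (D.pieceMk_eq i a a').1 (Quotient.sound' ha)
      have hb' : (b.1 - b'.1 : B) ∈ D.W j := (D.pieceMk_eq j b b').1 (Quotient.sound' hb)
      rw [pieceMk_eq]
      have h1 := D.mul_mem_left i j _ _ ha' b.2
      have h2 := D.mul_mem_right i j _ _ a'.2 hb'
      have h3 := Submodule.add_mem _ h1 h2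
      convert h3 using 1
      noncomm_ring)

theorem pieceMul_mk (i j : ℕ) (a : D.W (i + 1)) (b : D.W (j + 1)) :
    D.pieceMul i j (D.pieceMk i a) (D.pieceMk j b) =
      D.pieceMk (i + j) ⟨a.1 * b.1, D.mul_mem i j _ _ a.2 b.2⟩ := rfl

theorem pieceMk_surjective (k : ℕ) : Function.Surjective (D.pieceMk k) :=
  Submodule.mkQ_surjective _

theorem graded_ext {i j : ℕ} (h : i = j) (a : D.W (i + 1)) (b : D.W (j + 1)) (hab : a.1 = b.1) :
    (⟨i, D.pieceMk i a⟩ : GradedMonoid D.Piece) = ⟨j, D.pieceMk j b⟩ := by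
  subst h
  have : a = b := Subtype.ext hab
  rw [this]

instance : GradedMonoid.GMul D.Piece where
  mul {i j} x y := D.pieceMul i j x y

instance : GradedMonoid.GOne D.Piece where
  one := D.pieceMk 0 ⟨1, D.one_mem⟩

instance : DirectSum.GRing D.Piece where
  mul_zero {i j} x := by
    obtain ⟨a, rfl⟩ := D.pieceMk_surjective i x
    change D.pieceMul i j _ 0 = 0
    rw [← map_zero (D.pieceMk j), pieceMul_mk, ← map_zero (D.pieceMk (i + j))]
    congr 1; ext; simp
  zero_mul {i j} x := by
    obtain ⟨a, rfl⟩ := D.pieceMk_surjective j x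
    change D.pieceMul i j 0 _ = 0
    rw [← map_zero (D.pieceMk i), pieceMul_mk, ← map_zero (D.pieceMk (i + j))]
    congr 1; ext; simp
  mul_add {i j} x y z := by
    obtain ⟨a, rfl⟩ := D.pieceMk_surjective i x
    obtain ⟨b, rfl⟩ := D.pieceMk_surjective j y
    obtain ⟨c, rfl⟩ := D.pieceMk_surjective j z
    change D.pieceMul i j _ _ = D.pieceMul i j _ _ + D.pieceMul i j _ _
    rw [← map_add, pieceMul_mk, pieceMul_mk, pieceMul_mk, ← map_add]
    congr 1; ext; simp [mul_add]
  add_mul {i j} x y z := by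
    obtain ⟨a, rfl⟩ := D.pieceMk_surjective i x
    obtain ⟨b, rfl⟩ := D.pieceMk_surjective i y
    obtain ⟨c, rfl⟩ := D.pieceMk_surjective j z
    change D.pieceMul i j _ _ = D.pieceMul i j _ _ + D.pieceMul i j _ _
    rw [← map_add, pieceMul_mk, pieceMul_mk, pieceMul_mk, ← map_add]
    congr 1; ext; simp [add_mul]
  one_mul := by
    rintro ⟨i, x⟩
    obtain ⟨a, rfl⟩ := D.pieceMk_surjective i x
    exact D.graded_ext (zero_add i) _ _ (by simp)
  mul_one := by
    rintro ⟨i, x⟩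
    obtain ⟨a, rfl⟩ := D.pieceMk_surjective i x
    exact D.graded_ext (add_zero i) _ _ (by simp)
  mul_assoc := by
    rintro ⟨i, x⟩ ⟨j, y⟩ ⟨k, z⟩
    obtain ⟨a, rfl⟩ := D.pieceMk_surjective i x
    obtain ⟨b, rfl⟩ := D.pieceMk_surjective j y
    obtain ⟨c, rfl⟩ := D.pieceMk_surjective k z
    exact D.graded_ext (add_assoc i j k) _ _ (by simp [mul_assoc])
  natCast m := D.pieceMk 0 ((m : 𝕜) • ⟨1, D.one_mem⟩)
  natCast_zero := by simp
  natCast_succ m := by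
    change _ = _ + D.pieceMk 0 ⟨1, D.one_mem⟩
    rw [← map_add]
    congr 1
    push_cast
    rw [add_smul, one_smul]
  intCast m := D.pieceMk 0 ((m : 𝕜) • ⟨1, D.one_mem⟩)
  intCast_ofNat m := by
    change _ = D.pieceMk 0 _
    simp
  intCast_negSucc_ofNat m := by
    change _ = - D.pieceMk 0 _
    rw [← map_neg]
    congr 1
    ext
    simp [Int.cast_negSucc, add_smul]

instance : DirectSum.GAlgebra 𝕜 D.Piece where
  toFun := AddMonoidHom.mk' (fun c => D.pieceMk 0 (c • ⟨1, D.one_mem⟩))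
    (fun c d => by rw [add_smul, map_add])
  map_one := by
    change D.pieceMk 0 _ = D.pieceMk 0 _
    rw [one_smul]
  map_mul c d := by
    exact D.graded_ext (zero_add 0).symm _ _ (by simp [mul_smul, smul_comm c d])
  commutes c := by
    rintro ⟨i, x⟩
    obtain ⟨a, rfl⟩ := D.pieceMk_surjective i x
    exact D.graded_ext (add_comm 0 i) _ _ (by simp)
  smul_def c := by
    rintro ⟨i, x⟩
    obtain ⟨a, rfl⟩ := D.pieceMk_surjective i x
    exact D.graded_ext (zero_add i).symm (c • a) _ (by simp)

/-- The associated graded algebra `⨁ₖ D_k / D_{k-1}`. -/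
abbrev Gr := ⨁ k, D.Piece k

/-- The class in degree `k` of the associated graded algebra of an element of `D_k`. -/
def grMk (k : ℕ) : D.W (k + 1) →ₗ[𝕜] D.Gr :=
  DirectSum.lof 𝕜 ℕ D.Piece k ∘ₗ D.pieceMk k

/-- The degree `k` piece of the associated graded algebra. -/
def grDeg (k : ℕ) : Submodule 𝕜 D.Gr := LinearMap.range (D.grMk k)

end Filt

/-! ## The Clifford filtration determined by odd elements of a `ℤ/2`-graded algebra -/

section CliffordFiltration

variable {B ι : Type*} [Ring B] [Algebra ℂ B]

/-- The graded commutator `a b - (-1)^{p q} b a` of elements `a`, `b` of parity `p`, `q`. -/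
def superComm (p q : ZMod 2) (a b : B) : B := a * b - (-1 : ℂ) ^ (p.val * q.val) • (b * a)

/-- `homFilt par c (k + 1) p` consists of the elements `D` of parity `p` of the `k`-th filtration
step `{D | ∀ ξ, [D, c ξ] ∈ (k - 1)-st filtration step}`, where `c ξ` has parity `1`, and
`homFilt par c 0 p = 0` is the step of index `-1`. -/
def homFilt (par : ZMod 2 → Submodule ℂ B) (c : ι → B) : ℕ → ZMod 2 → Submodule ℂ B
  | 0, _ => ⊥
  | k + 1, p =>
    { carrier := {D | D ∈ par p ∧ ∀ ξ, superComm p 1 D (c ξ) ∈ homFilt par c k (p + 1)}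
      zero_mem' := ⟨Submodule.zero_mem _, fun ξ => by simp [superComm]⟩
      add_mem' := by
        rintro a b ⟨h1, h2⟩ ⟨h1', h2'⟩
        refine ⟨Submodule.add_mem _ h1 h1', fun ξ => ?_⟩
        convert Submodule.add_mem _ (h2 ξ) (h2' ξ) using 1
        simp only [superComm, add_mul, mul_add, smul_add]
        abel
      smul_mem' := by
        rintro z a ⟨h1, h2⟩
        refine ⟨Submodule.smul_mem _ z h1, fun ξ => ?_⟩
        convert Submodule.smul_mem _ z (h2 ξ) using 1
        simp only [superComm, smul_mul_assoc, mul_smul_comm, smul_sub]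
        rw [smul_comm] }

variable {par : ZMod 2 → Submodule ℂ B} {c : ι → B}

theorem mem_homFilt_succ {k : ℕ} {p : ZMod 2} {D : B} :
    D ∈ homFilt par c (k + 1) p ↔
      D ∈ par p ∧ ∀ ξ, superComm p 1 D (c ξ) ∈ homFilt par c k (p + 1) := Iff.rfl

theorem homFilt_mono (k : ℕ) : ∀ p, homFilt par c k p ≤ homFilt par c (k + 1) p := by
  induction k with
  | zero => intro p; exact bot_le
  | succ k ih => exact fun p D hD => ⟨hD.1, fun ξ => ih _ (hD.2 ξ)⟩

theorem superComm_mul (p q : ZMod 2) (a b x : B) :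
    superComm (p + q) 1 (a * b) x =
      a * superComm q 1 b x + (-1 : ℂ) ^ q.val • (superComm p 1 a x * b) := by
  have h1 : (1 : ZMod 2).val = 1 := rfl
  have key : ∀ p q : ZMod 2, (-1 : ℂ) ^ (p + q).val = (-1) ^ q.val * (-1) ^ p.val := by
    intro p q
    rw [← pow_add]
    have h : ∀ p q : ZMod 2, Even (p + q).val ↔ Even (q.val + p.val) := by decide
    exact neg_one_pow_congr (h p q)
  simp only [superComm, h1, mul_one, key, mul_sub, sub_mul, smul_sub, mul_smul_comm,
    smul_mul_assoc, smul_smul, mul_assoc]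
  abel

theorem homFilt_mul (hpar : ∀ p q a b, a ∈ par p → b ∈ par q → a * b ∈ par (p + q)) (N : ℕ) :
    ∀ i j p q a b, i + j = N → a ∈ homFilt par c (i + 1) p → b ∈ homFilt par c (j + 1) q →
      a * b ∈ homFilt par c (N + 1) (p + q) := by
  induction N with
  | zero =>
    intro i j p q a b hij ha hb
    obtain ⟨rfl, rfl⟩ : i = 0 ∧ j = 0 := by omega
    refine ⟨hpar _ _ _ _ ha.1 hb.1, fun ξ => ?_⟩
    have h1 : superComm p 1 a (c ξ) = 0 := ha.2 ξ
    have h2 : superComm q 1 b (c ξ) = 0 := hb.2 ξ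
    rw [superComm_mul, h1, h2]
    simp
  | succ N ih =>
    intro i j p q a b hij ha hb
    refine ⟨hpar _ _ _ _ ha.1 hb.1, fun ξ => ?_⟩
    rw [superComm_mul]
    refine Submodule.add_mem _ ?_ (Submodule.smul_mem _ _ ?_)
    · cases j with
      | zero =>
        have h2 : superComm q 1 b (c ξ) = 0 := hb.2 ξ
        rw [h2, mul_zero]; exact Submodule.zero_mem _
      | succ j =>
        have := ih i j p (q + 1) a _ (by omega) ha (hb.2 ξ)
        rwa [← add_assoc] at this
    · cases i with
      | zero =>
        have h2 : superComm p 1 a (c ξ) = 0 := ha.2 ξ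
        rw [h2, zero_mul]; exact Submodule.zero_mem _
      | succ i =>
        have := ih i j (p + 1) q _ b (by omega) (ha.2 ξ) hb
        rwa [add_right_comm] at this

/-- The filtration step of index `k - 1`: its elements are the sums of an even and an odd one. -/
def stepFilt (par : ZMod 2 → Submodule ℂ B) (c : ι → B) (k : ℕ) : Submodule ℂ B :=
  ⨆ p, homFilt par c k p

theorem stepFilt_mul (hpar : ∀ p q a b, a ∈ par p → b ∈ par q → a * b ∈ par (p + q)) (i j : ℕ)
    (a b : B) (ha : a ∈ stepFilt par c (i + 1)) (hb : b ∈ stepFilt par c (j + 1)) :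
    a * b ∈ stepFilt par c (i + j + 1) := by
  induction ha using Submodule.iSup_induction' with
  | zero => simp
  | add x y _ _ hx hy => rw [add_mul]; exact Submodule.add_mem _ hx hy
  | mem p x hx =>
    induction hb using Submodule.iSup_induction' with
    | zero => simp
    | add y z _ _ hy hz => rw [mul_add]; exact Submodule.add_mem _ hy hz
    | mem q y hy =>
      exact Submodule.mem_iSup_of_mem (p + q) (homFilt_mul hpar _ i j p q x y rfl hx hy)

theorem stepFilt_zero : stepFilt par c 0 = ⊥ := by
  simp [stepFilt, homFilt]

/-- The filtration `D₀ ⊆ D₁ ⊆ ⋯`, `D_k = {D | ∀ ξ, [D, c ξ] ∈ D_{k-1}}`, `D_{-1} = 0`. -/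
def cliffordFilt (par : ZMod 2 → Submodule ℂ B) (c : ι → B)
    (hone : 1 ∈ par 0)
    (hpar : ∀ p q a b, a ∈ par p → b ∈ par q → a * b ∈ par (p + q)) : Filt ℂ B where
  W := stepFilt par c
  mono k := iSup_mono fun p => homFilt_mono k p
  one_mem := Submodule.mem_iSup_of_mem 0 ⟨hone, fun ξ => by simp [superComm]⟩
  mul_mem := stepFilt_mul hpar
  mul_mem_left i j a b ha hb := by
    cases i with
    | zero =>
      rw [stepFilt_zero, Submodule.mem_bot] at ha
      simp [ha]
    | succ i =>
      have := stepFilt_mul hpar i j a b ha hb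
      rwa [add_right_comm] at this
  mul_mem_right i j a b ha hb := by
    cases j with
    | zero =>
      rw [stepFilt_zero, Submodule.mem_bot] at hb
      simp [hb]
    | succ j => exact stepFilt_mul hpar i j a b ha hb

end CliffordFiltration

/-! ## Sections of vector bundles -/

section Sections

variable {n : ℕ} {M : Type*} [TopologicalSpace M] [ChartedSpace (EuclideanSpace ℝ (Fin n)) M]
  {F : Type*} [NormedAddCommGroup F] [NormedSpace ℝ F]
  {E : M → Type*} [∀ x, AddCommGroup (E x)] [∀ x, Module ℝ (E x)] [∀ x, TopologicalSpace (E x)]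
  [TopologicalSpace (TotalSpace F E)] [FiberBundle F E] [VectorBundle ℝ F E]

instance sectionSMul : SMul C^∞⟮𝓡 n, M; ℝ⟯ Cₛ^∞⟮𝓡 n; F, E⟯ where
  smul f s := ⟨fun x => f x • s x, f.contMDiff.smul_section s.contMDiff⟩

theorem section_smul_apply (f : C^∞⟮𝓡 n, M; ℝ⟯) (s : Cₛ^∞⟮𝓡 n; F, E⟯) (x : M) :
    (f • s) x = f x • s x := rfl

instance sectionModule : Module C^∞⟮𝓡 n, M; ℝ⟯ Cₛ^∞⟮𝓡 n; F, E⟯ where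
  one_smul s := by ext x; exact one_smul ℝ (s x)
  mul_smul f g s := by ext x; exact mul_smul (f x) (g x) (s x)
  smul_zero f := by ext x; exact smul_zero (f x)
  smul_add f s t := by ext x; exact smul_add (f x) (s x) (t x)
  add_smul f g s := by ext x; exact add_smul (f x) (g x) (s x)
  zero_smul s := by ext x; exact zero_smul ℝ (s x)

instance sectionTower : IsScalarTower ℝ C^∞⟮𝓡 n, M; ℝ⟯ Cₛ^∞⟮𝓡 n; F, E⟯ where
  smul_assoc a f s := by ext x; exact mul_smul a (f x) (s x)

end Sections

section ComplexSections

variable {n : ℕ} {M : Type*} [TopologicalSpace M] [ChartedSpace (EuclideanSpace ℝ (Fin n)) M]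
  {F : Type*} [NormedAddCommGroup F] [NormedSpace ℝ F] [NormedSpace ℂ F] [IsScalarTower ℝ ℂ F]
  {S : M → Type*} [∀ x, AddCommGroup (S x)] [∀ x, Module ℝ (S x)] [∀ x, Module ℂ (S x)]
  [∀ x, IsScalarTower ℝ ℂ (S x)] [∀ x, TopologicalSpace (S x)]
  [TopologicalSpace (TotalSpace F S)] [FiberBundle F S] [VectorBundle ℝ F S] [VectorBundle ℂ F S]

set_option linter.unusedSectionVars false in
theorem contMDiff_complex_smul (z : ℂ) (s : Cₛ^∞⟮𝓡 n; F, S⟯) :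
    ContMDiff (𝓡 n) ((𝓡 n).prod 𝓘(ℝ, F)) ∞ (fun x => TotalSpace.mk' F x (z • s x)) := by
  intro x₀
  have hs := s.contMDiff x₀
  rw [contMDiffAt_section] at hs ⊢
  set e := trivializationAt F S x₀
  let L : F →L[ℝ] F := LinearMap.mkContinuous
    { toFun := fun v => z • v
      map_add' := smul_add z
      map_smul' := fun a v => smul_comm z a v } ‖z‖ (fun v => (norm_smul z v).le)
  have h2 : ContMDiffAt (𝓡 n) 𝓘(ℝ, F) ∞ (fun x => L (e ⟨x, s x⟩).2) x₀ :=
    L.contMDiff.contMDiffAt.comp x₀ hs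
  refine h2.congr_of_eventuallyEq ?_
  filter_upwards [e.open_baseSet.mem_nhds (mem_baseSet_trivializationAt F S x₀)] with x hx
  exact (e.linear ℂ hx).2 z (s x)

instance sectionComplexSMul : SMul ℂ Cₛ^∞⟮𝓡 n; F, S⟯ where
  smul z s := ⟨fun x => z • s x, contMDiff_complex_smul z s⟩

instance sectionComplexModule : Module ℂ Cₛ^∞⟮𝓡 n; F, S⟯ where
  one_smul s := by ext x; exact one_smul ℂ (s x)
  mul_smul z w s := by ext x; exact mul_smul z w (s x)
  smul_zero z := by ext x; exact smul_zero z
  smul_add z s t := by ext x; exact smul_add z (s x) (t x)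
  add_smul z w s := by ext x; exact add_smul z w (s x)
  zero_smul s := by ext x; exact zero_smul ℂ (s x)

/-- Multiplication by a smooth function, as an operator on sections. -/
def mulOp (f : C^∞⟮𝓡 n, M; ℝ⟯) : Module.End ℂ Cₛ^∞⟮𝓡 n; F, S⟯ where
  toFun s := f • s
  map_add' := smul_add f
  map_smul' z s := by ext x; exact smul_comm (f x) z (s x)

end ComplexSections

/-! ## Pseudo-Euclidean metrics, spinor bundles and spinor differential operators -/

section Spinors

variable {n : ℕ} {M : Type*} [TopologicalSpace M] [ChartedSpace (EuclideanSpace ℝ (Fin n)) M]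
  {F : Type*} [NormedAddCommGroup F] [NormedSpace ℝ F]
  {E : M → Type*} [∀ x, AddCommGroup (E x)] [∀ x, Module ℝ (E x)] [∀ x, TopologicalSpace (E x)]
  [TopologicalSpace (TotalSpace F E)] [FiberBundle F E] [VectorBundle ℝ F E]
  {G : Type*} [NormedAddCommGroup G] [NormedSpace ℝ G] [NormedSpace ℂ G] [IsScalarTower ℝ ℂ G]
  {S : M → Type*} [∀ x, AddCommGroup (S x)] [∀ x, Module ℝ (S x)] [∀ x, Module ℂ (S x)]
  [∀ x, IsScalarTower ℝ ℂ (S x)] [∀ x, TopologicalSpace (S x)]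
  [TopologicalSpace (TotalSpace G S)] [FiberBundle G S] [VectorBundle ℝ G S] [VectorBundle ℂ G S]

variable (n F E) in
/-- A smooth pseudo-Euclidean metric on the vector bundle `E`. -/
structure PseudoMetric where
  form : ∀ x, LinearMap.BilinForm ℝ (E x)
  symm : ∀ x v w, form x v w = form x w v
  nondegenerate : ∀ x v, (∀ w, form x v w = 0) → v = 0
  smooth : ∀ ξ η : Cₛ^∞⟮𝓡 n; F, E⟯,
    ContMDiff (𝓡 n) 𝓘(ℝ, ℝ) ∞ (fun x => form x (ξ x) (η x))

namespace PseudoMetric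

variable (g : PseudoMetric n F E)

/-- The quadratic form `v ↦ g(v, v)` on the fibre over `x`. -/
def quad (x : M) : QuadraticForm ℝ (E x) := LinearMap.BilinMap.toQuadraticMap (g.form x)

/-- The metric as a bilinear form on sections. -/
def onSections : LinearMap.BilinForm C^∞⟮𝓡 n, M; ℝ⟯ Cₛ^∞⟮𝓡 n; F, E⟯ :=
  LinearMap.mk₂ _ (fun ξ η => ⟨fun x => g.form x (ξ x) (η x), g.smooth ξ η⟩)
    (fun ξ ξ' η => by ext x; exact LinearMap.BilinForm.add_left _ _ _)
    (fun f ξ η => by ext x; exact LinearMap.BilinForm.smul_left _ _ _)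
    (fun ξ η η' => by ext x; exact LinearMap.BilinForm.add_right _ _ _)
    (fun f ξ η => by ext x; exact LinearMap.BilinForm.smul_right _ _ _)

end PseudoMetric

/-- `S` is a spinor bundle of `(E, g)`: a smooth isomorphism of bundles of complex algebras from
the complex Clifford bundle of `E` (with `ξ η + η ξ = 2 g(ξ, η)`) to `End S`. -/
structure SpinorStructure (g : PseudoMetric n F E) (G : Type*) [NormedAddCommGroup G]
    [NormedSpace ℝ G] [NormedSpace ℂ G] [IsScalarTower ℝ ℂ G]
    (S : M → Type*) [∀ x, AddCommGroup (S x)] [∀ x, Module ℝ (S x)] [∀ x, Module ℂ (S x)]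
    [∀ x, IsScalarTower ℝ ℂ (S x)] [∀ x, TopologicalSpace (S x)]
    [TopologicalSpace (TotalSpace G S)] [FiberBundle G S] where
  rep : ∀ x, (ℂ ⊗[ℝ] CliffordAlgebra (g.quad x)) ≃ₐ[ℂ] Module.End ℂ (S x)
  smooth : ∀ (ξ : Cₛ^∞⟮𝓡 n; F, E⟯) (s : Cₛ^∞⟮𝓡 n; G, S⟯),
    ContMDiff (𝓡 n) ((𝓡 n).prod 𝓘(ℝ, G)) ∞
      (fun x => TotalSpace.mk' G x (rep x (1 ⊗ₜ CliffordAlgebra.ι (g.quad x) (ξ x)) (s x)))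

namespace SpinorStructure

variable {g : PseudoMetric n F E} (σ : SpinorStructure g G S)

/-- The Clifford action `γ(ξ)` of a section `ξ` of `E` on sections of `S`. -/
def gam (ξ : Cₛ^∞⟮𝓡 n; F, E⟯) : Module.End ℂ Cₛ^∞⟮𝓡 n; G, S⟯ where
  toFun s := ⟨fun x => σ.rep x (1 ⊗ₜ CliffordAlgebra.ι (g.quad x) (ξ x)) (s x), σ.smooth ξ s⟩
  map_add' s t := by ext x; exact map_add (σ.rep x _) (s x) (t x)
  map_smul' z s := by ext x; exact map_smul (σ.rep x _) z (s x)

/-- `(∇^E, ∇^S)` is a compatible pair of connections: `∇^E` is metric and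
`[∇^S_X, γ(ξ)] = γ(∇^E_X ξ)`. -/
def Compatible (nE : Connection ℝ C^∞⟮𝓡 n, M; ℝ⟯ Cₛ^∞⟮𝓡 n; F, E⟯)
    (nS : Connection ℂ C^∞⟮𝓡 n, M; ℝ⟯ Cₛ^∞⟮𝓡 n; G, S⟯) : Prop :=
  nE.IsMetric g.onSections ∧
  ∀ X ξ, nS.toFun X * σ.gam ξ - σ.gam ξ * nS.toFun X = σ.gam (nE.toFun X ξ)

/-- `T` is given by a section of the even (`p = 0`) or odd (`p = 1`) part of the complex Clifford
bundle. -/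
def IsCliffordOp (p : ZMod 2) (T : Module.End ℂ Cₛ^∞⟮𝓡 n; G, S⟯) : Prop :=
  ∃ u : ∀ x, ℂ ⊗[ℝ] CliffordAlgebra (g.quad x),
    (∀ x, u x ∈ (CliffordAlgebra.evenOdd (g.quad x) p).baseChange ℂ) ∧
    ∀ s x, T s x = σ.rep x (u x) (s x)

/-- Products of covariant derivatives along vector fields, for spinor connections, and of even and
odd sections of the Clifford bundle, with their parity. -/
inductive IsParityMonomial : ZMod 2 → Module.End ℂ Cₛ^∞⟮𝓡 n; G, S⟯ → Prop
  | clifford (p T) (hT : σ.IsCliffordOp p T) : IsParityMonomial p T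
  | nabla (nE nS X) (h : σ.Compatible nE nS) : IsParityMonomial 0 (nS.toFun X)
  | mul (p q T U) (hT : IsParityMonomial p T) (hU : IsParityMonomial q U) :
      IsParityMonomial (p + q) (T * U)

end SpinorStructure

variable (n G S) in
/-- The algebra of differential operators on `S`, generated by the sections of `End S` and the
covariant derivatives. -/
def diffOp : Subalgebra ℂ (Module.End ℂ Cₛ^∞⟮𝓡 n; G, S⟯) :=
  Algebra.adjoin ℂ
    ({T | ∃ φ : ∀ x, Module.End ℂ (S x), ∀ s x, T s x = φ x (s x)} ∪
     {T | ∃ (nS : Connection ℂ C^∞⟮𝓡 n, M; ℝ⟯ Cₛ^∞⟮𝓡 n; G, S⟯) (X : _), T = nS.toFun X})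

namespace SpinorStructure

variable {g : PseudoMetric n F E} (σ : SpinorStructure g G S)

/-- The even (`p = 0`) and odd (`p = 1`) differential operators on `S`. -/
def parity (p : ZMod 2) : Submodule ℂ (Module.End ℂ Cₛ^∞⟮𝓡 n; G, S⟯) :=
  Subalgebra.toSubmodule (diffOp n G S) ⊓ Submodule.span ℂ {T | σ.IsParityMonomial p T}

theorem one_mem_parity : 1 ∈ σ.parity 0 := by
  refine ⟨one_mem (diffOp n G S), Submodule.subset_span (.clifford 0 1 ⟨fun _ => 1, ?_, ?_⟩)⟩
  · intro x
    exact Submodule.tmul_mem_baseChange_of_mem (1 : ℂ)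
      (Submodule.one_le.1 (CliffordAlgebra.one_le_evenOdd_zero (g.quad x)))
  · intro s x
    rw [map_one]
    rfl

theorem mul_mem_parity (p q : ZMod 2) (a b : Module.End ℂ Cₛ^∞⟮𝓡 n; G, S⟯)
    (ha : a ∈ σ.parity p) (hb : b ∈ σ.parity q) : a * b ∈ σ.parity (p + q) := by
  refine ⟨mul_mem (S := Subalgebra ℂ _) ha.1 hb.1, ?_⟩
  have h := Submodule.mul_mem_mul ha.2 hb.2
  rw [Submodule.span_mul_span] at h
  refine Submodule.span_mono ?_ h
  rintro _ ⟨T, hT, U, hU, rfl⟩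
  exact .mul p q T U hT hU

/-- The homogeneous elements of parity `p` of `𝓓_k(M, S)`. -/
def homOp (k : ℕ) (p : ZMod 2) : Submodule ℂ (Module.End ℂ Cₛ^∞⟮𝓡 n; G, S⟯) :=
  homFilt σ.parity σ.gam (k + 1) p

/-- The filtration `𝓓_k(M, S) = {D | ∀ ξ, [D, γ(ξ)] ∈ 𝓓_{k-1}(M, S)}`, `𝓓_{-1}(M, S) = 0`, of
the algebra of differential operators on `S`. -/
def filt : Filt ℂ (Module.End ℂ Cₛ^∞⟮𝓡 n; G, S⟯) :=
  cliffordFilt σ.parity σ.gam σ.one_mem_parity σ.mul_mem_parity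

/-- The associated graded algebra of the algebra of differential operators on `S`. -/
abbrev GrOp := σ.filt.Gr

/-- `b` is the bracket of `GrOp` induced by the graded commutator. -/
def IsCommutatorBracket (b : σ.GrOp →ₗ[ℂ] σ.GrOp →ₗ[ℂ] σ.GrOp) : Prop :=
  ∀ (k l : ℕ) (p q : ZMod 2) (D D' : Module.End ℂ Cₛ^∞⟮𝓡 n; G, S⟯)
    (hD : D ∈ σ.filt.W (k + 1)) (hD' : D' ∈ σ.filt.W (l + 1)),
    D ∈ σ.homOp k p → D' ∈ σ.homOp l q →
    (∀ m, k + l = m + 2 → ∃ h : superComm p q D D' ∈ σ.filt.W (m + 1),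
      b (σ.filt.grMk k ⟨D, hD⟩) (σ.filt.grMk l ⟨D', hD'⟩) = σ.filt.grMk m ⟨_, h⟩) ∧
    (k + l < 2 → superComm p q D D' = 0 ∧
      b (σ.filt.grMk k ⟨D, hD⟩) (σ.filt.grMk l ⟨D', hD'⟩) = 0)

/-- `Φ` is the symbol isomorphism of the spinor connection `∇^S`:
`Φ(f) = f`, `Φ(γ(ξ)/√2) = ξ`, `Φ(∇^S_X) = X`. -/
def IsSymbolIso (nS : Connection ℂ C^∞⟮𝓡 n, M; ℝ⟯ Cₛ^∞⟮𝓡 n; G, S⟯)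
    (Φ : σ.GrOp ≃ₐ[ℂ] ℂ ⊗[ℝ] SplitFun C^∞⟮𝓡 n, M; ℝ⟯ Cₛ^∞⟮𝓡 n; F, E⟯) : Prop :=
  (∀ f, ∃ h : mulOp f ∈ σ.filt.W 1, Φ (σ.filt.grMk 0 ⟨_, h⟩) =
    complexify (SplitFun.ext (algebraMap _ _ f))) ∧
  (∀ ξ, ∃ h : ((1 / Real.sqrt 2 : ℝ) : ℂ) • σ.gam ξ ∈ σ.filt.W 2, Φ (σ.filt.grMk 1 ⟨_, h⟩) =
    complexify (SplitFun.ext (ExteriorAlgebra.ι _ ξ))) ∧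
  (∀ X, ∃ h : nS.toFun X ∈ σ.filt.W 3, Φ (σ.filt.grMk 2 ⟨_, h⟩) =
    complexify (SplitFun.mom X))

end SpinorStructure

end Spinors

end SpinGr

end

open SpinGr

noncomputable section

open Bundle
open scoped Manifold ContDiff TensorProduct DirectSum

namespace SpinGr

open Finset (sum_congr mul_sum sum_add_distrib sum_mul smul_sum sum_sub_distrib sum_const_zero sum_comm)
open Submodule (smul_mem subset_span mul_mem_mul span_induction tmul_mem_baseChange_of_mem mem_bot
  span_le span_mono mul_induction_on mem_iSup_of_mem coe_add mul_le span_mul_span mem_sup coe_smul coe_sum)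
open LinearMap (mulLeft mulLeft_apply)
open LinearMap renaming add_apply → lm_add, smul_apply → lm_smul, sum_apply → lm_sum, comp_apply → lm_comp, sub_apply → lm_sub
open Algebra (smul_def algebraMap_eq_smul_one commutes)
open Algebra.TensorProduct (tmul_mul_tmul)
open TensorProduct (tmul_add tmul_smul smul_tmul' smul_tmul tmul_zero tmul_sub tmul_sum)
open Module.End (mul_apply)
open ExteriorAlgebra (ι)
open CliffordAlgebra (contractLeft evenOdd)
open CliffordAlgebra renaming ι → cι
open Complex (I)
open SpinGr.CotFun (fn mom)
open SpinGr.SplitFun renaming ext → sx, mom → sm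

section Algebraic

variable {A : Type*} [CommRing A] [Algebra ℝ A]
  {P : Type*} [AddCommGroup P] [Module ℝ P] [Module A P] [IsScalarTower ℝ A P]

local notation "Λ" => ShiftFun A P
local notation "Λ^" => shiftDeg A P
local notation "𝔛" => vectorField A P
local notation "𝓞" => CotFun A P
local notation "𝓢" => SplitFun A P
local notation "𝔇" => Derivation ℝ A A
local notation "𝓔" => Module.End ℝ
local notation "𝔞" => algebraMap A _
local notation "𝔞Λ" => algebraMap A Λ

local instance : NonUnitalNonAssocSemiring Λ := inferInstance
local instance : NonUnitalNonAssocSemiring 𝓞 := inferInstance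
local instance : AddCommMonoid Λ := inferInstance
local instance : AddCommMonoid 𝓞 := inferInstance
local instance : Module ℝ Λ := inferInstance
local instance : Module ℝ 𝓞 := inferInstance

lemma sum_ext {ι M : Type*} [AddCommMonoid M] {s : Finset ι} {f h : ι → M} (e : ∀ i, f i = h i) :
    ∑ i ∈ s, f i = ∑ i ∈ s, h i :=
  sum_congr rfl fun i _ => e i

lemma pm (k : ℕ) : (-1 : ℝ) ^ k = 1 ∨ (-1 : ℝ) ^ k = -1 :=
  neg_one_pow_eq_or ℝ k

lemma pm3 (i j k : ℕ) : ((-1 : ℝ) ^ i = 1 ∨ (-1 : ℝ) ^ i = -1) ∧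
    ((-1 : ℝ) ^ j = 1 ∨ (-1 : ℝ) ^ j = -1) ∧ ((-1 : ℝ) ^ k = 1 ∨ (-1 : ℝ) ^ k = -1) :=
  ⟨pm i, pm j, pm k⟩

/-! ## Functions and vector fields on `E[1]` -/

section ShiftFunctions

lemma shiftDeg_algebraMap (f : A) : 𝔞Λ f ∈ Λ^ 0 := by
  change _ ∈ (⋀[A]^0 P)
  rw [ExteriorAlgebra.exteriorPower, pow_zero]
  exact Submodule.algebraMap_mem f

lemma shiftDeg_one : (1 : Λ) ∈ Λ^ 0 := by
  simpa using shiftDeg_algebraMap (P := P) (1 : A)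

lemma shiftDeg_ι (ξ : P) : ι A ξ ∈ Λ^ 1 := by
  change _ ∈ (⋀[A]^1 P)
  rw [ExteriorAlgebra.exteriorPower, pow_one]
  exact LinearMap.mem_range_self _ ξ

lemma shiftDeg_mul {i j : ℕ} {r s : Λ} (hr : r ∈ Λ^ i) (hs : s ∈ Λ^ j) : r * s ∈ Λ^ (i + j) := by
  change _ ∈ (⋀[A]^(i + j) P)
  rw [ExteriorAlgebra.exteriorPower, pow_add]
  exact mul_mem_mul hr hs

lemma shiftDeg_smul {i : ℕ} (f : A) {r : Λ} (hr : r ∈ Λ^ i) : f • r ∈ Λ^ i :=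
  smul_mem (⋀[A]^i P) f hr

lemma shiftDeg_zero_eq {r : Λ} (hr : r ∈ Λ^ 0) : ∃ f : A, 𝔞Λ f = r := by
  change _ ∈ (⋀[A]^0 P) at hr
  rw [ExteriorAlgebra.exteriorPower, pow_zero] at hr
  simpa using hr

lemma shift_induction {p : Λ → Prop} (fn : ∀ f : A, p (𝔞 f))
    (lin : ∀ (ξ : P) r, p r → p (ι A ξ * r)) (add : ∀ r s, p r → p s → p (r + s)) (r : Λ) : p r :=
  CliffordAlgebra.left_induction (Q := (0 : QuadraticForm A P)) (P := p) fn add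
    (fun r ξ h => lin ξ r h) r

lemma shiftDeg_induction {p : ℕ → Λ → Prop} (fn : ∀ f : A, p 0 (𝔞 f))
    (lin : ∀ i (ξ : P) r, r ∈ Λ^ i → p i r → p (i + 1) (ι A ξ * r))
    (add : ∀ i r s, r ∈ Λ^ i → s ∈ Λ^ i → p i r → p i s → p i (r + s))
    (i : ℕ) : ∀ r ∈ Λ^ i, p i r := by
  induction i with
  | zero =>
    intro r hr
    obtain ⟨f, rfl⟩ := shiftDeg_zero_eq hr
    exact fn f
  | succ i ih =>
    intro r hr
    change _ ∈ (⋀[A]^(i + 1) P) at hr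
    rw [ExteriorAlgebra.exteriorPower, pow_succ'] at hr
    have key : ∀ r ∈ (LinearMap.range (ι A (M := P)) *
        LinearMap.range (ι A (M := P)) ^ i),
        r ∈ Λ^ (i + 1) ∧ p (i + 1) r := by
      intro r hr
      induction hr using Submodule.mul_induction_on' with
      | mem_mul_mem x hx y hy =>
        obtain ⟨ξ, rfl⟩ := hx
        have hy' : y ∈ Λ^ i := hy
        refine ⟨?_, lin i ξ y hy' (ih y hy')⟩
        rw [add_comm]
        exact shiftDeg_mul (shiftDeg_ι ξ) hy'
      | add x _ y _ hx hy => exact ⟨add_mem hx.1 hy.1, add _ _ _ hx.1 hy.1 hx.2 hy.2⟩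
    exact (key r hr).2

lemma iSup_shiftDeg (r : Λ) : r ∈ ⨆ i, Λ^ i := by
  induction r using shift_induction with
  | fn f => exact mem_iSup_of_mem 0 (shiftDeg_algebraMap f)
  | add r s hr hs => exact add_mem hr hs
  | lin ξ r hr =>
    induction hr using Submodule.iSup_induction' with
    | mem i r hr =>
      exact mem_iSup_of_mem (1 + i) (shiftDeg_mul (shiftDeg_ι ξ) hr)
    | zero => simp
    | add r s _ _ hr hs => rw [mul_add]; exact add_mem hr hs

lemma shift_hom_induction {p : Λ → Prop} (mem : ∀ i, ∀ r ∈ Λ^ i, p r)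
    (add : ∀ r s, p r → p s → p (r + s)) (r : Λ) : p r := by
  have hr := iSup_shiftDeg r
  induction hr using Submodule.iSup_induction' with
  | mem i r hr => exact mem i r hr
  | zero => exact mem 0 0 (zero_mem _)
  | add r s _ _ hr hs => exact add r s hr hs

variable (A P) in
/-- The parity automorphism of the functions on `E[1]`. -/
def shiftInv : Λ →ₐ[ℝ] Λ :=
  (CliffordAlgebra.involute (Q := (0 : QuadraticForm A P))).restrictScalars ℝ

lemma shiftInv_ι (ξ : P) : shiftInv A P (ι A ξ) = - ι A ξ :=
  CliffordAlgebra.involute_ι ξ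

lemma shiftInv_algebraMap (f : A) : shiftInv A P (𝔞 f) = 𝔞 f :=
  (CliffordAlgebra.involute (Q := (0 : QuadraticForm A P))).commutes f

lemma shiftInv_of_mem {i : ℕ} {r : Λ} (hr : r ∈ Λ^ i) : shiftInv A P r = (-1 : ℝ) ^ i • r := by
  refine shiftDeg_induction (p := fun i r => shiftInv A P r = (-1 : ℝ) ^ i • r) ?_ ?_ ?_ i r hr
  · intro f
    simp [shiftInv_algebraMap]
  · intro i ξ r _ h
    rw [map_mul, shiftInv_ι, h, pow_succ]
    simp
  · intro i r s _ _ hr hs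
    rw [map_add, hr, hs, smul_add]

lemma shift_comm_ι (ξ : P) (s : Λ) : s * ι A ξ = ι A ξ * shiftInv A P s := by
  induction s using shift_induction with
  | fn f => rw [shiftInv_algebraMap, commutes]
  | add r s hr hs => rw [add_mul, hr, hs, map_add, mul_add]
  | lin η r hr =>
    rw [map_mul, shiftInv_ι, mul_assoc, hr, ← mul_assoc, neg_mul, mul_neg, ← mul_assoc,
      eq_neg_iff_add_eq_zero, ← add_mul, ExteriorAlgebra.ι_add_mul_swap, zero_mul]

lemma neg_one_pow_mul_self (k : ℕ) : (-1 : ℝ) ^ k * (-1 : ℝ) ^ k = 1 := by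
  rw [← mul_pow]; simp

lemma shift_comm {i j : ℕ} {r s : Λ} (hr : r ∈ Λ^ i)
    (hs : s ∈ Λ^ j) : s * r = (-1 : ℝ) ^ (i * j) • (r * s) := by
  refine shiftDeg_induction (p := fun i r => s * r = (-1 : ℝ) ^ (i * j) • (r * s)) ?_ ?_ ?_ i r hr
  · intro f
    simp [commutes]
  · intro i ξ r _ h
    rw [← mul_assoc, shift_comm_ι, shiftInv_of_mem hs, mul_smul_comm, smul_mul_assoc, mul_assoc,
      h, mul_smul_comm, smul_smul, ← pow_add, mul_assoc]
    congr 2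
    ring
  · intro i r t _ _ hr ht
    rw [mul_add, hr, ht, add_mul, smul_add]

/-! ### Vector fields -/

lemma vf_deg {d i : ℕ} {V : 𝓔 Λ} (hV : V ∈ 𝔛 d) {r : Λ} (hr : r ∈ Λ^ i) : V r ∈ Λ^ (i + d - 2) := by
  by_cases h : i + d < 2
  · rw [hV.2.1 i r hr h]
    exact zero_mem _
  · exact hV.1 i _ r hr (by omega)

lemma vf_mul {d i : ℕ} {V : 𝓔 Λ} (hV : V ∈ 𝔛 d) {r : Λ} (hr : r ∈ Λ^ i) (s : Λ) :
    V (r * s) = V r * s + (-1 : ℝ) ^ (i * d) • (r * V s) :=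
  hV.2.2 i r s hr

lemma derivation_ext {d : ℕ} {V W : 𝓔 Λ}
    (hV : ∀ i r s, r ∈ Λ^ i → V (r * s) = V r * s + (-1 : ℝ) ^ (i * d) • (r * V s))
    (hW : ∀ i r s, r ∈ Λ^ i → W (r * s) = W r * s + (-1 : ℝ) ^ (i * d) • (r * W s))
    (h0 : ∀ f : A, V (𝔞 f) = W (𝔞 f)) (h1 : ∀ ξ : P, V (ι A ξ) = W (ι A ξ)) : V = W := by
  ext r
  induction r using shift_induction with
  | fn f => exact h0 f
  | add r s hr hs => rw [map_add, map_add, hr, hs]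
  | lin ξ r hr => rw [hV 1 _ _ (shiftDeg_ι ξ), hW 1 _ _ (shiftDeg_ι ξ), h1, hr]

lemma vf_ext {d e : ℕ} {V W : 𝓔 Λ} (hV : V ∈ 𝔛 d) (hW : W ∈ 𝔛 e) (hde : d = e)
    (h0 : ∀ f : A, V (𝔞 f) = W (𝔞 f)) (h1 : ∀ ξ : P, V (ι A ξ) = W (ι A ξ)) : V = W := by
  subst hde
  exact derivation_ext hV.2.2 hW.2.2 h0 h1

lemma vf_zero {V : 𝓔 Λ} (hV : V ∈ 𝔛 0) : V = 0 := by
  refine vf_ext hV (zero_mem _) rfl (fun f => ?_) (fun ξ => ?_)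
  · rw [hV.2.1 0 _ (shiftDeg_algebraMap f) (by norm_num)]; rfl
  · rw [hV.2.1 1 _ (shiftDeg_ι ξ) (by norm_num)]; rfl

lemma mem_vf_of_gen {d : ℕ} {V : 𝓔 Λ}
    (hV : ∀ i r s, r ∈ Λ^ i → V (r * s) = V r * s + (-1 : ℝ) ^ (i * d) • (r * V s))
    (h0 : ∀ f : A, (∀ k, d = k + 2 → V (𝔞 f) ∈ Λ^ k) ∧ (d < 2 → V (𝔞 f) = 0))
    (h1 : ∀ ξ : P, (∀ k, d = k + 1 → V (ι A ξ) ∈ Λ^ k) ∧ (d < 1 → V (ι A ξ) = 0)) : V ∈ 𝔛 d := by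
  have key : ∀ i, ∀ r ∈ Λ^ i, (∀ k, i + d = k + 2 → V r ∈ Λ^ k) ∧
      (i + d < 2 → V r = 0) := by
    refine shiftDeg_induction (p := fun i r => (∀ k, i + d = k + 2 → V r ∈ Λ^ k) ∧
      (i + d < 2 → V r = 0)) ?_ ?_ ?_
    · intro f
      simpa using h0 f
    · intro i ξ r hr ih
      rw [hV 1 _ _ (shiftDeg_ι ξ)]
      constructor
      · intro k hk
        refine add_mem ?_ (smul_mem _ _ ?_)
        · rcases Nat.eq_zero_or_pos d with hd | hd
          · rw [(h1 ξ).2 (by omega), zero_mul]; exact zero_mem _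
          · have := shiftDeg_mul ((h1 ξ).1 (d - 1) (by omega)) hr
            rwa [show d - 1 + i = k by omega] at this
        · by_cases h : i + d < 2
          · rw [ih.2 h, mul_zero]; exact zero_mem _
          · have := shiftDeg_mul (shiftDeg_ι ξ) (ih.1 (i + d - 2) (by omega))
            rwa [show 1 + (i + d - 2) = k by omega] at this
      · intro h
        rw [ih.2 (by omega), (h1 ξ).2 (by omega)]
        simp
    · intro i r s _ _ hr hs
      refine ⟨fun k hk => ?_, fun h => ?_⟩
      · rw [map_add]; exact add_mem (hr.1 k hk) (hs.1 k hk)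
      · rw [map_add, hr.2 h, hs.2 h, add_zero]
  exact ⟨fun i k r hr h => (key i r hr).1 k h, fun i r hr h => (key i r hr).2 h, hV⟩

lemma vf_smul {i d : ℕ} {r : Λ} (hr : r ∈ Λ^ i) {V : 𝓔 Λ} (hV : V ∈ 𝔛 d) :
    mulLeft ℝ r * V ∈ 𝔛 (i + d) := by
  refine ⟨fun j k s hs h => ?_, fun j s hs h => ?_, fun j s t hs => ?_⟩
  · by_cases h' : j + d < 2
    · simp only [mul_apply, mulLeft_apply, hV.2.1 j s hs h', mul_zero]
      exact zero_mem _
    · have := shiftDeg_mul hr (hV.1 j (j + d - 2) s hs (by omega))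
      rwa [show i + (j + d - 2) = k by omega] at this
  · simp [hV.2.1 j s hs (by omega)]
  · simp only [mul_apply, mulLeft_apply, vf_mul hV hs]
    rw [mul_add, mul_smul_comm, ← mul_assoc, ← mul_assoc, shift_comm hs hr, smul_mul_assoc,
      smul_smul, ← pow_add, mul_assoc s, mul_add, add_comm (j * i)]

/-- The graded commutator of two endomorphisms of degrees `d`, `e`. -/
def vfComm (d e : ℕ) (V W : 𝓔 Λ) : 𝓔 Λ :=
  V * W - (-1 : ℝ) ^ (d * e) • (W * V)

lemma vfComm_apply (d e : ℕ) (V W : 𝓔 Λ) (r : Λ) :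
    vfComm d e V W r = V (W r) - (-1 : ℝ) ^ (d * e) • W (V r) := rfl

lemma vfComm_eq_zero {d e : ℕ} {V W : 𝓔 Λ} (hV : V ∈ 𝔛 d)
    (hW : W ∈ 𝔛 e) (h : d + e < 2) : vfComm d e V W = 0 := by
  rcases (by omega : d = 0 ∨ e = 0) with rfl | rfl
  · ext; simp [vfComm, vf_zero hV]
  · ext; simp [vfComm, vf_zero hW]

lemma vfComm_mul {d e i : ℕ} {V W : 𝓔 Λ} (hV : V ∈ 𝔛 d) (hW : W ∈ 𝔛 e) {r : Λ} (hr : r ∈ Λ^ i)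
    (s : Λ) : vfComm d e V W (r * s) =
      vfComm d e V W r * s + (-1 : ℝ) ^ (i * (d + e)) • (r * vfComm d e V W s) := by
  rcases Nat.eq_zero_or_pos d with hd | hd
  · subst hd; simp [vfComm, vf_zero hV]
  rcases Nat.eq_zero_or_pos e with he | he
  · subst he; simp [vfComm, vf_zero hW]
  have sg : ∀ a : ℕ, a + d ≥ 2 → (-1 : ℝ) ^ ((a + d - 2) * e) = (-1) ^ ((a + d) * e) := by
    intro a ha
    obtain ⟨c, hc⟩ := Nat.exists_eq_add_of_le ha
    rw [hc, show 2 + c - 2 = c by omega, add_mul, pow_add, pow_mul]; simp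
  have sg' : ∀ a : ℕ, a + e ≥ 2 → (-1 : ℝ) ^ ((a + e - 2) * d) = (-1) ^ ((a + e) * d) := by
    intro a ha
    obtain ⟨c, hc⟩ := Nat.exists_eq_add_of_le ha
    rw [hc, show 2 + c - 2 = c by omega, add_mul, pow_add, pow_mul]; simp
  have h1 : (-1 : ℝ) ^ ((i + d - 2) * e) • (V r * W s) = (-1 : ℝ) ^ ((i + d) * e) • (V r * W s) := by
    by_cases h : i + d < 2
    · simp [hV.2.1 i r hr h]
    · rw [sg i (by omega)]
  have h2 : (-1 : ℝ) ^ ((i + e - 2) * d) • (W r * V s) = (-1 : ℝ) ^ ((i + e) * d) • (W r * V s) := by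
    by_cases h : i + e < 2
    · simp [hW.2.1 i r hr h]
    · rw [sg' i (by omega)]
  simp only [vfComm_apply]
  rw [vf_mul hV hr, vf_mul hW hr, map_add, map_add, map_smul, map_smul, vf_mul hV hr,
    vf_mul hW hr, vf_mul hW (vf_deg hV hr), vf_mul hV (vf_deg hW hr), h1, h2]
  obtain ⟨hd' | hd', he' | he', hi' | hi'⟩ := pm3 d e i <;>
  simp only [mul_add, add_mul, pow_add, pow_mul, hd', he', hi', one_pow, sub_mul, mul_sub, smul_sub,
    smul_add, smul_mul_assoc, mul_smul_comm, one_smul, neg_smul, neg_neg, mul_neg, neg_mul, mul_one,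
    one_mul, smul_neg] <;> abel

lemma vfComm_mem {d e : ℕ} {V W : 𝓔 Λ} (hV : V ∈ 𝔛 d)
    (hW : W ∈ 𝔛 e) : vfComm d e V W ∈ 𝔛 (d + e - 2) := by
  by_cases hlt : d + e < 2
  · rw [vfComm_eq_zero hV hW hlt]; exact zero_mem _
  rcases Nat.eq_zero_or_pos d with hd | hd
  · subst hd
    rw [show vfComm 0 e V W = 0 by ext; simp [vfComm, vf_zero hV]]; exact zero_mem _
  rcases Nat.eq_zero_or_pos e with he | he
  · subst he
    rw [show vfComm d 0 V W = 0 by ext; simp [vfComm, vf_zero hW]]; exact zero_mem _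
  have hz : ∀ {a b i j : ℕ} {V W : 𝓔 Λ}, V ∈ 𝔛 a →
      W ∈ 𝔛 b → ∀ {r}, r ∈ Λ^ i → i + (a + b - 2) < 2 → V (W r) = 0 := by
    intro a b i j V W hV hW r hr h
    by_cases h' : i + b < 2
    · rw [hW.2.1 i r hr h', map_zero]
    · exact hV.2.1 _ _ (vf_deg hW hr) (by omega)
  refine ⟨fun i k r hr h => ?_, fun i r hr h => ?_, fun i r s hr => ?_⟩
  · rw [vfComm_apply]
    refine sub_mem ?_ (smul_mem _ _ ?_)
    · by_cases h' : i + e < 2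
      · rw [hW.2.1 i r hr h', map_zero]; exact zero_mem _
      · exact hV.1 _ _ _ (vf_deg hW hr) (by omega)
    · by_cases h' : i + d < 2
      · rw [hV.2.1 i r hr h', map_zero]; exact zero_mem _
      · exact hW.1 _ _ _ (vf_deg hV hr) (by omega)
  · rw [vfComm_apply, hz (j := 0) hV hW hr h, hz (j := 0) hW hV hr (by omega)]
    simp
  · rw [vfComm_mul hV hW hr]
    congr 2
    obtain ⟨c, hc⟩ := Nat.exists_eq_add_of_le (not_lt.1 hlt)
    rw [hc, show 2 + c - 2 = c by omega, mul_add, pow_add, pow_mul']; simp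

end ShiftFunctions

/-! ## The algebra of functions on `T*[2]E[1]` and its graded derivations -/

lemma exists_linearMap_of_rel {𝕜 X Y : Type*} [Field 𝕜] [AddCommGroup X] [Module 𝕜 X]
    [AddCommGroup Y] [Module 𝕜 Y] (R : X → Y → Prop) (total : ∀ x, ∃ y, R x y)
    (add : ∀ x x' y y', R x y → R x' y' → R (x + x') (y + y'))
    (smul : ∀ (c : 𝕜) x y, R x y → R (c • x) (c • y))
    (uniq : ∀ x y y', R x y → R x y' → y = y') : ∃ B : X →ₗ[𝕜] Y, ∀ x, R x (B x) := by
  choose B hB using total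
  exact ⟨{ toFun := B
           map_add' := fun x x' => uniq _ _ _ (hB _) (add _ _ _ _ (hB x) (hB x'))
           map_smul' := fun c x => uniq _ _ _ (hB _) (smul c _ _ (hB x)) }, hB⟩

section CotangentFunctions

namespace CotFun

lemma mk_rel {x y : FreeAlgebra ℝ (CotGen A P)} (h : CotRel A P x y) :
    CotFun.mk A P x = CotFun.mk A P y :=
  RingQuot.mkAlgHom_rel ℝ h

variable (A P) in
/-- The pullback of functions from `E[1]` to `T*[2]E[1]`, as a homomorphism of algebras. -/
def fnHom : Λ →ₐ[ℝ] 𝓞 where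
  toFun := fn
  map_one' := by
    have h := mk_rel (CotRel.fn_const (A := A) (P := P) 1)
    simpa [fn] using h
  map_mul' r s := (mk_rel (.fn_mul r s)).trans (map_mul _ _ _)
  map_zero' := by
    have h := mk_rel (CotRel.fn_const (A := A) (P := P) 0)
    simpa [fn] using h
  map_add' r s := (mk_rel (.fn_add r s)).trans (map_add _ _ _)
  commutes' c := by
    have h := mk_rel (CotRel.fn_const (A := A) (P := P) c)
    rwa [AlgHom.commutes] at h

lemma fnHom_apply (r : Λ) : fnHom A P r = fn r := rfl

lemma fn_add (r s : Λ) : fn (r + s) = fn r + fn s :=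
  map_add (fnHom A P) r s

lemma fn_mul (r s : Λ) : fn (r * s) = fn r * fn s :=
  map_mul (fnHom A P) r s

lemma fn_smul (c : ℝ) (r : Λ) : fn (c • r) = c • fn r :=
  map_smul (fnHom A P) c r

lemma fn_zero : fn (0 : Λ) = 0 := map_zero (fnHom A P)

lemma fn_neg (r : Λ) : fn (-r) = -fn r := map_neg (fnHom A P) r

lemma fn_one : fn (1 : Λ) = 1 := map_one (fnHom A P)

lemma mom_mul_left {i d e : ℕ} {r : Λ} (hr : r ∈ Λ^ i) (V : 𝔛 d) (W : 𝔛 e) (he : e = i + d)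
    (hW : ∀ s, W.1 s = r * V.1 s) : mom W = fn r * mom V :=
  (mk_rel (.mom_smul i d e r V W hr he hW)).trans (map_mul _ _ _)

variable (A P) in
/-- The fibrewise linear functions on `T*[2]E[1]`, as a linear map. -/
def momHom (d : ℕ) : 𝔛 d →ₗ[ℝ] 𝓞 where
  toFun := mom
  map_add' V W := (mk_rel (.mom_add d V W)).trans (map_add _ _ _)
  map_smul' c V := by
    have h0 : algebraMap ℝ Λ c ∈ Λ^ 0 := by
      rw [algebraMap_eq_smul_one]
      exact smul_mem _ c shiftDeg_one
    rw [mom_mul_left h0 V (c • V) (zero_add d).symm (fun s => by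
      rw [← smul_def]; rfl), ← fnHom_apply, AlgHom.commutes, ← smul_def]
    rfl

lemma momHom_apply {d : ℕ} (V : 𝔛 d) : momHom A P d V = mom V := rfl

open Classical in
variable (A P) in
/-- The fibrewise linear function of an endomorphism, if it is a vector field of the given
degree. -/
def endMom (d : ℕ) (T : 𝓔 Λ) : 𝓞 :=
  if h : T ∈ 𝔛 d then mom ⟨T, h⟩ else 0

lemma endMom_of_mem {d : ℕ} {T : 𝓔 Λ} (h : T ∈ 𝔛 d) : endMom A P d T = mom ⟨T, h⟩ := dif_pos h

lemma endMom_coe {d : ℕ} (V : 𝔛 d) : endMom A P d V.1 = mom V :=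
  endMom_of_mem V.2

lemma endMom_zero (d : ℕ) : endMom A P d 0 = 0 := by
  rw [endMom_of_mem (zero_mem _)]
  exact map_zero (momHom A P d)

lemma endMom_add {d : ℕ} {T U : 𝓔 Λ} (hT : T ∈ 𝔛 d)
    (hU : U ∈ 𝔛 d) : endMom A P d (T + U) = endMom A P d T + endMom A P d U := by
  rw [endMom_of_mem hT, endMom_of_mem hU, endMom_of_mem (add_mem hT hU)]
  exact map_add (momHom A P d) ⟨T, hT⟩ ⟨U, hU⟩

lemma endMom_smul {d : ℕ} (c : ℝ) {T : 𝓔 Λ}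
    (hT : T ∈ 𝔛 d) : endMom A P d (c • T) = c • endMom A P d T := by
  rw [endMom_of_mem hT, endMom_of_mem (smul_mem _ c hT)]
  exact map_smul (momHom A P d) c ⟨T, hT⟩

lemma endMom_mulLeft {i d e : ℕ} {r : Λ} (hr : r ∈ Λ^ i) {T : 𝓔 Λ} (hT : T ∈ 𝔛 d)
    (he : e = i + d ∨ r = 0 ∨ T = 0) : endMom A P e (mulLeft ℝ r * T) = fn r * endMom A P d T := by
  rcases he with rfl | rfl | rfl
  · rw [endMom_of_mem hT, endMom_of_mem (vf_smul hr hT)]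
    exact mom_mul_left hr ⟨T, hT⟩ ⟨_, vf_smul hr hT⟩ rfl (fun s => rfl)
  · rw [LinearMap.mulLeft_zero_eq_zero, zero_mul, endMom_zero, fn_zero, zero_mul]
  · rw [mul_zero, endMom_zero, endMom_zero, mul_zero]

lemma monomial_one : CotMonomial 0 (1 : 𝓞) := by
  rw [← fn_one]; exact .fn 0 1 shiftDeg_one

lemma exists_lift {Q : Type*} [Ring Q] [Algebra ℝ Q] (F : Λ →ₐ[ℝ] Q) (G : ∀ d, 𝔛 d →ₗ[ℝ] Q)
    (h1 : ∀ i d e r (V : 𝔛 d) (W : 𝔛 e), r ∈ Λ^ i →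
      e = i + d → (∀ s, W.1 s = r * V.1 s) → G e W = F r * G d V)
    (h2 : ∀ i d r (V : 𝔛 d), r ∈ Λ^ i → G d V * F r = (-1 : ℝ) ^ (d * i) • (F r * G d V))
    (h3 : ∀ d e (V : 𝔛 d) (W : 𝔛 e), G d V * G e W = (-1 : ℝ) ^ (d * e) • (G e W * G d V)) :
    ∃ Φ : 𝓞 →ₐ[ℝ] Q, (∀ r, Φ (fn r) = F r) ∧ ∀ d (V : 𝔛 d), Φ (mom V) = G d V := by
  let f : CotGen A P → Q
    | .fn r => F r
    | .mom d V => G d V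
  have hl : ∀ x, FreeAlgebra.lift ℝ f (FreeAlgebra.ι ℝ x) = f x :=
    fun x => FreeAlgebra.lift_ι_apply f x
  have w : ∀ ⦃x y⦄, CotRel A P x y → FreeAlgebra.lift ℝ f x = FreeAlgebra.lift ℝ f y := by
    intro x y h
    cases h with
    | fn_add r s => rw [map_add, hl, hl, hl]; exact map_add F r s
    | fn_mul r s => rw [map_mul, hl, hl, hl]; exact map_mul F r s
    | fn_const c => rw [hl, AlgHom.commutes]; exact F.commutes c
    | mom_add d V W => rw [map_add, hl, hl, hl]; exact map_add (G d) V W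
    | mom_smul i d e r V W hr he hW =>
      rw [map_mul, hl, hl, hl]; exact h1 i d e r V W hr he hW
    | mom_fn i d r V hr =>
      rw [map_smul, map_mul, map_mul, hl, hl]; exact h2 i d r V hr
    | mom_mom d e V W =>
      rw [map_smul, map_mul, map_mul, hl, hl]; exact h3 d e V W
  refine ⟨RingQuot.liftAlgHom ℝ ⟨FreeAlgebra.lift ℝ f, w⟩, fun r => ?_, fun d V => ?_⟩
  · exact (RingQuot.liftAlgHom_mkAlgHom_apply ℝ _ w _).trans (hl _)
  · exact (RingQuot.liftAlgHom_mkAlgHom_apply ℝ _ w _).trans (hl _)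

lemma mk_surjective : Function.Surjective (CotFun.mk A P) :=
  RingQuot.mkAlgHom_surjective ℝ _

lemma span_monomial (x : 𝓞) : x ∈ Submodule.span ℝ {x : 𝓞 | ∃ k, CotMonomial k x} := by
  obtain ⟨x, rfl⟩ := mk_surjective x
  induction x using FreeAlgebra.induction with
  | grade0 c =>
    rw [AlgHom.commutes, algebraMap_eq_smul_one]
    exact smul_mem _ c (subset_span ⟨0, monomial_one⟩)
  | grade1 x =>
    cases x with
    | fn r =>
      change fn r ∈ _
      induction r using shift_hom_induction with
      | mem i r hr => exact subset_span ⟨i, .fn i r hr⟩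
      | add r s hr hs => rw [fn_add]; exact add_mem hr hs
    | mom d V => exact subset_span ⟨d, .mom d V⟩
  | add x y hx hy => rw [map_add]; exact add_mem hx hy
  | mul x y hx hy =>
    rw [map_mul]
    have h := mul_mem_mul hx hy
    rw [span_mul_span] at h
    refine span_mono ?_ h
    rintro _ ⟨a, ⟨k, ha⟩, b, ⟨l, hb⟩, rfl⟩
    exact ⟨k + l, .mul k l a b ha hb⟩

lemma induction {p : 𝓞 → Prop} (mem : ∀ k x, CotMonomial k x → p x)
    (add : ∀ x y, p x → p y → p (x + y)) (smul : ∀ (c : ℝ) x, p x → p (c • x)) (x : 𝓞) : p x := by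
  have hx := span_monomial x
  induction hx using span_induction with
  | mem x h => obtain ⟨k, h⟩ := h; exact mem k x h
  | zero => simpa using smul 0 1 (mem 0 1 monomial_one)
  | add x y _ _ hx hy => exact add x y hx hy
  | smul c x _ hx => exact smul c x hx

lemma hom_ext {Q : Type*} [Ring Q] [Algebra ℝ Q] {Φ Ψ : 𝓞 →ₐ[ℝ] Q} (h1 : ∀ r, Φ (fn r) = Ψ (fn r))
    (h2 : ∀ d (V : 𝔛 d), Φ (mom V) = Ψ (mom V)) : Φ = Ψ := by
  ext x
  induction x using CotFun.induction with
  | mem k x hx =>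
    induction hx with
    | fn i r hr => exact h1 r
    | mom d V => exact h2 d V
    | mul k l x y _ _ hx hy => rw [map_mul, map_mul, hx, hy]
  | add x y hx hy => rw [map_add, map_add, hx, hy]
  | smul c x hx => rw [map_smul, map_smul, hx]

lemma monomial_comm {k l : ℕ} {x y : 𝓞} (hx : CotMonomial k x) (hy : CotMonomial l y) :
    y * x = (-1 : ℝ) ^ (k * l) • (x * y) := by
  have hmul : ∀ {k l m : ℕ} {x y z : 𝓞}, y * x = (-1 : ℝ) ^ (k * l) • (x * y) →
      z * x = (-1 : ℝ) ^ (k * m) • (x * z) →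
      (y * z) * x = (-1 : ℝ) ^ (k * (l + m)) • (x * (y * z)) := by
    intro k l m x y z h1 h2
    rw [mul_assoc, h2, mul_smul_comm, ← mul_assoc, h1, smul_mul_assoc, smul_smul, ← pow_add,
      mul_assoc]
    congr 2; ring
  have hsymm : ∀ {k l : ℕ} {x y : 𝓞}, y * x = (-1 : ℝ) ^ (k * l) • (x * y) →
      x * y = (-1 : ℝ) ^ (l * k) • (y * x) := by
    intro k l x y h
    rw [h, smul_smul, mul_comm l k, neg_one_pow_mul_self, one_smul]
  induction hx generalizing l y with
  | fn i r hr =>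
    induction hy with
    | fn j s hs => rw [← fn_mul, shift_comm hr hs, fn_smul, fn_mul]
    | mom d V =>
      rw [mul_comm i d]
      exact ((map_mul _ _ _).symm.trans (mk_rel (.mom_fn i d r V hr))).trans
        ((map_smul _ _ _).trans (by rw [map_mul]; rfl))
    | mul l m y z _ _ h1 h2 => exact hmul h1 h2
  | mom d V =>
    induction hy with
    | fn i r hr =>
      apply hsymm
      exact ((map_mul _ _ _).symm.trans (mk_rel (.mom_fn i d r V hr))).trans
        ((map_smul _ _ _).trans (by rw [map_mul, mul_comm d i]; rfl))
    | mom e W =>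
      exact ((map_mul _ _ _).symm.trans (mk_rel (.mom_mom e d W V))).trans
        ((map_smul _ _ _).trans (by rw [map_mul, mul_comm d e]; rfl))
    | mul l m y z _ _ h1 h2 => exact hmul h1 h2
  | mul k m x z _ _ h1 h2 => exact hsymm (hmul (hsymm (h1 hy)) (hsymm (h2 hy)))

/-! ### The parity automorphism -/

lemma exists_inv : ∃ Φ : 𝓞 →ₐ[ℝ] 𝓞, (∀ r, Φ (fn r) = fn (shiftInv A P r)) ∧
      ∀ d (V : 𝔛 d), Φ (mom V) = (-1 : ℝ) ^ d • mom V := by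
  refine exists_lift ((fnHom A P).comp (shiftInv A P))
    (fun d => (-1 : ℝ) ^ d • momHom A P d) ?_ ?_ ?_
  · rintro i d e r V W hr rfl hW
    simp only [lm_smul, momHom_apply, AlgHom.comp_apply, fnHom_apply]
    rw [shiftInv_of_mem hr, fn_smul, mom_mul_left hr V W rfl hW, smul_mul_smul_comm, pow_add]
  · intro i d r V hr
    simp only [lm_smul, momHom_apply, AlgHom.comp_apply, fnHom_apply]
    rw [shiftInv_of_mem hr, fn_smul, smul_mul_smul_comm, smul_mul_smul_comm,
      monomial_comm (.fn i r hr) (.mom d V), smul_smul, smul_smul]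
    congr 1
    rw [mul_comm i d]; ring
  · intro d e V W
    simp only [lm_smul, momHom_apply]
    rw [smul_mul_smul_comm, smul_mul_smul_comm,
      monomial_comm (.mom e W) (.mom d V), smul_smul, smul_smul]
    congr 1
    rw [mul_comm e d]; ring

variable (A P) in
/-- The parity automorphism of the functions on `T*[2]E[1]`. -/
def inv : 𝓞 →ₐ[ℝ] 𝓞 := exists_inv.choose

lemma inv_fn (r : Λ) : inv A P (fn r) = fn (shiftInv A P r) :=
  exists_inv.choose_spec.1 r

lemma inv_mom {d : ℕ} (V : 𝔛 d) : inv A P (mom V) = (-1 : ℝ) ^ d • mom V :=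
  exists_inv.choose_spec.2 d V

lemma inv_monomial {k : ℕ} {x : 𝓞} (hx : CotMonomial k x) : inv A P x = (-1 : ℝ) ^ k • x := by
  induction hx with
  | fn i r hr => rw [inv_fn, shiftInv_of_mem hr, fn_smul]
  | mom d V => exact inv_mom V
  | mul k l x y _ _ hx hy => rw [map_mul, hx, hy, smul_mul_smul_comm, pow_add]

variable (A P) in
/-- The functions of parity `k` on `T*[2]E[1]`. -/
def par (k : ℕ) : Submodule ℝ 𝓞 where
  carrier := {x | inv A P x = (-1 : ℝ) ^ k • x}
  zero_mem' := by simp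
  add_mem' := by
    intro x y hx hy
    simp only [Set.mem_ofPred_eq] at *
    rw [map_add, hx, hy, smul_add]
  smul_mem' := by
    intro c x hx
    simp only [Set.mem_ofPred_eq] at *
    rw [map_smul, hx, smul_comm]

local notation "𝔓" => par A P

lemma mem_par {k : ℕ} {x : 𝓞} : x ∈ 𝔓 k ↔ inv A P x = (-1 : ℝ) ^ k • x := Iff.rfl

lemma par_congr {k l : ℕ} (h : (-1 : ℝ) ^ k = (-1 : ℝ) ^ l) : 𝔓 k = 𝔓 l := by
  ext x; rw [mem_par, mem_par, h]

lemma cotDeg_le_par (k : ℕ) : cotDeg A P k ≤ 𝔓 k :=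
  span_le.2 fun _ hx => inv_monomial hx

lemma par_mul {k l : ℕ} {x y : 𝓞} (hx : x ∈ 𝔓 k) (hy : y ∈ 𝔓 l) : x * y ∈ 𝔓 (k + l) := by
  rw [mem_par] at *
  rw [map_mul, hx, hy, smul_mul_smul_comm, pow_add]

lemma inv_inv (x : 𝓞) : inv A P (inv A P x) = x := by
  induction x using CotFun.induction with
  | mem k x hx => rw [inv_monomial hx, map_smul, inv_monomial hx, smul_smul,
      neg_one_pow_mul_self, one_smul]
  | add x y hx hy => rw [map_add, map_add, hx, hy]
  | smul c x hx => rw [map_smul, map_smul, hx]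

/-- The component of parity `k` of a function. -/
def proj (k : ℕ) : 𝓞 →ₗ[ℝ] 𝓞 :=
  (1 / 2 : ℝ) • (LinearMap.id + (-1 : ℝ) ^ k • (inv A P).toLinearMap)

lemma proj_apply (k : ℕ) (x : 𝓞) : proj k x = (1 / 2 : ℝ) • (x + (-1 : ℝ) ^ k • inv A P x) := rfl

lemma proj_mem (k : ℕ) (x : 𝓞) : proj k x ∈ 𝔓 k := by
  rw [mem_par, proj_apply, map_smul, map_add, map_smul, inv_inv]
  rcases pm k with h | h <;> rw [h] <;> module

lemma proj_add (x : 𝓞) : proj 0 x + proj 1 x = x := by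
  simp only [proj_apply]
  module

lemma proj_of_mem {k l : ℕ} {x : 𝓞} (hx : x ∈ 𝔓 l) :
    proj k x = ((1 + (-1 : ℝ) ^ k * (-1 : ℝ) ^ l) / 2) • x := by
  rw [mem_par] at hx
  rw [proj_apply, hx]
  module

lemma par_induction {k : ℕ} {p : 𝓞 → Prop}
    (mem : ∀ l x, (-1 : ℝ) ^ l = (-1 : ℝ) ^ k → CotMonomial l x → p x)
    (add : ∀ x y, p x → p y → p (x + y)) (smul : ∀ (c : ℝ) x, p x → p (c • x))
    (x : 𝓞) (hx : x ∈ 𝔓 k) : p x := by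
  have h0 : p 0 := by
    by_cases h : Even k
    · simpa using smul 0 1 (mem 0 1 (by simp [h.neg_one_pow]) monomial_one)
    · rw [Nat.not_even_iff_odd] at h
      have := mem 1 (fn (ι A (0 : P))) (by simp [h.neg_one_pow])
        (.fn 1 _ (shiftDeg_ι 0))
      simpa [fn_zero] using this
  have key : ∀ y : 𝓞, p (proj k y) := by
    intro y
    induction y using CotFun.induction with
    | mem l y hy =>
      rw [proj_of_mem (cotDeg_le_par l (subset_span hy))]
      rcases pm k with hk | hk <;> rcases pm l with hl | hl
      · exact smul _ _ (mem l y (by rw [hk, hl]) hy)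
      · simpa [hk, hl] using h0
      · simpa [hk, hl] using h0
      · exact smul _ _ (mem l y (by rw [hk, hl]) hy)
    | add x y hx hy => rw [map_add]; exact add _ _ hx hy
    | smul c x hx => rw [map_smul]; exact smul _ _ hx
  have := key x
  rwa [proj_of_mem hx, neg_one_pow_mul_self, show ((1 : ℝ) + 1) / 2 = 1 by norm_num,
    one_smul] at this

lemma par_comm {k l : ℕ} {x y : 𝓞} (hx : x ∈ 𝔓 k) (hy : y ∈ 𝔓 l) :
    y * x = (-1 : ℝ) ^ (k * l) • (x * y) := by
  refine par_induction (p := fun x => y * x = (-1 : ℝ) ^ (k * l) • (x * y)) ?_ ?_ ?_ x hx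
  · intro k' x hk hx
    rw [pow_mul, ← hk, ← pow_mul]
    refine par_induction (p := fun y => y * x = (-1 : ℝ) ^ (k' * l) • (x * y)) ?_ ?_ ?_ y hy
    · intro l' y hl hy
      rw [mul_comm k', pow_mul, ← hl, ← pow_mul, mul_comm l', monomial_comm hx hy]
    · intro y z hy hz
      rw [add_mul, mul_add, hy, hz, smul_add]
    · intro c y hy
      rw [smul_mul_assoc, mul_smul_comm, hy, smul_comm]
  · intro x z hx hz
    rw [add_mul, mul_add, hx, hz, smul_add]
  · intro c x hx
    rw [smul_mul_assoc, mul_smul_comm, hx, smul_comm]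

/-! ### Graded derivations -/

/-- `D` is a graded derivation of parity `p` of the functions on `T*[2]E[1]`. -/
structure IsDer (p : ℕ) (D : 𝓞 →ₗ[ℝ] 𝓞) : Prop where
  mul : ∀ k x y, x ∈ 𝔓 k → D (x * y) = D x * y + (-1 : ℝ) ^ (p * k) • (x * D y)
  par : ∀ k x, x ∈ 𝔓 k → D x ∈ 𝔓 (p + k)

lemma IsDer.congr {p q : ℕ} {D : 𝓞 →ₗ[ℝ] 𝓞} (hD : IsDer p D)
    (h : (-1 : ℝ) ^ p = (-1 : ℝ) ^ q) : IsDer q D where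
  mul k x y hx := by rw [hD.mul k x y hx, pow_mul, h, ← pow_mul]
  par k x hx := by
    rw [par_congr (k := q + k) (l := p + k) (by rw [pow_add, pow_add, h])]
    exact hD.par k x hx

lemma IsDer.zero (p : ℕ) : IsDer p (0 : 𝓞 →ₗ[ℝ] 𝓞) where
  mul k x y hx := by simp
  par k x hx := by simp

lemma IsDer.add {p : ℕ} {D D' : 𝓞 →ₗ[ℝ] 𝓞} (hD : IsDer p D)
    (hD' : IsDer p D') : IsDer p (D + D') where
  mul k x y hx := by
    simp only [lm_add, hD.mul k x y hx, hD'.mul k x y hx, add_mul, mul_add, smul_add]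
    abel
  par k x hx := add_mem (hD.par k x hx) (hD'.par k x hx)

lemma IsDer.smul {p : ℕ} (c : ℝ) {D : 𝓞 →ₗ[ℝ] 𝓞} (hD : IsDer p D) : IsDer p (c • D) where
  mul k x y hx := by
    simp only [lm_smul, hD.mul k x y hx, smul_add, smul_mul_assoc, mul_smul_comm]
    rw [smul_comm c]
  par k x hx := smul_mem _ c (hD.par k x hx)

lemma IsDer.mulLeft {p k : ℕ} {D : 𝓞 →ₗ[ℝ] 𝓞} (hD : IsDer p D)
    {z : 𝓞} (hz : z ∈ 𝔓 k) : IsDer (k + p) (mulLeft ℝ z * D) where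
  mul l x y hx := by
    simp only [mul_apply, mulLeft_apply, hD.mul l x y hx]
    rw [mul_add, mul_smul_comm, ← mul_assoc, ← mul_assoc, par_comm hx hz, smul_mul_assoc,
      smul_smul, ← pow_add, mul_assoc x]
    congr 3
    ring
  par l x hx := by
    rw [add_assoc]
    exact par_mul hz (hD.par l x hx)

lemma IsDer.comm {p q : ℕ} {D D' : 𝓞 →ₗ[ℝ] 𝓞} (hD : IsDer p D) (hD' : IsDer q D') :
    IsDer (p + q) (D ∘ₗ D' - (-1 : ℝ) ^ (p * q) • (D' ∘ₗ D)) where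
  mul k x y hx := by
    simp only [lm_sub, lm_smul, lm_comp, hD.mul k x y hx,
      hD'.mul k x y hx, map_add, map_smul, hD.mul _ _ y (hD'.par k x hx),
      hD'.mul _ _ y (hD.par k x hx), hD.mul k x _ hx, hD'.mul k x _ hx]
    obtain ⟨hp | hp, hq | hq, hk | hk⟩ := pm3 p q k <;>
    simp only [mul_add, add_mul, pow_add, pow_mul, hp, hq, hk, one_pow, sub_mul, mul_sub, smul_sub,
      smul_add, one_smul, neg_smul, neg_neg, mul_neg, neg_mul, mul_one, smul_neg] <;> abel
  par k x hx := by
    refine sub_mem ?_ (smul_mem _ _ ?_)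
    · rw [add_assoc]; exact hD.par _ _ (hD'.par k x hx)
    · rw [add_comm p q, add_assoc]; exact hD'.par _ _ (hD.par k x hx)

lemma IsDer.ext {p : ℕ} {D D' : 𝓞 →ₗ[ℝ] 𝓞} (hD : IsDer p D) (hD' : IsDer p D')
    (h1 : ∀ i, ∀ r ∈ Λ^ i, D (fn r) = D' (fn r))
    (h2 : ∀ d (V : 𝔛 d), D (mom V) = D' (mom V)) : D = D' := by
  ext x
  induction x using CotFun.induction with
  | mem k x hx =>
    induction hx with
    | fn i r hr => exact h1 i r hr
    | mom d V => exact h2 d V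
    | mul k l x y hx' _ hx hy =>
      have := cotDeg_le_par k (subset_span hx')
      rw [hD.mul k x y this, hD'.mul k x y this, hx, hy]
  | add x y hx hy => rw [map_add, map_add, hx, hy]
  | smul c x hx => rw [map_smul, map_smul, hx]

lemma inv_pow_apply {k : ℕ} {x : 𝓞} (hx : x ∈ 𝔓 k) (p : ℕ) :
    (inv A P ^ p) x = (-1 : ℝ) ^ (p * k) • x := by
  induction p with
  | zero => simp
  | succ p ih =>
    rw [pow_succ, AlgHom.mul_apply, mem_par.1 hx, map_smul, ih, smul_smul, ← pow_add]
    congr 2; ring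

lemma fn_mem_par {i : ℕ} {r : Λ} (hr : r ∈ Λ^ i) : fn r ∈ 𝔓 i := inv_monomial (.fn i r hr)

lemma mom_mem_par {d : ℕ} (V : 𝔛 d) : mom V ∈ 𝔓 d :=
  inv_monomial (.mom d V)

lemma mat_congr {C : Type*} [Zero C] {a b c a' b' c' : C} (ha : a = a') (hb : b = b')
    (hc : c = c') : !![a, b; 0, c] = !![a', b'; 0, c'] := by
  rw [ha, hb, hc]

lemma mat_mul {C : Type*} [Ring C] (a b c a' b' c' : C) :
    !![a, b; 0, c] * !![a', b'; 0, c'] = !![a * a', a * b' + b * c'; 0, c * c'] := by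
  rw [Matrix.mul_fin_two]; simp

lemma mat_smul {C : Type*} [Ring C] [Algebra ℝ C] (t : ℝ) (a b c : C) :
    t • !![a, b; 0, c] = !![t • a, t • b; 0, t • c] := by
  ext i j; fin_cases i <;> fin_cases j <;> simp

lemma mat_add {C : Type*} [Ring C] (a b c a' b' c' : C) :
    !![a, b; 0, c] + !![a', b'; 0, c'] = !![a + a', b + b'; 0, c + c'] := by
  ext i j; fin_cases i <;> fin_cases j <;> simp

lemma mat_one {C : Type*} [Ring C] : (1 : Matrix (Fin 2) (Fin 2) C) = !![1, 0; 0, 1] :=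
  Matrix.one_fin_two

lemma triangular_comm {p i d : ℕ} {x y u v : 𝓞} (hx : x ∈ 𝔓 i) (hy : y ∈ 𝔓 d)
    (hu : u ∈ 𝔓 (p + i)) (hv : v ∈ 𝔓 (p + d)) :
    !![(inv A P ^ p) y, v; 0, y] * !![(inv A P ^ p) x, u; 0, x] = (-1 : ℝ) ^ (d * i) •
      (!![(inv A P ^ p) x, u; 0, x] * !![(inv A P ^ p) y, v; 0, y]) := by
  have h0 := par_comm hx hy
  rw [mat_mul, mat_mul, mat_smul]
  refine mat_congr ?_ ?_ ?_
  · rw [← map_mul, ← map_mul, ← map_smul, mul_comm d i, h0]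
  · rw [inv_pow_apply hy, inv_pow_apply hx, smul_mul_assoc, smul_mul_assoc, par_comm hu hy,
      par_comm hx hv, smul_add, smul_smul, smul_smul, ← pow_add, ← pow_add, add_comm]
    obtain ⟨hp | hp, hd | hd, he | he⟩ := pm3 p d i <;>
    simp only [pow_add, pow_mul, mul_add, add_mul, hp, hd, he, one_pow, one_mul, mul_one, one_smul,
      mul_neg, neg_mul, neg_neg]
  · rw [mul_comm d i, h0]

variable (p : ℕ) (F : ShiftFun A P →ₗ[ℝ] CotFun A P) (G : ∀ d, vectorField A P d →ₗ[ℝ] CotFun A P)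
  (hFpar : ∀ i, ∀ r ∈ shiftDeg A P i, F r ∈ CotFun.par A P (p + i))
  (hGpar : ∀ d V, G d V ∈ CotFun.par A P (p + d))
  (hG : ∀ i d e r (V : vectorField A P d) (W : vectorField A P e), r ∈ shiftDeg A P i →
    e = i + d → (∀ s, W.1 s = r * V.1 s) →
    G e W = F r * mom V + (-1 : ℝ) ^ (p * i) • (fn r * G d V))

include hFpar hGpar hG in
lemma exists_triangular (hF : ∀ r s, F (r * s) = F r * fn s + (inv A P ^ p) (fn r) * F s) :
    ∃ Φ : 𝓞 →ₐ[ℝ] Matrix (Fin 2) (Fin 2) 𝓞,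
      (∀ r, Φ (fn r) = !![(inv A P ^ p) (fn r), F r; 0, fn r]) ∧ ∀ d (V : 𝔛 d),
        Φ (mom V) = !![(inv A P ^ p) (mom V), G d V; 0, mom V] := by
  have hF1 : F 1 = 0 := by
    have := hF 1 1
    simpa [fn_one] using this
  let F' : Λ →ₐ[ℝ] Matrix (Fin 2) (Fin 2) 𝓞 := AlgHom.ofLinearMap
    { toFun := fun r => !![(inv A P ^ p) (fn r), F r; 0, fn r]
      map_add' := fun r s => by rw [fn_add, map_add, map_add, mat_add]
      map_smul' := fun c r => by rw [fn_smul, map_smul, map_smul, RingHom.id_apply, mat_smul] }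
    (by
      change !![(inv A P ^ p) (fn 1), F 1; 0, fn 1] = 1
      rw [fn_one, map_one, hF1, mat_one])
    (fun r s => by
      change !![(inv A P ^ p) (fn (r * s)), F (r * s); 0, fn (r * s)] =
        !![(inv A P ^ p) (fn r), F r; 0, fn r] *
        !![(inv A P ^ p) (fn s), F s; 0, fn s]
      rw [mat_mul, hF, fn_mul, map_mul, add_comm (F r * _)])
  let G' : ∀ d, 𝔛 d →ₗ[ℝ] Matrix (Fin 2) (Fin 2) 𝓞 := fun d =>
    { toFun := fun V => !![(inv A P ^ p) (momHom A P d V), G d V; 0, momHom A P d V]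
      map_add' := fun V W => by rw [map_add, map_add, map_add, mat_add]
      map_smul' := fun c V => by rw [map_smul, map_smul, map_smul, RingHom.id_apply, mat_smul] }
  have F'a : ∀ r, F' r = !![(inv A P ^ p) (fn r), F r; 0, fn r] := fun r => rfl
  have G'a : ∀ d V, G' d V = !![(inv A P ^ p) (mom V), G d V; 0, mom V] :=
    fun d V => rfl
  clear_value F' G'
  have key := exists_lift F' G' ?_ ?_ ?_
  · obtain ⟨Φ, h1, h2⟩ := key
    exact ⟨Φ, fun r => (h1 r).trans (F'a r), fun d V => (h2 d V).trans (G'a d V)⟩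
  · intro i d e r V W hr he hW
    rw [F'a, G'a, G'a, mat_mul, mom_mul_left hr V W he hW]
    refine mat_congr (map_mul _ _ _) ?_ rfl
    rw [hG i d e r V W hr he hW, inv_pow_apply (fn_mem_par hr), smul_mul_assoc, add_comm]
  · intro i d r V hr
    rw [F'a, G'a]
    exact triangular_comm (fn_mem_par hr) (mom_mem_par V) (hFpar i r hr) (hGpar d V)
  · intro d e V W
    rw [G'a, G'a]
    exact triangular_comm (mom_mem_par W) (mom_mem_par V) (hGpar e W) (hGpar d V)

include hFpar hGpar hG in
lemma exists_der (hF : ∀ i j, ∀ r ∈ Λ^ i, ∀ s ∈ Λ^ j, F (r * s) = F r * fn s +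
      (-1 : ℝ) ^ (p * i) • (fn r * F s)) : ∃ D : 𝓞 →ₗ[ℝ] 𝓞, IsDer p D ∧ (∀ r, D (fn r) = F r) ∧
      ∀ d (V : 𝔛 d), D (mom V) = G d V := by
  have hF' : ∀ r s, F (r * s) = F r * fn s + (inv A P ^ p) (fn r) * F s := by
    intro r s
    induction r using shift_hom_induction with
    | mem i r hr =>
      induction s using shift_hom_induction with
      | mem j s hs =>
        rw [hF i j r hr s hs, inv_pow_apply (fn_mem_par hr), smul_mul_assoc]
      | add s t hs ht => rw [mul_add, map_add, hs, ht, map_add, fn_add, mul_add, mul_add]; abel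
    | add r t hr ht =>
      rw [add_mul, map_add, hr, ht, map_add, fn_add, map_add, add_mul, add_mul]; abel
  obtain ⟨Φ, h1, h2⟩ := exists_triangular p F G hFpar hGpar hG hF'
  have key : ∀ x, Φ x = !![(inv A P ^ p) x, Φ x 0 1; 0, x] := by
    intro x
    induction x using CotFun.induction with
    | mem k x hx =>
      induction hx with
      | fn i r hr => rw [h1]; rfl
      | mom d V => rw [h2]; rfl
      | mul k l x y _ _ hx hy =>
        rw [map_mul, hx, hy, mat_mul, map_mul]; rfl
    | add x y hx hy =>
      rw [map_add, map_add, Matrix.add_apply, ← mat_add, ← hx, ← hy]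
    | smul c x hx =>
      rw [map_smul, map_smul, Matrix.smul_apply, ← mat_smul, ← hx]
  let D : 𝓞 →ₗ[ℝ] 𝓞 :=
    { toFun := fun x => Φ x 0 1
      map_add' := fun x y => by rw [map_add]; rfl
      map_smul' := fun c x => by rw [map_smul]; rfl }
  have hD : ∀ x, D x = Φ x 0 1 := fun x => rfl
  have hD1 : ∀ r, D (fn r) = F r := fun r => by rw [hD, h1]; rfl
  have hD2 : ∀ d (V : 𝔛 d), D (mom V) = G d V :=
    fun d V => by rw [hD, h2]; rfl
  have hmul : ∀ k x y, x ∈ 𝔓 k →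
      D (x * y) = D x * y + (-1 : ℝ) ^ (p * k) • (x * D y) := by
    intro k x y hx
    rw [hD, map_mul, key x, key y, mat_mul, inv_pow_apply hx, smul_mul_assoc, smul_mul_assoc,
      add_comm]
    rfl
  refine ⟨D, ⟨hmul, fun k x hx => ?_⟩, hD1, hD2⟩
  refine par_induction (p := fun x => D x ∈ 𝔓 (p + k)) ?_ ?_ ?_ x hx
  · intro l x hl hx
    rw [par_congr (k := p + k) (l := p + l) (by rw [pow_add, pow_add, hl])]
    clear hl
    induction hx with
    | fn i r hr => rw [hD1]; exact hFpar i r hr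
    | mom d V => rw [hD2]; exact hGpar d V
    | mul k l x y hx' hy' hx hy =>
      have h1 := cotDeg_le_par k (subset_span hx')
      have h2 := cotDeg_le_par l (subset_span hy')
      rw [hmul k x y h1]
      refine add_mem ?_ (smul_mem _ _ ?_)
      · rw [← add_assoc]; exact par_mul hx h2
      · rw [add_left_comm]; exact par_mul h1 hy
  · intro x y hx hy; rw [map_add]; exact add_mem hx hy
  · intro c x hx; rw [map_smul]; exact smul_mem _ c hx

end CotFun

end CotangentFunctions

/-! ## The canonical Poisson bracket of `T*[2]E[1]` -/

section CanonicalBracket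

local notation "𝔓" => CotFun.par A P

namespace CotFun

lemma monomial_mem {k : ℕ} {x : 𝓞} (hx : CotMonomial k x) : x ∈ 𝔓 k :=
  cotDeg_le_par k (subset_span hx)

lemma endMom_mem_par (d : ℕ) (T : 𝓔 Λ) : endMom A P d T ∈ 𝔓 d := by
  by_cases h : T ∈ 𝔛 d
  · rw [endMom_of_mem h]; exact mom_mem_par _
  · rw [endMom, dif_neg h]; exact zero_mem _

lemma neg_one_pow_sub_two {k : ℕ} (h : 2 ≤ k) : (-1 : ℝ) ^ (k - 2) = (-1) ^ k := by
  obtain ⟨c, rfl⟩ := Nat.exists_eq_add_of_le h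
  rw [show 2 + c - 2 = c by omega, pow_add]; simp

lemma vf_pos {d : ℕ} {V : 𝓔 Λ} (hV : V ∈ 𝔛 d) : V = 0 ∨ 1 ≤ d := by
  rcases Nat.eq_zero_or_pos d with h | h
  · subst h; exact Or.inl (vf_zero hV)
  · exact Or.inr h

lemma fn_vf_mem_par {d i : ℕ} (V : 𝔛 d) {r : Λ} (hr : r ∈ Λ^ i) : fn (V.1 r) ∈ 𝔓 (d + i) := by
  by_cases h : i + d < 2
  · rw [V.2.2.1 i r hr h, fn_zero]; exact zero_mem _
  · rw [par_congr (k := d + i) (l := i + d - 2)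
      (by rw [neg_one_pow_sub_two (by omega), add_comm])]
    exact fn_mem_par (vf_deg V.2 hr)

lemma endMom_comm_mem_par {d e : ℕ} (V : 𝔛 d) (W : 𝔛 e) :
    endMom A P (d + e - 2) (vfComm d e V.1 W.1) ∈ 𝔓 (d + e) := by
  by_cases h : d + e < 2
  · rw [vfComm_eq_zero V.2 W.2 h, endMom_zero]; exact zero_mem _
  · rw [← par_congr (k := d + e - 2) (l := d + e) (neg_one_pow_sub_two (by omega))]
    exact endMom_mem_par _ _

lemma endMom_comm_smul_right {a i d e : ℕ} {r : Λ} (hr : r ∈ Λ^ i)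
    (U : 𝔛 a) (V : 𝔛 d) (W : 𝔛 e) (he : e = i + d) (hW : ∀ s, W.1 s = r * V.1 s) :
    endMom A P (a + e - 2) (vfComm a e U.1 W.1) = fn (U.1 r) * mom V +
      (-1 : ℝ) ^ (a * i) • (fn r * endMom A P (a + d - 2) (vfComm a d U.1 V.1)) := by
  subst he
  have hWe : W.1 = mulLeft ℝ r * V.1 := LinearMap.ext hW
  rcases vf_pos U.2 with hU | ha
  · rw [hU]
    simp [vfComm, endMom_zero, fn_zero]
  rcases vf_pos V.2 with hV | hd
  · have : W.1 = 0 := by rw [hWe, hV, mul_zero]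
    rw [this, ← endMom_coe, hV]
    simp [vfComm, endMom_zero]
  have key : vfComm a (i + d) U.1 W.1 = mulLeft ℝ (U.1 r) * V.1 +
      (-1 : ℝ) ^ (a * i) • (mulLeft ℝ r * vfComm a d U.1 V.1) := by
    ext s
    simp only [vfComm_apply, lm_add, mul_apply, lm_smul,
      mulLeft_apply, hW, vf_mul U.2 hr, mul_sub, smul_sub, mul_smul_comm, smul_smul,
      ← pow_add, mul_add]
    rw [mul_comm i a]
    abel
  have h2 : i + a < 2 → U.1 r = 0 := U.2.2.1 i r hr
  have e1 : endMom A P (a + (i + d) - 2) (mulLeft ℝ (U.1 r) * V.1) =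
      fn (U.1 r) * endMom A P d V.1 := by
    refine endMom_mulLeft (vf_deg U.2 hr) V.2 ?_
    by_cases h : i + a < 2
    · exact Or.inr (Or.inl (h2 h))
    · left; omega
  have m1 : mulLeft ℝ (U.1 r) * V.1 ∈ 𝔛 (a + (i + d) - 2) := by
    by_cases h : i + a < 2
    · rw [h2 h, LinearMap.mulLeft_zero_eq_zero, zero_mul]; exact zero_mem _
    · have := vf_smul (vf_deg U.2 hr) V.2
      rwa [show i + a - 2 + d = a + (i + d) - 2 by omega] at this
  have e2 : endMom A P (a + (i + d) - 2) (mulLeft ℝ r * vfComm a d U.1 V.1) =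
      fn r * endMom A P (a + d - 2) (vfComm a d U.1 V.1) :=
    endMom_mulLeft hr (vfComm_mem U.2 V.2) (Or.inl (by omega))
  have m2 : mulLeft ℝ r * vfComm a d U.1 V.1 ∈ 𝔛 (a + (i + d) - 2) := by
    have := vf_smul hr (vfComm_mem U.2 V.2)
    rwa [show i + (a + d - 2) = a + (i + d) - 2 by omega] at this
  rw [key, endMom_add m1 (smul_mem _ _ m2), endMom_smul _ m2, e1, e2, endMom_coe]

lemma vfComm_swap (d e : ℕ) (V W : 𝓔 Λ) :
    vfComm e d W V = -((-1 : ℝ) ^ (d * e) • vfComm d e V W) := by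
  simp only [vfComm, smul_sub, smul_smul, neg_one_pow_mul_self, one_smul, mul_comm e d]
  abel

lemma endMom_comm_swap {d e : ℕ} (V : 𝔛 d) (W : 𝔛 e) : endMom A P (e + d - 2) (vfComm e d W.1 V.1) =
      -((-1 : ℝ) ^ (d * e) • endMom A P (d + e - 2) (vfComm d e V.1 W.1)) := by
  have h : vfComm e d W.1 V.1 = (-(-1 : ℝ) ^ (d * e)) • vfComm d e V.1 W.1 := by
    rw [vfComm_swap d e]; exact (neg_smul _ _).symm
  rw [h, add_comm e d, endMom_smul _ (vfComm_mem V.2 W.2), neg_smul]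

/-- The linear functions as a linear map on graded commutators with a fixed vector field. -/
def commMom {a : ℕ} (U : 𝔛 a) (d : ℕ) : 𝔛 d →ₗ[ℝ] 𝓞 where
  toFun V := endMom A P (a + d - 2) (vfComm a d U.1 V.1)
  map_add' V W := by
    rw [← endMom_add (vfComm_mem U.2 V.2) (vfComm_mem U.2 W.2)]
    congr 1
    simp only [vfComm, coe_add, mul_add, add_mul, smul_add]
    abel
  map_smul' c V := by
    rw [RingHom.id_apply, ← endMom_smul _ (vfComm_mem U.2 V.2)]
    congr 1
    simp only [vfComm, coe_smul, mul_smul_comm, smul_mul_assoc, smul_sub]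
    rw [smul_comm c]

lemma exists_momDer (a : ℕ) : ∃ B : 𝔛 a →ₗ[ℝ] 𝓔 𝓞,
    ∀ U, IsDer a (B U) ∧ (∀ r, B U (fn r) = fn (U.1 r)) ∧ ∀ d (V : 𝔛 d),
        B U (mom V) = endMom A P (a + d - 2) (vfComm a d U.1 V.1) := by
  refine exists_linearMap_of_rel (fun (U : 𝔛 a) D => IsDer a D ∧
    (∀ r, D (fn r) = fn (U.1 r)) ∧ ∀ d (V : 𝔛 d),
      D (mom V) = endMom A P (a + d - 2) (vfComm a d U.1 V.1)) ?_ ?_ ?_ ?_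
  · intro U
    refine exists_der a ((fnHom A P).toLinearMap ∘ₗ U.1) (fun d => commMom U d) ?_ ?_ ?_ ?_
    · exact fun i r hr => fn_vf_mem_par U hr
    · exact fun d V => endMom_comm_mem_par U V
    · exact fun i d e r V W hr he hW => endMom_comm_smul_right hr U V W he hW
    · intro i j r hr s hs
      change fn (U.1 (r * s)) = fn (U.1 r) * fn s +
        (-1 : ℝ) ^ (a * i) • (fn r * fn (U.1 s))
      rw [vf_mul U.2 hr, fn_add, fn_smul, fn_mul, fn_mul, mul_comm i a]
  · rintro U U' D D' ⟨h1, h2, h3⟩ ⟨h1', h2', h3'⟩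
    refine ⟨h1.add h1', fun r => ?_, fun d V => ?_⟩
    · rw [lm_add, h2, h2', ← fn_add]; rfl
    · rw [lm_add, h3, h3', ← endMom_add (vfComm_mem U.2 V.2) (vfComm_mem U'.2 V.2)]
      congr 1
      simp only [vfComm, coe_add, mul_add, add_mul, smul_add]
      abel
  · rintro c U D ⟨h1, h2, h3⟩
    refine ⟨h1.smul c, fun r => ?_, fun d V => ?_⟩
    · rw [lm_smul, h2, ← fn_smul]; rfl
    · rw [lm_smul, h3, ← endMom_smul _ (vfComm_mem U.2 V.2)]
      congr 1
      simp only [vfComm, coe_smul, mul_smul_comm, smul_mul_assoc, smul_sub]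
      rw [smul_comm c]
  · rintro U D D' ⟨h1, h2, h3⟩ ⟨h1', h2', h3'⟩
    exact h1.ext h1' (fun i r _ => by rw [h2, h2']) (fun d V => by rw [h3, h3'])

/-- The Hamiltonian vector field of a fibrewise linear function. -/
def momDer (a : ℕ) : 𝔛 a →ₗ[ℝ] 𝓔 𝓞 :=
  (exists_momDer a).choose

lemma momDer_isDer {a : ℕ} (U : 𝔛 a) : IsDer a (momDer a U) :=
  ((exists_momDer a).choose_spec U).1

lemma momDer_fn {a : ℕ} (U : 𝔛 a) (r : Λ) : momDer a U (fn r) = fn (U.1 r) :=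
  ((exists_momDer a).choose_spec U).2.1 r

lemma momDer_mom {a d : ℕ} (U : 𝔛 a) (V : 𝔛 d) :
    momDer a U (mom V) = endMom A P (a + d - 2) (vfComm a d U.1 V.1) :=
  ((exists_momDer a).choose_spec U).2.2 d V

/-- `D` is the Hamiltonian vector field of the pullback of the function `r` of degree `i`. -/
def IsFnDer (i : ℕ) (r : Λ) (D : 𝓔 𝓞) : Prop :=
  IsDer i D ∧ (∀ s, D (fn s) = 0) ∧ ∀ d (V : 𝔛 d),
    D (mom V) = -((-1 : ℝ) ^ (i * d) • fn (V.1 r))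

lemma IsFnDer.congr {i j : ℕ} {r : Λ} {D : 𝓔 𝓞}
    (h : IsFnDer i r D) (hij : (-1 : ℝ) ^ i = (-1 : ℝ) ^ j) : IsFnDer j r D :=
  ⟨h.1.congr hij, h.2.1, fun d V => by rw [h.2.2, pow_mul, hij, ← pow_mul]⟩

lemma IsFnDer.add {i : ℕ} {r s : Λ} {D D' : 𝓔 𝓞}
    (h : IsFnDer i r D) (h' : IsFnDer i s D') : IsFnDer i (r + s) (D + D') :=
  ⟨h.1.add h'.1, fun t => by rw [lm_add, h.2.1, h'.2.1, add_zero], fun d V => by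
    rw [lm_add, h.2.2, h'.2.2, map_add, fn_add, smul_add, neg_add]⟩

lemma IsFnDer.smul {i : ℕ} (c : ℝ) {r : Λ} {D : 𝓔 𝓞}
    (h : IsFnDer i r D) : IsFnDer i (c • r) (c • D) :=
  ⟨h.1.smul c, fun t => by rw [lm_smul, h.2.1, smul_zero], fun d V => by
    rw [lm_smul, h.2.2, map_smul, fn_smul, smul_neg, smul_comm c]⟩

lemma IsFnDer.uniq {i : ℕ} {r : Λ} {D D' : 𝓔 𝓞}
    (h : IsFnDer i r D) (h' : IsFnDer i r D') : D = D' :=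
  h.1.ext h'.1 (fun _ s _ => by rw [h.2.1, h'.2.1]) (fun d V => by rw [h.2.2, h'.2.2])

lemma exists_isFnDer {i : ℕ} {r : Λ} (hr : r ∈ Λ^ i) : ∃ D, IsFnDer i r D := by
  refine exists_der i 0 (fun d =>
    { toFun := fun V => -((-1 : ℝ) ^ (i * d) • fn (V.1 r))
      map_add' := fun V W => by
        rw [← neg_add, ← smul_add, ← fn_add]; rfl
      map_smul' := fun c V => by
        rw [RingHom.id_apply, smul_neg, smul_comm c, ← fn_smul c]; rfl }) ?_ ?_ ?_ ?_
  · exact fun i r _ => zero_mem _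
  · intro d V
    refine neg_mem (smul_mem _ _ ?_)
    rw [add_comm]
    exact fn_vf_mem_par V hr
  · intro j d e s V W hs he hW
    subst he
    change -((-1 : ℝ) ^ (i * (j + d)) • fn (W.1 r)) = _ + _ • (_ *
      -((-1 : ℝ) ^ (i * d) • fn (V.1 r)))
    rw [hW, fn_mul, LinearMap.zero_apply, zero_mul, zero_add, mul_neg, mul_smul_comm, smul_neg,
      smul_smul, ← pow_add, ← mul_add]
  · intro i j r _ s _
    simp

lemma exists_fnDer : ∃ B : Λ →ₗ[ℝ] 𝓔 𝓞, ∀ i, ∀ r ∈ Λ^ i, IsFnDer i r (B r) := by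
  have key := exists_linearMap_of_rel (𝕜 := ℝ) (X := Λ)
    (Y := 𝓔 𝓞 × 𝓔 𝓞)
    (fun r D => ∃ s t, r = s + t ∧ shiftInv A P r = s - t ∧ IsFnDer 0 s D.1 ∧ IsFnDer 1 t D.2)
    ?_ ?_ ?_ ?_
  · obtain ⟨B, hB⟩ := key
    refine ⟨(LinearMap.fst ℝ _ _ + LinearMap.snd ℝ _ _) ∘ₗ B, fun i r hr => ?_⟩
    obtain ⟨s, t, h1, h2, h3, h4⟩ := hB r
    rw [shiftInv_of_mem hr] at h2
    change IsFnDer i r ((B r).1 + (B r).2)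
    rcases pm i with hi | hi
    · rw [hi, one_smul] at h2
      have ht : t = 0 := by
        have : (2 : ℝ) • t = 0 := by
          calc (2 : ℝ) • t = (s + t) - (s - t) := by rw [two_smul]; abel
            _ = 0 := by rw [← h1, ← h2, sub_self]
        simpa using this
      have h0 : IsFnDer (A := A) (P := P) 1 0 0 :=
        ⟨IsDer.zero 1, fun s => rfl, fun d V => by simp [fn_zero]⟩
      rw [ht] at h4
      have hrs : r = s := by rw [h1, ht, add_zero]
      rw [h4.uniq h0, add_zero]
      rw [← hrs] at h3
      exact h3.congr (by rw [hi, pow_zero])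
    · rw [hi, neg_one_smul] at h2
      have hs : s = 0 := by
        have : (2 : ℝ) • s = 0 := by
          calc (2 : ℝ) • s = (s + t) + (s - t) := by rw [two_smul]; abel
            _ = 0 := by rw [← h1, ← h2, add_neg_cancel]
        simpa using this
      have h0 : IsFnDer (A := A) (P := P) 0 0 0 :=
        ⟨IsDer.zero 0, fun s => rfl, fun d V => by simp [fn_zero]⟩
      rw [hs] at h3
      have hrt : r = t := by rw [h1, hs, zero_add]
      rw [h3.uniq h0, zero_add]
      rw [← hrt] at h4
      exact h4.congr (by rw [hi, pow_one])
  · intro r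
    induction r using shift_hom_induction with
    | mem i r hr =>
      obtain ⟨D, hD⟩ := exists_isFnDer hr
      rcases pm i with hi | hi
      · refine ⟨(D, 0), r, 0, by simp, by rw [shiftInv_of_mem hr, hi]; simp,
          hD.congr (by rw [hi, pow_zero]), IsDer.zero 1, fun s => rfl, fun d V => by simp [fn_zero]⟩
      · refine ⟨(0, D), 0, r, by simp, by rw [shiftInv_of_mem hr, hi]; simp,
          ⟨IsDer.zero 0, fun s => rfl, fun d V => by simp [fn_zero]⟩,
          hD.congr (by rw [hi, pow_one])⟩
    | add r r' hr hr' =>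
      obtain ⟨D, s, t, h1, h2, h3, h4⟩ := hr
      obtain ⟨D', s', t', h1', h2', h3', h4'⟩ := hr'
      exact ⟨D + D', s + s', t + t', by rw [h1, h1']; abel, by rw [map_add, h2, h2']; abel,
        h3.add h3', h4.add h4'⟩
  · rintro r r' D D' ⟨s, t, h1, h2, h3, h4⟩ ⟨s', t', h1', h2', h3', h4'⟩
    exact ⟨s + s', t + t', by rw [h1, h1']; abel, by rw [map_add, h2, h2']; abel,
        h3.add h3', h4.add h4'⟩
  · rintro c r D ⟨s, t, h1, h2, h3, h4⟩
    exact ⟨c • s, c • t, by rw [h1, smul_add], by rw [map_smul, h2, smul_sub], h3.smul c,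
      h4.smul c⟩
  · rintro r D D' ⟨s, t, h1, h2, h3, h4⟩ ⟨s', t', h1', h2', h3', h4'⟩
    have hs : s = s' := by
      have : (2 : ℝ) • s = (2 : ℝ) • s' := by
        calc (2 : ℝ) • s = (s + t) + (s - t) := by rw [two_smul]; abel
          _ = (s' + t') + (s' - t') := by rw [← h1, ← h2, ← h1', ← h2']
          _ = _ := by rw [two_smul]; abel
      simpa using this
    subst hs
    have ht : t = t' := add_left_cancel (h1.symm.trans h1')
    subst ht
    exact Prod.ext (h3.uniq h3') (h4.uniq h4')

/-- The Hamiltonian vector field of the pullback of a function on `E[1]`. -/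
def fnDer : Λ →ₗ[ℝ] 𝓔 𝓞 := exists_fnDer.choose

lemma fnDer_isFnDer {i : ℕ} {r : Λ} (hr : r ∈ Λ^ i) :
    IsFnDer i r (fnDer r) := exists_fnDer.choose_spec i r hr

lemma fnDer_fn (r s : Λ) : fnDer r (fn s) = 0 := by
  induction r using shift_hom_induction with
  | mem i r hr => exact (fnDer_isFnDer hr).2.1 s
  | add r t hr ht => rw [map_add, lm_add, hr, ht, add_zero]

lemma fnDer_mul {i j : ℕ} {r s : Λ} (hr : r ∈ Λ^ i)
    (hs : s ∈ Λ^ j) : fnDer (r * s) = mulLeft ℝ (fn r) * fnDer s +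
      (-1 : ℝ) ^ (i * j) • (mulLeft ℝ (fn s) * fnDer r) := by
  refine (fnDer_isFnDer (shiftDeg_mul hr hs)).1.ext
    (((fnDer_isFnDer hs).1.mulLeft (fn_mem_par hr)).add ((((fnDer_isFnDer hr).1.mulLeft
      (fn_mem_par hs)).congr (by rw [add_comm])).smul _)) ?_ ?_
  · intro k t _
    simp [fnDer_fn]
  · intro d V
    simp only [lm_add, lm_smul, mul_apply, mulLeft_apply]
    rw [(fnDer_isFnDer (shiftDeg_mul hr hs)).2.2, (fnDer_isFnDer hr).2.2,
      (fnDer_isFnDer hs).2.2, vf_mul V.2 hr, fn_add, fn_smul, fn_mul, fn_mul,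
      par_comm (fn_mem_par hs) (fn_vf_mem_par V hr)]
    simp only [mul_neg, mul_smul_comm]
    obtain ⟨hi | hi, hj | hj, hd | hd⟩ := pm3 i j d <;>
    simp [pow_add, pow_mul, mul_add, add_mul, hi, hj, hd] <;> abel

lemma momDer_smul {i d e : ℕ} {r : Λ} (hr : r ∈ Λ^ i) (V : 𝔛 d) (W : 𝔛 e) (he : e = i + d)
    (hW : ∀ s, W.1 s = r * V.1 s) : momDer e W = mulLeft ℝ (fn r) * momDer d V +
      (-1 : ℝ) ^ (i * d) • (mulLeft ℝ (mom V) * fnDer r) := by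
  refine (momDer_isDer W).ext
    ((((momDer_isDer V).mulLeft (fn_mem_par hr)).congr (by rw [he])).add
      ((((fnDer_isFnDer hr).1.mulLeft (mom_mem_par V)).congr (by rw [he, add_comm])).smul _)) ?_ ?_
  · intro k t _
    simp only [lm_add, lm_smul, mul_apply, mulLeft_apply, momDer_fn, fnDer_fn]
    rw [hW, fn_mul, mul_zero, smul_zero, add_zero]
  · intro a U
    simp only [lm_add, lm_smul, mul_apply, mulLeft_apply, momDer_mom]
    rw [endMom_comm_swap U W, endMom_comm_swap U V, endMom_comm_smul_right hr U V W he hW,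
      (fnDer_isFnDer hr).2.2, he, par_comm (mom_mem_par V) (fn_vf_mem_par U hr)]
    simp only [mul_neg, mul_smul_comm, smul_add, smul_neg, smul_smul]
    obtain ⟨hi | hi, hj | hj, hd | hd⟩ := pm3 i a d <;>
    simp only [pow_add, pow_mul, mul_add, hi, hj, hd, one_pow, mul_one, one_smul,
      mul_neg, neg_mul, neg_neg, neg_smul] <;> abel

/-- `D` is the Hamiltonian vector field of the function `z` of parity `q`. -/
def IsHam (q : ℕ) (z : 𝓞) (D : 𝓔 𝓞) : Prop :=
  IsDer q D ∧ (∀ i, ∀ r ∈ Λ^ i,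
    D (fn r) = -((-1 : ℝ) ^ (q * i) • fnDer r z)) ∧
  ∀ d (V : 𝔛 d), D (mom V) = -((-1 : ℝ) ^ (q * d) • momDer d V z)

lemma IsHam.congr {p q : ℕ} {z : 𝓞} {D : 𝓔 𝓞}
    (h : IsHam p z D) (hpq : (-1 : ℝ) ^ p = (-1 : ℝ) ^ q) : IsHam q z D :=
  ⟨h.1.congr hpq, fun i r hr => by rw [h.2.1 i r hr, pow_mul, hpq, ← pow_mul],
    fun d V => by rw [h.2.2, pow_mul, hpq, ← pow_mul]⟩

lemma IsHam.zero (q : ℕ) : IsHam (A := A) (P := P) q 0 0 :=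
  ⟨IsDer.zero q, fun i r _ => by simp, fun d V => by simp⟩

lemma IsHam.add {q : ℕ} {z w : 𝓞} {D D' : 𝓔 𝓞}
    (h : IsHam q z D) (h' : IsHam q w D') : IsHam q (z + w) (D + D') :=
  ⟨h.1.add h'.1, fun i r hr => by
    rw [lm_add, h.2.1 i r hr, h'.2.1 i r hr, map_add, smul_add, neg_add],
    fun d V => by rw [lm_add, h.2.2, h'.2.2, map_add, smul_add, neg_add]⟩

lemma IsHam.smul {q : ℕ} (c : ℝ) {z : 𝓞} {D : 𝓔 𝓞} (h : IsHam q z D) : IsHam q (c • z) (c • D) :=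
  ⟨h.1.smul c, fun i r hr => by
    rw [lm_smul, h.2.1 i r hr, map_smul, smul_neg, smul_comm c],
    fun d V => by rw [lm_smul, h.2.2, map_smul, smul_neg, smul_comm c]⟩

lemma IsHam.uniq {q : ℕ} {z : 𝓞} {D D' : 𝓔 𝓞} (h : IsHam q z D) (h' : IsHam q z D') : D = D' :=
  h.1.ext h'.1 (fun i r hr => by rw [h.2.1 i r hr, h'.2.1 i r hr])
    (fun d V => by rw [h.2.2, h'.2.2])

lemma exists_isHam {q : ℕ} {z : 𝓞} (hz : z ∈ 𝔓 q) : ∃ D, IsHam q z D := by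
  let F : Λ →ₗ[ℝ] 𝓞 :=
    -(LinearMap.applyₗ z ∘ₗ fnDer ∘ₗ (shiftInv A P ^ q).toLinearMap)
  have sp : ∀ {i} {r : Λ}, r ∈ Λ^ i →
      (shiftInv A P ^ q) r = (-1 : ℝ) ^ (q * i) • r := by
    intro i r hr
    clear hz F
    induction q with
    | zero => simp
    | succ q ih =>
      rw [pow_succ, AlgHom.mul_apply, shiftInv_of_mem hr, map_smul, ih, smul_smul, ← pow_add]
      congr 2; ring
  have hF : ∀ i, ∀ r ∈ Λ^ i, F r = -((-1 : ℝ) ^ (q * i) • fnDer r z) := by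
    intro i r hr
    change -(fnDer ((shiftInv A P ^ q) r) z) = _
    rw [sp hr, map_smul, lm_smul]
  have key := exists_der q F
    (fun d => -((-1 : ℝ) ^ (q * d) • (LinearMap.applyₗ z ∘ₗ momDer d))) ?_ ?_ ?_ ?_
  · obtain ⟨D, h1, h2, h3⟩ := key
    exact ⟨D, h1, fun i r hr => (h2 r).trans (hF i r hr), h3⟩
  · intro i r hr
    rw [hF i r hr, add_comm]
    exact neg_mem (smul_mem _ _ ((fnDer_isFnDer hr).1.par q z hz))
  · intro d V
    rw [add_comm]
    exact neg_mem (smul_mem _ _ ((momDer_isDer V).par q z hz))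
  · intro i d e r V W hr he hW
    change -((-1 : ℝ) ^ (q * e) • momDer e W z) = _ + _ • (_ * -((-1 : ℝ) ^ (q * d) • momDer d V z))
    rw [hF i r hr, momDer_smul hr V W he hW, he]
    simp only [lm_add, lm_smul, mul_apply, mulLeft_apply]
    rw [par_comm ((fnDer_isFnDer hr).1.par q z hz) (mom_mem_par V)]
    simp only [neg_mul, mul_neg, smul_neg, smul_add, smul_mul_assoc, mul_smul_comm, smul_smul]
    obtain ⟨hi | hi, hj | hj, hd | hd⟩ := pm3 i d q <;>
    simp [pow_add, pow_mul, mul_add, add_mul, hi, hj, hd, neg_add] <;> abel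
  · intro i j r hr s hs
    rw [hF i r hr, hF j s hs, hF _ _ (shiftDeg_mul hr hs), fnDer_mul hr hs]
    simp only [lm_add, lm_smul, mul_apply, mulLeft_apply]
    rw [par_comm ((fnDer_isFnDer hr).1.par q z hz) (fn_mem_par hs)]
    simp only [neg_mul, mul_neg, smul_neg, smul_add, smul_mul_assoc, mul_smul_comm, smul_smul]
    obtain ⟨hi | hi, hj | hj, hd | hd⟩ := pm3 i j q <;>
    simp [pow_add, pow_mul, mul_add, add_mul, hi, hj, hd, neg_add] <;> abel

lemma exists_bracket : ∃ B : 𝓞 →ₗ[ℝ] 𝓔 𝓞, ∀ q, ∀ z ∈ 𝔓 q, IsHam q z (B z) := by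
  have H : ∀ q : ℕ, ∃ B : 𝔓 q →ₗ[ℝ] 𝓔 𝓞, ∀ z, IsHam q z.1 (B z) :=
    fun q => exists_linearMap_of_rel (fun (z : 𝔓 q) D => IsHam q z.1 D)
      (fun z => exists_isHam z.2) (fun _ _ _ _ h h' => h.add h') (fun c _ _ h => h.smul c)
      (fun _ _ _ h h' => h.uniq h')
  obtain ⟨B0, h0⟩ := H 0
  obtain ⟨B1, h1⟩ := H 1
  refine ⟨B0 ∘ₗ (proj 0).codRestrict _ (proj_mem 0) + B1 ∘ₗ (proj 1).codRestrict _ (proj_mem 1),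
    fun q z hz => ?_⟩
  have e0 := h0 ((proj 0).codRestrict _ (proj_mem 0) z)
  have e1 := h1 ((proj 1).codRestrict _ (proj_mem 1) z)
  have p0 := proj_of_mem (k := 0) hz
  have p1 := proj_of_mem (k := 1) hz
  rw [LinearMap.codRestrict_apply] at e0 e1
  rw [lm_add, lm_comp, lm_comp]
  rcases pm q with hq | hq
  · rw [p0, hq] at e0
    rw [p1, hq] at e1
    norm_num at e0 e1
    rw [e1.uniq (IsHam.zero 1), add_zero]
    exact e0.congr (by rw [hq, pow_zero])
  · rw [p0, hq] at e0
    rw [p1, hq] at e1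
    norm_num at e0 e1
    rw [e0.uniq (IsHam.zero 0), zero_add]
    exact e1.congr (by rw [hq, pow_one])

variable (A P) in
/-- The canonical Poisson bracket of `T*[2]E[1]`. -/
def bracket : 𝓞 →ₗ[ℝ] 𝓞 →ₗ[ℝ] 𝓞 := exists_bracket.choose

lemma bracket_isHam {q : ℕ} {z : 𝓞} (hz : z ∈ 𝔓 q) :
    IsHam q z (bracket A P z) := exists_bracket.choose_spec q z hz

lemma bracket_isDer {q : ℕ} {z : 𝓞} (hz : z ∈ 𝔓 q) : IsDer q (bracket A P z) := (bracket_isHam hz).1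

lemma bracket_fn {i : ℕ} {r : Λ} (hr : r ∈ Λ^ i) : bracket A P (fn r) = fnDer r := by
  refine (bracket_isDer (fn_mem_par hr)).ext (fnDer_isFnDer hr).1 ?_ ?_
  · intro j s hs
    rw [(bracket_isHam (fn_mem_par hr)).2.1 j s hs, fnDer_fn, fnDer_fn, smul_zero, neg_zero]
  · intro d V
    rw [(bracket_isHam (fn_mem_par hr)).2.2, (fnDer_isFnDer hr).2.2, momDer_fn]

lemma bracket_mom {d : ℕ} (V : 𝔛 d) : bracket A P (mom V) = momDer d V := by
  refine (bracket_isDer (mom_mem_par V)).ext (momDer_isDer V) ?_ ?_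
  · intro j s hs
    rw [(bracket_isHam (mom_mem_par V)).2.1 j s hs, (fnDer_isFnDer hs).2.2, momDer_fn, smul_neg,
      neg_neg, smul_smul, mul_comm j, neg_one_pow_mul_self, one_smul]
  · intro e W
    rw [(bracket_isHam (mom_mem_par V)).2.2, momDer_mom, momDer_mom, endMom_comm_swap V W, smul_neg,
      neg_neg, smul_smul, neg_one_pow_mul_self, one_smul]

lemma bracket_mul {k l : ℕ} {x y : 𝓞} (hx : x ∈ 𝔓 k) (hy : y ∈ 𝔓 l) :
    bracket A P (x * y) = mulLeft ℝ x * bracket A P y +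
      (-1 : ℝ) ^ (k * l) • (mulLeft ℝ y * bracket A P x) := by
  have sgn : ∀ (m : ℕ) (D : 𝓔 𝓞), IsDer m D →
      -((-1 : ℝ) ^ ((k + l) * m) • D (x * y)) =
      x * -((-1 : ℝ) ^ (l * m) • D y) + (-1 : ℝ) ^ (k * l) • (y * -((-1 : ℝ) ^ (k * m) • D x)) := by
    intro m D hD
    rw [hD.mul k x y hx, par_comm hy (hD.par k x hx)]
    simp only [mul_neg, smul_neg, smul_add, mul_smul_comm, smul_smul]
    obtain ⟨hi | hi, hj | hj, hd | hd⟩ := pm3 k l m <;>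
    simp [pow_add, pow_mul, mul_add, add_mul, hi, hj, hd, neg_add] <;> abel
  refine (bracket_isDer (par_mul hx hy)).ext (((bracket_isDer hy).mulLeft hx).add
    ((((bracket_isDer hx).mulLeft hy).congr (by rw [add_comm])).smul _)) ?_ ?_
  · intro j s hs
    simp only [lm_add, lm_smul, mul_apply, mulLeft_apply]
    rw [(bracket_isHam (par_mul hx hy)).2.1 j s hs, (bracket_isHam hx).2.1 j s hs,
      (bracket_isHam hy).2.1 j s hs]
    exact sgn j _ (fnDer_isFnDer hs).1
  · intro e W
    simp only [lm_add, lm_smul, mul_apply, mulLeft_apply]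
    rw [(bracket_isHam (par_mul hx hy)).2.2, (bracket_isHam hx).2.2, (bracket_isHam hy).2.2]
    exact sgn e _ (momDer_isDer W)

lemma bracket_skew {k l : ℕ} {x y : 𝓞} (hx : x ∈ 𝔓 k) (hy : y ∈ 𝔓 l) :
    bracket A P x y = -((-1 : ℝ) ^ (k * l) • bracket A P y x) := by
  refine par_induction (p := fun y => bracket A P x y =
    -((-1 : ℝ) ^ (k * l) • bracket A P y x)) ?_ ?_ ?_ y hy
  · intro l' y hl hy
    rw [mul_comm, pow_mul, ← hl, ← pow_mul, mul_comm]
    clear hl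
    induction hy with
    | fn i r hr => rw [bracket_fn hr, (bracket_isHam hx).2.1 i r hr]
    | mom d V => rw [bracket_mom, (bracket_isHam hx).2.2]
    | mul l m y z hy' hz' hy hz =>
      rw [bracket_mul (monomial_mem hy') (monomial_mem hz'),
        (bracket_isDer hx).mul _ y z (monomial_mem hy'), hy, hz]
      simp only [lm_add, lm_smul, mul_apply, mulLeft_apply, neg_mul, smul_mul_assoc]
      rw [par_comm (monomial_mem hz') ((bracket_isDer (monomial_mem hy')).par k x hx)]
      simp only [mul_neg, neg_mul, smul_neg, smul_add, mul_smul_comm, smul_mul_assoc, smul_smul]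
      obtain ⟨hi | hi, hj | hj, hd | hd⟩ := pm3 k l m <;>
      simp [pow_add, pow_mul, mul_add, add_mul, hi, hj, hd, neg_add] <;> abel
  · intro y z hy hz
    rw [map_add, hy, hz, map_add, lm_add, smul_add, neg_add]
  · intro c y hy
    rw [map_smul, hy, map_smul, lm_smul, smul_neg, smul_comm c]

lemma bracket_fn_fn (r s : Λ) : bracket A P (fn r) (fn s) = 0 := by
  induction r using shift_hom_induction with
  | mem i r hr => rw [bracket_fn hr, fnDer_fn]
  | add r t hr ht => rw [fn_add, map_add, lm_add, hr, ht, add_zero]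

lemma bracket_mom_fn {d : ℕ} (V : 𝔛 d) (r : Λ) : bracket A P (mom V) (fn r) = fn (V.1 r) := by
  rw [bracket_mom, momDer_fn]

lemma bracket_mom_mom {d e : ℕ} (V : 𝔛 d) (W : 𝔛 e) : bracket A P (mom V) (mom W) =
      endMom A P (d + e - 2) (vfComm d e V.1 W.1) := by
  rw [bracket_mom, momDer_mom]

/-- The Jacobiator of the canonical bracket. -/
def jac (k l : ℕ) (x y : 𝓞) : 𝓞 →ₗ[ℝ] 𝓞 :=
  (bracket A P x ∘ₗ bracket A P y - (-1 : ℝ) ^ (k * l) • (bracket A P y ∘ₗ bracket A P x)) +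
    (-1 : ℝ) • bracket A P (bracket A P x y)

lemma jac_apply (k l : ℕ) (x y z : 𝓞) : jac k l x y z = bracket A P x (bracket A P y z) -
      (-1 : ℝ) ^ (k * l) • bracket A P y (bracket A P x z) - bracket A P (bracket A P x y) z := by
  have h : jac k l x y z = bracket A P x (bracket A P y z) -
      (-1 : ℝ) ^ (k * l) • bracket A P y (bracket A P x z) +
        (-1 : ℝ) • bracket A P (bracket A P x y) z := rfl
  rw [h, neg_one_smul, ← sub_eq_add_neg]

lemma jac_isDer {k l : ℕ} {x y : 𝓞} (hx : x ∈ 𝔓 k) (hy : y ∈ 𝔓 l) : IsDer (k + l) (jac k l x y) :=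
  ((bracket_isDer hx).comm (bracket_isDer hy)).add
    ((bracket_isDer ((bracket_isDer hx).par l y hy)).smul (-1))

lemma jac_swap {k l : ℕ} {x y : 𝓞} (hx : x ∈ 𝔓 k) (hy : y ∈ 𝔓 l)
    (h : jac k l x y = 0) : jac l k y x = 0 := by
  have : jac l k y x = (-(-1 : ℝ) ^ (k * l)) • jac k l x y := by
    ext z
    rw [lm_smul, jac_apply, jac_apply, bracket_skew hy hx]
    rw [mul_comm l k]
    simp only [map_neg, map_smul, LinearMap.neg_apply, lm_smul]
    rcases pm (k * l) with h | h <;>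
      simp only [h, one_smul, neg_smul, neg_neg, smul_sub, smul_neg, smul_add] <;> abel
  rw [this, h, smul_zero]

lemma jac_swap_right {k l m : ℕ} {x y z : 𝓞} (hx : x ∈ 𝔓 k) (hy : y ∈ 𝔓 l)
    (hz : z ∈ 𝔓 m) (h : jac k m x z y = 0) : jac k l x y z = 0 := by
  have : jac k l x y z = (-(-1 : ℝ) ^ (l * m)) • jac k m x z y := by
    have hb := fun {k l x y} hx hy => (bracket_isDer (A := A) (P := P) (q := k) (z := x) hx).par l y hy
    rw [jac_apply, jac_apply, bracket_skew hy hz, bracket_skew (hb hx hy) hz,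
      bracket_skew (hb hx hz) hy]
    simp only [smul_sub, smul_smul, neg_smul, smul_neg, map_neg, map_smul]
    obtain ⟨hi | hi, hj | hj, hd | hd⟩ := pm3 k l m <;>
      simp [pow_add, pow_mul, mul_add, add_mul, hi, hj, hd, neg_add] <;> abel
  rw [this, h, smul_zero]

end CotFun

end CanonicalBracket

/-! ## Jacobi identity, degrees and uniqueness of the canonical bracket -/

section CanonicalPoisson

local notation "𝔓" => CotFun.par A P

namespace CotFun

/-- The generators of the algebra of functions on `T*[2]E[1]`. -/
inductive IsGen : ℕ → 𝓞 → Prop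
  | fn (i r) (hr : r ∈ Λ^ i) : IsGen i (fn r)
  | mom (d) (V : 𝔛 d) : IsGen d (mom V)

lemma IsGen.mem {k : ℕ} {x : 𝓞} (hx : IsGen k x) : x ∈ 𝔓 k := by
  cases hx with
  | fn r hr => exact fn_mem_par hr
  | mom V => exact mom_mem_par V

lemma IsDer.eq_zero {p : ℕ} {D : 𝓞 →ₗ[ℝ] 𝓞} (hD : IsDer p D)
    (h : ∀ k x, IsGen k x → D x = 0) : D = 0 :=
  hD.ext (IsDer.zero p) (fun i r hr => h i _ (.fn i r hr)) (fun d V => h d _ (.mom d V))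

lemma jac_mom_mom_fn {d e : ℕ} (V : 𝔛 d) (W : 𝔛 e)
    (r : Λ) : jac d e (mom V) (mom W) (fn r) = 0 := by
  rw [jac_apply, bracket_mom_mom, endMom_of_mem (vfComm_mem V.2 W.2)]
  simp only [bracket_mom_fn, vfComm_apply]
  rw [sub_eq_add_neg (V.1 (W.1 r)), fn_add, fn_neg, fn_smul]
  abel

lemma vfComm_jacobi (d e f : ℕ) (U V W : 𝓔 Λ) :
    vfComm d (e + f) U (vfComm e f V W) - (-1 : ℝ) ^ (d * e) •
      vfComm e (d + f) V (vfComm d f U W) = vfComm (d + e) f (vfComm d e U V) W := by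
  ext r
  simp only [vfComm_apply, lm_sub, lm_smul, map_sub, map_smul]
  obtain ⟨hi | hi, hj | hj, hd | hd⟩ := pm3 d e f <;>
    simp [pow_add, pow_mul, mul_add, add_mul, hi, hj, hd, neg_add] <;> abel

lemma vfComm_congr {d e d' e' : ℕ} (V W : 𝓔 Λ)
    (h : (-1 : ℝ) ^ (d * e) = (-1 : ℝ) ^ (d' * e')) : vfComm d e V W = vfComm d' e' V W := by
  rw [vfComm, h, vfComm]

lemma vfComm_sub_two {d e f : ℕ} (U : 𝓔 Λ) (V : 𝔛 e) (W : 𝔛 f) :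
    vfComm d (e + f - 2) U (vfComm e f V.1 W.1) = vfComm d (e + f) U (vfComm e f V.1 W.1) := by
  by_cases h : e + f < 2
  · rw [vfComm_eq_zero V.2 W.2 h]; simp [vfComm]
  · refine vfComm_congr _ _ ?_
    rw [mul_comm d, pow_mul, neg_one_pow_sub_two (by omega), ← pow_mul, mul_comm]

lemma vfComm_sub_two' {d e f : ℕ} (U : 𝓔 Λ) (V : 𝔛 e) (W : 𝔛 f) :
    vfComm (e + f - 2) d (vfComm e f V.1 W.1) U = vfComm (e + f) d (vfComm e f V.1 W.1) U := by
  by_cases h : e + f < 2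
  · rw [vfComm_eq_zero V.2 W.2 h]; simp [vfComm]
  · refine vfComm_congr _ _ ?_
    rw [pow_mul, neg_one_pow_sub_two (by omega), ← pow_mul]

lemma endMom_congr {d e : ℕ} {T : 𝓔 Λ} (h : T = 0 ∨ d = e) : endMom A P d T = endMom A P e T := by
  rcases h with rfl | rfl
  · rw [endMom_zero, endMom_zero]
  · rfl

lemma bracket_mom_endMom {d e f : ℕ} (U : 𝔛 d) (V : 𝔛 e) (W : 𝔛 f) :
    bracket A P (mom U) (endMom A P (e + f - 2) (vfComm e f V.1 W.1)) =
      endMom A P (d + e + f - 4) (vfComm d (e + f) U.1 (vfComm e f V.1 W.1)) := by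
  rw [endMom_of_mem (vfComm_mem V.2 W.2), bracket_mom_mom, vfComm_sub_two]
  refine endMom_congr ?_
  by_cases h : e + f < 2
  · left; rw [vfComm_eq_zero V.2 W.2 h]; simp [vfComm]
  · right; omega

lemma jac_mom_mom_mom {d e f : ℕ} (U : 𝔛 d) (V : 𝔛 e) (W : 𝔛 f) :
    jac d e (mom U) (mom V) (mom W) = 0 := by
  have m1 : ∀ {d e f : ℕ} (U : 𝔛 d) (V : 𝔛 e)
      (W : 𝔛 f), vfComm d (e + f) U.1 (vfComm e f V.1 W.1) ∈
        𝔛 (d + e + f - 4) := by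
    intro d e f U V W
    rw [← vfComm_sub_two]
    by_cases h : e + f < 2
    · rw [vfComm_eq_zero V.2 W.2 h]; simp [vfComm]
    · have := vfComm_mem U.2 (vfComm_mem V.2 W.2)
      rwa [show d + (e + f - 2) - 2 = d + e + f - 4 by omega] at this
  have h3 : bracket A P (endMom A P (d + e - 2) (vfComm d e U.1 V.1)) (mom W) =
      endMom A P (d + e + f - 4) (vfComm (d + e) f (vfComm d e U.1 V.1) W.1) := by
    rw [endMom_of_mem (vfComm_mem U.2 V.2), bracket_mom_mom, vfComm_sub_two']
    refine endMom_congr ?_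
    by_cases h : d + e < 2
    · left; rw [vfComm_eq_zero U.2 V.2 h]; simp [vfComm]
    · right; omega
  rw [jac_apply, bracket_mom_mom V W, bracket_mom_mom U W, bracket_mom_mom U V,
    bracket_mom_endMom, bracket_mom_endMom, h3, ← vfComm_jacobi, add_comm e d,
    sub_eq_add_neg (vfComm d (e + f) U.1 _)]
  have h4 := m1 V U W
  rw [add_comm e d] at h4
  have e1 : ∀ T : 𝓔 Λ, -((-1 : ℝ) ^ (d * e) • T) =
    (-(-1 : ℝ) ^ (d * e)) • T := fun T => by ext; simp
  rw [e1, endMom_add (m1 U V W) (smul_mem _ _ h4), endMom_smul _ h4, neg_smul]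
  abel

lemma jac_gen {k l : ℕ} {x y : 𝓞} (hx : IsGen k x) (hy : IsGen l y) : jac k l x y = 0 := by
  have hmm : ∀ {d e : ℕ} (U : 𝔛 d) (V : 𝔛 e),
      jac d e (mom U) (mom V) = 0 := by
    intro d e U V
    refine (jac_isDer (mom_mem_par U) (mom_mem_par V)).eq_zero ?_
    rintro m _ (⟨r, hr⟩ | ⟨W⟩)
    · exact jac_mom_mom_fn U V r
    · exact jac_mom_mom_mom U V W
  have hmf : ∀ {d i : ℕ} (U : 𝔛 d) {r : Λ}, r ∈ Λ^ i →
      jac d i (mom U) (fn r) = 0 := by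
    intro d i U r hr
    refine (jac_isDer (mom_mem_par U) (fn_mem_par hr)).eq_zero ?_
    rintro m _ (⟨s, hs⟩ | ⟨W⟩)
    · rw [jac_apply, bracket_fn_fn, bracket_mom_fn, bracket_mom_fn, bracket_fn_fn, bracket_fn_fn]
      simp
    · refine jac_swap_right (mom_mem_par U) (fn_mem_par hr) (mom_mem_par W) ?_
      rw [hmm]; rfl
  have hff : ∀ {i j : ℕ} {r s : Λ}, r ∈ Λ^ i → s ∈ Λ^ j →
      jac i j (fn r) (fn s) = 0 := by
    intro i j r s hr hs
    refine (jac_isDer (fn_mem_par hr) (fn_mem_par hs)).eq_zero ?_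
    rintro m _ (⟨t, ht⟩ | ⟨W⟩)
    · rw [jac_apply]; simp [bracket_fn_fn]
    · refine jac_swap_right (fn_mem_par hr) (fn_mem_par hs) (mom_mem_par W) ?_
      rw [jac_swap (mom_mem_par W) (fn_mem_par hr) (hmf W hr)]; rfl
  rcases hx with ⟨r, hr⟩ | ⟨U⟩ <;> rcases hy with ⟨s, hs⟩ | ⟨V⟩
  · exact hff hr hs
  · exact jac_swap (mom_mem_par V) (fn_mem_par hr) (hmf V hr)
  · exact hmf U hs
  · exact hmm U V

lemma jac_eq_zero {k l : ℕ} {x y : 𝓞} (hx : x ∈ 𝔓 k) (hy : y ∈ 𝔓 l) : jac k l x y = 0 := by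
  have h1 : ∀ {k l : ℕ} {x y : 𝓞}, IsGen k x → y ∈ 𝔓 l → jac k l x y = 0 := by
    intro k l x y hx hy
    refine (jac_isDer hx.mem hy).eq_zero fun m z hz => ?_
    refine jac_swap_right hx.mem hy hz.mem ?_
    rw [jac_gen hx hz]; rfl
  refine (jac_isDer hx hy).eq_zero fun m z hz => ?_
  refine jac_swap_right hx hy hz.mem ?_
  rw [jac_swap hz.mem hx (h1 hz hx)]; rfl

lemma jacobi {k l : ℕ} {x y : 𝓞} (hx : x ∈ 𝔓 k) (hy : y ∈ 𝔓 l)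
    (z : 𝓞) : bracket A P x (bracket A P y z) = bracket A P (bracket A P x y) z +
      (-1 : ℝ) ^ (k * l) • bracket A P y (bracket A P x z) := by
  have := jac_apply k l x y z
  rw [jac_eq_zero hx hy, LinearMap.zero_apply] at this
  rw [sub_sub, eq_comm, sub_eq_zero] at this
  rw [this, add_comm]

/-! ### Degrees -/

lemma fn_mem_cotDeg {i : ℕ} {r : Λ} (hr : r ∈ Λ^ i) :
    fn r ∈ cotDeg A P i := subset_span (.fn i r hr)

lemma mom_mem_cotDeg {d : ℕ} (V : 𝔛 d) : mom V ∈ cotDeg A P d :=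
  subset_span (.mom d V)

lemma cotDeg_mul {k l : ℕ} {x y : 𝓞} (hx : x ∈ cotDeg A P k) (hy : y ∈ cotDeg A P l) :
    x * y ∈ cotDeg A P (k + l) := by
  have h := mul_mem_mul hx hy
  rw [cotDeg, cotDeg, span_mul_span] at h
  refine span_mono ?_ h
  rintro _ ⟨x, hx, y, hy, rfl⟩
  exact .mul k l x y hx hy

/-- An operator lowers the degree by `2` after raising it by `k`. -/
def DegShift (k : ℕ) (D : 𝓞 →ₗ[ℝ] 𝓞) (l : ℕ) (x : 𝓞) : Prop :=
  (∀ m, k + l = m + 2 → D x ∈ cotDeg A P m) ∧ (k + l < 2 → D x = 0)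

lemma DegShift.mul {k l m : ℕ} {D : 𝓞 →ₗ[ℝ] 𝓞} {x y : 𝓞} {c : ℝ}
    (hx' : x ∈ cotDeg A P l) (hy' : y ∈ cotDeg A P m)
    (hD : D (x * y) = D x * y + c • (x * D y)) (hx : DegShift k D l x) (hy : DegShift k D m y) :
    DegShift k D (l + m) (x * y) := by
  have hx2 : D x * y ∈ cotDeg A P (k + l - 2 + m) ∧ (k + l < 2 → D x * y = 0) := by
    by_cases h : k + l < 2
    · rw [hx.2 h, zero_mul]; exact ⟨zero_mem _, fun _ => rfl⟩
    · exact ⟨cotDeg_mul (hx.1 (k + l - 2) (by omega)) hy', fun h' => absurd h' h⟩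
  have hy2 : x * D y ∈ cotDeg A P (l + (k + m - 2)) ∧ (k + m < 2 → x * D y = 0) := by
    by_cases h : k + m < 2
    · rw [hy.2 h, mul_zero]; exact ⟨zero_mem _, fun _ => rfl⟩
    · exact ⟨cotDeg_mul hx' (hy.1 (k + m - 2) (by omega)), fun h' => absurd h' h⟩
  refine ⟨fun p hp => ?_, fun h => ?_⟩
  · rw [hD]
    refine add_mem ?_ (smul_mem _ _ ?_)
    · by_cases h : k + l < 2
      · rw [hx2.2 h]; exact zero_mem _
      · rw [show p = k + l - 2 + m by omega]; exact hx2.1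
    · by_cases h : k + m < 2
      · rw [hy2.2 h]; exact zero_mem _
      · rw [show p = l + (k + m - 2) by omega]; exact hy2.1
  · rw [hD, hx2.2 (by omega), hy2.2 (by omega), smul_zero, add_zero]

lemma DegShift.of_gen {k : ℕ} {D : 𝓞 →ₗ[ℝ] 𝓞} (hD : IsDer k D)
    (h : ∀ l x, IsGen l x → DegShift k D l x) {l : ℕ} {x : 𝓞} (hx : x ∈ cotDeg A P l) :
    DegShift k D l x := by
  replace hx : x ∈ Submodule.span ℝ {x | CotMonomial l x} := hx
  induction hx using span_induction with
  | mem x hx =>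
    replace hx : CotMonomial l x := hx
    induction hx with
    | fn i r hr => exact h _ _ (.fn i r hr)
    | mom d V => exact h _ _ (.mom d V)
    | mul l m x y hx hy ihx ihy =>
      exact DegShift.mul (subset_span hx) (subset_span hy)
        (hD.mul l x y (monomial_mem hx)) ihx ihy
  | zero => exact ⟨fun m _ => by rw [map_zero]; exact zero_mem _, fun _ => map_zero _⟩
  | add x y hx hy ihx ihy =>
    exact ⟨fun m hm => by
      rw [map_add]; exact add_mem (ihx.1 m hm) (ihy.1 m hm),
      fun hm => by rw [map_add, ihx.2 hm, ihy.2 hm, add_zero]⟩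
  | smul c x hx ihx =>
    exact ⟨fun m hm => by rw [map_smul]; exact smul_mem _ _ (ihx.1 m hm),
      fun hm => by rw [map_smul, ihx.2 hm, smul_zero]⟩

lemma DegShift.swap {k l : ℕ} {x y : 𝓞} (hx : x ∈ 𝔓 k) (hy : y ∈ 𝔓 l)
    (h : DegShift k (bracket A P x) l y) : DegShift l (bracket A P y) k x := by
  refine ⟨fun m hm => ?_, fun hm => ?_⟩
  · rw [bracket_skew hy hx]
    exact neg_mem (smul_mem _ _ (h.1 m (by omega)))
  · rw [bracket_skew hy hx, h.2 (by omega), smul_zero, neg_zero]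

lemma degShift_gen {k l : ℕ} {x y : 𝓞} (hx : IsGen k x) (hy : IsGen l y) :
    DegShift k (bracket A P x) l y := by
  have hmf : ∀ {d i : ℕ} (V : 𝔛 d) {r : Λ}, r ∈ Λ^ i →
      DegShift d (bracket A P (mom V)) i (fn r) := fun {d i} V {r} hr =>
    ⟨fun m hm => by rw [bracket_mom_fn]; exact fn_mem_cotDeg (V.2.1 i m r hr (by omega)),
      fun hm => by rw [bracket_mom_fn, V.2.2.1 i r hr (by omega), fn_zero]⟩
  rcases hx with ⟨r, hr⟩ | ⟨U⟩ <;> rcases hy with ⟨s, hs⟩ | ⟨V⟩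
  · exact ⟨fun m _ => by rw [bracket_fn_fn]; exact zero_mem _,
      fun _ => bracket_fn_fn r s⟩
  · exact DegShift.swap (mom_mem_par V) (fn_mem_par hr) (hmf V hr)
  · exact hmf U hs
  · refine ⟨fun m hm => ?_, fun hm => ?_⟩
    · rw [bracket_mom_mom, endMom_of_mem (vfComm_mem U.2 V.2), show m = k + l - 2 by omega]
      exact mom_mem_cotDeg _
    · rw [bracket_mom_mom, vfComm_eq_zero U.2 V.2 hm, endMom_zero]

lemma degShift_bracket {k l : ℕ} {x y : 𝓞} (hx : x ∈ cotDeg A P k)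
    (hy : y ∈ cotDeg A P l) : DegShift k (bracket A P x) l y := by
  have h1 : ∀ {k l : ℕ} {x y : 𝓞}, IsGen k x → y ∈ cotDeg A P l →
      DegShift k (bracket A P x) l y := fun {k l x y} hx hy =>
    DegShift.of_gen (bracket_isDer hx.mem) (fun m z hz => degShift_gen hx hz) hy
  exact DegShift.of_gen (bracket_isDer (cotDeg_le_par k hx)) (fun m z hz =>
    (h1 hz hx).swap hz.mem (cotDeg_le_par k hx)) hy

lemma isPoissonBracket_bracket : IsPoissonBracket (cotDeg A P) (bracket A P) where
  degree k l m x y hx hy h := (degShift_bracket hx hy).1 m h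
  degree_lt k l x y hx hy h := (degShift_bracket hx hy).2 h
  skew k l x y hx hy := bracket_skew (cotDeg_le_par k hx) (cotDeg_le_par l hy)
  leibniz k l x y z hx hy :=
    (bracket_isDer (cotDeg_le_par k hx)).mul l y z (cotDeg_le_par l hy)
  jacobi k l x y z hx hy := jacobi (cotDeg_le_par k hx) (cotDeg_le_par l hy) z

lemma isCanonicalBracket_bracket : IsCanonicalBracket (bracket A P) where
  poisson := isPoissonBracket_bracket
  fn_fn := bracket_fn_fn
  mom_fn _ V r := bracket_mom_fn V r
  mom_mom d e m V W U h hU := by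
    have : vfComm d e V.1 W.1 = U.1 := LinearMap.ext fun r => (hU r).symm
    rw [bracket_mom_mom, this, show d + e - 2 = m by omega, endMom_coe]

end CotFun

lemma IsPoissonBracket.ext_cotFun {b b' : 𝓞 →ₗ[ℝ] 𝓞 →ₗ[ℝ] 𝓞}
    (hb : IsPoissonBracket (cotDeg A P) b) (hb' : IsPoissonBracket (cotDeg A P) b')
    (h : ∀ k l x y, CotFun.IsGen k x → CotFun.IsGen l y → b x y = b' x y) : b = b' := by
  have h1 : ∀ k l x y, CotFun.IsGen k x → CotMonomial l y → b x y = b' x y := by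
    intro k l x y hx hy
    have hx' : x ∈ cotDeg A P k := by
      cases hx with
      | fn r hr => exact CotFun.fn_mem_cotDeg hr
      | mom V => exact CotFun.mom_mem_cotDeg V
    induction hy with
    | fn i r hr => exact h k i x _ hx (.fn i r hr)
    | mom d V => exact h k d x _ hx (.mom d V)
    | mul l m y z hy _ ihy ihz =>
      rw [hb.leibniz k l x y z hx' (subset_span hy),
        hb'.leibniz k l x y z hx' (subset_span hy), ihy, ihz]
  have h2 : ∀ k l x y, CotMonomial k x → CotMonomial l y → b x y = b' x y := by
    intro k l x y hx hy
    have hx' : x ∈ cotDeg A P k := subset_span hx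
    have key : ∀ m z, CotFun.IsGen m z → b x z = b' x z := by
      intro m z hz
      have hz' : z ∈ cotDeg A P m := by
        cases hz with
        | fn r hr => exact CotFun.fn_mem_cotDeg hr
        | mom V => exact CotFun.mom_mem_cotDeg V
      rw [hb.skew k m x z hx' hz', hb'.skew k m x z hx' hz', h1 m k z x hz hx]
    induction hy with
    | fn i r hr => exact key i _ (.fn i r hr)
    | mom d V => exact key d _ (.mom d V)
    | mul l m y z hy _ ihy ihz =>
      rw [hb.leibniz k l x y z hx' (subset_span hy),
        hb'.leibniz k l x y z hx' (subset_span hy), ihy, ihz]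
  ext x y
  induction x using CotFun.induction with
  | mem k x hx =>
    induction y using CotFun.induction with
    | mem l y hy => exact h2 k l x y hx hy
    | add y z hy hz => rw [map_add, map_add, hy, hz]
    | smul c y hy => rw [map_smul, map_smul, hy]
  | add x z hx hz => rw [map_add, map_add, lm_add, lm_add, hx, hz]
  | smul c x hx => rw [map_smul, map_smul, lm_smul, lm_smul, hx]

lemma isCanonicalBracket_iff (b : 𝓞 →ₗ[ℝ] 𝓞 →ₗ[ℝ] 𝓞) :
    IsCanonicalBracket b ↔ b = CotFun.bracket A P := by
  constructor
  · intro hb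
    have hc := CotFun.isCanonicalBracket_bracket (A := A) (P := P)
    refine hb.poisson.ext_cotFun hc.poisson ?_
    intro k l x y hx hy
    rcases hx with ⟨r, hr⟩ | ⟨U⟩ <;> rcases hy with ⟨s, hs⟩ | ⟨V⟩
    · rw [hb.fn_fn, hc.fn_fn]
    · rw [hb.poisson.skew k l _ _ (CotFun.fn_mem_cotDeg hr) (CotFun.mom_mem_cotDeg V),
        hc.poisson.skew k l _ _ (CotFun.fn_mem_cotDeg hr) (CotFun.mom_mem_cotDeg V),
        hb.mom_fn, hc.mom_fn]
    · rw [hb.mom_fn, hc.mom_fn]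
    · by_cases h : k + l < 2
      · rw [hb.poisson.degree_lt k l _ _ (CotFun.mom_mem_cotDeg U) (CotFun.mom_mem_cotDeg V) h,
          hc.poisson.degree_lt k l _ _ (CotFun.mom_mem_cotDeg U) (CotFun.mom_mem_cotDeg V) h]
      · have hm : k + l = (k + l - 2) + 2 := by omega
        rw [hb.mom_mom k l _ U V ⟨_, vfComm_mem U.2 V.2⟩ hm (fun r => vfComm_apply k l _ _ r),
          hc.mom_mom k l _ U V ⟨_, vfComm_mem U.2 V.2⟩ hm (fun r => vfComm_apply k l _ _ r)]
  · rintro rfl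
    exact CotFun.isCanonicalBracket_bracket

end CanonicalPoisson

/-! ## Homomorphisms out of functions on `E[1]` and on `T*[2]M ⊕ E[1]` -/

section Lifts

lemma exists_extHom {B : Type*} [Ring B] [Algebra ℝ B] (j : A →ₐ[ℝ] B)
    (hj : ∀ f b, j f * b = b * j f) (φ : P →+ B) (hφ : ∀ (f : A) ξ, φ (f • ξ) = j f * φ ξ)
    (hsq : ∀ ξ, φ ξ * φ ξ = 0) : ∃ Φ : Λ →ₐ[ℝ] B, (∀ f, Φ (𝔞 f) = j f) ∧ ∀ ξ, Φ (ι A ξ) = φ ξ := by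
  letI : Algebra A B := j.toRingHom.toAlgebra' hj
  haveI : IsScalarTower ℝ A B := IsScalarTower.of_algebraMap_eq fun c => (j.commutes c).symm
  let φ' : P →ₗ[A] B := { φ with map_smul' := fun f ξ => (hφ f ξ).trans (smul_def f _).symm }
  refine ⟨(ExteriorAlgebra.lift A ⟨φ', hsq⟩).restrictScalars ℝ, fun f => ?_, fun ξ => ?_⟩
  · exact (ExteriorAlgebra.lift A ⟨φ', hsq⟩).commutes f
  · exact ExteriorAlgebra.lift_ι_apply A φ' hsq ξ

lemma leibniz_of_gen {d : ℕ} {V : 𝓔 Λ} (h0 : ∀ (f : A) s, V (𝔞 f * s) = V (𝔞 f) * s + 𝔞 f * V s)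
    (h1 : ∀ (ξ : P) s, V (ι A ξ * s) = V (ι A ξ) * s + (-1 : ℝ) ^ d • (ι A ξ * V s)) :
    ∀ i r s, r ∈ Λ^ i → V (r * s) = V r * s + (-1 : ℝ) ^ (i * d) • (r * V s) := by
  intro i r s hr
  revert s
  refine shiftDeg_induction (p := fun i r => ∀ s, V (r * s) = V r * s +
    (-1 : ℝ) ^ (i * d) • (r * V s)) ?_ ?_ ?_ i r hr
  · intro f s
    rw [h0, zero_mul, pow_zero, one_smul]
  · intro i ξ r _ ih s
    rw [mul_assoc, h1, h1, ih, add_mul, mul_add, smul_add, mul_smul_comm, smul_mul_assoc, smul_smul,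
      ← pow_add, mul_assoc, mul_assoc, mul_assoc, add_assoc, add_mul i, one_mul, add_comm d]
  · intro i r t _ _ hr ht s
    rw [add_mul, map_add, hr, ht, map_add, add_mul, add_mul, smul_add]
    abel

lemma exists_dualHom {C : Type*} [Ring C] [Algebra ℝ C] [Algebra A C] [IsScalarTower ℝ A C]
    (X : 𝔇) : ∃ j : A →ₐ[ℝ] DualNumber C,
      (∀ f, (j f).fst = algebraMap A C f) ∧ ∀ f, (j f).snd = algebraMap A C (X f) := by
  refine ⟨AlgHom.ofLinearMap
    { toFun := fun f => ((algebraMap A C f, algebraMap A C (X f)) : C × C)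
      map_add' := fun f h => by
        refine TrivSqZeroExt.ext ?_ ?_
        · exact map_add (algebraMap A C) f h
        · exact (congrArg _ (map_add X f h)).trans (map_add (algebraMap A C) _ _)
      map_smul' := fun c f => by
        refine TrivSqZeroExt.ext ?_ ?_
        · change algebraMap A C (c • f) = c • algebraMap A C f
          rw [algebraMap_eq_smul_one, algebraMap_eq_smul_one, smul_assoc]
        · change algebraMap A C (X (c • f)) = c • algebraMap A C (X f)
          rw [Derivation.map_smul, algebraMap_eq_smul_one,
            algebraMap_eq_smul_one, smul_assoc] } ?_ ?_, fun f => rfl, fun f => rfl⟩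
  · refine TrivSqZeroExt.ext ?_ ?_
    · exact map_one (algebraMap A C)
    · change algebraMap A C (X 1) = 0
      rw [Derivation.map_one_eq_zero, map_zero]
  · intro f h
    refine TrivSqZeroExt.ext ?_ ?_
    · exact map_mul (algebraMap A C) f h
    · change algebraMap A C (X (f * h)) = algebraMap A C f * algebraMap A C (X h) +
        algebraMap A C (X f) * algebraMap A C h
      rw [Derivation.leibniz, map_add, smul_eq_mul, smul_eq_mul, map_mul, map_mul, commutes h]

lemma exists_dualAdd {C Q : Type*} [Ring C] [AddCommGroup Q] (a b : Q →+ C) :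
    ∃ φ : Q →+ DualNumber C, (∀ ξ, (φ ξ).fst = a ξ) ∧ ∀ ξ, (φ ξ).snd = b ξ :=
  ⟨a.prod b, fun _ => rfl, fun _ => rfl⟩

lemma exists_liftField (X : 𝔇) (T : P →+ P) (hT : ∀ (f : A) ξ, T (f • ξ) = X f • ξ + f • T ξ) :
    ∃ V : 𝔛 2, (∀ f, V.1 (𝔞 f) = 𝔞 (X f)) ∧ ∀ ξ, V.1 (ι A ξ) = ι A (T ξ) := by
  obtain ⟨j, j1, j2⟩ := exists_dualHom (C := Λ) X
  obtain ⟨φ, φ1, φ2⟩ := exists_dualAdd (C := Λ) (ι A).toAddMonoidHom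
    ((ι A).toAddMonoidHom.comp T)
  simp only [LinearMap.toAddMonoidHom_coe, AddMonoidHom.comp_apply] at φ1 φ2
  have hcomm : ∀ f b, j f * b = b * j f := fun f b => by
    ext
    · rw [TrivSqZeroExt.fst_mul, TrivSqZeroExt.fst_mul, j1, commutes]
    · simp only [TrivSqZeroExt.snd_mul, j1, j2, smul_eq_mul, MulOpposite.smul_eq_mul_unop,
        MulOpposite.unop_op, commutes]
      rw [add_comm]
  have hlin : ∀ (f : A) ξ, φ (f • ξ) = j f * φ ξ := fun f ξ => by
    ext
    · rw [TrivSqZeroExt.fst_mul, j1, φ1, φ1, map_smul, smul_def]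
    · rw [TrivSqZeroExt.snd_mul, j1, j2, φ1, φ2, φ2, hT, map_add, map_smul, map_smul,
        smul_def, smul_def, add_comm]
      rfl
  have hsq : ∀ ξ, φ ξ * φ ξ = 0 := fun ξ => by
    ext
    · rw [TrivSqZeroExt.fst_mul, φ1, ExteriorAlgebra.ι_sq_zero]; rfl
    · rw [TrivSqZeroExt.snd_mul, φ1, φ2]
      exact ExteriorAlgebra.ι_add_mul_swap ξ (T ξ)
  obtain ⟨Φ, h1, h2⟩ := exists_extHom j hcomm φ hlin hsq
  have hfst : ∀ r, (Φ r).fst = r := by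
    intro r
    induction r using shift_induction with
    | fn f => rw [h1, j1]
    | lin ξ r hr => rw [map_mul, TrivSqZeroExt.fst_mul, hr, h2, φ1]
    | add r s hr hs => rw [map_add, TrivSqZeroExt.fst_add, hr, hs]
  let V : 𝓔 Λ :=
    { toFun := fun r => (Φ r).snd
      map_add' := fun r s => by rw [map_add]; rfl
      map_smul' := fun c r => by rw [map_smul]; rfl }
  have hV : ∀ r s, V (r * s) = V r * s + r * V s := by
    intro r s
    change (Φ (r * s)).snd = (Φ r).snd * s + r * (Φ s).snd
    rw [map_mul, TrivSqZeroExt.snd_mul, hfst, hfst, add_comm]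
    rfl
  have V1 : ∀ f, V (𝔞 f) = 𝔞 (X f) := fun f => by
    change (Φ _).snd = _; rw [h1, j2]
  have V2 : ∀ ξ, V (ι A ξ) = ι A (T ξ) := fun ξ => by
    change (Φ _).snd = _; rw [h2, φ2]
  refine ⟨⟨V, mem_vf_of_gen (fun i r s _ => ?_) (fun f => ⟨fun k hk => ?_, fun h => ?_⟩)
    (fun ξ => ⟨fun k hk => ?_, fun h => ?_⟩)⟩, V1, V2⟩
  · rw [hV, mul_comm i, pow_mul]; simp
  · obtain rfl : k = 0 := by omega
    rw [V1]; exact shiftDeg_algebraMap _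
  · omega
  · obtain rfl : k = 1 := by omega
    rw [V2]; exact shiftDeg_ι _
  · omega

/-- The contraction with a linear form on sections, as a vector field on `E[1]`. -/
def contr (α : Module.Dual A P) : 𝔛 1 :=
  ⟨(contractLeft (Q := (0 : QuadraticForm A P)) α).restrictScalars ℝ, by
    have h0 : ∀ (f : A) (s : Λ), contractLeft (Q := 0) α
        (𝔞 f * s) = 𝔞 f * contractLeft (Q := 0) α s :=
      fun f s => CliffordAlgebra.contractLeft_algebraMap_mul α f s
    have h0' : ∀ (f : A), contractLeft (Q := 0) α
        (𝔞Λ f) = 0 := fun f => CliffordAlgebra.contractLeft_algebraMap 0 α f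
    have h1 : ∀ (ξ : P) (s : Λ), contractLeft (Q := 0) α
        (ι A ξ * s) = 𝔞 (α ξ) * s -
          ι A ξ * contractLeft (Q := 0) α s :=
      fun ξ s => (CliffordAlgebra.contractLeft_ι_mul α ξ s).trans (by rw [smul_def])
    have h1' : ∀ (ξ : P), contractLeft (Q := 0) α
        (ι A ξ) = 𝔞 (α ξ) :=
      fun ξ => CliffordAlgebra.contractLeft_ι 0 α ξ
    refine mem_vf_of_gen (leibniz_of_gen (fun f s => ?_) (fun ξ s => ?_))
      (fun f => ⟨fun k hk => by omega, fun _ => h0' f⟩)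
      (fun ξ => ⟨fun k hk => ?_, fun h => by omega⟩)
    · change contractLeft (Q := 0) α _ =
        contractLeft (Q := 0) α _ * s + _ * contractLeft (Q := 0) α s
      rw [h0, h0', zero_mul, zero_add]
    · change contractLeft (Q := 0) α _ =
        contractLeft (Q := 0) α _ * s +
          _ • (_ * contractLeft (Q := 0) α s)
      rw [h1, h1', pow_one, neg_one_smul, sub_eq_add_neg]
    · obtain rfl : k = 0 := by omega
      change contractLeft (Q := 0) α _ ∈ _
      rw [h1']; exact shiftDeg_algebraMap _⟩

lemma contr_algebraMap (α : Module.Dual A P) (f : A) : (contr α).1 (𝔞Λ f) = 0 :=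
  (contr α).2.2.1 0 _ (shiftDeg_algebraMap f) (by norm_num)

lemma contr_ι (α : Module.Dual A P) (ξ : P) : (contr α).1 (ι A ξ) = 𝔞Λ (α ξ) :=
  CliffordAlgebra.contractLeft_ι 0 α ξ

lemma contr_ι_mul (α : Module.Dual A P) (ξ : P) (s : Λ) : (contr α).1 (ι A ξ * s) =
      α ξ • s - ι A ξ * (contr α).1 s :=
  CliffordAlgebra.contractLeft_ι_mul α ξ s

lemma contr_smul (α : Module.Dual A P) (f : A) (s : Λ) : (contr α).1 (f • s) = f • (contr α).1 s :=
  map_smul (contractLeft (Q := (0 : QuadraticForm A P)) α) f s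

lemma vf_one_eq_contr (V : 𝔛 1) (α : Module.Dual A P)
    (h : ∀ ξ, V.1 (ι A ξ) = 𝔞 (α ξ)) : V = contr α :=
  Subtype.ext (vf_ext V.2 (contr α).2 rfl (fun f => by
    rw [contr_algebraMap, V.2.2.1 0 _ (shiftDeg_algebraMap f) (by norm_num)])
    (fun ξ => by rw [h, contr_ι]))

/-! ### Functions on `T*[2]M ⊕ E[1]` -/

variable (A P) in
/-- The inclusion of the functions on `E[1]`. -/
def SplitFun.extHom : Λ →ₐ[ℝ] 𝓢 :=
  (Algebra.TensorProduct.includeLeft : Λ →ₐ[A] 𝓢).restrictScalars ℝ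

lemma SplitFun.extHom_apply (r : Λ) : SplitFun.extHom A P r = sx r := rfl

lemma SplitFun.ext_mul (r s : Λ) : sx (r * s) = sx r * sx s := map_mul (SplitFun.extHom A P) r s

lemma SplitFun.ext_add (r s : Λ) : sx (r + s) = sx r + sx s := map_add (SplitFun.extHom A P) r s

lemma SplitFun.ext_smul (c : ℝ) (r : Λ) :
    sx (c • r) = c • sx r := map_smul (SplitFun.extHom A P) c r

lemma SplitFun.mom_comm (X : 𝔇) (y : 𝓢) : y * sm X = sm X * y := by
  induction y using TensorProduct.induction_on with
  | zero => simp
  | tmul r s =>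
    simp only [sm, tmul_mul_tmul, mul_one, one_mul, mul_comm s]
  | add x y hx hy => rw [add_mul, mul_add, hx, hy]

lemma SplitFun.mom_add (X Y : 𝔇) : (sm (X + Y) : 𝓢) = sm X + sm Y := by
  simp [sm, tmul_add]

lemma SplitFun.mom_smul (f : A) (X : 𝔇) : (sm (f • X) : 𝓢) = sx (𝔞 f) * sm X := by
  simp only [sm, sx, map_smul, tmul_mul_tmul, mul_one, one_mul]
  rw [tmul_smul, smul_tmul', smul_def, mul_one]

lemma SplitFun.induction {p : 𝓢 → Prop} (ext : ∀ r, p (sx r))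
    (mom : ∀ X y, p y → p (y * sm X)) (add : ∀ x y, p x → p y → p (x + y)) (y : 𝓢) : p y := by
  have key : ∀ (s : SymmetricAlgebra A 𝔇) (y : 𝓢),
      (∀ f : A, p (sx (𝔞 f) * y)) →
      ∀ f : A, p (sx (𝔞 f) * (y * 1 ⊗ₜ s)) := by
    intro s
    induction s using SymmetricAlgebra.induction with
    | algebraMap h =>
      intro y hy f
      have : (1 : Λ) ⊗ₜ[A] algebraMap A (SymmetricAlgebra A 𝔇) h =
          algebraMap A 𝓢 h := by
        rw [Algebra.TensorProduct.algebraMap_apply, algebraMap_eq_smul_one,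
          algebraMap_eq_smul_one, smul_tmul]
      rw [this, ← commutes, ← mul_assoc, Algebra.TensorProduct.algebraMap_apply]
      have := hy (f * h)
      rw [map_mul, SplitFun.ext_mul] at this
      exact this
    | ι X =>
      intro y hy f
      rw [← mul_assoc]
      exact mom X _ (hy f)
    | mul a b ha hb =>
      intro y hy f
      have : (1 : Λ) ⊗ₜ[A] (a * b) = (1 ⊗ₜ a) * (1 ⊗ₜ b) := by simp
      rw [this, ← mul_assoc y]
      exact hb _ (ha y hy) f
    | add a b ha hb =>
      intro y hy f
      rw [tmul_add, mul_add, mul_add]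
      exact add _ _ (ha y hy f) (hb y hy f)
  induction y using TensorProduct.induction_on with
  | zero => simpa [sx] using ext 0
  | tmul r s =>
    have := key s (sx r) (fun f => by rw [← SplitFun.ext_mul]; exact ext _) 1
    have h1 : sx (1 : Λ) = 1 := rfl
    rwa [map_one, h1, one_mul, sx, tmul_mul_tmul, mul_one, one_mul] at this
  | add x y hx hy => exact add x y hx hy

lemma SplitFun.hom_ext {C : Type*} [Ring C] [Algebra ℝ C] {Φ Ψ : 𝓢 →ₐ[ℝ] C}
    (h1 : ∀ r, Φ (sx r) = Ψ (sx r)) (h2 : ∀ X, Φ (sm X) = Ψ (sm X)) : Φ = Ψ := by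
  ext y
  induction y using SplitFun.induction with
  | ext r => exact h1 r
  | mom X y hy => rw [map_mul, map_mul, h2, hy]
  | add x y hx hy => rw [map_add, map_add, hx, hy]

lemma SplitFun.exists_hom {C : Type*} [Ring C] [Algebra ℝ C] (F : Λ →ₐ[ℝ] C)
    (hF : ∀ (f : A) c, F (𝔞 f) * c = c * F (𝔞 f))
    (G : 𝔇 →+ C) (hG : ∀ (f : A) X, G (f • X) = F (𝔞 f) * G X) (hc : ∀ X c, G X * c = c * G X) :
    ∃ Φ : 𝓢 →ₐ[ℝ] C, (∀ r, Φ (sx r) = F r) ∧ ∀ X, Φ (sm X) = G X := by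
  letI : Algebra A C := (F.toRingHom.comp 𝔞Λ).toAlgebra' hF
  have hA : ∀ f : A, algebraMap A C f = F (𝔞 f) := fun f => rfl
  haveI : IsScalarTower ℝ A C := IsScalarTower.of_algebraMap_eq fun c => by
    rw [hA, ← IsScalarTower.algebraMap_apply, F.commutes]
  let G' : 𝔇 →ₗ[A] Subalgebra.center A C :=
    { toFun := fun X => ⟨G X, Subalgebra.mem_center_iff.2 fun c => (hc X c).symm⟩
      map_add' := fun X Y => Subtype.ext (map_add G X Y)
      map_smul' := fun f X => Subtype.ext ((hG f X).trans (by
        rw [← hA, ← smul_def]; rfl)) }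
  let F' : Λ →ₐ[A] C := { F with commutes' := fun f => rfl }
  let G'' : SymmetricAlgebra A 𝔇 →ₐ[A] C :=
    (Subalgebra.center A C).val.comp (SymmetricAlgebra.lift G')
  have hFG : ∀ r s, Commute (F' r) (G'' s) := fun r s =>
    Subalgebra.mem_center_iff.1 (SymmetricAlgebra.lift G' s).2 (F' r)
  refine ⟨(Algebra.TensorProduct.lift F' G'' hFG).restrictScalars ℝ, fun r => ?_, fun X => ?_⟩
  · change Algebra.TensorProduct.lift F' G'' hFG (r ⊗ₜ 1) = _
    rw [Algebra.TensorProduct.lift_tmul, map_one, mul_one]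
    rfl
  · change Algebra.TensorProduct.lift F' G'' hFG (1 ⊗ₜ _) = _
    rw [Algebra.TensorProduct.lift_tmul, map_one, one_mul]
    change ((SymmetricAlgebra.lift G' _ : Subalgebra.center A C) : C) = _
    rw [SymmetricAlgebra.lift_ι_apply]
    rfl

/-- Products of generators of the functions on `T*[2]M ⊕ E[1]`, with their degrees. -/
inductive SplitMonomial : ℕ → 𝓢 → Prop
  | ext (i r) (hr : r ∈ Λ^ i) : SplitMonomial i (sx r)
  | mom (k y X) (hy : SplitMonomial k y) : SplitMonomial (k + 2) (y * sm X)

variable (A P) in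
/-- Functions of degree `k` on `T*[2]M ⊕ E[1]`. -/
def splitDeg (k : ℕ) : Submodule ℝ 𝓢 := Submodule.span ℝ {y | SplitMonomial k y}

lemma SplitMonomial.mul {k l : ℕ} {x y : 𝓢} (hx : SplitMonomial k x)
    (hy : SplitMonomial l y) : SplitMonomial (k + l) (x * y) := by
  induction hx with
  | ext i r hr =>
    induction hy with
    | ext j s hs => rw [← SplitFun.ext_mul]; exact .ext _ _ (shiftDeg_mul hr hs)
    | mom l y X _ ih => rw [← mul_assoc, ← add_assoc]; exact .mom _ _ _ ih
  | mom k x X _ ih =>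
    rw [mul_assoc, ← SplitFun.mom_comm, ← mul_assoc, add_right_comm]
    exact .mom _ _ _ ih

lemma splitDeg_mul {k l : ℕ} {x y : 𝓢} (hx : x ∈ splitDeg A P k)
    (hy : y ∈ splitDeg A P l) : x * y ∈ splitDeg A P (k + l) := by
  have h := mul_mem_mul hx hy
  rw [splitDeg, splitDeg, span_mul_span] at h
  refine span_mono ?_ h
  rintro _ ⟨x, hx, y, hy, rfl⟩
  exact SplitMonomial.mul hx hy

lemma ext_mem_splitDeg {i : ℕ} {r : Λ} (hr : r ∈ Λ^ i) :
    sx r ∈ splitDeg A P i := subset_span (.ext i r hr)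

lemma mom_mem_splitDeg (X : 𝔇) : (sm X : 𝓢) ∈ splitDeg A P 2 := by
  have := SplitMonomial.mom 0 _ X (.ext 0 (1 : Λ) shiftDeg_one)
  have h1 : sx (1 : Λ) = 1 := rfl
  rw [h1, one_mul] at this
  exact subset_span this

lemma iSup_splitDeg (y : 𝓢) : y ∈ ⨆ k, splitDeg A P k := by
  induction y using SplitFun.induction with
  | ext r =>
    induction r using shift_hom_induction with
    | mem i r hr => exact mem_iSup_of_mem i (ext_mem_splitDeg hr)
    | add r s hr hs => rw [SplitFun.ext_add]; exact add_mem hr hs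
  | mom X y hy =>
    induction hy using Submodule.iSup_induction' with
    | mem k y hy => exact mem_iSup_of_mem (k + 2) (splitDeg_mul hy (mom_mem_splitDeg X))
    | zero => simp
    | add x y _ _ hx hy => rw [add_mul]; exact add_mem hx hy
  | add x y hx hy => exact add_mem hx hy

end Lifts

/-! ## The isomorphism of functions on `T*[2]M ⊕ E[1]` and on `𝓜` -/

section RoyIso

/-- Dual families of sections of a bundle with metric, and of functions and vector fields. -/
structure Frames (g : LinearMap.BilinForm A P) where
  m : ℕ
  e : Fin m → P
  e' : Fin m → P
  sum_left : ∀ ξ, ∑ i, g (e' i) ξ • e i = ξ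
  sum_right : ∀ ξ, ∑ i, g (e i) ξ • e' i = ξ
  l : ℕ
  f : Fin l → A
  X : Fin l → 𝔇
  sum_X : ∀ D : 𝔇, ∑ j, D (f j) • X j = D
  symm : ∀ ξ η, g ξ η = g η ξ

variable {g : LinearMap.BilinForm A P} (Fr : Frames g)

lemma derivation_sum_apply {κ : Type*} (s : Finset κ) (D : κ → 𝔇) (h : A) :
    (∑ j ∈ s, D j) h = ∑ j ∈ s, D j h :=
  map_sum (⟨⟨fun D => D h, rfl⟩, fun _ _ => rfl⟩ : 𝔇 →+ A) D s

include Fr in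
lemma Frames.euler_ext (k : ℕ) : ∀ r ∈ Λ^ k,
    ∑ i, ι A (Fr.e i) * (contr (g (Fr.e' i))).1 r = (k : ℝ) • r := by
  refine shiftDeg_induction (p := fun k r => ∑ i, ι A (Fr.e i) *
    (contr (g (Fr.e' i))).1 r = (k : ℝ) • r) ?_ ?_ ?_ k
  · intro f
    simp [contr_algebraMap]
  · intro i ξ r _ ih
    have h : ∀ j, ι A (Fr.e j) * (contr (g (Fr.e' j))).1 (ι A ξ * r) =
        ι A (g (Fr.e' j) ξ • Fr.e j) * r + ι A ξ *
          (ι A (Fr.e j) * (contr (g (Fr.e' j))).1 r) := by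
      intro j
      rw [contr_ι_mul, mul_sub, ← mul_assoc, ← mul_assoc, sub_eq_add_neg, ← neg_mul,
        ← eq_neg_of_add_eq_zero_left (ExteriorAlgebra.ι_add_mul_swap ξ (Fr.e j)), map_smul,
        mul_smul_comm, smul_mul_assoc]
    simp only [h]
    rw [sum_add_distrib, ← mul_sum, ih, ← sum_mul, ← map_sum, Fr.sum_left]
    push_cast
    rw [mul_smul_comm, add_smul, one_smul, add_comm]
  · intro i r s _ _ hr hs
    simp only [map_add, mul_add, sum_add_distrib, hr, hs, smul_add]

include Fr in
lemma Frames.eq_zero_of_contr {k : ℕ} {r : Λ} (hr : r ∈ Λ^ (k + 1))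
    (h : ∀ ξ, (contr (g ξ)).1 r = 0) : r = 0 := by
  have := Fr.euler_ext (k + 1) r hr
  simp only [h, mul_zero, sum_const_zero] at this
  have hk : ((k + 1 : ℕ) : ℝ) ≠ 0 := by positivity
  exact (smul_eq_zero.1 this.symm).resolve_left hk

lemma Frames.der_expand (k : ℕ) : ∀ δ : A →ₗ[ℝ] Λ,
    (∀ f h, δ (f * h) = f • δ h + h • δ f) → (∀ f, δ f ∈ Λ^ k) →
    ∀ h, δ h = ∑ j, Fr.X j h • δ (Fr.f j) := by
  induction k with
  | zero =>
    intro δ hδ hmem h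
    let D : 𝔇 := Derivation.mk'
      ((ExteriorAlgebra.algebraMapInv (R := A) (M := P)).toLinearMap.restrictScalars ℝ ∘ₗ δ)
      (fun f h => by
        change ExteriorAlgebra.algebraMapInv (δ (f * h)) = _
        rw [hδ, map_add, map_smul, map_smul]; rfl)
    have hD : ∀ f, 𝔞Λ (D f) = δ f := fun f => by
      obtain ⟨a, ha⟩ := shiftDeg_zero_eq (hmem f)
      change 𝔞 (ExteriorAlgebra.algebraMapInv (δ f)) = _
      rw [← ha, ExteriorAlgebra.algebraMap_leftInverse]
    rw [← hD]
    conv_lhs => rw [← Fr.sum_X D]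
    simp only [← hD, derivation_sum_apply, Derivation.smul_apply, smul_eq_mul, map_sum, map_mul]
    refine sum_ext fun j => ?_
    rw [← map_mul, mul_comm, map_mul, smul_def]
  | succ k ih =>
    intro δ hδ hmem h
    rw [← sub_eq_zero]
    refine Fr.eq_zero_of_contr (k := k) ?_ fun ξ => ?_
    · exact sub_mem (hmem h)
        (sum_mem fun j _ => shiftDeg_smul _ (hmem _))
    · have := ih ((contr (g ξ)).1 ∘ₗ δ) (fun f h => by
        simp only [lm_comp, hδ, map_add, contr_smul])
        (fun f => by
          have := (contr (g ξ)).2.1 (k + 1) k _ (hmem f) (by omega)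
          exact this) h
      simp only [lm_comp] at this
      rw [map_sub, map_sum, this, sub_eq_zero]
      exact sum_ext fun j => (contr_smul _ _ _).symm

lemma vf_algebraMap_mul {d : ℕ} (V : 𝔛 d) (f : A) (s : Λ) :
    V.1 (𝔞 f * s) = V.1 (𝔞 f) * s + 𝔞 f * V.1 s := by
  rw [vf_mul V.2 (shiftDeg_algebraMap f), zero_mul, pow_zero, one_smul]

lemma vf_smul_apply {d : ℕ} (V : 𝔛 d) (f : A) (s : Λ) :
    V.1 (f • s) = V.1 (𝔞 f) * s + f • V.1 s := by
  rw [smul_def, vf_algebraMap_mul, smul_def]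

lemma Frames.vf_expand {d : ℕ} (V : 𝔛 d) (h : A) :
    V.1 (𝔞 h) = ∑ j, Fr.X j h • V.1 (𝔞 (Fr.f j)) := by
  by_cases hd : d < 2
  · have h0 : ∀ f, V.1 (𝔞 f) = 0 := fun f =>
      V.2.2.1 0 _ (shiftDeg_algebraMap f) (by omega)
    simp [h0]
  · refine Fr.der_expand (d - 2) (V.1 ∘ₗ (IsScalarTower.toAlgHom ℝ A Λ).toLinearMap)
      (fun f h => ?_) (fun f => ?_) h
    · change V.1 (𝔞 (f * h)) = f • V.1 (𝔞 h) + h • V.1 (𝔞 f)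
      rw [map_mul, vf_algebraMap_mul, smul_def, smul_def, commutes h, add_comm]
    · exact V.2.1 0 _ _ (shiftDeg_algebraMap f) (by omega)

/-! ### Horizontal lifts -/

variable (nab : Connection ℝ A P)

lemma exists_horizontalLift (X : 𝔇) : ∃ V, IsHorizontalLift nab X V :=
  exists_liftField X (nab.toFun X).toAddMonoidHom fun f ξ => nab.leibniz X f ξ

/-- The horizontal lift of a vector field. -/
def horLift (X : 𝔇) : 𝔛 2 := (exists_horizontalLift nab X).choose

lemma horLift_algebraMap (X : 𝔇) (f : A) : (horLift nab X).1 (𝔞 f) = 𝔞Λ (X f) :=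
  (exists_horizontalLift nab X).choose_spec.1 f

lemma horLift_ι (X : 𝔇) (ξ : P) : (horLift nab X).1 (ι A ξ) = ι A (nab.toFun X ξ) :=
  (exists_horizontalLift nab X).choose_spec.2 ξ

lemma vf_eq_of_gen {d : ℕ} {V W : 𝔛 d} (h0 : ∀ f : A, V.1 (𝔞 f) = W.1 (𝔞 f))
    (h1 : ∀ ξ : P, V.1 (ι A ξ) = W.1 (ι A ξ)) : V = W :=
  Subtype.ext (vf_ext V.2 W.2 rfl h0 h1)

lemma IsHorizontalLift.eq {X : 𝔇} {V : 𝔛 2} (h : IsHorizontalLift nab X V) : V = horLift nab X :=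
  vf_eq_of_gen (fun f => by rw [h.1, horLift_algebraMap]) (fun ξ => by rw [h.2, horLift_ι])

lemma horLift_add (X Y : 𝔇) : horLift nab (X + Y) = horLift nab X + horLift nab Y := by
  refine vf_eq_of_gen (fun f => ?_) (fun ξ => ?_)
  · simp [horLift_algebraMap]
  · simp [horLift_ι, nab.map_add]

lemma horLift_smul (f : A) (X : 𝔇) (s : Λ) :
    (horLift nab (f • X)).1 s = 𝔞 f * (horLift nab X).1 s := by
  have h := vf_smul (shiftDeg_algebraMap (P := P) f) (horLift nab X).2
  rw [zero_add] at h
  have : horLift nab (f • X) = ⟨_, h⟩ := by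
    refine vf_eq_of_gen (fun h => ?_) (fun ξ => ?_)
    · simp [horLift_algebraMap]
    · simp [horLift_ι, nab.map_smul, smul_def]
  rw [this]; rfl

/-- The vertical coefficients of a vector field on `E[1]`. -/
def Frames.vert (i : Fin Fr.m) : 𝓔 Λ →ₗ[ℝ] Λ :=
  LinearMap.applyₗ (ι A (Fr.e i)) - ∑ j,
    LinearMap.mulRight ℝ (ι A (nab.toFun (Fr.X j) (Fr.e i))) ∘ₗ
      LinearMap.applyₗ (𝔞 (Fr.f j))

lemma Frames.vert_apply (i : Fin Fr.m) (V : 𝓔 Λ) :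
    Fr.vert nab i V = V (ι A (Fr.e i)) - ∑ j, V (𝔞 (Fr.f j)) *
      ι A (nab.toFun (Fr.X j) (Fr.e i)) := by
  simp [Frames.vert, lm_sum]

lemma vf_base_cases {d : ℕ} (V : 𝔛 d) (f : A) : V.1 (𝔞 f) = 0 ∨
      ∃ k, d = k + 2 ∧ V.1 (𝔞 f) ∈ Λ^ k := by
  by_cases hd : d < 2
  · exact Or.inl (V.2.2.1 0 _ (shiftDeg_algebraMap f) (by omega))
  · exact Or.inr ⟨d - 2, by omega, V.2.1 0 _ _ (shiftDeg_algebraMap f) (by omega)⟩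

lemma Frames.vert_cases {d : ℕ} (V : 𝔛 d) (i : Fin Fr.m) :
    Fr.vert nab i V.1 = 0 ∨ ∃ k, d = k + 1 ∧ Fr.vert nab i V.1 ∈ Λ^ k := by
  rcases Nat.eq_zero_or_pos d with hd | hd
  · subst hd
    left
    rw [vf_zero V.2, map_zero]
  · right
    refine ⟨d - 1, by omega, ?_⟩
    rw [Fr.vert_apply]
    refine sub_mem (V.2.1 1 _ _ (shiftDeg_ι _) (by omega))
      (sum_mem fun j _ => ?_)
    rcases vf_base_cases V (Fr.f j) with h | ⟨k, hk, h⟩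
    · rw [h, zero_mul]; exact zero_mem _
    · have := shiftDeg_mul h (shiftDeg_ι (nab.toFun (Fr.X j) (Fr.e i)))
      rwa [show k + 1 = d - 1 by omega] at this

lemma hor_mem {d : ℕ} (V : 𝔛 d) (f : A) (X : 𝔇) :
    mulLeft ℝ (V.1 (𝔞 f)) * (horLift nab X).1 ∈ 𝔛 d := by
  rcases vf_base_cases V f with h | ⟨k, hk, h⟩
  · rw [h, LinearMap.mulLeft_zero_eq_zero, zero_mul]; exact zero_mem _
  · have := vf_smul h (horLift nab X).2
    rwa [← hk] at this

lemma Frames.vert_mem {d : ℕ} (V : 𝔛 d) (i : Fin Fr.m) (α : Module.Dual A P) :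
    mulLeft ℝ (Fr.vert nab i V.1) * (contr α).1 ∈ 𝔛 d := by
  rcases Fr.vert_cases nab V i with h | ⟨k, hk, h⟩
  · rw [h, LinearMap.mulLeft_zero_eq_zero, zero_mul]; exact zero_mem _
  · have := vf_smul h (contr α).2
    rwa [← hk] at this

lemma Frames.vf_ι {d : ℕ} (V : 𝔛 d) (ξ : P) : V.1 (ι A ξ) = ∑ i, (V.1 (𝔞 (g (Fr.e' i) ξ)) *
      ι A (Fr.e i) + g (Fr.e' i) ξ • V.1 (ι A (Fr.e i))) := by
  conv_lhs => rw [← Fr.sum_left ξ]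
  rw [map_sum, map_sum]
  exact sum_ext fun i => by rw [map_smul, vf_smul_apply]

lemma Frames.vf_decomp {d : ℕ} (V : 𝔛 d) : V = ∑ j, ⟨_, hor_mem nab V (Fr.f j) (Fr.X j)⟩ +
      ∑ i, ⟨_, Fr.vert_mem nab V i (g (Fr.e' i))⟩ := by
  refine vf_eq_of_gen (fun h => ?_) (fun ξ => ?_)
  · rw [Fr.vf_expand V h]
    simp only [coe_add, coe_sum, lm_add, lm_sum,
      mul_apply, mulLeft_apply, horLift_algebraMap, contr_algebraMap, mul_zero,
      sum_const_zero, add_zero]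
    exact sum_ext fun j => by rw [smul_def, commutes]
  · simp only [coe_add, coe_sum, lm_add, lm_sum, mul_apply, mulLeft_apply, contr_ι]
    rw [Fr.vf_ι V]
    have h1 : ∀ j, (horLift nab (Fr.X j)).1 (ι A ξ) = ∑ i,
        (𝔞 (Fr.X j (g (Fr.e' i) ξ)) * ι A (Fr.e i) +
        𝔞 (g (Fr.e' i) ξ) *
          ι A (nab.toFun (Fr.X j) (Fr.e i))) := by
      intro j
      rw [Fr.vf_ι]
      simp only [horLift_algebraMap, horLift_ι, smul_def]
    simp only [h1, Fr.vert_apply, mul_sum, sub_mul, sum_mul]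
    rw [sum_comm, ← sum_add_distrib]
    refine sum_ext fun i => ?_
    rw [Fr.vf_expand V, sum_mul, add_sub_left_comm, ← commutes,
      ← smul_def, add_comm, ← sum_sub_distrib]
    congr 1
    refine sum_ext fun j => ?_
    rw [mul_add, ← mul_assoc, ← commutes (Fr.X j _), ← smul_def (Fr.X j _), mul_assoc,
      ← commutes (g _ _), add_sub_cancel_right]

/-! ### The inverse of the pullback by `Ξ_∇` -/

/-- The function on `T*[2]M ⊕ E[1]` of a vector field on `E[1]`. -/
def Frames.kap : 𝓔 Λ →ₗ[ℝ] 𝓢 :=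
  ∑ j, LinearMap.mulRight ℝ (sm (Fr.X j)) ∘ₗ (SplitFun.extHom A P).toLinearMap ∘ₗ
      LinearMap.applyₗ (𝔞 (Fr.f j)) +
    (1 / 2 : ℝ) • ∑ i, LinearMap.mulRight ℝ (sx (ι A (Fr.e' i))) ∘ₗ
      (SplitFun.extHom A P).toLinearMap ∘ₗ Fr.vert nab i

lemma Frames.kap_apply (V : 𝓔 Λ) : Fr.kap nab V = ∑ j, sx (V (𝔞 (Fr.f j))) * sm (Fr.X j) +
      (1 / 2 : ℝ) • ∑ i, sx (Fr.vert nab i V) * sx (ι A (Fr.e' i)) := by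
  simp only [Frames.kap, lm_add, lm_sum, lm_smul]
  rfl

lemma Frames.kap_mul (r : Λ) (V W : 𝓔 Λ)
    (hW : ∀ s, W s = r * V s) : Fr.kap nab W = sx r * Fr.kap nab V := by
  have hv : ∀ i, Fr.vert nab i W = r * Fr.vert nab i V := by
    intro i
    simp only [Fr.vert_apply, hW, mul_sub, mul_sum, mul_assoc]
  simp only [Fr.kap_apply, hv, hW, SplitFun.ext_mul, mul_add, mul_smul_comm, mul_sum, mul_assoc]

lemma Frames.kap_mem {d : ℕ} (V : 𝔛 d) : Fr.kap nab V.1 ∈ splitDeg A P d := by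
  rw [Fr.kap_apply]
  refine add_mem (sum_mem fun j _ => ?_)
    (smul_mem _ _ (sum_mem fun i _ => ?_))
  · rcases vf_base_cases V (Fr.f j) with h | ⟨k, rfl, h⟩
    · rw [h, ← SplitFun.extHom_apply, map_zero, zero_mul]; exact zero_mem _
    · exact splitDeg_mul (ext_mem_splitDeg h) (mom_mem_splitDeg _)
  · rcases Fr.vert_cases nab V i with h | ⟨k, rfl, h⟩
    · rw [h, ← SplitFun.extHom_apply, map_zero, zero_mul]; exact zero_mem _
    · exact splitDeg_mul (ext_mem_splitDeg h) (ext_mem_splitDeg (shiftDeg_ι _))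

lemma SplitMonomial.comm {k l : ℕ} {x y : 𝓢} (hx : SplitMonomial k x)
    (hy : SplitMonomial l y) : y * x = (-1 : ℝ) ^ (k * l) • (x * y) := by
  induction hx with
  | ext i r hr =>
    induction hy with
    | ext j s hs => rw [← SplitFun.ext_mul, shift_comm hr hs, SplitFun.ext_smul, SplitFun.ext_mul]
    | mom l y X _ ih =>
      rw [mul_assoc, ← SplitFun.mom_comm, ← mul_assoc, ih, smul_mul_assoc, mul_assoc, mul_add,
        pow_add, mul_comm _ 2, pow_mul (-1 : ℝ) 2]
      simp
  | mom k x X _ ih =>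
    rw [← mul_assoc, ih, smul_mul_assoc, mul_assoc, SplitFun.mom_comm, ← mul_assoc, add_mul,
      pow_add, pow_mul (-1 : ℝ) 2]
    simp

lemma splitDeg_comm {k l : ℕ} {x y : 𝓢} (hx : x ∈ splitDeg A P k)
    (hy : y ∈ splitDeg A P l) : y * x = (-1 : ℝ) ^ (k * l) • (x * y) := by
  induction hx using span_induction with
  | mem x hx =>
    induction hy using span_induction with
    | mem y hy => exact SplitMonomial.comm hx hy
    | zero => simp
    | add y z _ _ hy hz => rw [add_mul, mul_add, hy, hz, smul_add]
    | smul c y _ hy => rw [smul_mul_assoc, mul_smul_comm, hy, smul_comm]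
  | zero => simp
  | add y z _ _ hy hz => rw [add_mul, mul_add, hy, hz, smul_add]
  | smul c y _ hy => rw [smul_mul_assoc, mul_smul_comm, hy, smul_comm]

lemma restrict_rel {x y : 𝓞} (h : SubRel g x y) : restrict g x = restrict g y :=
  RingQuot.mkAlgHom_rel ℝ h

lemma restrict_surjective : Function.Surjective (restrict g) :=
  RingQuot.mkAlgHom_surjective ℝ _

lemma exists_royHom {Q : Type*} [Ring Q] [Algebra ℝ Q] (F : 𝓞 →ₐ[ℝ] Q)
    (hF : ∀ x y, SubRel g x y → F x = F y) : ∃ Φ : RoyFun g →ₐ[ℝ] Q, ∀ x, Φ (restrict g x) = F x :=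
  ⟨RingQuot.liftAlgHom ℝ ⟨F, fun {x y} h => hF x y h⟩,
    fun x => RingQuot.liftAlgHom_mkAlgHom_apply ℝ _ _ x⟩

lemma Frames.exists_kappa : ∃ κ : RoyFun g →ₐ[ℝ] 𝓢, (∀ r, κ (restrict g (fn r)) = sx r) ∧
    ∀ d (V : 𝔛 d), κ (restrict g (mom V)) = Fr.kap nab V.1 := by
  have key := CotFun.exists_lift (SplitFun.extHom A P)
    (fun d => Fr.kap nab ∘ₗ (𝔛 d).subtype) ?_ ?_ ?_
  · obtain ⟨F, h1, h2⟩ := key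
    obtain ⟨κ, hκ⟩ := exists_royHom (g := g) F (by
      rintro x y ⟨ξ, V, hV⟩
      rw [h2, map_smul, h1, SplitFun.extHom_apply]
      have hVc := vf_one_eq_contr V (g ξ) hV
      change Fr.kap nab V.1 = _
      have h0 : ∀ f : A, V.1 (𝔞 f) = 0 := fun f => by rw [hVc, contr_algebraMap]
      have e0 : sx (0 : Λ) = 0 := map_zero (SplitFun.extHom A P)
      simp only [Fr.kap_apply, Fr.vert_apply, h0, e0, zero_mul, sum_const_zero, zero_add,
        sub_zero, hV]
      congr 1
      conv_rhs => rw [← Fr.sum_right ξ, map_sum, ← SplitFun.extHom_apply, map_sum]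
      refine sum_ext fun i => ?_
      rw [← SplitFun.ext_mul, ← smul_def, map_smul, Fr.symm]
      rfl)
    exact ⟨κ, fun r => by rw [hκ, h1]; rfl, fun d V => by rw [hκ, h2]; rfl⟩
  · intro i d e r V W hr he hW
    exact Fr.kap_mul nab r V.1 W.1 hW
  · intro i d r V hr
    change Fr.kap nab V.1 * sx r = _ • (sx r * Fr.kap nab V.1)
    rw [splitDeg_comm (ext_mem_splitDeg hr) (Fr.kap_mem nab V), mul_comm i]
  · intro d e V W
    change Fr.kap nab V.1 * Fr.kap nab W.1 = _
    rw [splitDeg_comm (Fr.kap_mem nab W) (Fr.kap_mem nab V), mul_comm d]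
    rfl

/-! ### The pullback by `Ξ_∇` -/

lemma CotFun.even_comm {k : ℕ} {x : 𝓞} (hx : x ∈ CotFun.par A P k) (hk : Even k)
    (y : 𝓞) : x * y = y * x := by
  rw [← CotFun.proj_add y, mul_add, add_mul, CotFun.par_comm (CotFun.proj_mem 0 y) hx,
    CotFun.par_comm (CotFun.proj_mem 1 y) hx, mul_comm 0, mul_comm 1, pow_mul, pow_mul,
    hk.neg_one_pow]
  simp

lemma exists_xi : ∃ Φ : 𝓢 →ₐ[ℝ] RoyFun g, (∀ r, Φ (sx r) = restrict g (fn r)) ∧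
    ∀ X, Φ (sm X) = restrict g (mom (horLift nab X)) := by
  refine SplitFun.exists_hom ((restrict g).comp (CotFun.fnHom A P)) (fun f c => ?_)
    { toFun := fun X => restrict g (mom (horLift nab X))
      map_zero' := ?_
      map_add' := fun X Y => ?_ } (fun f X => ?_) (fun X c => ?_)
  · obtain ⟨c, rfl⟩ := restrict_surjective c
    change restrict g (fn _) * _ = _ * restrict g (fn _)
    rw [← map_mul, ← map_mul,
      CotFun.even_comm (CotFun.fn_mem_par (shiftDeg_algebraMap f)) (by norm_num)]
  · have : horLift nab 0 = 0 := by
      have := horLift_add nab 0 0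
      rwa [add_zero, left_eq_add] at this
    rw [this, ← CotFun.momHom_apply, map_zero, map_zero]
  · rw [horLift_add, ← CotFun.momHom_apply, map_add, map_add]; rfl
  · change restrict g (mom _) = restrict g (fn _) * restrict g (mom _)
    rw [← map_mul, CotFun.mom_mul_left (shiftDeg_algebraMap f) (horLift nab X)
      (horLift nab (f • X)) rfl (horLift_smul nab f X)]
  · obtain ⟨c, rfl⟩ := restrict_surjective c
    change restrict g (mom _) * _ = _ * restrict g (mom _)
    rw [← map_mul, ← map_mul, CotFun.even_comm (CotFun.mom_mem_par _) (by norm_num)]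

variable (g) in
/-- The pullback by `Ξ_∇`. -/
def xi : 𝓢 →ₐ[ℝ] RoyFun g := (exists_xi nab).choose

lemma xi_ext (r : Λ) : xi g nab (sx r) = restrict g (fn r) :=
  (exists_xi nab).choose_spec.1 r

lemma xi_mom (X : 𝔇) : xi g nab (sm X) = restrict g (mom (horLift nab X)) :=
  (exists_xi nab).choose_spec.2 X

lemma isXiPullback_iff (Φ : 𝓢 →ₐ[ℝ] RoyFun g) : IsXiPullback g nab Φ ↔ Φ = xi g nab := by
  constructor
  · rintro ⟨h1, h2⟩
    refine SplitFun.hom_ext (fun r => by rw [h1, xi_ext]) (fun X => ?_)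
    obtain ⟨V, hV, h⟩ := h2 X
    rw [h, xi_mom, hV.eq]
  · rintro rfl
    exact ⟨xi_ext nab, fun X => ⟨_, ⟨horLift_algebraMap nab X, horLift_ι nab X⟩,
      xi_mom nab X⟩⟩

lemma roy_hom_ext {Q : Type*} [Ring Q] [Algebra ℝ Q] {Φ Ψ : RoyFun g →ₐ[ℝ] Q}
    (h1 : ∀ r, Φ (restrict g (fn r)) = Ψ (restrict g (fn r))) (h2 : ∀ d (V : 𝔛 d),
      Φ (restrict g (mom V)) = Ψ (restrict g (mom V))) : Φ = Ψ := by
  have : Φ.comp (restrict g) = Ψ.comp (restrict g) := CotFun.hom_ext h1 h2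
  ext x
  obtain ⟨x, rfl⟩ := restrict_surjective x
  exact DFunLike.congr_fun this x

lemma restrict_mom_contr (ξ : P) : restrict g (mom (contr (g ξ))) =
    (1 / 2 : ℝ) • restrict g (fn (ι A ξ)) := by
  rw [restrict_rel (.contract ξ (contr (g ξ)) (fun η => contr_ι _ η)), map_smul]

lemma Frames.xi_kap {d : ℕ} (V : 𝔛 d) : xi g nab (Fr.kap nab V.1) = restrict g (mom V) := by
  rw [Fr.kap_apply, map_add, map_sum, map_smul, map_sum]
  conv_rhs => rw [Fr.vf_decomp nab V, ← CotFun.momHom_apply, map_add, map_add, map_sum, map_sum,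
    map_sum, map_sum]
  rw [smul_sum]
  congr 1
  · refine sum_ext fun j => ?_
    rw [map_mul, xi_ext, xi_mom, CotFun.momHom_apply, ← map_mul]
    rcases vf_base_cases V (Fr.f j) with h | ⟨k, rfl, h⟩
    · have : (⟨_, hor_mem nab V (Fr.f j) (Fr.X j)⟩ : 𝔛 d) = 0 :=
        Subtype.ext (by simp [h, LinearMap.mulLeft_zero_eq_zero])
      rw [this, h, CotFun.fn_zero, zero_mul, ← CotFun.momHom_apply, map_zero, map_zero, map_zero]
    · rw [CotFun.mom_mul_left h (horLift nab (Fr.X j)) ⟨_, hor_mem nab V (Fr.f j) (Fr.X j)⟩ rfl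
        (fun s => rfl)]
  · refine sum_ext fun i => ?_
    rw [map_mul, xi_ext, xi_ext, CotFun.momHom_apply, ← mul_smul_comm, ← restrict_mom_contr,
      ← map_mul]
    rcases Fr.vert_cases nab V i with h | ⟨k, rfl, h⟩
    · have : (⟨_, Fr.vert_mem nab V i (g (Fr.e' i))⟩ : 𝔛 d) = 0 :=
        Subtype.ext (by simp [h, LinearMap.mulLeft_zero_eq_zero])
      rw [this, h, CotFun.fn_zero, zero_mul, ← CotFun.momHom_apply, map_zero, map_zero, map_zero]
    · rw [CotFun.mom_mul_left h (contr (g (Fr.e' i))) ⟨_, Fr.vert_mem nab V i (g (Fr.e' i))⟩ rfl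
        (fun s => rfl)]

lemma Frames.kap_horLift (X : 𝔇) : Fr.kap nab (horLift nab X).1 = sm X := by
  have hv : ∀ i, Fr.vert nab i (horLift nab X).1 = 0 := by
    intro i
    rw [Fr.vert_apply, sub_eq_zero, horLift_ι]
    simp only [horLift_algebraMap, ← smul_def, ← map_smul]
    rw [← map_sum]
    congr 1
    conv_lhs => rw [← Fr.sum_X X]
    have : ∀ (s : Finset (Fin Fr.l)) (a : Fin Fr.l → A), nab.toFun (∑ j ∈ s, a j • Fr.X j) (Fr.e i) =
        ∑ j ∈ s, a j • nab.toFun (Fr.X j) (Fr.e i) := by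
      intro s a
      classical
      induction s using Finset.induction_on with
      | empty =>
        have := nab.map_smul 0 0 (Fr.e i)
        simpa using this
      | insert j s hj ih =>
        rw [Finset.sum_insert hj, Finset.sum_insert hj, nab.map_add, lm_add, ih, nab.map_smul]
    exact this _ _
  have e0 : sx (0 : Λ) = 0 := map_zero (SplitFun.extHom A P)
  simp only [Fr.kap_apply, hv, e0, zero_mul, sum_const_zero, smul_zero, add_zero,
    horLift_algebraMap, ← SplitFun.mom_smul]
  conv_rhs => rw [← Fr.sum_X X]
  simp only [sm]
  rw [map_sum, tmul_sum]

lemma Frames.exists_xiEquiv : ∃ Θ : 𝓢 ≃ₐ[ℝ] RoyFun g, (∀ x, Θ x = xi g nab x) ∧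
    (∀ r, Θ.symm (restrict g (fn r)) = sx r) ∧
    ∀ d (V : 𝔛 d), Θ.symm (restrict g (mom V)) = Fr.kap nab V.1 := by
  obtain ⟨κ, h1, h2⟩ := Fr.exists_kappa nab
  refine ⟨AlgEquiv.ofAlgHom (xi g nab) κ (roy_hom_ext (fun r => ?_) (fun d V => ?_))
    (SplitFun.hom_ext (fun r => ?_) (fun X => ?_)), fun x => rfl, h1, h2⟩
  · rw [AlgHom.comp_apply, h1, xi_ext]; rfl
  · rw [AlgHom.comp_apply, h2, Fr.xi_kap]; rfl
  · rw [AlgHom.comp_apply, xi_ext, h1]; rfl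
  · rw [AlgHom.comp_apply, xi_mom, h2, Fr.kap_horLift]; rfl

end RoyIso

/-! ## The Poisson bracket of `𝓜` -/

section RoyBracket

local notation "𝔓" => CotFun.par A P

variable {g : LinearMap.BilinForm A P}

open CotFun

lemma CotFun.IsDer.mul_inv {p : ℕ} {D : 𝓞 →ₗ[ℝ] 𝓞} (hD : IsDer p D)
    (x y : 𝓞) : D (x * y) = D x * y + (inv A P ^ p) x * D y := by
  induction x using CotFun.induction with
  | mem k x hx =>
    rw [hD.mul k x y (monomial_mem hx), inv_pow_apply (monomial_mem hx), smul_mul_assoc]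
  | add x z hx hz => rw [add_mul, map_add, hx, hz, map_add, map_add, add_mul, add_mul]; abel
  | smul c x hx => rw [smul_mul_assoc, map_smul, hx, map_smul, map_smul, smul_mul_assoc,
      smul_mul_assoc, smul_add]

variable (g) in
/-- The Hamiltonian vector field of the function `x` is tangent to `𝓜`. -/
def IsTangent (x : 𝓞) : Prop :=
  ∀ z, restrict g z = 0 → restrict g (bracket A P x z) = 0

lemma restrict_inv {x : 𝓞} (h : restrict g x = 0) : restrict g (inv A P x) = 0 := by
  obtain ⟨Φ, hΦ⟩ := exists_royHom (g := g) ((restrict g).comp (inv A P)) (by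
    rintro x y ⟨ξ, V, hV⟩
    rw [AlgHom.comp_apply, AlgHom.comp_apply, inv_mom, map_smul, map_smul, inv_fn, shiftInv_ι,
      fn_neg, map_smul, restrict_rel (.contract ξ V hV), map_smul, map_neg, pow_one]
    simp)
  rw [← AlgHom.comp_apply, ← hΦ, h, map_zero]

lemma restrict_proj {x : 𝓞} (h : restrict g x = 0) (k : ℕ) : restrict g (proj k x) = 0 := by
  rw [proj_apply, map_smul, map_add, map_smul, h, restrict_inv h]
  simp

lemma isTangent_of_gen {p : ℕ} {x : 𝓞} (hx : x ∈ 𝔓 p)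
    (h : ∀ ξ, restrict g (bracket A P x (mom (contr (g ξ)))) =
      (1 / 2 : ℝ) • restrict g (bracket A P x (fn (ι A ξ)))) : IsTangent g x := by
  have hD := bracket_isDer hx
  set D := bracket A P x
  have hD1 : D 1 = 0 := by
    have := hD.mul_inv 1 1
    rwa [mul_one, map_one (inv A P ^ p), one_mul, mul_one, left_eq_add] at this
  let T : 𝓞 →ₐ[ℝ] Matrix (Fin 2) (Fin 2) (RoyFun g) := AlgHom.ofLinearMap
    { toFun := fun z => !![restrict g ((inv A P ^ p) z), restrict g (D z); 0, restrict g z]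
      map_add' := fun z w => by simp only [map_add, mat_add]
      map_smul' := fun c z => by simp only [map_smul, mat_smul, RingHom.id_apply] }
    (by
      change !![restrict g ((inv A P ^ p) 1), restrict g (D 1); 0, restrict g 1] = 1
      rw [map_one, map_one, hD1, map_zero, mat_one])
    (fun z w => by
      change !![restrict g ((inv A P ^ p) (z * w)), restrict g (D (z * w)); 0, restrict g (z * w)] =
        !![restrict g ((inv A P ^ p) z), restrict g (D z); 0, restrict g z] *
        !![restrict g ((inv A P ^ p) w), restrict g (D w); 0, restrict g w]
      rw [mat_mul, hD.mul_inv]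
      simp only [map_mul, map_add]
      rw [add_comm])
  have hT : ∀ z, T z = !![restrict g ((inv A P ^ p) z), restrict g (D z); 0, restrict g z] :=
    fun z => rfl
  clear_value T
  obtain ⟨Φ, hΦ⟩ := exists_royHom (g := g) T (by
    rintro x y ⟨ξ, V, hV⟩
    have hr := restrict_rel (.contract ξ V hV : SubRel g _ _)
    rw [map_smul] at hr
    rw [hT, hT]
    refine mat_congr ?_ ?_ (by rw [hr, map_smul])
    · rw [map_smul, inv_pow_apply (mom_mem_par V), inv_pow_apply (fn_mem_par (shiftDeg_ι ξ)),
        map_smul, map_smul, map_smul, hr, smul_comm]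
    · rw [vf_one_eq_contr V (g ξ) hV, h, map_smul, map_smul])
  intro z hz
  have := hΦ z
  rw [hz, map_zero, hT] at this
  exact (congrFun (congrFun this 0) 1).symm

lemma bracket_inv (x y : 𝓞) : inv A P (bracket A P x y) = bracket A P (inv A P x) (inv A P y) := by
  have key : ∀ k l (x y : 𝓞), x ∈ 𝔓 k → y ∈ 𝔓 l →
      inv A P (bracket A P x y) = bracket A P (inv A P x) (inv A P y) := by
    intro k l x y hx hy
    rw [mem_par.1 ((bracket_isDer hx).par l y hy), mem_par.1 hx, mem_par.1 hy, map_smul, map_smul,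
      lm_smul, smul_smul, pow_add, mul_comm]
  rw [← proj_add x, ← proj_add y]
  simp only [map_add, lm_add]
  rw [key _ _ _ _ (proj_mem 0 x) (proj_mem 0 y), key _ _ _ _ (proj_mem 1 x) (proj_mem 0 y),
    key _ _ _ _ (proj_mem 0 x) (proj_mem 1 y), key _ _ _ _ (proj_mem 1 x) (proj_mem 1 y)]

lemma IsTangent.add {x y : 𝓞} (hx : IsTangent g x) (hy : IsTangent g y) :
    IsTangent g (x + y) := fun z hz => by
  rw [map_add, lm_add, map_add, hx z hz, hy z hz, add_zero]

lemma IsTangent.smul {x : 𝓞} (c : ℝ) (hx : IsTangent g x) : IsTangent g (c • x) := fun z hz => by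
  rw [map_smul, lm_smul, map_smul, hx z hz, smul_zero]

lemma isTangent_zero : IsTangent g (0 : 𝓞) := fun z _ => by simp

lemma IsTangent.inv {x : 𝓞} (hx : IsTangent g x) : IsTangent g (inv A P x) := by
  intro z hz
  have := restrict_inv (hx _ (restrict_inv hz))
  rwa [bracket_inv, CotFun.inv_inv] at this

lemma IsTangent.proj {x : 𝓞} (hx : IsTangent g x) (k : ℕ) : IsTangent g (proj k x) := by
  rw [proj_apply]
  exact (hx.add (hx.inv.smul _)).smul _

lemma IsTangent.skew {x y : 𝓞} (hy : IsTangent g y) (hx : restrict g x = 0) :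
    restrict g (bracket A P x y) = 0 := by
  have key : ∀ k l, restrict g (bracket A P (CotFun.proj k x) (CotFun.proj l y)) = 0 := by
    intro k l
    rw [bracket_skew (proj_mem k x) (proj_mem l y), map_neg, map_smul,
      hy.proj l _ (restrict_proj hx k), smul_zero, neg_zero]
  rw [← proj_add x, ← proj_add y]
  simp only [map_add, lm_add, key, add_zero]

lemma IsTangent.mul {x y : 𝓞} (hx : IsTangent g x) (hy : IsTangent g y) : IsTangent g (x * y) := by
  have key : ∀ k l, IsTangent g (CotFun.proj k x * CotFun.proj l y) := by
    intro k l z hz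
    rw [bracket_mul (proj_mem k x) (proj_mem l y)]
    simp only [lm_add, lm_smul, mul_apply,
      mulLeft_apply, map_add, map_smul, map_mul, hx.proj k z hz, hy.proj l z hz,
      mul_zero, smul_zero, add_zero]
  rw [← proj_add x, ← proj_add y, add_mul, mul_add, mul_add]
  exact ((key 0 0).add (key 0 1)).add ((key 1 0).add (key 1 1))

lemma IsTangent.bracket {k l : ℕ} {x y : 𝓞} (hx : IsTangent g x) (hy : IsTangent g y)
    (hxk : x ∈ 𝔓 k) (hyl : y ∈ 𝔓 l) : IsTangent g (bracket A P x y) := by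
  intro z hz
  have := jacobi hxk hyl z
  rw [← sub_eq_iff_eq_add] at this
  rw [← this, map_sub, map_smul, hx _ (hy z hz), hy _ (hx z hz)]
  simp

/-! ### Tangent functions -/

/-- `V` is an infinitesimal isometry of the metric, acting on sections by `T`. -/
structure IsMetricField (g : LinearMap.BilinForm A P) (V : 𝔛 2) (T : P → P) :
    Prop where
  lin : ∀ ξ, V.1 (ι A ξ) = ι A (T ξ)
  metric : ∀ ξ η, V.1 (𝔞 (g ξ η)) =
    𝔞Λ (g (T ξ) η + g ξ (T η))

lemma IsMetricField.comm_contr {V : 𝔛 2} {T : P → P} (h : IsMetricField g V T)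
    (ξ : P) : vfComm 2 1 V.1 (contr (g ξ)).1 = (contr (g (T ξ))).1 := by
  have hc := vfComm_mem V.2 (contr (g ξ)).2
  refine congrArg Subtype.val (vf_one_eq_contr ⟨_, hc⟩ (g (T ξ)) fun η => ?_)
  change vfComm 2 1 V.1 (contr (g ξ)).1 _ = _
  rw [vfComm_apply, contr_ι, h.metric, h.lin, contr_ι, map_add]
  simp

lemma IsMetricField.isTangent {V : 𝔛 2} {T : P → P} (h : IsMetricField g V T) :
    IsTangent g (mom V) := by
  refine isTangent_of_gen (mom_mem_par V) fun ξ => ?_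
  rw [bracket_mom_mom, h.comm_contr, endMom_of_mem (contr (g (T ξ))).2, bracket_mom_fn, h.lin]
  exact restrict_mom_contr (T ξ)

lemma isTangent_fn (f : A) : IsTangent g (fn (𝔞Λ f)) := by
  refine isTangent_of_gen (fn_mem_par (shiftDeg_algebraMap f)) fun ξ => ?_
  rw [bracket_skew (fn_mem_par (shiftDeg_algebraMap f)) (mom_mem_par _), bracket_mom_fn,
    contr_algebraMap, bracket_fn_fn, fn_zero]
  simp

variable (g) in
/-- The extension of a linear function on `𝓜` to a tangent function. -/
def linLift (ξ : P) : 𝓞 :=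
  (1 / 2 : ℝ) • fn (ι A ξ) + mom (contr (g ξ))

lemma linLift_mem (ξ : P) : linLift g ξ ∈ cotDeg A P 1 :=
  add_mem (smul_mem _ _ (fn_mem_cotDeg (shiftDeg_ι ξ))) (mom_mem_cotDeg _)

lemma restrict_linLift (ξ : P) : restrict g (linLift g ξ) = restrict g (fn (ι A ξ)) := by
  rw [linLift, map_add, map_smul, restrict_mom_contr, ← add_smul]
  norm_num

lemma bracket_linLift_fn (ξ : P) (r : Λ) :
    bracket A P (linLift g ξ) (fn r) = fn ((contr (g ξ)).1 r) := by
  rw [linLift, map_add, map_smul, lm_add, lm_smul, bracket_fn_fn,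
    bracket_mom_fn, smul_zero, zero_add]

lemma bracket_linLift_mom (ξ η : P) : bracket A P (linLift g ξ) (mom (contr (g η))) =
      (1 / 2 : ℝ) • fn (𝔞 (g η ξ)) := by
  have h0 : vfComm 1 1 (contr (g ξ)).1 (contr (g η)).1 = 0 :=
    vf_zero (vfComm_mem (contr (g ξ)).2 (contr (g η)).2)
  rw [linLift, map_add, map_smul, lm_add, lm_smul, bracket_mom_mom, h0,
    endMom_zero, add_zero, bracket_skew (fn_mem_par (shiftDeg_ι ξ)) (mom_mem_par _),
    bracket_mom_fn, contr_ι]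
  simp

lemma isTangent_linLift (hs : ∀ ξ η, g ξ η = g η ξ) (ξ : P) : IsTangent g (linLift g ξ) := by
  refine isTangent_of_gen (cotDeg_le_par 1 (linLift_mem ξ)) fun η => ?_
  rw [bracket_linLift_mom, bracket_linLift_fn, contr_ι, map_smul, hs]

lemma isMetricField_horLift {nab : Connection ℝ A P} (hm : nab.IsMetric g)
    (X : 𝔇) : IsMetricField g (horLift nab X) (nab.toFun X) :=
  ⟨horLift_ι nab X, fun ξ η => by rw [horLift_algebraMap, hm]⟩

variable (Fr : Frames g) {nab : Connection ℝ A P}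

lemma exists_tangent_fn (hs : ∀ ξ η, g ξ η = g η ξ) (i : ℕ) : ∀ r ∈ Λ^ i,
    ∃ x ∈ cotDeg A P i, IsTangent g x ∧ restrict g x = restrict g (fn r) := by
  refine shiftDeg_induction (p := fun i r => ∃ x ∈ cotDeg A P i, IsTangent g x ∧
    restrict g x = restrict g (fn r)) ?_ ?_ ?_ i
  · exact fun f => ⟨_, fn_mem_cotDeg (shiftDeg_algebraMap f), isTangent_fn f, rfl⟩
  · rintro i ξ r _ ⟨x, h1, h2, h3⟩
    refine ⟨linLift g ξ * x, ?_, (isTangent_linLift hs ξ).mul h2, ?_⟩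
    · rw [add_comm]; exact cotDeg_mul (linLift_mem ξ) h1
    · rw [map_mul, restrict_linLift, h3, fn_mul, map_mul]
  · rintro i r s _ _ ⟨x, h1, h2, h3⟩ ⟨y, h1', h2', h3'⟩
    exact ⟨x + y, add_mem h1 h1', h2.add h2', by rw [map_add, h3, h3', fn_add, map_add]⟩

lemma exists_tangent_split (hs : ∀ ξ η, g ξ η = g η ξ) (hm : nab.IsMetric g) {k : ℕ}
    {y : 𝓢} (hy : y ∈ splitDeg A P k) :
    ∃ x ∈ cotDeg A P k, IsTangent g x ∧ restrict g x = xi g nab y := by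
  induction hy using span_induction with
  | mem y hy =>
    replace hy : SplitMonomial k y := hy
    induction hy with
    | ext i r hr => rw [xi_ext]; exact exists_tangent_fn hs i r hr
    | mom k y X _ ih =>
      obtain ⟨x, h1, h2, h3⟩ := ih
      exact ⟨x * mom (horLift nab X), cotDeg_mul h1 (mom_mem_cotDeg _),
        h2.mul (isMetricField_horLift hm X).isTangent, by rw [map_mul, h3, map_mul, xi_mom]⟩
  | zero => exact ⟨0, zero_mem _, isTangent_zero, by simp⟩
  | add y z _ _ hy hz =>
    obtain ⟨x, h1, h2, h3⟩ := hy
    obtain ⟨w, h1', h2', h3'⟩ := hz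
    exact ⟨x + w, add_mem h1 h1', h2.add h2', by rw [map_add, h3, h3', map_add]⟩
  | smul c y _ hy =>
    obtain ⟨x, h1, h2, h3⟩ := hy
    exact ⟨c • x, smul_mem _ _ h1, h2.smul c, by rw [map_smul, h3, map_smul]⟩

lemma Frames.kappa_mem {κ : RoyFun g →ₐ[ℝ] 𝓢} (h1 : ∀ r, κ (restrict g (fn r)) = sx r)
    (h2 : ∀ d (V : 𝔛 d), κ (restrict g (mom V)) = Fr.kap nab V.1) {k : ℕ}
    {x : 𝓞} (hx : x ∈ cotDeg A P k) : κ (restrict g x) ∈ splitDeg A P k := by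
  induction hx using span_induction with
  | mem x hx =>
    replace hx : CotMonomial k x := hx
    induction hx with
    | fn i r hr => rw [h1]; exact ext_mem_splitDeg hr
    | mom d V => rw [h2]; exact Fr.kap_mem nab V
    | mul k l x y _ _ hx hy => rw [map_mul, map_mul]; exact splitDeg_mul hx hy
  | zero => simp
  | add x y _ _ hx hy => rw [map_add, map_add]; exact add_mem hx hy
  | smul c x _ hx => rw [map_smul, map_smul]; exact smul_mem _ _ hx

include Fr in
lemma Frames.exists_tangent_deg (hm : nab.IsMetric g) {k : ℕ} {u : RoyFun g}
    (hu : u ∈ royDeg g k) : ∃ x ∈ cotDeg A P k, IsTangent g x ∧ restrict g x = u := by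
  obtain ⟨z, hz, rfl⟩ := hu
  obtain ⟨Θ, h0, h1, h2⟩ := Fr.exists_xiEquiv nab
  obtain ⟨x, hx⟩ := exists_tangent_split Fr.symm hm
    (Fr.kappa_mem (κ := Θ.symm.toAlgHom) h1 h2 hz)
  refine ⟨x, hx.1, hx.2.1, hx.2.2.trans ?_⟩
  rw [← h0]
  exact Θ.apply_symm_apply _

include Fr in
lemma Frames.exists_tangent (hm : nab.IsMetric g) (u : RoyFun g) :
    ∃ x, IsTangent g x ∧ restrict g x = u := by
  obtain ⟨z, rfl⟩ := restrict_surjective u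
  induction z using CotFun.induction with
  | mem k x hx =>
    obtain ⟨y, _, h⟩ := Fr.exists_tangent_deg hm (k := k) (u := restrict g x)
      ⟨x, subset_span hx, rfl⟩
    exact ⟨y, h⟩
  | add x y hx hy =>
    obtain ⟨z, h1, h2⟩ := hx
    obtain ⟨w, h1', h2'⟩ := hy
    exact ⟨z + w, h1.add h1', by rw [map_add, h2, h2', map_add]⟩
  | smul c x hx =>
    obtain ⟨z, h1, h2⟩ := hx
    exact ⟨c • z, h1.smul c, by rw [map_smul, h2, map_smul]⟩

lemma exists_tangentAction {x : 𝓞} (hx : IsTangent g x) :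
    ∃ B : RoyFun g →ₗ[ℝ] RoyFun g, ∀ y, B (restrict g y) = restrict g (bracket A P x y) := by
  obtain ⟨B, hB⟩ := exists_linearMap_of_rel (𝕜 := ℝ) (X := RoyFun g) (Y := RoyFun g)
    (fun u v => ∃ y, restrict g y = u ∧ restrict g (bracket A P x y) = v)
    (fun u => by
      obtain ⟨y, rfl⟩ := restrict_surjective u
      exact ⟨_, y, rfl, rfl⟩)
    (by
      rintro _ _ _ _ ⟨y, rfl, rfl⟩ ⟨z, rfl, rfl⟩
      exact ⟨y + z, map_add _ _ _, by rw [map_add, map_add]⟩)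
    (by
      rintro c _ _ ⟨y, rfl, rfl⟩
      exact ⟨c • y, map_smul _ _ _, by rw [map_smul, map_smul]⟩)
    (by
      rintro _ _ _ ⟨y, rfl, rfl⟩ ⟨z, hz, rfl⟩
      rw [← sub_eq_zero, ← map_sub, ← map_sub]
      exact hx _ (by rw [map_sub, hz, sub_self]))
  refine ⟨B, fun y => ?_⟩
  obtain ⟨z, hz, h⟩ := hB (restrict g y)
  rw [← h, ← sub_eq_zero, ← map_sub, ← map_sub]
  exact hx _ (by rw [map_sub, hz, sub_self])

include Fr in
lemma Frames.exists_royBracket (hm : nab.IsMetric g) :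
    ∃ b, IsRestrictedBracket g (bracket A P) b := by
  obtain ⟨b, hb⟩ := exists_linearMap_of_rel (𝕜 := ℝ) (X := RoyFun g)
    (Y := RoyFun g →ₗ[ℝ] RoyFun g)
    (fun u B => ∃ x, IsTangent g x ∧ restrict g x = u ∧ ∀ y, IsTangent g y →
      B (restrict g y) = restrict g (bracket A P x y))
    (fun u => by
      obtain ⟨x, hx, rfl⟩ := Fr.exists_tangent hm u
      obtain ⟨B, hB⟩ := exists_tangentAction hx
      exact ⟨B, x, hx, rfl, fun y _ => hB y⟩)
    (by
      rintro _ _ _ _ ⟨x, hx, rfl, h⟩ ⟨y, hy, rfl, h'⟩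
      refine ⟨x + y, hx.add hy, map_add _ _ _, fun z hz => ?_⟩
      rw [lm_add, h z hz, h' z hz, map_add, lm_add, map_add])
    (by
      rintro c _ _ ⟨x, hx, rfl, h⟩
      refine ⟨c • x, hx.smul c, map_smul _ _ _, fun z hz => ?_⟩
      rw [lm_smul, h z hz, map_smul, lm_smul, map_smul])
    (by
      rintro _ B B' ⟨x, hx, rfl, h⟩ ⟨y, hy, hxy, h'⟩
      ext u
      obtain ⟨z, hz, rfl⟩ := Fr.exists_tangent hm u
      rw [h z hz, h' z hz, ← sub_eq_zero, ← map_sub, ← lm_sub, ← map_sub]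
      exact hz.skew (by rw [map_sub, hxy, sub_self]))
  refine ⟨b, fun x y hx hy => ?_⟩
  obtain ⟨x', hx', hxx, h⟩ := hb (restrict g x)
  rw [h y hy, ← sub_eq_zero, ← map_sub, ← lm_sub, ← map_sub]
  exact IsTangent.skew hy (by rw [map_sub, hxx, sub_self])

include Fr in
lemma Frames.isRestrictedBracket_unique (hm : nab.IsMetric g)
    {b b' : RoyFun g →ₗ[ℝ] RoyFun g →ₗ[ℝ] RoyFun g}
    (hb : IsRestrictedBracket g (bracket A P) b) (hb' : IsRestrictedBracket g (bracket A P) b') :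
    b = b' := by
  ext u v
  obtain ⟨x, hx, rfl⟩ := Fr.exists_tangent hm u
  obtain ⟨y, hy, rfl⟩ := Fr.exists_tangent hm v
  rw [hb x y hx hy, hb' x y hx hy]

include Fr in
lemma Frames.isPoissonBracket_roy (hm : nab.IsMetric g) {b : RoyFun g →ₗ[ℝ] RoyFun g →ₗ[ℝ] RoyFun g}
    (hb : IsRestrictedBracket g (bracket A P) b) : IsPoissonBracket (royDeg g) b where
  degree k l m u v hu hv h := by
    obtain ⟨x, hx, tx, rfl⟩ := Fr.exists_tangent_deg hm hu
    obtain ⟨y, hy, ty, rfl⟩ := Fr.exists_tangent_deg hm hv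
    rw [hb x y tx ty]
    exact ⟨_, isPoissonBracket_bracket.degree k l m x y hx hy h, rfl⟩
  degree_lt k l u v hu hv h := by
    obtain ⟨x, hx, tx, rfl⟩ := Fr.exists_tangent_deg hm hu
    obtain ⟨y, hy, ty, rfl⟩ := Fr.exists_tangent_deg hm hv
    rw [hb x y tx ty, isPoissonBracket_bracket.degree_lt k l x y hx hy h, map_zero]
  skew k l u v hu hv := by
    obtain ⟨x, hx, tx, rfl⟩ := Fr.exists_tangent_deg hm hu
    obtain ⟨y, hy, ty, rfl⟩ := Fr.exists_tangent_deg hm hv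
    rw [hb x y tx ty, hb y x ty tx, isPoissonBracket_bracket.skew k l x y hx hy, map_neg, map_smul]
  leibniz k l u v w hu hv := by
    obtain ⟨x, hx, tx, rfl⟩ := Fr.exists_tangent_deg hm hu
    obtain ⟨y, hy, ty, rfl⟩ := Fr.exists_tangent_deg hm hv
    obtain ⟨z, tz, rfl⟩ := Fr.exists_tangent hm w
    rw [← map_mul, hb x _ tx (ty.mul tz), hb x y tx ty, hb x z tx tz,
      isPoissonBracket_bracket.leibniz k l x y z hx hy, map_add, map_smul, map_mul, map_mul]
  jacobi k l u v w hu hv := by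
    obtain ⟨x, hx, tx, rfl⟩ := Fr.exists_tangent_deg hm hu
    obtain ⟨y, hy, ty, rfl⟩ := Fr.exists_tangent_deg hm hv
    obtain ⟨z, tz, rfl⟩ := Fr.exists_tangent hm w
    have hxp := cotDeg_le_par k hx
    have hyp := cotDeg_le_par l hy
    have tb : ∀ {k : ℕ} {x : 𝓞}, x ∈ 𝔓 k → IsTangent g x →
        IsTangent g (bracket A P x z) := by
      intro k x hx tx
      rw [← proj_add z, map_add]
      exact (tx.bracket (tz.proj 0) hx (proj_mem 0 z)).add
        (tx.bracket (tz.proj 1) hx (proj_mem 1 z))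
    rw [hb y z ty tz, hb x _ tx (tb hyp ty), hb x y tx ty, hb _ z (tx.bracket ty hxp hyp) tz,
      hb x z tx tz, hb y _ ty (tb hxp tx), jacobi hxp hyp, map_add, map_smul]

/-! ### Values of the bracket on generators -/

section Values

variable {b : RoyFun g →ₗ[ℝ] RoyFun g →ₗ[ℝ] RoyFun g}
  (hb : IsRestrictedBracket g (bracket A P) b)

include hb

lemma roy_fn_fn (f h : A) : b (restrict g (fn (𝔞 f))) (restrict g (fn (𝔞 h))) = 0 := by
  rw [hb _ _ (isTangent_fn f) (isTangent_fn h), bracket_fn_fn, map_zero]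

lemma roy_lin_fn (hs : ∀ ξ η, g ξ η = g η ξ) (ξ : P) (f : A) : b (restrict g (fn (ι A ξ)))
      (restrict g (fn (𝔞 f))) = 0 := by
  rw [← restrict_linLift, hb _ _ (isTangent_linLift hs ξ) (isTangent_fn f), bracket_linLift_fn,
    contr_algebraMap, fn_zero, map_zero]

lemma roy_lin_lin (hs : ∀ ξ η, g ξ η = g η ξ) (ξ η : P) : b (restrict g (fn (ι A ξ)))
      (restrict g (fn (ι A η))) = restrict g (fn (𝔞 (g ξ η))) := by
  rw [← restrict_linLift, ← restrict_linLift,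
    hb _ _ (isTangent_linLift hs ξ) (isTangent_linLift hs η), linLift.eq_1 g η, map_add, map_smul,
    bracket_linLift_fn, bracket_linLift_mom, contr_ι, map_add, map_smul, map_smul, hs η, ← add_smul]
  norm_num

lemma IsMetricField.roy_fn {V : 𝔛 2} {T : P → P} (h : IsMetricField g V T) (f : A) :
    b (restrict g (mom V)) (restrict g (fn (𝔞 f))) = restrict g (fn (V.1 (𝔞 f))) := by
  rw [hb _ _ h.isTangent (isTangent_fn f), bracket_mom_fn]

lemma IsMetricField.roy_lin {V : 𝔛 2} {T : P → P} (h : IsMetricField g V T)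
    (hs : ∀ ξ η, g ξ η = g η ξ) (ξ : P) : b (restrict g (mom V)) (restrict g (fn (ι A ξ))) =
      restrict g (fn (ι A (T ξ))) := by
  rw [← restrict_linLift, hb _ _ h.isTangent (isTangent_linLift hs ξ), linLift, map_add, map_smul,
    bracket_mom_fn, bracket_mom_mom, h.comm_contr, endMom_of_mem (contr (g (T ξ))).2, h.lin,
    map_add, map_smul, restrict_mom_contr, ← add_smul]
  norm_num

lemma IsMetricField.roy_mom {V W : 𝔛 2} {T U : P → P} (h : IsMetricField g V T)
    (h' : IsMetricField g W U) : b (restrict g (mom V)) (restrict g (mom W)) =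
      restrict g (mom ⟨vfComm 2 2 V.1 W.1, vfComm_mem V.2 W.2⟩) := by
  rw [hb _ _ h.isTangent h'.isTangent, bracket_mom_mom, endMom_of_mem (vfComm_mem V.2 W.2)]

end Values

end RoyBracket

/-! ## Graded commutators -/

section SuperCommutators

lemma zmod2 (p : ZMod 2) : p = 0 ∨ p = 1 := by
  revert p; decide

variable {B : Type*} [Ring B] [Algebra ℂ B]

lemma sc_zero_zero (a b : B) : superComm 0 0 a b = a * b - b * a := by simp [superComm]

lemma sc_zero_one (a b : B) : superComm 0 1 a b = a * b - b * a := by simp [superComm]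

lemma sc_one_zero (a b : B) : superComm 1 0 a b = a * b - b * a := by simp [superComm]

lemma sc_one_one (a b : B) : superComm 1 1 a b = a * b + b * a := by
  simp [superComm, ZMod.val_one]

lemma superComm_zero_right (p : ZMod 2) (a b : B) : superComm p 0 a b = a * b - b * a := by
  simp [superComm]

/-- The sign `(-1)^{p q}`. -/
def sgn (p q : ZMod 2) : ℂ := (-1) ^ (p.val * q.val)

lemma sgn_zero_left (q : ZMod 2) : sgn 0 q = 1 := by simp [sgn]

lemma sgn_zero_right (q : ZMod 2) : sgn q 0 = 1 := by simp [sgn]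

lemma sgn_one_one : sgn 1 1 = -1 := by simp [sgn, ZMod.val_one]

lemma one_add_one_zmod : (1 + 1 : ZMod 2) = 0 := rfl

lemma sc_jacobi (p q t : ZMod 2) (a b d : B) :
    superComm (p + q) t (superComm p q a b) d = superComm p (q + t) a (superComm q t b d) +
      sgn q t • superComm (p + t) q (superComm p t a d) b := by
  rcases zmod2 p with rfl | rfl <;> rcases zmod2 q with rfl | rfl <;>
  rcases zmod2 t with rfl | rfl <;>
  simp only [add_zero, zero_add, one_add_one_zmod, sc_zero_zero, sc_zero_one,
    sc_one_zero, sc_one_one, sgn_zero_left, sgn_zero_right, sgn_one_one, one_smul,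
    neg_smul] <;> noncomm_ring

lemma sc_mul_right (p q t : ZMod 2) (a b d : B) :
    superComm p (q + t) a (b * d) = superComm p q a b * d + sgn p q • (b * superComm p t a d) := by
  rcases zmod2 p with rfl | rfl <;> rcases zmod2 q with rfl | rfl <;>
  rcases zmod2 t with rfl | rfl <;>
  simp only [add_zero, zero_add, one_add_one_zmod, sc_zero_zero, sc_zero_one,
    sc_one_zero, sc_one_one, sgn_zero_left, sgn_zero_right, sgn_one_one, one_smul,
    neg_smul] <;> noncomm_ring

lemma sc_skew (p q : ZMod 2) (a b : B) : superComm p q a b = -(sgn p q • superComm q p b a) := by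
  rcases zmod2 p with rfl | rfl <;> rcases zmod2 q with rfl | rfl <;>
  simp only [sc_zero_zero, sc_zero_one,
    sc_one_zero, sc_one_one, sgn_zero_left, sgn_zero_right, sgn_one_one, one_smul,
    neg_smul] <;> first | noncomm_ring | abel

lemma sc_add_left (p q : ZMod 2) (a b d : B) :
    superComm p q (a + b) d = superComm p q a d + superComm p q b d := by
  simp only [superComm, add_mul, mul_add, smul_add]; abel

lemma superComm_add_right (p q : ZMod 2) (a b d : B) :
    superComm p q a (b + d) = superComm p q a b + superComm p q a d := by
  simp only [superComm, add_mul, mul_add, smul_add]; abel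

lemma sc_smul_left (p q : ZMod 2) (z : ℂ) (a d : B) :
    superComm p q (z • a) d = z • superComm p q a d := by
  simp only [superComm, smul_mul_assoc, mul_smul_comm, smul_sub, smul_comm z]

lemma sc_smul_right (p q : ZMod 2) (z : ℂ) (a d : B) :
    superComm p q a (z • d) = z • superComm p q a d := by
  simp only [superComm, smul_mul_assoc, mul_smul_comm, smul_sub, smul_comm z]

lemma superComm_zero_arg_left (p q : ZMod 2) (d : B) : superComm p q 0 d = 0 := by
  simp [superComm]

lemma superComm_zero_arg_right (p q : ZMod 2) (d : B) : superComm p q d 0 = 0 := by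
  simp [superComm]

lemma superComm_sub_left (p q : ZMod 2) (a b d : B) :
    superComm p q (a - b) d = superComm p q a d - superComm p q b d := by
  simp only [superComm, sub_mul, mul_sub, smul_sub]; abel

end SuperCommutators

/-! ## Algebras of operators with a Clifford action -/

section Operators

/-- The structure of the algebra of operators on spinors on which the study of its filtration
depends: parities, multiplication by functions `m`, and Clifford multiplication `c`. -/
structure CliffordOps (g : LinearMap.BilinForm A P) (B : Type*) [Ring B] [Algebra ℂ B] where
  par : ZMod 2 → Submodule ℂ B
  one_mem : 1 ∈ par 0
  mul_mem : ∀ p q a b, a ∈ par p → b ∈ par q → a * b ∈ par (p + q)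
  m : A →ₐ[ℝ] B
  c : P → B
  c_add : ∀ ξ η, c (ξ + η) = c ξ + c η
  c_smul : ∀ f ξ, c (f • ξ) = m f * c ξ
  m_comm : ∀ f ξ, m f * c ξ = c ξ * m f
  cliff : ∀ ξ η, c ξ * c η + c η * c ξ = (2 : ℂ) • m (g ξ η)
  m_mem : ∀ f, m f ∈ par 0
  c_mem : ∀ ξ, c ξ ∈ par 1
  disj : ∀ a, a ∈ par 0 → a ∈ par 1 → a = 0
  even_eq : ∀ D ∈ par 0, (∀ ξ, D * c ξ = c ξ * D) → ∃ f h, D = m f + I • m h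
  odd_eq : ∀ D ∈ par 1, (∀ ξ, D * c ξ = -(c ξ * D)) → D = 0
  m_inj : ∀ f h, m f + I • m h = 0 → f = 0 ∧ h = 0
  frames : Frames g
  rank : ℝ
  rank_ne : rank ≠ 0
  sum_rank : ∑ i, g (frames.e' i) (frames.e i) = algebraMap ℝ A rank

variable {g : LinearMap.BilinForm A P} {B : Type*} [Ring B] [Algebra ℂ B]

namespace CliffordOps

variable (O : CliffordOps g B)

/-- The homogeneous elements of a step of the filtration. -/
abbrev H (i : ℕ) (p : ZMod 2) : Submodule ℂ B := homFilt O.par O.c i p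

/-- The filtration. -/
abbrev filt : Filt ℂ B := cliffordFilt O.par O.c O.one_mem O.mul_mem

lemma c_zero : O.c 0 = 0 := by
  have := O.c_smul 0 0
  rwa [zero_smul, map_zero, zero_mul] at this

lemma c_sum {κ : Type*} (s : Finset κ) (ξ : κ → P) : O.c (∑ i ∈ s, ξ i) = ∑ i ∈ s, O.c (ξ i) :=
  map_sum (⟨⟨O.c, O.c_zero⟩, O.c_add⟩ : P →+ B) ξ s

lemma c_sub (ξ η : P) : O.c (ξ - η) = O.c ξ - O.c η :=
  map_sub (⟨⟨O.c, O.c_zero⟩, O.c_add⟩ : P →+ B) ξ η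

lemma m_mul_m (f h : A) : O.m f * O.m h = O.m h * O.m f := by
  rw [← map_mul, ← map_mul, mul_comm]

lemma mem_par {i : ℕ} {p : ZMod 2} {a : B} (ha : a ∈ O.H i p) : a ∈ O.par p := by
  cases i with
  | zero => rw [(mem_bot ℂ).1 ha]; exact zero_mem _
  | succ i => exact ha.1

lemma superComm_mem_par {p q : ZMod 2} {a b : B} (ha : a ∈ O.par p) (hb : b ∈ O.par q) :
    superComm p q a b ∈ O.par (p + q) :=
  sub_mem (O.mul_mem p q a b ha hb)
    (smul_mem _ _ (by rw [add_comm]; exact O.mul_mem q p b a hb ha))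

lemma H_mono {i j : ℕ} (h : i ≤ j) (p : ZMod 2) : O.H i p ≤ O.H j p := by
  induction h with
  | refl => exact le_rfl
  | step _ ih => exact ih.trans (homFilt_mono _ _)

lemma H_mul {i j : ℕ} {p q : ZMod 2} {a b : B} (ha : a ∈ O.H (i + 1) p)
    (hb : b ∈ O.H (j + 1) q) : a * b ∈ O.H (i + j + 1) (p + q) :=
  homFilt_mul O.mul_mem _ i j p q a b rfl ha hb

lemma m_mem_H (f : A) : O.m f ∈ O.H 1 0 := by
  refine ⟨O.m_mem f, fun ξ => ?_⟩
  rw [sc_zero_one, O.m_comm, sub_self]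
  exact zero_mem _

lemma c_mem_H (ξ : P) : O.c ξ ∈ O.H 2 1 := by
  refine ⟨O.c_mem ξ, fun η => ?_⟩
  rw [sc_one_one, O.cliff]
  exact smul_mem _ _ (O.m_mem_H _)

lemma H_one_zero {D : B} (hD : D ∈ O.H 1 0) : ∃ f h, D = O.m f + I • O.m h := by
  refine O.even_eq D hD.1 fun ξ => ?_
  have := hD.2 ξ
  rwa [sc_zero_one, homFilt, mem_bot, sub_eq_zero] at this

lemma H_one_one {D : B} (hD : D ∈ O.H 1 1) : D = 0 := by
  refine O.odd_eq D hD.1 fun ξ => ?_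
  have := hD.2 ξ
  rwa [sc_one_one, homFilt, mem_bot, ← eq_neg_iff_add_eq_zero] at this

lemma superComm_twice (p : ZMod 2) (D : B) (ξ η : P) :
    superComm (p + 1) 1 (superComm p 1 D (O.c ξ)) (O.c η) +
      superComm (p + 1) 1 (superComm p 1 D (O.c η)) (O.c ξ) =
      (2 : ℂ) • superComm p 0 D (O.m (g ξ η)) := by
  rw [← sc_smul_right, ← O.cliff]
  rcases zmod2 p with rfl | rfl <;>
  simp only [zero_add, one_add_one_zmod, sc_zero_zero, sc_zero_one,
    sc_one_zero, sc_one_one] <;> noncomm_ring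

lemma superComm_m_eq_zero {p : ZMod 2} {D : B}
    (h : ∀ ξ η, superComm p 0 D (O.m (g ξ η)) = 0) (f : A) : superComm p 0 D (O.m f) = 0 := by
  have h1 : (algebraMap ℝ A O.rank * f) = ∑ i, g (f • O.frames.e' i) (O.frames.e i) := by
    simp only [map_smul, lm_smul, smul_eq_mul]
    rw [← mul_sum, O.sum_rank, mul_comm]
  have h2 : f = O.rank⁻¹ • ∑ i, g (f • O.frames.e' i) (O.frames.e i) := by
    rw [← h1, ← smul_def, smul_smul, inv_mul_cancel₀ O.rank_ne, one_smul]
  rw [h2, map_smul, map_sum, superComm_zero_right, mul_smul_comm, smul_mul_assoc, ← smul_sub,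
    mul_sum, sum_mul, ← sum_sub_distrib]
  simp only [superComm_zero_right] at h
  simp only [h, sum_const_zero, smul_zero]

lemma superComm_m_of_twice {p : ZMod 2} {D : B}
    (h : ∀ ξ η, superComm (p + 1) 1 (superComm p 1 D (O.c ξ)) (O.c η) = 0) (f : A) :
    superComm p 0 D (O.m f) = 0 := by
  refine O.superComm_m_eq_zero (fun ξ η => ?_) f
  have := O.superComm_twice p D ξ η
  rw [h, h, add_zero] at this
  exact (smul_eq_zero.1 this.symm).resolve_left two_ne_zero

lemma H_zero {p : ZMod 2} {D : B} (hD : D ∈ O.H 0 p) : D = 0 := (mem_bot ℂ).1 hD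

lemma superComm_m_H_two {p : ZMod 2} {D : B} (hD : D ∈ O.H 2 p) (f : A) :
    superComm p 0 D (O.m f) = 0 :=
  O.superComm_m_of_twice (fun ξ η => O.H_zero ((hD.2 ξ).2 η)) f

lemma superComm_mem (n : ℕ) : ∀ i j, i + j = n → ∀ p q a b, a ∈ O.H i p → b ∈ O.H j q →
    superComm p q a b ∈ O.H (i + j - 3) (p + q) := by
  have base : ∀ j, j ≤ 2 → ∀ p q a b, a ∈ O.H 1 p → b ∈ O.H j q → superComm p q a b = 0 := by
    intro j hj p q a b ha hb
    rcases zmod2 p with rfl | rfl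
    · obtain ⟨f, h, rfl⟩ := O.H_one_zero ha
      have hb2 := O.H_mono hj q hb
      rw [sc_skew, superComm_add_right, sc_smul_right, O.superComm_m_H_two hb2,
        O.superComm_m_H_two hb2]
      simp
    · rw [O.H_one_one ha, superComm_zero_arg_left]
  induction n with
  | zero =>
    intro i j hij p q a b ha hb
    obtain rfl : i = 0 := by omega
    rw [O.H_zero ha, superComm_zero_arg_left]
    exact zero_mem _
  | succ n ih =>
    intro i j hij p q a b ha hb
    rcases Nat.eq_zero_or_pos i with hi | hi
    · subst hi
      rw [O.H_zero ha, superComm_zero_arg_left]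
      exact zero_mem _
    rcases Nat.eq_zero_or_pos j with hj | hj
    · subst hj
      rw [O.H_zero hb, superComm_zero_arg_right]
      exact zero_mem _
    by_cases h3 : i + j ≤ 3
    · rcases (by omega : i = 1 ∨ j = 1) with rfl | rfl
      · rw [base j (by omega) p q a b ha hb]; exact zero_mem _
      · rw [sc_skew, base i (by omega) q p b a hb ha, smul_zero, neg_zero]
        exact zero_mem _
    · obtain ⟨i, rfl⟩ := Nat.exists_eq_succ_of_ne_zero hi.ne'
      obtain ⟨j, rfl⟩ := Nat.exists_eq_succ_of_ne_zero hj.ne'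
      have : i.succ + j.succ - 3 = (i + j - 2) + 1 := by omega
      rw [this]
      refine ⟨O.superComm_mem_par (O.mem_par ha) (O.mem_par hb), fun ξ => ?_⟩
      rw [sc_jacobi]
      refine add_mem ?_ (smul_mem _ _ ?_)
      · have := ih i.succ j (by omega) p (q + 1) a _ ha (hb.2 ξ)
        rwa [show i.succ + j - 3 = i + j - 2 by omega, ← add_assoc] at this
      · have := ih i j.succ (by omega) (p + 1) q _ b (ha.2 ξ) hb
        rwa [show i + j.succ - 3 = i + j - 2 by omega, add_right_comm] at this

lemma superComm_m_mem {i : ℕ} {p : ZMod 2} {D : B} (hD : D ∈ O.H i p) (f : A) :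
    superComm p 0 D (O.m f) ∈ O.H (i - 2) p := by
  have := O.superComm_mem _ i 1 rfl p 0 D _ hD (O.m_mem_H f)
  rwa [add_zero] at this

lemma H_drop (k : ℕ) : ∀ p : ZMod 2, p ≠ k → O.H (k + 1) p ≤ O.H k p := by
  induction k with
  | zero =>
    intro p hp D hD
    obtain rfl : p = 1 := (zmod2 p).resolve_left (by simpa using hp)
    rw [O.H_one_one hD]; exact zero_mem _
  | succ k ih =>
    intro p hp D hD
    refine ⟨hD.1, fun ξ => ih (p + 1) ?_ (hD.2 ξ)⟩
    intro h
    apply hp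
    push_cast
    rw [← h, add_assoc, one_add_one_zmod, add_zero]

lemma W_eq (i : ℕ) : O.filt.W i = O.H i 0 ⊔ O.H i 1 := by
  change ⨆ p, homFilt O.par O.c i p = _
  apply le_antisymm
  · refine iSup_le fun p => ?_
    rcases zmod2 p with rfl | rfl
    · exact le_sup_left
    · exact le_sup_right
  · exact sup_le (le_iSup (fun p => homFilt O.par O.c i p) 0)
      (le_iSup (fun p => homFilt O.par O.c i p) 1)

lemma H_le_W (i : ℕ) (p : ZMod 2) : O.H i p ≤ O.filt.W i :=
  le_iSup (fun p => homFilt O.par O.c i p) p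

lemma par_eq {p q : ZMod 2} (hpq : p ≠ q) {a : B} (hp : a ∈ O.par p) (hq : a ∈ O.par q) :
    a = 0 := by
  rcases zmod2 p with rfl | rfl <;> rcases zmod2 q with rfl | rfl
  · exact absurd rfl hpq
  · exact O.disj a hp hq
  · exact O.disj a hq hp
  · exact absurd rfl hpq

lemma mem_H_of_mem_W {i : ℕ} {p : ZMod 2} {a : B} (ha : a ∈ O.filt.W i) (hp : a ∈ O.par p) :
    a ∈ O.H i p := by
  rw [O.W_eq, mem_sup] at ha
  obtain ⟨x, hx, y, hy, rfl⟩ := ha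
  have key : ∀ p q : ZMod 2, p ≠ q → ∀ x y, x ∈ O.H i p → y ∈ O.H i q → x + y ∈ O.par p →
      x + y ∈ O.H i p := by
    intro p q hpq x y hx hy hxy
    have h1 : y ∈ O.par p := by
      have := sub_mem hxy (O.mem_par hx)
      rwa [add_sub_cancel_left] at this
    rw [O.par_eq hpq h1 (O.mem_par hy), add_zero]
    exact hx
  rcases zmod2 p with rfl | rfl
  · exact key 0 1 (by decide) x y hx hy hp
  · rw [add_comm] at hp ⊢
    exact key 1 0 (by decide) y x hy hx hp

lemma exists_H_of_W {k : ℕ} {a : B} (ha : a ∈ O.filt.W (k + 1)) :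
    ∃ b ∈ O.H (k + 1) k, a - b ∈ O.filt.W k := by
  rw [O.W_eq, mem_sup] at ha
  obtain ⟨x, hx, y, hy, rfl⟩ := ha
  rcases zmod2 (k : ZMod 2) with hk | hk <;> rw [hk]
  · refine ⟨x, hx, ?_⟩
    rw [add_sub_cancel_left]
    exact O.H_le_W k 1 (O.H_drop k 1 (by rw [hk]; decide) hy)
  · refine ⟨y, hy, ?_⟩
    rw [add_sub_cancel_right]
    exact O.H_le_W k 0 (O.H_drop k 0 (by rw [hk]; decide) hx)

end CliffordOps

end Operators

/-! ## The bracket of the graded algebra -/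

section GradedBracket

lemma sgn_natCast (k l : ℕ) : sgn (k : ZMod 2) (l : ZMod 2) = (-1 : ℂ) ^ (k * l) := by
  rw [sgn]
  refine neg_one_pow_congr ?_
  rw [Nat.even_mul, Nat.even_mul, ZMod.val_natCast, ZMod.val_natCast]
  simp only [Nat.even_iff, Nat.mod_mod]

lemma sc_jacobi' {B : Type*} [Ring B] [Algebra ℂ B] (p q t : ZMod 2) (a b d : B) :
    superComm p (q + t) a (superComm q t b d) = superComm (p + q) t (superComm p q a b) d +
      sgn p q • superComm q (p + t) b (superComm p t a d) := by
  rcases zmod2 p with rfl | rfl <;> rcases zmod2 q with rfl | rfl <;>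
  rcases zmod2 t with rfl | rfl <;>
  simp only [add_zero, zero_add, one_add_one_zmod, sc_zero_zero, sc_zero_one,
    sc_one_zero, sc_one_one, sgn_zero_left, sgn_zero_right, sgn_one_one, one_smul,
    neg_smul] <;> noncomm_ring

variable {g : LinearMap.BilinForm A P} {B : Type*} [Ring B] [Algebra ℂ B]

namespace Filt

variable (D : Filt ℂ B)

open Classical in
/-- The class in degree `k` of an element of `D_k`, extended by zero. -/
def cl (k : ℕ) (a : B) : D.Gr := if h : a ∈ D.W (k + 1) then D.grMk k ⟨a, h⟩ else 0

variable {D}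

lemma cl_of_mem {k : ℕ} {a : B} (h : a ∈ D.W (k + 1)) : D.cl k a = D.grMk k ⟨a, h⟩ := dif_pos h

lemma cl_add {k : ℕ} {a b : B} (ha : a ∈ D.W (k + 1)) (hb : b ∈ D.W (k + 1)) :
    D.cl k (a + b) = D.cl k a + D.cl k b := by
  rw [cl_of_mem ha, cl_of_mem hb, cl_of_mem (add_mem ha hb), ← map_add]; rfl

lemma cl_smul {k : ℕ} {a : B} (z : ℂ) (ha : a ∈ D.W (k + 1)) : D.cl k (z • a) = z • D.cl k a := by
  rw [cl_of_mem ha, cl_of_mem (smul_mem _ z ha), ← map_smul]; rfl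

lemma cl_zero (k : ℕ) : D.cl k 0 = 0 := by
  rw [cl_of_mem (zero_mem _)]
  exact map_zero (D.grMk k)

lemma grMk_eq_zero {k : ℕ} {a : D.W (k + 1)} : D.grMk k a = 0 ↔ (a : B) ∈ D.W k := by
  rw [grMk, lm_comp, DirectSum.lof_eq_of,
    ← map_zero (DirectSum.of D.Piece k), (DirectSum.of_injective k).eq_iff, ← map_zero (D.pieceMk k),
    pieceMk_eq]
  simp

lemma cl_eq_zero {k : ℕ} {a : B} (h : a ∈ D.W k) : D.cl k a = 0 := by
  rw [cl_of_mem (D.mono k h), grMk_eq_zero]; exact h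

lemma mem_of_cl_eq_zero {k : ℕ} {a : B} (h : a ∈ D.W (k + 1)) (h0 : D.cl k a = 0) : a ∈ D.W k := by
  rwa [cl_of_mem h, grMk_eq_zero] at h0

lemma cl_sub {k : ℕ} {a b : B} (ha : a ∈ D.W (k + 1)) (hb : b ∈ D.W (k + 1)) :
    D.cl k (a - b) = D.cl k a - D.cl k b := by
  rw [cl_of_mem ha, cl_of_mem hb, cl_of_mem (sub_mem ha hb), ← map_sub]; rfl

lemma cl_neg {k : ℕ} {a : B} (ha : a ∈ D.W (k + 1)) : D.cl k (-a) = -D.cl k a := by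
  rw [← zero_sub, cl_sub (zero_mem _) ha, cl_zero, zero_sub]

lemma cl_eq {k : ℕ} {a b : B} (ha : a ∈ D.W (k + 1)) (hb : b ∈ D.W (k + 1))
    (h : a - b ∈ D.W k) : D.cl k a = D.cl k b := by
  rw [← sub_eq_zero, ← cl_sub ha hb, cl_eq_zero h]

lemma cl_sum {κ : Type*} {k : ℕ} (s : Finset κ) (a : κ → B) (ha : ∀ i, a i ∈ D.W (k + 1)) :
    D.cl k (∑ i ∈ s, a i) = ∑ i ∈ s, D.cl k (a i) := by
  classical
  induction s using Finset.induction_on with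
  | empty => simp [cl_zero]
  | insert i s hi ih =>
    rw [Finset.sum_insert hi, Finset.sum_insert hi, cl_add (ha i) (sum_mem fun i _ => ha i), ih]

lemma cl_mul {i j : ℕ} {a b : B} (ha : a ∈ D.W (i + 1)) (hb : b ∈ D.W (j + 1)) :
    D.cl i a * D.cl j b = D.cl (i + j) (a * b) := by
  rw [cl_of_mem ha, cl_of_mem hb, cl_of_mem (D.mul_mem i j a b ha hb)]
  exact DirectSum.of_mul_of (A := D.Piece) _ _

lemma cl_one : D.cl 0 1 = 1 := by
  rw [cl_of_mem D.one_mem]; rfl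

lemma mem_grDeg {k : ℕ} {x : D.Gr} : x ∈ D.grDeg k ↔ ∃ a ∈ D.W (k + 1), D.cl k a = x := by
  constructor
  · rintro ⟨a, rfl⟩
    exact ⟨a, a.2, cl_of_mem a.2⟩
  · rintro ⟨a, ha, rfl⟩
    rw [cl_of_mem ha]
    exact ⟨_, rfl⟩

lemma gr_induction {p : D.Gr → Prop} (cl : ∀ k, ∀ a ∈ D.W (k + 1), p (D.cl k a))
    (add : ∀ x y, p x → p y → p (x + y)) (x : D.Gr) : p x := by
  induction x using DirectSum.induction_on with
  | zero => rw [← D.cl_zero 0]; exact cl 0 0 (zero_mem _)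
  | of k x =>
    obtain ⟨a, rfl⟩ := D.pieceMk_surjective k x
    have := cl k a a.2
    rwa [cl_of_mem a.2] at this
  | add x y hx hy => exact add x y hx hy

end Filt

namespace CliffordOps

variable (O : CliffordOps g B)

lemma mem_W {k : ℕ} {p : ZMod 2} {a : B} (h : a ∈ O.H k p) : a ∈ O.filt.W k := O.H_le_W k p h

lemma gr_induction {p : O.filt.Gr → Prop}
    (cl : ∀ (k : ℕ), ∀ a ∈ O.H (k + 1) (k : ZMod 2), p (O.filt.cl k a))
    (add : ∀ x y, p x → p y → p (x + y)) (x : O.filt.Gr) : p x := by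
  refine Filt.gr_induction (fun k a ha => ?_) add x
  obtain ⟨b, hb, hab⟩ := O.exists_H_of_W ha
  rw [Filt.cl_eq ha (O.mem_W hb) hab]
  exact cl k b hb

lemma mem_grDeg {k : ℕ} {x : O.filt.Gr} :
    x ∈ O.filt.grDeg k ↔ ∃ a ∈ O.H (k + 1) (k : ZMod 2), O.filt.cl k a = x := by
  rw [Filt.mem_grDeg]
  constructor
  · rintro ⟨a, ha, rfl⟩
    obtain ⟨b, hb, hab⟩ := O.exists_H_of_W ha
    exact ⟨b, hb, (Filt.cl_eq ha (O.mem_W hb) hab).symm⟩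
  · rintro ⟨a, ha, rfl⟩
    exact ⟨a, O.mem_W ha, rfl⟩

lemma bracket_mem {k l : ℕ} {p q : ZMod 2} {a b : B} (ha : a ∈ O.H (k + 1) p)
    (hb : b ∈ O.H (l + 1) q) : superComm p q a b ∈ O.H (k + l - 2 + 1) (p + q) :=
  O.H_mono (by omega) _ (O.superComm_mem _ _ _ rfl p q a b ha hb)

lemma bracket_mem_left {k l : ℕ} {p q : ZMod 2} {a b : B} (ha : a ∈ O.H k p)
    (hb : b ∈ O.H (l + 1) q) : superComm p q a b ∈ O.H (k + l - 2) (p + q) :=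
  O.H_mono (by omega) _ (O.superComm_mem _ _ _ rfl p q a b ha hb)

lemma bracket_mem_right {k l : ℕ} {p q : ZMod 2} {a b : B} (ha : a ∈ O.H (k + 1) p)
    (hb : b ∈ O.H l q) : superComm p q a b ∈ O.H (k + l - 2) (p + q) :=
  O.H_mono (by omega) _ (O.superComm_mem _ _ _ rfl p q a b ha hb)

lemma superComm_eq_zero {k l : ℕ} {p q : ZMod 2} {a b : B} (ha : a ∈ O.H (k + 1) p)
    (hb : b ∈ O.H (l + 1) q) (h : k + l < 2) : superComm p q a b = 0 := by
  have := O.superComm_mem _ _ _ rfl p q a b ha hb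
  rw [show k + 1 + (l + 1) - 3 = 0 by omega] at this
  exact O.H_zero this

lemma mem_H_of_cl_eq {k : ℕ} {p : ZMod 2} {a b : B} (ha : a ∈ O.H (k + 1) p)
    (hb : b ∈ O.H (k + 1) p) (h : O.filt.cl k a = O.filt.cl k b) : a - b ∈ O.H k p := by
  refine O.mem_H_of_mem_W (Filt.mem_of_cl_eq_zero (O.mem_W (sub_mem ha hb)) ?_)
    (O.mem_par (sub_mem ha hb))
  rw [Filt.cl_sub (O.mem_W ha) (O.mem_W hb), h, sub_self]

lemma exists_act {k : ℕ} {p : ZMod 2} {a : B} (ha : a ∈ O.H (k + 1) p) :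
    ∃ T : O.filt.Gr →ₗ[ℂ] O.filt.Gr, ∀ (l : ℕ), ∀ b ∈ O.H (l + 1) (l : ZMod 2),
      T (O.filt.cl l b) = O.filt.cl (k + l - 2) (superComm p l a b) := by
  have key : ∀ l : ℕ, ∃ T : O.filt.Piece l →ₗ[ℂ] O.filt.Gr, ∀ b (h : b ∈ O.H (l + 1) (l : ZMod 2)),
      T (O.filt.pieceMk l ⟨b, O.mem_W h⟩) = O.filt.cl (k + l - 2) (superComm p l a b) := by
    intro l
    have key := exists_linearMap_of_rel (𝕜 := ℂ) (X := O.filt.Piece l) (Y := O.filt.Gr)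
      (fun x y => ∃ b ∈ O.H (l + 1) (l : ZMod 2), DirectSum.lof ℂ ℕ O.filt.Piece l x = O.filt.cl l b ∧
        y = O.filt.cl (k + l - 2) (superComm p l a b)) ?_ ?_ ?_ ?_
    · obtain ⟨T, hT⟩ := key
      refine ⟨T, fun b hb => ?_⟩
      obtain ⟨b', hb', h1, h2⟩ := hT (O.filt.pieceMk l ⟨b, O.mem_W hb⟩)
      have h3 : O.filt.cl l b = O.filt.cl l b' := by rw [← h1, Filt.cl_of_mem (O.mem_W hb)]; rfl
      have h4 := O.bracket_mem_right ha (O.mem_H_of_cl_eq hb hb' h3)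
      rw [h2]
      refine (Filt.cl_eq (O.mem_W (O.bracket_mem ha hb)) (O.mem_W (O.bracket_mem ha hb')) ?_).symm
      have h5 := superComm_add_right p (l : ZMod 2) a (b - b') b'
      rw [sub_add_cancel] at h5
      rw [h5, add_sub_cancel_right]
      exact O.mem_W h4
    · intro x
      obtain ⟨⟨b, hb⟩, rfl⟩ := O.filt.pieceMk_surjective l x
      obtain ⟨b', hb', hbb⟩ := O.exists_H_of_W hb
      refine ⟨_, b', hb', ?_, rfl⟩
      rw [← Filt.cl_eq hb (O.mem_W hb') hbb, Filt.cl_of_mem hb]; rfl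
    · rintro x x' y y' ⟨b, hb, h1, rfl⟩ ⟨b', hb', h1', rfl⟩
      refine ⟨b + b', add_mem hb hb', ?_, ?_⟩
      · rw [map_add, h1, h1', Filt.cl_add (O.mem_W hb) (O.mem_W hb')]
      · rw [superComm_add_right, Filt.cl_add (O.mem_W (O.bracket_mem ha hb))
          (O.mem_W (O.bracket_mem ha hb'))]
    · rintro z x y ⟨b, hb, h1, rfl⟩
      refine ⟨z • b, smul_mem _ z hb, ?_, ?_⟩
      · rw [map_smul, h1, Filt.cl_smul z (O.mem_W hb)]
      · rw [sc_smul_right, Filt.cl_smul z (O.mem_W (O.bracket_mem ha hb))]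
    · rintro x y y' ⟨b, hb, h1, rfl⟩ ⟨b', hb', h1', rfl⟩
      have h4 := O.bracket_mem_right ha (O.mem_H_of_cl_eq hb hb' (h1.symm.trans h1'))
      refine Filt.cl_eq (O.mem_W (O.bracket_mem ha hb)) (O.mem_W (O.bracket_mem ha hb')) ?_
      have h5 := superComm_add_right p (l : ZMod 2) a (b - b') b'
      rw [sub_add_cancel] at h5
      rw [h5, add_sub_cancel_right]
      exact O.mem_W h4
  choose T hT using key
  refine ⟨DirectSum.toModule ℂ ℕ _ T, fun l b hb => ?_⟩
  rw [Filt.cl_of_mem (O.mem_W hb), ← hT l b hb, Filt.grMk, lm_comp, DirectSum.toModule_lof]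

lemma exists_bracket_aux : ∃ b : O.filt.Gr →ₗ[ℂ] O.filt.Gr →ₗ[ℂ] O.filt.Gr,
    ∀ (k l : ℕ), ∀ a ∈ O.H (k + 1) (k : ZMod 2), ∀ a' ∈ O.H (l + 1) (l : ZMod 2),
      b (O.filt.cl k a) (O.filt.cl l a') = O.filt.cl (k + l - 2) (superComm k l a a') := by
  have key : ∀ k : ℕ, ∃ T : O.filt.Piece k →ₗ[ℂ] O.filt.Gr →ₗ[ℂ] O.filt.Gr,
      ∀ a (h : a ∈ O.H (k + 1) (k : ZMod 2)), ∀ l : ℕ, ∀ a' ∈ O.H (l + 1) (l : ZMod 2),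
      T (O.filt.pieceMk k ⟨a, O.mem_W h⟩) (O.filt.cl l a') =
        O.filt.cl (k + l - 2) (superComm k l a a') := by
    intro k
    have uniq : ∀ a b, a ∈ O.H (k + 1) (k : ZMod 2) → b ∈ O.H (k + 1) (k : ZMod 2) →
        O.filt.cl k a = O.filt.cl k b → ∀ l : ℕ, ∀ a' ∈ O.H (l + 1) (l : ZMod 2),
        O.filt.cl (k + l - 2) (superComm k l a a') = O.filt.cl (k + l - 2) (superComm k l b a') := by
      intro a b ha hb hab l a' ha'
      refine Filt.cl_eq (O.mem_W (O.bracket_mem ha ha')) (O.mem_W (O.bracket_mem hb ha')) ?_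
      rw [← superComm_sub_left]
      exact O.mem_W (O.bracket_mem_left (O.mem_H_of_cl_eq ha hb hab) ha')
    have key := exists_linearMap_of_rel (𝕜 := ℂ) (X := O.filt.Piece k)
      (Y := O.filt.Gr →ₗ[ℂ] O.filt.Gr)
      (fun x T => ∃ a ∈ O.H (k + 1) (k : ZMod 2), DirectSum.lof ℂ ℕ O.filt.Piece k x = O.filt.cl k a ∧
        ∀ l : ℕ, ∀ a' ∈ O.H (l + 1) (l : ZMod 2),
        T (O.filt.cl l a') = O.filt.cl (k + l - 2) (superComm k l a a')) ?_ ?_ ?_ ?_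
    · obtain ⟨T, hT⟩ := key
      refine ⟨T, fun a ha l a' ha' => ?_⟩
      obtain ⟨b, hb, h1, h2⟩ := hT (O.filt.pieceMk k ⟨a, O.mem_W ha⟩)
      have h3 : O.filt.cl k a = O.filt.cl k b := by rw [← h1, Filt.cl_of_mem (O.mem_W ha)]; rfl
      rw [h2 l a' ha', uniq a b ha hb h3 l a' ha']
    · intro x
      obtain ⟨⟨a, ha⟩, rfl⟩ := O.filt.pieceMk_surjective k x
      obtain ⟨b, hb, hab⟩ := O.exists_H_of_W ha
      obtain ⟨T, hT⟩ := O.exists_act hb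
      refine ⟨T, b, hb, ?_, hT⟩
      rw [← Filt.cl_eq ha (O.mem_W hb) hab, Filt.cl_of_mem ha]; rfl
    · rintro x x' T T' ⟨a, ha, h1, h2⟩ ⟨b, hb, h1', h2'⟩
      refine ⟨a + b, add_mem ha hb, ?_, fun l a' ha' => ?_⟩
      · rw [map_add, h1, h1', Filt.cl_add (O.mem_W ha) (O.mem_W hb)]
      · rw [sc_add_left, Filt.cl_add (O.mem_W (O.bracket_mem ha ha'))
          (O.mem_W (O.bracket_mem hb ha')), lm_add, h2 l a' ha', h2' l a' ha']
    · rintro z x T ⟨a, ha, h1, h2⟩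
      refine ⟨z • a, smul_mem _ z ha, ?_, fun l a' ha' => ?_⟩
      · rw [map_smul, h1, Filt.cl_smul z (O.mem_W ha)]
      · rw [sc_smul_left, Filt.cl_smul z (O.mem_W (O.bracket_mem ha ha')), lm_smul, h2 l a' ha']
    · rintro x T T' ⟨a, ha, h1, h2⟩ ⟨b, hb, h1', h2'⟩
      refine LinearMap.ext fun y => ?_
      induction y using O.gr_induction with
      | cl l a' ha' => rw [h2 l a' ha', h2' l a' ha', uniq a b ha hb (h1.symm.trans h1') l a' ha']
      | add x y hx hy => rw [map_add, map_add, hx, hy]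
  choose T hT using key
  refine ⟨DirectSum.toModule ℂ ℕ _ T, fun k l a ha a' ha' => ?_⟩
  rw [← hT k a ha l a' ha', Filt.cl_of_mem (O.mem_W ha), Filt.grMk, lm_comp, DirectSum.toModule_lof]

/-- The bracket induced by the graded commutator. -/
def bracket : O.filt.Gr →ₗ[ℂ] O.filt.Gr →ₗ[ℂ] O.filt.Gr := O.exists_bracket_aux.choose

lemma bracket_cl {k l : ℕ} {p q : ZMod 2} {a b : B} (ha : a ∈ O.H (k + 1) p)
    (hb : b ∈ O.H (l + 1) q) : O.bracket (O.filt.cl k a) (O.filt.cl l b) =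
      O.filt.cl (k + l - 2) (superComm p q a b) := by
  by_cases hp : p = k
  · by_cases hq : q = l
    · subst hp hq
      exact O.exists_bracket_aux.choose_spec k l a ha b hb
    · have := O.H_drop l q hq hb
      rw [Filt.cl_eq_zero (O.mem_W this), map_zero,
        Filt.cl_eq_zero (O.mem_W (O.bracket_mem_right ha this))]
  · have := O.H_drop k p hp ha
    rw [Filt.cl_eq_zero (O.mem_W this), map_zero, LinearMap.zero_apply,
      Filt.cl_eq_zero (O.mem_W (O.bracket_mem_left this hb))]

lemma isPoissonBracket_bracket : IsPoissonBracket O.filt.grDeg O.bracket where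
  degree k l m x y hx hy h := by
    obtain ⟨a, ha, rfl⟩ := O.mem_grDeg.1 hx
    obtain ⟨b, hb, rfl⟩ := O.mem_grDeg.1 hy
    rw [O.bracket_cl ha hb, show k + l - 2 = m by omega]
    have := O.bracket_mem ha hb
    rw [show k + l - 2 = m by omega] at this
    exact Filt.mem_grDeg.2 ⟨_, O.mem_W this, rfl⟩
  degree_lt k l x y hx hy h := by
    obtain ⟨a, ha, rfl⟩ := O.mem_grDeg.1 hx
    obtain ⟨b, hb, rfl⟩ := O.mem_grDeg.1 hy
    rw [O.bracket_cl ha hb, O.superComm_eq_zero ha hb h, Filt.cl_zero]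
  skew k l x y hx hy := by
    obtain ⟨a, ha, rfl⟩ := O.mem_grDeg.1 hx
    obtain ⟨b, hb, rfl⟩ := O.mem_grDeg.1 hy
    have h := O.mem_W (O.bracket_mem hb ha)
    rw [O.bracket_cl ha hb, O.bracket_cl hb ha, sc_skew, sgn_natCast, add_comm k l,
      Filt.cl_neg (smul_mem _ _ h), Filt.cl_smul _ h]
  leibniz k l x y z hx hy := by
    obtain ⟨a, ha, rfl⟩ := O.mem_grDeg.1 hx
    obtain ⟨b, hb, rfl⟩ := O.mem_grDeg.1 hy
    induction z using O.gr_induction with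
    | cl t d hd =>
      have hbd := O.H_mul hb hd
      have h1 := O.bracket_mem ha hb
      have h2 := O.bracket_mem ha hd
      rw [Filt.cl_mul (O.mem_W hb) (O.mem_W hd), O.bracket_cl ha hbd, sc_mul_right, sgn_natCast,
        O.bracket_cl ha hb, O.bracket_cl ha hd, Filt.cl_mul (O.mem_W h1) (O.mem_W hd),
        Filt.cl_mul (O.mem_W hb) (O.mem_W h2)]
      have e1 : superComm k l a b * d ∈ O.filt.W (k + (l + t) - 2 + 1) ∧
          O.filt.cl (k + l - 2 + t) (superComm k l a b * d) =
          O.filt.cl (k + (l + t) - 2) (superComm k l a b * d) := by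
        by_cases h : k + l < 2
        · rw [O.superComm_eq_zero ha hb h, zero_mul, Filt.cl_zero, Filt.cl_zero]
          exact ⟨zero_mem _, rfl⟩
        · rw [show k + (l + t) - 2 = k + l - 2 + t by omega]
          exact ⟨O.mem_W (O.H_mul h1 hd), rfl⟩
      have e2 : b * superComm k t a d ∈ O.filt.W (k + (l + t) - 2 + 1) ∧
          O.filt.cl (l + (k + t - 2)) (b * superComm k t a d) =
          O.filt.cl (k + (l + t) - 2) (b * superComm k t a d) := by
        by_cases h : k + t < 2
        · rw [O.superComm_eq_zero ha hd h, mul_zero, Filt.cl_zero, Filt.cl_zero]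
          exact ⟨zero_mem _, rfl⟩
        · rw [show k + (l + t) - 2 = l + (k + t - 2) by omega]
          exact ⟨O.mem_W (O.H_mul hb h2), rfl⟩
      rw [e1.2, e2.2, Filt.cl_add e1.1 (smul_mem _ _ e2.1), Filt.cl_smul _ e2.1]
    | add z z' h h' =>
      rw [mul_add, map_add, map_add, h, h', mul_add, mul_add, smul_add]
      abel
  jacobi k l x y z hx hy := by
    obtain ⟨a, ha, rfl⟩ := O.mem_grDeg.1 hx
    obtain ⟨b, hb, rfl⟩ := O.mem_grDeg.1 hy
    induction z using O.gr_induction with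
    | cl t d hd =>
      have e : ∀ {k l t : ℕ} {p q s : ZMod 2} {a b d : B}, a ∈ O.H (k + 1) p → b ∈ O.H (l + 1) q →
          d ∈ O.H (t + 1) s →
          superComm p (q + s) a (superComm q s b d) ∈ O.filt.W (k + l + t - 4 + 1) ∧
          O.bracket (O.filt.cl k a) (O.bracket (O.filt.cl l b) (O.filt.cl t d)) =
          O.filt.cl (k + l + t - 4) (superComm p (q + s) a (superComm q s b d)) := by
        intro k l t p q s a b d ha hb hd
        have h1 := O.bracket_mem hb hd
        rw [O.bracket_cl hb hd, O.bracket_cl ha h1]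
        by_cases h : l + t < 2
        · rw [O.superComm_eq_zero hb hd h, superComm_zero_arg_right, Filt.cl_zero, Filt.cl_zero]
          exact ⟨zero_mem _, rfl⟩
        · rw [show k + l + t - 4 = k + (l + t - 2) - 2 by omega]
          exact ⟨O.mem_W (O.bracket_mem ha h1), rfl⟩
      have e' : superComm ((k : ZMod 2) + l) t (superComm k l a b) d ∈ O.filt.W (k + l + t - 4 + 1) ∧
          O.bracket (O.bracket (O.filt.cl k a) (O.filt.cl l b)) (O.filt.cl t d) =
          O.filt.cl (k + l + t - 4) (superComm ((k : ZMod 2) + l) t (superComm k l a b) d) := by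
        have h1 := O.bracket_mem ha hb
        rw [O.bracket_cl ha hb, O.bracket_cl h1 hd]
        by_cases h : k + l < 2
        · rw [O.superComm_eq_zero ha hb h, superComm_zero_arg_left, Filt.cl_zero, Filt.cl_zero]
          exact ⟨zero_mem _, rfl⟩
        · rw [show k + l + t - 4 = (k + l - 2) + t - 2 by omega]
          exact ⟨O.mem_W (O.bracket_mem h1 hd), rfl⟩
      have e2 := e hb ha hd
      rw [add_comm l k] at e2
      rw [(e ha hb hd).2, e'.2, e2.2, sc_jacobi', sgn_natCast,
        Filt.cl_add e'.1 (smul_mem _ _ e2.1), Filt.cl_smul _ e2.1]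
    | add z z' h h' =>
      simp only [map_add, h, h', smul_add]
      abel

lemma bracket_unique {b b' : O.filt.Gr →ₗ[ℂ] O.filt.Gr →ₗ[ℂ] O.filt.Gr}
    (h : ∀ (k l : ℕ), ∀ x ∈ O.H (k + 1) (k : ZMod 2), ∀ y ∈ O.H (l + 1) (l : ZMod 2),
      b (O.filt.cl k x) (O.filt.cl l y) = b' (O.filt.cl k x) (O.filt.cl l y)) : b = b' := by
  refine LinearMap.ext fun x => LinearMap.ext fun y => ?_
  induction x using O.gr_induction with
  | cl k x hx =>
    induction y using O.gr_induction with
    | cl l y hy => exact h k l x hx y hy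
    | add y y' h h' => rw [map_add, map_add, h, h']
  | add x x' h h' => rw [map_add, map_add, lm_add, lm_add, h, h']

lemma bracket_iff (b : O.filt.Gr →ₗ[ℂ] O.filt.Gr →ₗ[ℂ] O.filt.Gr) :
    (∀ (k l : ℕ) (p q : ZMod 2) (D D' : B)
    (hD : D ∈ O.filt.W (k + 1)) (hD' : D' ∈ O.filt.W (l + 1)),
    D ∈ O.H (k + 1) p → D' ∈ O.H (l + 1) q →
    (∀ m, k + l = m + 2 → ∃ h : superComm p q D D' ∈ O.filt.W (m + 1),
      b (O.filt.grMk k ⟨D, hD⟩) (O.filt.grMk l ⟨D', hD'⟩) = O.filt.grMk m ⟨_, h⟩) ∧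
    (k + l < 2 → superComm p q D D' = 0 ∧
      b (O.filt.grMk k ⟨D, hD⟩) (O.filt.grMk l ⟨D', hD'⟩) = 0)) ↔ b = O.bracket := by
  constructor
  · intro h
    refine O.bracket_unique fun k l x hx y hy => ?_
    have h1 := h k l k l x y (O.mem_W hx) (O.mem_W hy) hx hy
    rw [← Filt.cl_of_mem, ← Filt.cl_of_mem] at h1
    rw [O.bracket_cl hx hy]
    by_cases hkl : k + l < 2
    · rw [(h1.2 hkl).2, (h1.2 hkl).1, Filt.cl_zero]
    · obtain ⟨h2, h3⟩ := h1.1 (k + l - 2) (by omega)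
      rw [h3, Filt.cl_of_mem h2]
  · rintro rfl k l p q x y hx' hy' hx hy
    rw [← Filt.cl_of_mem, ← Filt.cl_of_mem, O.bracket_cl hx hy]
    refine ⟨fun m hm => ?_, fun hkl => ?_⟩
    · have h1 := O.bracket_mem hx hy
      rw [show k + l - 2 = m by omega] at h1 ⊢
      exact ⟨O.mem_W h1, Filt.cl_of_mem _⟩
    · rw [O.superComm_eq_zero hx hy hkl]
      exact ⟨rfl, Filt.cl_zero _⟩

end CliffordOps

end GradedBracket

/-! ## Graded Poisson algebras with generators -/

section Models

namespace IsPoissonBracket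

variable {𝕜 C : Type*} [Field 𝕜] [Ring C] [Algebra 𝕜 C] {𝒜 : ℕ → Submodule 𝕜 C}
  {b : C →ₗ[𝕜] C →ₗ[𝕜] C}

lemma mul_left (hb : IsPoissonBracket 𝒜 b)
    (hmul : ∀ k l x y, x ∈ 𝒜 k → y ∈ 𝒜 l → x * y ∈ 𝒜 (k + l)) {k l p : ℕ} {x y z : C}
    (hx : x ∈ 𝒜 k) (hy : y ∈ 𝒜 l) (hz : z ∈ 𝒜 p) :
    b (x * y) z = x * b y z + (-1 : 𝕜) ^ (l * p) • (b x z * y) := by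
  rw [hb.skew _ _ _ _ (hmul k l x y hx hy) hz, hb.leibniz p k z x y hz hx, hb.skew p k z x hz hx,
    hb.skew p l z y hz hy, add_mul, pow_add, mul_comm p k, mul_comm p l]
  rcases neg_one_pow_eq_or 𝕜 (k * p) with h | h <;> rcases neg_one_pow_eq_or 𝕜 (l * p) with h' | h' <;>
  simp [h, h'] <;> abel

end IsPoissonBracket

/-- A graded commutative algebra with a Poisson bracket of degree `-2`, and with functions,
sections and vector fields as elements of degree `0`, `1` and `2`, whose brackets are given by the
metric and the connection. -/
structure Model (g : LinearMap.BilinForm A P) (nab : Connection ℝ A P) {𝕜 C : Type*} [Field 𝕜]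
    [Ring C] [Algebra 𝕜 C] (𝒜 : ℕ → Submodule 𝕜 C) (b : C →ₗ[𝕜] C →ₗ[𝕜] C) where
  poisson : IsPoissonBracket 𝒜 b
  mul_mem : ∀ k l x y, x ∈ 𝒜 k → y ∈ 𝒜 l → x * y ∈ 𝒜 (k + l)
  comm : ∀ k l x y, x ∈ 𝒜 k → y ∈ 𝒜 l → x * y = (-1 : 𝕜) ^ (k * l) • (y * x)
  F : A →+* C
  c : P →+ C
  S : 𝔇 →+ C
  c_smul : ∀ f ξ, c (f • ξ) = F f * c ξ
  S_smul : ∀ (f : A) X, S (f • X) = F f * S X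
  F_mem : ∀ f, F f ∈ 𝒜 0
  c_mem : ∀ ξ, c ξ ∈ 𝒜 1
  S_mem : ∀ X, S X ∈ 𝒜 2
  F_F : ∀ f h, b (F f) (F h) = 0
  c_F : ∀ ξ f, b (c ξ) (F f) = 0
  c_c : ∀ ξ η, b (c ξ) (c η) = F (g ξ η)
  S_F : ∀ X f, b (S X) (F f) = F (X f)
  S_c : ∀ X ξ, b (S X) (c ξ) = c (nab.toFun X ξ)

namespace Model

variable {g : LinearMap.BilinForm A P} {nab : Connection ℝ A P} {𝕜 C : Type*} [Field 𝕜]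
  [Ring C] [Algebra 𝕜 C] {𝒜 : ℕ → Submodule 𝕜 C} {b : C →ₗ[𝕜] C →ₗ[𝕜] C}
  (M : Model g nab 𝒜 b)

include M in
lemma comm_even {k l : ℕ} {x y : C} (hx : x ∈ 𝒜 k) (hy : y ∈ 𝒜 l) (h : Even l) : x * y = y * x := by
  rw [M.comm k l x y hx hy, (h.mul_left k).neg_one_pow, one_smul]

lemma F_comm {k : ℕ} {x : C} (hx : x ∈ 𝒜 k) (f : A) : x * M.F f = M.F f * x :=
  M.comm_even hx (M.F_mem f) Even.zero

lemma F_c (f : A) (ξ : P) : b (M.F f) (M.c ξ) = 0 := by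
  rw [M.poisson.skew 0 1 _ _ (M.F_mem f) (M.c_mem ξ), M.c_F, smul_zero, neg_zero]

lemma bc_mem {k : ℕ} {Y : C} (hY : Y ∈ 𝒜 k) (ξ : P) : b Y (M.c ξ) ∈ 𝒜 (k - 1) := by
  cases k with
  | zero =>
    rw [M.poisson.degree_lt 0 1 _ _ hY (M.c_mem ξ) (by norm_num)]
    exact zero_mem _
  | succ k => exact M.poisson.degree _ 1 _ _ _ hY (M.c_mem ξ) (by omega)

lemma bF_eq_zero {k : ℕ} {Y : C} (hY : Y ∈ 𝒜 k) (f : A) (h : k < 2) : b Y (M.F f) = 0 :=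
  M.poisson.degree_lt k 0 _ _ hY (M.F_mem f) h

lemma bF_mem {k : ℕ} {Y : C} (hY : Y ∈ 𝒜 k) (f : A) : b Y (M.F f) ∈ 𝒜 (k - 2) := by
  by_cases h : k < 2
  · rw [M.bF_eq_zero hY f h]
    exact zero_mem _
  · exact M.poisson.degree _ 0 _ _ _ hY (M.F_mem f) (by omega)

lemma bc_bc {k : ℕ} {Y : C} (hY : Y ∈ 𝒜 k) (ξ η : P) :
    b (b Y (M.c η)) (M.c ξ) + b (b Y (M.c ξ)) (M.c η) = b Y (M.F (g η ξ)) := by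
  cases k with
  | zero =>
    rw [M.bF_eq_zero hY _ (by norm_num), M.poisson.degree_lt 0 1 _ _ hY (M.c_mem ξ) (by norm_num),
      M.poisson.degree_lt 0 1 _ _ hY (M.c_mem η) (by norm_num)]
    simp
  | succ k =>
    have h1 := M.poisson.jacobi _ 1 Y (M.c η) (M.c ξ) hY (M.c_mem η)
    rw [M.c_c, M.poisson.skew 1 k _ _ (M.c_mem η) (M.bc_mem hY ξ)] at h1
    rw [h1]
    rcases neg_one_pow_eq_or 𝕜 k with h | h <;> simp [h, pow_succ]

lemma bF_bc {k : ℕ} {Y : C} (hY : Y ∈ 𝒜 k) (ξ : P) (f : A) :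
    b (b Y (M.F f)) (M.c ξ) = b (b Y (M.c ξ)) (M.F f) := by
  by_cases hk : k < 2
  · rw [M.bF_eq_zero hY _ hk, M.bF_eq_zero (M.bc_mem hY ξ) _ (by omega), map_zero,
      LinearMap.zero_apply]
  · obtain ⟨k, rfl⟩ : ∃ m, k = m + 2 := ⟨k - 2, by omega⟩
    have h1 := M.poisson.jacobi _ 1 Y (M.c ξ) (M.F f) hY (M.c_mem ξ)
    rw [M.c_F, map_zero, M.poisson.skew 1 k _ _ (M.c_mem ξ) (M.bF_mem hY f)] at h1
    rcases neg_one_pow_eq_or 𝕜 k with h | h <;> simp [h, pow_succ] at h1 <;>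
      exact (sub_eq_zero.1 (by rw [sub_eq_add_neg]; exact h1.symm)).symm

lemma b_Fmul_c {k : ℕ} {Y : C} (hY : Y ∈ 𝒜 k) (ξ : P) (f : A) :
    b (M.F f * Y) (M.c ξ) = M.F f * b Y (M.c ξ) := by
  rw [M.poisson.mul_left M.mul_mem (M.F_mem f) hY (M.c_mem ξ), M.F_c, zero_mul, smul_zero, add_zero]

lemma b_smul {k : ℕ} {Y : C} (hY : Y ∈ 𝒜 k) (f : A) (ξ : P) :
    b Y (M.c (f • ξ)) = b Y (M.F f) * M.c ξ + b Y (M.c ξ) * M.F f := by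
  rw [M.c_smul, M.poisson.leibniz k 0 _ _ _ hY (M.F_mem f), mul_zero, pow_zero, one_smul,
    M.F_comm (M.bc_mem hY ξ)]

lemma b_mulc_c {k : ℕ} {Y : C} (hY : Y ∈ 𝒜 k) (η ξ : P) :
    b (Y * M.c η) (M.c ξ) = Y * M.F (g η ξ) - b Y (M.c ξ) * M.c η := by
  rw [M.poisson.mul_left M.mul_mem hY (M.c_mem η) (M.c_mem ξ), M.c_c, sub_eq_add_neg]
  simp

section Euler

variable (Fr : Frames g)

/-- The element of degree `2` which corrects for the connection in the Euler operator. -/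
def R (j : Fin Fr.l) : C :=
  (2 : 𝕜) • M.S (Fr.X j) - ∑ i, M.c (nab.toFun (Fr.X j) (Fr.e' i)) * M.c (Fr.e i)

/-- The Euler operator. -/
def E (Y : C) : C :=
  ∑ i, b Y (M.c (Fr.e' i)) * M.c (Fr.e i) + ∑ j, b Y (M.F (Fr.f j)) * M.R Fr j

lemma R_mem (j : Fin Fr.l) : M.R Fr j ∈ 𝒜 2 :=
  sub_mem (smul_mem _ _ (M.S_mem _))
    (sum_mem fun i _ => M.mul_mem 1 1 _ _ (M.c_mem _) (M.c_mem _))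

lemma E_mem {k : ℕ} {Y : C} (hY : Y ∈ 𝒜 k) : M.E Fr Y ∈ 𝒜 k := by
  refine add_mem (sum_mem fun i _ => ?_) (sum_mem fun j _ => ?_)
  · cases k with
    | zero =>
      rw [M.poisson.degree_lt 0 1 _ _ hY (M.c_mem _) (by norm_num), zero_mul]
      exact zero_mem _
    | succ k => exact M.mul_mem k 1 _ _ (M.bc_mem hY _) (M.c_mem _)
  · by_cases h : k < 2
    · rw [M.bF_eq_zero hY _ h, zero_mul]
      exact zero_mem _
    · have := M.mul_mem (k - 2) 2 _ _ (M.bF_mem hY (Fr.f j)) (M.R_mem Fr j)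
      rwa [show k - 2 + 2 = k by omega] at this

lemma E_add (Y Z : C) : M.E Fr (Y + Z) = M.E Fr Y + M.E Fr Z := by
  simp only [E, map_add, lm_add, add_mul, sum_add_distrib]
  abel

lemma E_zero_deg {Y : C} (hY : Y ∈ 𝒜 0) : M.E Fr Y = 0 := by
  rw [E, Finset.sum_eq_zero, Finset.sum_eq_zero, add_zero]
  · intro j _
    rw [M.bF_eq_zero hY _ (by norm_num), zero_mul]
  · intro i _
    rw [M.poisson.degree_lt 0 1 _ _ hY (M.c_mem _) (by norm_num), zero_mul]

lemma E_c (η : P) : M.E Fr (M.c η) = M.c η := by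
  rw [E]
  simp only [M.c_F, zero_mul, sum_const_zero, add_zero, M.c_c, ← M.c_smul]
  rw [← map_sum]
  congr 1
  conv_rhs => rw [← Fr.sum_left η]
  exact sum_ext fun i => by rw [Fr.symm]

lemma E_S (X : 𝔇) : M.E Fr (M.S X) = (2 : 𝕜) • M.S X := by
  have h : ∑ j, X (Fr.f j) • Fr.X j = X := Fr.sum_X X
  have hn : ∀ ξ, nab.toFun X ξ = ∑ j, X (Fr.f j) • nab.toFun (Fr.X j) ξ := by
    intro ξ
    conv_lhs => rw [← h]
    have : ∀ s : Finset (Fin Fr.l), nab.toFun (∑ j ∈ s, X (Fr.f j) • Fr.X j) ξ =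
        ∑ j ∈ s, X (Fr.f j) • nab.toFun (Fr.X j) ξ := by
      intro s
      let φ : 𝔇 →+ P :=
        { toFun := fun Y => nab.toFun Y ξ
          map_zero' := by
            have := nab.map_smul 0 0 ξ
            rwa [zero_smul, zero_smul] at this
          map_add' := fun Y Z => by rw [nab.map_add]; rfl }
      exact (map_sum φ _ s).trans (sum_ext fun j => nab.map_smul _ _ _)
    exact this _
  have hS : M.S X = ∑ j, M.F (X (Fr.f j)) * M.S (Fr.X j) := by
    conv_lhs => rw [← h]
    rw [map_sum]
    exact sum_ext fun j => M.S_smul _ _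
  rw [E]
  simp only [M.S_F, M.S_c, R, mul_sub, mul_smul_comm]
  rw [sum_sub_distrib, ← smul_sum, ← hS]
  have : ∑ j, M.F (X (Fr.f j)) * ∑ i, M.c (nab.toFun (Fr.X j) (Fr.e' i)) * M.c (Fr.e i) =
      ∑ i, M.c (nab.toFun X (Fr.e' i)) * M.c (Fr.e i) := by
    simp only [mul_sum]
    rw [sum_comm]
    refine sum_ext fun i => ?_
    rw [hn, map_sum, sum_mul]
    exact sum_ext fun j => by rw [M.c_smul, mul_assoc]
  rw [this]
  abel

lemma E_mul {k l : ℕ} {x y : C} (hx : x ∈ 𝒜 k) (hy : y ∈ 𝒜 l) :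
    M.E Fr (x * y) = M.E Fr x * y + x * M.E Fr y := by
  have h1 : ∀ i, b (x * y) (M.c (Fr.e' i)) * M.c (Fr.e i) =
      b x (M.c (Fr.e' i)) * M.c (Fr.e i) * y + x * (b y (M.c (Fr.e' i)) * M.c (Fr.e i)) := by
    intro i
    rw [M.poisson.mul_left M.mul_mem hx hy (M.c_mem _), add_mul, mul_assoc, mul_assoc,
      M.comm 1 l _ _ (M.c_mem _) hy, one_mul, mul_one, smul_mul_assoc, mul_smul_comm, mul_assoc,
      add_comm]
  have h2 : ∀ j, b (x * y) (M.F (Fr.f j)) * M.R Fr j =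
      b x (M.F (Fr.f j)) * M.R Fr j * y + x * (b y (M.F (Fr.f j)) * M.R Fr j) := by
    intro j
    rw [M.poisson.mul_left M.mul_mem hx hy (M.F_mem _), add_mul, mul_assoc, mul_assoc,
      ← M.comm_even hy (M.R_mem Fr j) even_two, mul_zero, pow_zero, one_smul, mul_assoc,
      add_comm]
  rw [E, E, E, sum_ext fun i => h1 i, sum_ext fun j => h2 j,
    sum_add_distrib, sum_add_distrib, add_mul, mul_add, sum_mul,
    sum_mul, mul_sum, mul_sum]
  abel

lemma d_expand (nd : ∀ k, ∀ Z ∈ 𝒜 (k + 1), (∀ ξ, b Z (M.c ξ) = 0) → Z = 0)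
    (hd : ∀ Y ∈ 𝒜 2, ∀ h, b Y (M.F h) = ∑ j, M.F (Fr.X j h) * b Y (M.F (Fr.f j))) (k : ℕ) :
    ∀ Y ∈ 𝒜 k, ∀ h, b Y (M.F h) = ∑ j, M.F (Fr.X j h) * b Y (M.F (Fr.f j)) := by
  induction k with
  | zero =>
    intro Y hY h
    simp only [M.bF_eq_zero hY _ (by norm_num : 0 < 2), mul_zero, sum_const_zero]
  | succ k ih =>
    intro Y hY h
    obtain rfl | rfl | ⟨m, rfl⟩ : k = 0 ∨ k = 1 ∨ ∃ m, k = m + 2 := by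
      rcases k with _ | _ | m
      · exact Or.inl rfl
      · exact Or.inr (Or.inl rfl)
      · exact Or.inr (Or.inr ⟨m, rfl⟩)
    · simp only [M.bF_eq_zero hY _ (by norm_num : 0 + 1 < 2), mul_zero, sum_const_zero]
    · exact hd Y hY h
    · rw [← sub_eq_zero]
      refine nd m _ (sub_mem (M.bF_mem hY h) (sum_mem fun j _ => ?_))
        fun ξ => ?_
      · have := M.mul_mem 0 _ _ _ (M.F_mem (Fr.X j h)) (M.bF_mem hY (Fr.f j))
        rwa [zero_add] at this
      · rw [map_sub, lm_sub, map_sum, lm_sum, M.bF_bc hY, ih _ (M.bc_mem hY ξ), sub_eq_zero]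
        exact sum_ext fun j => by rw [M.b_Fmul_c (M.bF_mem hY _), M.bF_bc hY]

lemma b_R_c (hm : nab.IsMetric g) (j : Fin Fr.l) (ξ : P) : b (M.R Fr j) (M.c ξ) =
    M.c (∑ i, (Fr.X j (g (Fr.e' i) ξ) • Fr.e i + Fr.X j (g (Fr.e i) ξ) • Fr.e' i)) := by
  set N := nab.toFun (Fr.X j)
  have h1 : N ξ = ∑ i, (Fr.X j (g (Fr.e i) ξ) • Fr.e' i + g (Fr.e i) ξ • N (Fr.e' i)) := by
    conv_lhs => rw [← Fr.sum_right ξ]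
    rw [map_sum]
    exact sum_ext fun i => nab.leibniz _ _ _
  have h2 : N ξ = ∑ i, g (Fr.e' i) (N ξ) • Fr.e i := (Fr.sum_left _).symm
  rw [R, map_sub, map_smul, map_sum, lm_sub, lm_smul, lm_sum, M.S_c]
  have h3 : ∀ i, b (M.c (N (Fr.e' i)) * M.c (Fr.e i)) (M.c ξ) =
      M.c (g (Fr.e i) ξ • N (Fr.e' i) - g (N (Fr.e' i)) ξ • Fr.e i) := by
    intro i
    rw [M.b_mulc_c (M.c_mem _), M.c_c, M.F_comm (M.c_mem _), ← M.c_smul, ← M.c_smul, map_sub]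
  rw [sum_ext fun i => h3 i, ← map_sum, two_smul, ← map_add, ← map_sub]
  congr 1
  rw [sum_sub_distrib, sum_add_distrib]
  have h4 : ∑ i, Fr.X j (g (Fr.e' i) ξ) • Fr.e i = ∑ i, g (N (Fr.e' i)) ξ • Fr.e i + N ξ := by
    conv_rhs => rw [h2]
    rw [← sum_add_distrib]
    exact sum_ext fun i => by rw [hm, add_smul]
  rw [sum_add_distrib] at h1
  rw [h4]
  nth_rewrite 2 [h1]
  abel

lemma b_E_c (hm : nab.IsMetric g)
    (hd : ∀ k, ∀ Y ∈ 𝒜 k, ∀ h, b Y (M.F h) = ∑ j, M.F (Fr.X j h) * b Y (M.F (Fr.f j)))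
    {k : ℕ} {Y : C} (hY : Y ∈ 𝒜 k) (ξ : P) :
    b (M.E Fr Y) (M.c ξ) = M.E Fr (b Y (M.c ξ)) + b Y (M.c ξ) := by
  have h1 : ∀ i, b (b Y (M.c (Fr.e' i)) * M.c (Fr.e i)) (M.c ξ) =
      b Y (M.c (Fr.e' i)) * M.F (g (Fr.e i) ξ) + b (b Y (M.c ξ)) (M.c (Fr.e' i)) * M.c (Fr.e i) -
        b Y (M.F (g (Fr.e' i) ξ)) * M.c (Fr.e i) := by
    intro i
    rw [M.b_mulc_c (M.bc_mem hY _), ← M.bc_bc hY]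
    noncomm_ring
  have h2 : ∀ j, b (b Y (M.F (Fr.f j)) * M.R Fr j) (M.c ξ) =
      b Y (M.F (Fr.f j)) * b (M.R Fr j) (M.c ξ) + b (b Y (M.c ξ)) (M.F (Fr.f j)) * M.R Fr j := by
    intro j
    rw [M.poisson.mul_left M.mul_mem (M.bF_mem hY _) (M.R_mem Fr j) (M.c_mem ξ), M.bF_bc hY]
    simp
  have h3 : b Y (M.c ξ) = ∑ i, (b Y (M.F (g (Fr.e i) ξ)) * M.c (Fr.e' i) +
      b Y (M.c (Fr.e' i)) * M.F (g (Fr.e i) ξ)) := by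
    conv_lhs => rw [← Fr.sum_right ξ]
    rw [map_sum, map_sum]
    exact sum_ext fun i => M.b_smul hY _ _
  have h4 : ∀ h η, b Y (M.F h) * M.c η = ∑ j, b Y (M.F (Fr.f j)) * M.c (Fr.X j h • η) := by
    intro h η
    rw [hd k Y hY h, sum_mul]
    exact sum_ext fun j => by
      rw [M.c_smul, ← mul_assoc, M.F_comm (M.bF_mem hY _)]
  have h5 : ∑ j, b Y (M.F (Fr.f j)) * b (M.R Fr j) (M.c ξ) =
      ∑ i, (b Y (M.F (g (Fr.e' i) ξ)) * M.c (Fr.e i) + b Y (M.F (g (Fr.e i) ξ)) * M.c (Fr.e' i)) := by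
    simp only [M.b_R_c Fr hm, map_sum, map_add, mul_sum, mul_add]
    rw [sum_comm]
    exact sum_ext fun i => by rw [h4, h4, ← sum_add_distrib]
  rw [E, map_add, map_sum, map_sum, lm_add, lm_sum, lm_sum,
    sum_ext fun i => h1 i, sum_ext fun j => h2 j,
    sum_add_distrib, h5, E]
  refine Eq.trans ?_ (congrArg (_ + ·) h3.symm)
  simp only [sum_add_distrib, sum_sub_distrib]
  abel

lemma euler (hm : nab.IsMetric g) (nd : ∀ k, ∀ Z ∈ 𝒜 (k + 1), (∀ ξ, b Z (M.c ξ) = 0) → Z = 0)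
    (hd : ∀ Y ∈ 𝒜 2, ∀ h, b Y (M.F h) = ∑ j, M.F (Fr.X j h) * b Y (M.F (Fr.f j))) (k : ℕ) :
    ∀ Y ∈ 𝒜 k, M.E Fr Y = (k : 𝕜) • Y := by
  induction k with
  | zero => intro Y hY; rw [M.E_zero_deg Fr hY, Nat.cast_zero, zero_smul]
  | succ k ih =>
    intro Y hY
    rw [← sub_eq_zero]
    refine nd k _ (sub_mem (M.E_mem Fr hY) (smul_mem _ _ hY)) fun ξ => ?_
    rw [map_sub, lm_sub, map_smul, lm_smul,
      M.b_E_c Fr hm (M.d_expand Fr nd hd) hY, ih _ (M.bc_mem hY ξ), Nat.cast_succ, add_smul, one_smul,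
      sub_self]

end Euler

end Model

end Models

/-! ## The model given by the functions on `𝓜` -/

section RoyModel

open CotFun

lemma splitDeg_induction {p : ℕ → 𝓢 → Prop} (zero : ∀ k, p k 0) (fn : ∀ f : A, p 0 (sx (𝔞 f)))
    (lin : ∀ k (ξ : P) y, y ∈ splitDeg A P k → p k y → p (k + 1) (sx (ι A ξ) * y))
    (mom : ∀ k X y, y ∈ splitDeg A P k → p k y → p (k + 2) (sm X * y))
    (add : ∀ k y z, y ∈ splitDeg A P k → z ∈ splitDeg A P k → p k y → p k z → p k (y + z))
    (k : ℕ) (y : 𝓢) (hy : y ∈ splitDeg A P k) : p k y := by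
  have hext : ∀ i, ∀ r ∈ Λ^ i, p i (sx r) := by
    intro i
    refine shiftDeg_induction (p := fun i r => p i (sx r)) fn ?_ ?_ i
    · intro i ξ r hr h
      rw [SplitFun.ext_mul]
      exact lin i ξ _ (ext_mem_splitDeg hr) h
    · intro i r s hr hs h h'
      rw [SplitFun.ext_add]
      exact add i _ _ (ext_mem_splitDeg hr) (ext_mem_splitDeg hs) h h'
  have key : ∀ k (y : 𝓢), SplitMonomial k y →
      ∀ c : ℝ, c • y ∈ splitDeg A P k ∧ p k (c • y) := by
    intro k y hy c
    refine ⟨smul_mem _ c (subset_span hy), ?_⟩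
    induction hy with
    | ext i r hr =>
      rw [← SplitFun.ext_smul]
      exact hext i _ (smul_mem _ c hr)
    | mom k y X hy ih =>
      rw [SplitFun.mom_comm, ← mul_smul_comm]
      exact mom k X _ (smul_mem _ c (subset_span hy)) ih
  have h2 : ∀ c : ℝ, c • y ∈ splitDeg A P k ∧ p k (c • y) := by
    induction hy using span_induction with
    | mem y hy => exact key k y hy
    | zero => intro c; rw [smul_zero]; exact ⟨zero_mem _, zero k⟩
    | add y z _ _ h h' =>
      intro c
      rw [smul_add]
      exact ⟨add_mem (h c).1 (h' c).1, add k _ _ (h c).1 (h' c).1 (h c).2 (h' c).2⟩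
    | smul a y _ h => intro c; rw [smul_smul]; exact h _
  have := (h2 1).2
  rwa [one_smul] at this

variable {g : LinearMap.BilinForm A P} {nab : Connection ℝ A P}

lemma royDeg_mul {k l : ℕ} {x y : RoyFun g} (hx : x ∈ royDeg g k) (hy : y ∈ royDeg g l) :
    x * y ∈ royDeg g (k + l) := by
  obtain ⟨x, hx, rfl⟩ := hx
  obtain ⟨y, hy, rfl⟩ := hy
  exact ⟨x * y, cotDeg_mul hx hy, map_mul (restrict g) x y⟩

lemma royDeg_comm {k l : ℕ} {x y : RoyFun g} (hx : x ∈ royDeg g k) (hy : y ∈ royDeg g l) :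
    x * y = (-1 : ℝ) ^ (k * l) • (y * x) := by
  obtain ⟨x, hx, rfl⟩ := hx
  obtain ⟨y, hy, rfl⟩ := hy
  change restrict g x * restrict g y = (-1 : ℝ) ^ (k * l) • (restrict g y * restrict g x)
  rw [← map_mul, CotFun.par_comm (cotDeg_le_par l hy) (cotDeg_le_par k hx), map_smul, map_mul,
    mul_comm l k]

lemma IsMetricField.commutator {V W : 𝔛 2} {T U : P → P} (h : IsMetricField g V T)
    (h' : IsMetricField g W U) :
    IsMetricField g ⟨vfComm 2 2 V.1 W.1, vfComm_mem V.2 W.2⟩ (fun ξ => T (U ξ) - U (T ξ)) := by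
  have e : ∀ r, vfComm 2 2 V.1 W.1 r = V.1 (W.1 r) - W.1 (V.1 r) := by
    intro r
    simp [SpinGr.vfComm, show ((-1 : ℝ) ^ 4) = 1 by norm_num]
  refine ⟨fun ξ => ?_, fun ξ η => ?_⟩
  · change SpinGr.vfComm 2 2 V.1 W.1 _ = _
    rw [e, h'.lin, h.lin, h.lin, h'.lin, map_sub]
  · change SpinGr.vfComm 2 2 V.1 W.1 _ = _
    rw [e, h'.metric, h.metric, map_add, map_add, map_add, map_add, h.metric, h.metric, h'.metric,
      h'.metric, ← map_add, ← map_add, ← map_sub]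
    congr 1
    simp only [map_sub, lm_sub]
    ring

lemma vf_two_algebraMap (V : 𝔛 2) (f : A) : ∃ f', V.1 (𝔞 f) = 𝔞 f' := by
  obtain ⟨f', h⟩ := shiftDeg_zero_eq (V.2.1 0 0 _ (shiftDeg_algebraMap f) (by norm_num))
  exact ⟨f', h.symm⟩

variable (Fr : Frames g)

include Fr in
lemma Frames.royDeg_eq (nab : Connection ℝ A P) (k : ℕ) :
    royDeg g k = (splitDeg A P k).map (xi g nab).toLinearMap := by
  obtain ⟨Θ, h0, h1, h2⟩ := Fr.exists_xiEquiv nab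
  apply le_antisymm
  · rintro _ ⟨x, hx, rfl⟩
    refine ⟨Θ.symm (restrict g x), Fr.kappa_mem (κ := Θ.symm.toAlgHom) h1 h2 hx, ?_⟩
    exact (h0 _).symm.trans (Θ.apply_symm_apply _)
  · rintro _ ⟨y, hy, rfl⟩
    refine splitDeg_induction (p := fun k y => xi g nab y ∈ royDeg g k) ?_ ?_ ?_ ?_ ?_ k y hy
    · intro k; rw [map_zero]; exact zero_mem _
    · intro f
      rw [xi_ext]
      exact ⟨_, fn_mem_cotDeg (shiftDeg_algebraMap f), rfl⟩
    · intro k ξ y _ h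
      rw [map_mul, xi_ext, add_comm]
      exact royDeg_mul ⟨_, fn_mem_cotDeg (shiftDeg_ι ξ), rfl⟩ h
    · intro k X y _ h
      rw [map_mul, xi_mom, add_comm]
      exact royDeg_mul ⟨_, mom_mem_cotDeg _, rfl⟩ h
    · intro k y z _ _ h h'
      rw [map_add]
      exact add_mem h h'

variable {b : RoyFun g →ₗ[ℝ] RoyFun g →ₗ[ℝ] RoyFun g}

/-- The functions on `𝓜` as a model. -/
def Frames.royModel (hm : nab.IsMetric g) (hb : IsRestrictedBracket g (CotFun.bracket A P) b) :
    Model g nab (royDeg g) b where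
  poisson := Fr.isPoissonBracket_roy hm hb
  mul_mem _ _ _ _ hx hy := royDeg_mul hx hy
  comm _ _ _ _ hx hy := royDeg_comm hx hy
  F := (((restrict g).comp (CotFun.fnHom A P)) : Λ →+* RoyFun g).comp 𝔞
  c := (((restrict g).comp (CotFun.fnHom A P)) : Λ →+ RoyFun g).comp
    (ι A).toAddMonoidHom
  S := ((xi g nab) : 𝓢 →+ RoyFun g).comp
    { toFun := sm, map_add' := SplitFun.mom_add, map_zero' := by simp [sm] }
  c_smul f ξ := by
    change restrict g (fn (ι A (f • ξ))) =
      restrict g (fn (𝔞 f)) * restrict g (fn (ι A ξ))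
    rw [← map_mul, ← CotFun.fn_mul, map_smul, smul_def]
  S_smul f X := by
    change xi g nab (sm (f • X)) =
      restrict g (fn (𝔞 f)) * xi g nab (sm X)
    rw [SplitFun.mom_smul, map_mul, xi_ext]
  F_mem f := ⟨_, fn_mem_cotDeg (shiftDeg_algebraMap f), rfl⟩
  c_mem ξ := ⟨_, fn_mem_cotDeg (shiftDeg_ι ξ), rfl⟩
  S_mem X := ⟨_, mom_mem_cotDeg (horLift nab X), (xi_mom nab X).symm⟩
  F_F f h := roy_fn_fn hb f h
  c_F ξ f := roy_lin_fn hb Fr.symm ξ f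
  c_c ξ η := roy_lin_lin hb Fr.symm ξ η
  S_F X f := by
    change b (xi g nab (sm X)) (restrict g (fn (𝔞 f))) = _
    rw [xi_mom, (isMetricField_horLift hm X).roy_fn hb, horLift_algebraMap]
    rfl
  S_c X ξ := by
    change b (xi g nab (sm X)) (restrict g (fn (ι A ξ))) = _
    rw [xi_mom, (isMetricField_horLift hm X).roy_lin hb Fr.symm]
    rfl

variable {𝕜 C : Type*} [Field 𝕜] [Ring C] [Algebra 𝕜 C] [Algebra ℝ C]
  {𝒜 : ℕ → Submodule 𝕜 C} {b' : C →ₗ[𝕜] C →ₗ[𝕜] C}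

section

variable (hm : nab.IsMetric g) (hb : IsRestrictedBracket g (CotFun.bracket A P) b)

include nab in
lemma Frames.royDeg_induction {p : ℕ → RoyFun g → Prop} (zero : ∀ k, p k 0)
    (fn : ∀ f : A, p 0 ((Fr.royModel hm hb).F f))
    (lin : ∀ k (ξ : P) y, y ∈ royDeg g k → p k y → p (k + 1) ((Fr.royModel hm hb).c ξ * y))
    (mom : ∀ k X y, y ∈ royDeg g k → p k y → p (k + 2) ((Fr.royModel hm hb).S X * y))
    (add : ∀ k y z, y ∈ royDeg g k → z ∈ royDeg g k → p k y → p k z → p k (y + z))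
    (k : ℕ) (y : RoyFun g) (hy : y ∈ royDeg g k) : p k y := by
  rw [Fr.royDeg_eq nab k] at hy
  obtain ⟨y, hy, rfl⟩ := hy
  have hmem : ∀ k, ∀ y ∈ splitDeg A P k, xi g nab y ∈ royDeg g k := fun k y hy => by
    rw [Fr.royDeg_eq nab k]; exact ⟨y, hy, rfl⟩
  refine splitDeg_induction (p := fun k y => p k (xi g nab y)) ?_ ?_ ?_ ?_ ?_ k y hy
  · intro k; rw [map_zero]; exact zero k
  · intro f
    rw [xi_ext]
    exact fn f
  · intro k ξ y hy h
    rw [map_mul, xi_ext]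
    exact lin k ξ _ (hmem k y hy) h
  · intro k X y hy h
    rw [map_mul]
    exact mom k X _ (hmem k y hy) h
  · intro k y z hy hz h h'
    rw [map_add]
    exact add k _ _ (hmem k y hy) (hmem k z hz) h h'

lemma Frames.roy_euler (k : ℕ) : ∀ y ∈ royDeg g k, (Fr.royModel hm hb).E Fr y = (k : ℝ) • y := by
  set M := Fr.royModel hm hb
  refine Fr.royDeg_induction hm hb (p := fun k y => M.E Fr y = (k : ℝ) • y) ?_ ?_ ?_ ?_ ?_ k
  · intro k
    rw [M.E_zero_deg Fr (zero_mem _), smul_zero]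
  · intro f
    rw [M.E_zero_deg Fr (M.F_mem f), Nat.cast_zero, zero_smul]
  · intro k ξ y hy h
    rw [M.E_mul Fr (M.c_mem ξ) hy, M.E_c, h, mul_smul_comm, Nat.cast_succ, add_smul, one_smul,
      add_comm]
  · intro k X y hy h
    rw [M.E_mul Fr (M.S_mem X) hy, M.E_S, h, mul_smul_comm, Nat.cast_add, add_smul, smul_mul_assoc,
      add_comm]
    norm_num
    rfl
  · intro k y z _ _ h h'
    rw [M.E_add, h, h', smul_add]

lemma Frames.roy_eq_zero {k : ℕ} {y : RoyFun g} (hy : y ∈ royDeg g (k + 1))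
    (h1 : ∀ ξ, b y ((Fr.royModel hm hb).c ξ) = 0) (h2 : ∀ f, b y ((Fr.royModel hm hb).F f) = 0) :
    y = 0 := by
  have h := Fr.roy_euler hm hb (k + 1) y hy
  rw [Model.E] at h
  simp only [h1, h2, zero_mul, sum_const_zero, add_zero] at h
  exact (smul_eq_zero.1 h.symm).resolve_left (by positivity)

variable (M' : Model g nab 𝒜 b') (Ψ : RoyFun g →ₐ[ℝ] C)
  (hF : ∀ f, Ψ ((Fr.royModel hm hb).F f) = M'.F f) (hc : ∀ ξ, Ψ ((Fr.royModel hm hb).c ξ) = M'.c ξ)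
  (hS : ∀ X, Ψ ((Fr.royModel hm hb).S X) = M'.S X)

include hF hc hS

lemma Frames.roy_hom_mem (k : ℕ) : ∀ y ∈ royDeg g k, Ψ y ∈ 𝒜 k := by
  refine Fr.royDeg_induction hm hb (p := fun k y => Ψ y ∈ 𝒜 k) ?_ ?_ ?_ ?_ ?_ k
  · intro k; rw [map_zero]; exact zero_mem _
  · intro f; rw [hF]; exact M'.F_mem f
  · intro k ξ y _ h
    rw [map_mul, hc, add_comm]
    exact M'.mul_mem 1 k _ _ (M'.c_mem ξ) h
  · intro k X y _ h
    rw [map_mul, hS, add_comm]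
    exact M'.mul_mem 2 k _ _ (M'.S_mem X) h
  · intro k y z _ _ h h'
    rw [map_add]
    exact add_mem h h'

lemma Frames.roy_hom_bracket (hSS : ∀ X Y, b' (M'.S X) (M'.S Y) =
      Ψ (b ((Fr.royModel hm hb).S X) ((Fr.royModel hm hb).S Y))) {k l : ℕ} {x y : RoyFun g}
    (hx : x ∈ royDeg g k) (hy : y ∈ royDeg g l) : b' (Ψ x) (Ψ y) = Ψ (b x y) := by
  set M := Fr.royModel hm hb
  have hmem := Fr.roy_hom_mem hm hb M' Ψ hF hc hS
  have sign : ∀ (n : ℕ) (x : RoyFun g), Ψ ((-1 : ℝ) ^ n • x) = (-1 : 𝕜) ^ n • Ψ x := by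
    intro n x
    rcases Nat.even_or_odd n with h | h
    · rw [h.neg_one_pow, h.neg_one_pow, one_smul, one_smul]
    · rw [h.neg_one_pow, h.neg_one_pow, neg_smul, neg_smul, one_smul, one_smul, map_neg]
  have skew : ∀ {k l : ℕ} {x y : RoyFun g}, x ∈ royDeg g k → y ∈ royDeg g l →
      b' (Ψ x) (Ψ y) = Ψ (b x y) → b' (Ψ y) (Ψ x) = Ψ (b y x) := by
    intro k l x y hx hy h
    rw [M'.poisson.skew l k _ _ (hmem l y hy) (hmem k x hx), h, M.poisson.skew l k _ _ hy hx,
      map_neg, sign]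
  have leib : ∀ {k l : ℕ} {x y z : RoyFun g}, x ∈ royDeg g k → y ∈ royDeg g l →
      b' (Ψ x) (Ψ y) = Ψ (b x y) → b' (Ψ x) (Ψ z) = Ψ (b x z) →
      b' (Ψ x) (Ψ (y * z)) = Ψ (b x (y * z)) := by
    intro k l x y z hx hy h h'
    rw [map_mul, M'.poisson.leibniz k l _ _ _ (hmem k x hx) (hmem l y hy), h, h',
      M.poisson.leibniz k l _ _ _ hx hy, map_add, map_mul, sign, map_mul]
  have F_F : ∀ f h, b' (Ψ (M.F f)) (Ψ (M.F h)) = Ψ (b (M.F f) (M.F h)) := by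
    intro f h; rw [hF, hF, M.F_F, M'.F_F, map_zero]
  have c_F : ∀ ξ h, b' (Ψ (M.c ξ)) (Ψ (M.F h)) = Ψ (b (M.c ξ) (M.F h)) := by
    intro f h; rw [hc, hF, M.c_F, M'.c_F, map_zero]
  have c_c : ∀ ξ η, b' (Ψ (M.c ξ)) (Ψ (M.c η)) = Ψ (b (M.c ξ) (M.c η)) := by
    intro f h; rw [hc, hc, M.c_c, M'.c_c, hF]
  have S_F : ∀ X h, b' (Ψ (M.S X)) (Ψ (M.F h)) = Ψ (b (M.S X) (M.F h)) := by
    intro f h; rw [hS, hF, M.S_F, M'.S_F, hF]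
  have S_c : ∀ X ξ, b' (Ψ (M.S X)) (Ψ (M.c ξ)) = Ψ (b (M.S X) (M.c ξ)) := by
    intro f h; rw [hS, hc, M.S_c, M'.S_c, hc]
  have S_S : ∀ X Y, b' (Ψ (M.S X)) (Ψ (M.S Y)) = Ψ (b (M.S X) (M.S Y)) := by
    intro f h; rw [hS, hS, hSS]
  have gen : ∀ {k : ℕ} {x : RoyFun g}, x ∈ royDeg g k →
      (∀ f, b' (Ψ x) (Ψ (M.F f)) = Ψ (b x (M.F f))) →
      (∀ ξ, b' (Ψ x) (Ψ (M.c ξ)) = Ψ (b x (M.c ξ))) →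
      (∀ X, b' (Ψ x) (Ψ (M.S X)) = Ψ (b x (M.S X))) →
      ∀ l, ∀ y ∈ royDeg g l, b' (Ψ x) (Ψ y) = Ψ (b x y) := by
    intro k x hx h0 h1 h2 l
    refine Fr.royDeg_induction hm hb (p := fun l y => b' (Ψ x) (Ψ y) = Ψ (b x y)) ?_ h0 ?_ ?_ ?_ l
    · intro l; simp only [map_zero]
    · exact fun l ξ y _ h => leib hx (M.c_mem ξ) (h1 ξ) h
    · exact fun l X y _ h => leib hx (M.S_mem X) (h2 X) h
    · intro l y z _ _ h h'
      simp only [map_add, h, h']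
  refine gen hx (fun f => skew (M.F_mem f) hx ?_) (fun ξ => skew (M.c_mem ξ) hx ?_)
    (fun X => skew (M.S_mem X) hx ?_) l y hy
  · exact gen (M.F_mem f) (F_F f) (fun ξ => skew (M.c_mem ξ) (M.F_mem f) (c_F ξ f))
      (fun X => skew (M.S_mem X) (M.F_mem f) (S_F X f)) k x hx
  · exact gen (M.c_mem ξ) (c_F ξ) (c_c ξ) (fun X => skew (M.S_mem X) (M.c_mem ξ) (S_c X ξ)) k x hx
  · exact gen (M.S_mem X) (S_F X) (S_c X) (S_S X) k x hx

end

end RoyModel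

/-! ## The model given by the graded algebra of operators -/

section OperatorModel

variable {g : LinearMap.BilinForm A P} {B : Type*} [Ring B] [Algebra ℂ B]

namespace CliffordOps

variable (O : CliffordOps g B)

/-- `S` is the spinor part of a compatible pair of connections with vector part `nab`. -/
structure IsSpinConn (nab : Connection ℝ A P) (S : 𝔇 → B) : Prop where
  metric : nab.IsMetric g
  mem : ∀ X, S X ∈ O.par 0
  comm_c : ∀ X ξ, S X * O.c ξ - O.c ξ * S X = O.c (nab.toFun X ξ)
  comm_m : ∀ X f, S X * O.m f - O.m f * S X = O.m (X f)
  add : ∀ X Y, S (X + Y) = S X + S Y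
  smul : ∀ (f : A) X, S (f • X) = O.m f * S X

/-- The normalization of Clifford multiplication. -/
def nrm : ℂ := ((1 / Real.sqrt 2 : ℝ) : ℂ)

lemma nrm_mul_nrm : nrm * nrm = 1 / 2 := by
  rw [nrm, ← Complex.ofReal_mul, div_mul_div_comm, one_mul,
    Real.mul_self_sqrt (by norm_num : (0 : ℝ) ≤ 2)]
  norm_num

lemma nrm_ne_zero : nrm ≠ 0 := by
  intro h
  have := nrm_mul_nrm
  rw [h] at this
  norm_num at this

lemma nc_mem_H (ξ : P) : nrm • O.c ξ ∈ O.H (1 + 1) 1 := smul_mem _ _ (O.c_mem_H ξ)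

variable {O} in
lemma IsSpinConn.mem_H {nab : Connection ℝ A P} {S : 𝔇 → B}
    (h : O.IsSpinConn nab S) (X : 𝔇) : S X ∈ O.H (2 + 1) 0 := by
  refine ⟨h.mem X, fun ξ => ?_⟩
  rw [sc_zero_one, h.comm_c]
  exact O.c_mem_H _

lemma gr_comm {k l : ℕ} {x y : O.filt.Gr} (hx : x ∈ O.filt.grDeg k) (hy : y ∈ O.filt.grDeg l) :
    x * y = (-1 : ℂ) ^ (k * l) • (y * x) := by
  obtain ⟨a, ha, rfl⟩ := O.mem_grDeg.1 hx
  obtain ⟨b, hb, rfl⟩ := O.mem_grDeg.1 hy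
  have h2 := O.mem_W (O.H_mul hb ha)
  rw [add_comm l k] at h2
  rw [Filt.cl_mul (O.mem_W ha) (O.mem_W hb), Filt.cl_mul (O.mem_W hb) (O.mem_W ha), add_comm l k,
    ← Filt.cl_smul _ h2, ← sgn_natCast]
  refine Filt.cl_eq (O.mem_W (O.H_mul ha hb)) (smul_mem _ _ h2) ?_
  exact O.mem_W (O.H_mono (by omega) _ (O.superComm_mem _ _ _ rfl k l a b ha hb))

lemma gr_even_comm {k : ℕ} {x : O.filt.Gr} (hx : x ∈ O.filt.grDeg k) (hk : Even k)
    (y : O.filt.Gr) : x * y = y * x := by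
  induction y using O.gr_induction with
  | cl l a ha =>
    rw [O.gr_comm hx (O.mem_grDeg.2 ⟨a, ha, rfl⟩), (hk.mul_right l).neg_one_pow, one_smul]
  | add y z hy hz => rw [mul_add, add_mul, hy, hz]

lemma gr_mul_mem (k l : ℕ) (x y : O.filt.Gr) (hx : x ∈ O.filt.grDeg k)
    (hy : y ∈ O.filt.grDeg l) : x * y ∈ O.filt.grDeg (k + l) := by
  obtain ⟨a, ha, rfl⟩ := Filt.mem_grDeg.1 hx
  obtain ⟨b, hb, rfl⟩ := Filt.mem_grDeg.1 hy
  rw [Filt.cl_mul ha hb]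
  exact Filt.mem_grDeg.2 ⟨_, O.filt.mul_mem k l a b ha hb, rfl⟩

lemma cl_mem_grDeg {k : ℕ} {p : ZMod 2} {a : B} (ha : a ∈ O.H (k + 1) p) :
    O.filt.cl k a ∈ O.filt.grDeg k := Filt.mem_grDeg.2 ⟨a, O.mem_W ha, rfl⟩

variable {nab : Connection ℝ A P} {S : Derivation ℝ A A → B} (hS : O.IsSpinConn nab S)

/-- The graded algebra of operators as a model. -/
def grModel : Model g nab O.filt.grDeg O.bracket where
  poisson := O.isPoissonBracket_bracket
  mul_mem := O.gr_mul_mem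
  comm k l x y := O.gr_comm
  F :=
    { toFun := fun f => O.filt.cl 0 (O.m f)
      map_one' := by rw [map_one, Filt.cl_one]
      map_mul' := fun f h => by
        rw [Filt.cl_mul (O.mem_W (O.m_mem_H f)) (O.mem_W (O.m_mem_H h)), map_mul]
      map_zero' := by rw [map_zero, Filt.cl_zero]
      map_add' := fun f h => by
        rw [map_add, Filt.cl_add (O.mem_W (O.m_mem_H f)) (O.mem_W (O.m_mem_H h))] }
  c :=
    { toFun := fun ξ => O.filt.cl 1 (nrm • O.c ξ)
      map_zero' := by rw [O.c_zero, smul_zero, Filt.cl_zero]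
      map_add' := fun ξ η => by
        rw [O.c_add, smul_add, Filt.cl_add (O.mem_W (O.nc_mem_H ξ)) (O.mem_W (O.nc_mem_H η))] }
  S :=
    { toFun := fun X => O.filt.cl 2 (S X)
      map_zero' := by
        have : S 0 = 0 := by
          have := hS.smul 0 0
          rwa [zero_smul, map_zero, zero_mul] at this
        rw [this, Filt.cl_zero]
      map_add' := fun X Y => by
        rw [hS.add, Filt.cl_add (O.mem_W (hS.mem_H X)) (O.mem_W (hS.mem_H Y))] }
  c_smul f ξ := by
    change O.filt.cl 1 (nrm • O.c (f • ξ)) = O.filt.cl 0 (O.m f) * O.filt.cl 1 (nrm • O.c ξ)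
    rw [Filt.cl_mul (O.mem_W (O.m_mem_H f)) (O.mem_W (O.nc_mem_H ξ)), O.c_smul, mul_smul_comm]
  S_smul f X := by
    change O.filt.cl 2 (S (f • X)) = O.filt.cl 0 (O.m f) * O.filt.cl 2 (S X)
    rw [Filt.cl_mul (O.mem_W (O.m_mem_H f)) (O.mem_W (hS.mem_H X)), hS.smul]
  F_mem f := O.cl_mem_grDeg (O.m_mem_H f)
  c_mem ξ := O.cl_mem_grDeg (O.nc_mem_H ξ)
  S_mem X := O.cl_mem_grDeg (hS.mem_H X)
  F_F f h := by
    change O.bracket (O.filt.cl 0 (O.m f)) (O.filt.cl 0 (O.m h)) = 0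
    rw [O.bracket_cl (O.m_mem_H f) (O.m_mem_H h), sc_zero_zero, O.m_mul_m, sub_self, Filt.cl_zero]
  c_F ξ f := by
    change O.bracket (O.filt.cl 1 (nrm • O.c ξ)) (O.filt.cl 0 (O.m f)) = 0
    rw [O.bracket_cl (O.nc_mem_H ξ) (O.m_mem_H f), sc_smul_left, sc_one_zero,
      O.m_comm, sub_self, smul_zero, Filt.cl_zero]
  c_c ξ η := by
    change O.bracket (O.filt.cl 1 (nrm • O.c ξ)) (O.filt.cl 1 (nrm • O.c η)) =
      O.filt.cl 0 (O.m (g ξ η))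
    rw [O.bracket_cl (O.nc_mem_H ξ) (O.nc_mem_H η), sc_smul_left, sc_smul_right,
      sc_one_one, O.cliff, smul_smul, smul_smul, nrm_mul_nrm]
    norm_num
  S_F X f := by
    change O.bracket (O.filt.cl 2 (S X)) (O.filt.cl 0 (O.m f)) = O.filt.cl 0 (O.m (X f))
    rw [O.bracket_cl (hS.mem_H X) (O.m_mem_H f), sc_zero_zero, hS.comm_m]
  S_c X ξ := by
    change O.bracket (O.filt.cl 2 (S X)) (O.filt.cl 1 (nrm • O.c ξ)) =
      O.filt.cl 1 (nrm • O.c (nab.toFun X ξ))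
    rw [O.bracket_cl (hS.mem_H X) (O.nc_mem_H ξ), sc_smul_right, sc_zero_one, hS.comm_c]

lemma gr_eq_zero (k : ℕ) (Z : O.filt.Gr) (hZ : Z ∈ O.filt.grDeg (k + 1))
    (h : ∀ ξ, O.bracket Z ((O.grModel hS).c ξ) = 0) : Z = 0 := by
  obtain ⟨D, hD, rfl⟩ := O.mem_grDeg.1 hZ
  refine Filt.cl_eq_zero (O.mem_W (p := ((k + 1 : ℕ) : ZMod 2)) ⟨hD.1, fun ξ => ?_⟩)
  have h1 : O.bracket (O.filt.cl (k + 1) D) (O.filt.cl 1 (nrm • O.c ξ)) = 0 := h ξ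
  have h2 := hD.2 ξ
  rw [O.bracket_cl hD (O.nc_mem_H ξ), sc_smul_right, show k + 1 + 1 - 2 = k by omega,
    Filt.cl_smul _ (O.mem_W h2)] at h1
  exact O.mem_H_of_mem_W (Filt.mem_of_cl_eq_zero (O.mem_W h2)
    ((smul_eq_zero.1 h1).resolve_left nrm_ne_zero)) (O.mem_par h2)

lemma m_algebraMap (c : ℝ) : O.m (algebraMap ℝ A c) = (c : ℂ) • 1 := by
  rw [AlgHom.commutes, algebraMap_eq_smul_one]; rfl

lemma m_smul (c : ℝ) (f : A) : O.m (c • f) = (c : ℂ) • O.m f := by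
  rw [map_smul]; rfl

lemma m_inj' {f h f' h' : A} (e : O.m f + I • O.m h = O.m f' + I • O.m h') : f = f' ∧ h = h' := by
  have := O.m_inj (f - f') (h - h') (by
    rw [map_sub, map_sub, smul_sub, ← sub_eq_zero.2 e]; abel)
  exact ⟨sub_eq_zero.1 this.1, sub_eq_zero.1 this.2⟩

lemma exists_derivations {D : B} (hD : D ∈ O.H 3 0) : ∃ U V : 𝔇,
    ∀ h, D * O.m h - O.m h * D = O.m (U h) + I • O.m (V h) := by
  have key : ∀ h, ∃ u v, D * O.m h - O.m h * D = O.m u + I • O.m v := by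
    intro h
    have := O.superComm_m_mem hD h
    rw [sc_zero_zero] at this
    exact O.H_one_zero this
  choose u v huv using key
  have hadd : ∀ a b, u (a + b) = u a + u b ∧ v (a + b) = v a + v b := by
    intro a b
    refine O.m_inj' ?_
    rw [← huv, map_add, map_add, map_add, smul_add, mul_add, add_mul, add_sub_add_comm, huv, huv]
    abel
  have hsmul : ∀ (c : ℝ) a, u (c • a) = c • u a ∧ v (c • a) = c • v a := by
    intro c a
    refine O.m_inj' ?_
    rw [← huv, O.m_smul, O.m_smul, O.m_smul, smul_comm I, ← smul_add, ← huv, smul_sub,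
      mul_smul_comm, smul_mul_assoc]
  have hmul : ∀ a b, u (a * b) = a • u b + b • u a ∧ v (a * b) = a • v b + b • v a := by
    intro a b
    refine O.m_inj' ?_
    have e : D * O.m (a * b) - O.m (a * b) * D =
        O.m a * (D * O.m b - O.m b * D) + (D * O.m a - O.m a * D) * O.m b := by
      rw [map_mul]; noncomm_ring
    rw [← huv, e, huv, huv, smul_eq_mul, smul_eq_mul, smul_eq_mul, smul_eq_mul, map_add, map_add,
      map_mul, map_mul, map_mul, map_mul, mul_add, add_mul, O.m_mul_m b (u a), O.m_mul_m b (v a),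
      smul_add, mul_smul_comm, smul_mul_assoc]
    abel
  let U : A →ₗ[ℝ] A :=
    { toFun := u
      map_add' := fun a b => (hadd a b).1
      map_smul' := fun c a => (hsmul c a).1 }
  let V : A →ₗ[ℝ] A :=
    { toFun := v
      map_add' := fun a b => (hadd a b).2
      map_smul' := fun c a => (hsmul c a).2 }
  exact ⟨Derivation.mk' U fun a b => (hmul a b).1, Derivation.mk' V fun a b => (hmul a b).2, huv⟩

lemma gr_expand (Y : O.filt.Gr) (hY : Y ∈ O.filt.grDeg 2) (h : A) :
    O.bracket Y ((O.grModel hS).F h) = ∑ j, (O.grModel hS).F (O.frames.X j h) *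
      O.bracket Y ((O.grModel hS).F (O.frames.f j)) := by
  obtain ⟨D, hD, rfl⟩ := O.mem_grDeg.1 hY
  have e : ∀ h, O.bracket (O.filt.cl 2 D) ((O.grModel hS).F h) =
      O.filt.cl 0 (D * O.m h - O.m h * D) := by
    intro h
    refine (O.bracket_cl hD (O.m_mem_H h)).trans ?_
    rw [superComm_zero_right]
  have hD' : D ∈ O.H 3 0 := hD
  obtain ⟨U, V, hUV⟩ := O.exists_derivations hD'
  have hx : ∀ X : 𝔇, X h = ∑ j, O.frames.X j h * X (O.frames.f j) := by
    intro X
    conv_lhs => rw [← O.frames.sum_X X]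
    rw [derivation_sum_apply]
    exact sum_ext fun j => by rw [Derivation.smul_apply, smul_eq_mul, mul_comm]
  have hm : ∀ u v, O.m u + I • O.m v ∈ O.H (0 + 1) 0 := fun u v =>
    add_mem (O.m_mem_H u) (smul_mem _ _ (O.m_mem_H v))
  have hp : ∀ j, (O.grModel hS).F (O.frames.X j h) *
      O.bracket (O.filt.cl 2 D) ((O.grModel hS).F (O.frames.f j)) =
      O.filt.cl 0 (O.m (O.frames.X j h * U (O.frames.f j)) +
        I • O.m (O.frames.X j h * V (O.frames.f j))) := by
    intro j
    rw [e, hUV]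
    change O.filt.cl 0 (O.m (O.frames.X j h)) * _ = _
    rw [Filt.cl_mul (O.mem_W (O.m_mem_H _)) (O.mem_W (hm _ _)), mul_add, map_mul, map_mul,
      mul_smul_comm]
  rw [e, hUV, hx U, hx V, sum_ext fun j => hp j,
    ← Filt.cl_sum _ _ fun j => O.mem_W (hm _ _), sum_add_distrib, ← smul_sum, map_sum,
    map_sum]

lemma exists_splitHom : ∃ Φ : 𝓢 →ₐ[ℝ] O.filt.Gr, (∀ f, Φ (sx (𝔞 f)) = (O.grModel hS).F f) ∧
    (∀ ξ, Φ (sx (ι A ξ)) = (O.grModel hS).c ξ) ∧ ∀ X, Φ (sm X) = (O.grModel hS).S X := by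
  set M := O.grModel hS
  have hF : ∀ f y, M.F f * y = y * M.F f := fun f y => O.gr_even_comm (M.F_mem f) Even.zero y
  obtain ⟨Φ, h1, h2⟩ := exists_extHom (A := A) (P := P) (B := O.filt.Gr)
    { M.F with
      commutes' := fun c => by
        change O.filt.cl 0 (O.m (algebraMap ℝ A c)) = _
        rw [O.m_algebraMap, Filt.cl_smul _ O.filt.one_mem, Filt.cl_one, algebraMap_eq_smul_one]
        rfl } hF M.c M.c_smul (fun ξ => by
      change O.filt.cl 1 (nrm • O.c ξ) * O.filt.cl 1 (nrm • O.c ξ) = 0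
      rw [Filt.cl_mul (O.mem_W (O.nc_mem_H ξ)) (O.mem_W (O.nc_mem_H ξ)), smul_mul_smul_comm]
      have h := O.cliff ξ ξ
      rw [← two_smul ℂ] at h
      rw [smul_right_injective B (two_ne_zero : (2 : ℂ) ≠ 0) h]
      exact Filt.cl_eq_zero (O.mem_W (O.H_mono (by norm_num) 0
        (smul_mem _ _ (O.m_mem_H (g ξ ξ))))))
  obtain ⟨Ψ, h3, h4⟩ := SplitFun.exists_hom Φ (fun f y => by rw [h1]; exact hF f y) M.S
    (fun f X => by rw [h1]; exact M.S_smul f X) fun X y => O.gr_even_comm (M.S_mem X) even_two y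
  exact ⟨Ψ, fun f => by rw [h3, h1]; rfl, fun ξ => by rw [h3, h2], h4⟩

end CliffordOps

end OperatorModel

/-! ## The isomorphism between graded operators and functions on `𝓜` -/

section MainIso

variable {g : LinearMap.BilinForm A P} {B : Type*} [Ring B] [Algebra ℂ B]

lemma Frames.eq_of_pairing (Fr : Frames g) {x y : P} (h : ∀ η, g x η = g y η) : x = y := by
  rw [← Fr.sum_left x, ← Fr.sum_left y]
  exact sum_ext fun i => by rw [Fr.symm, h, Fr.symm]

lemma algebraMap_shift_injective : Function.Injective 𝔞Λ :=
  (ExteriorAlgebra.algebraMap_leftInverse P).injective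

namespace CliffordOps

variable (O : CliffordOps g B)

lemma c_mul_c_comm (x y ξ : P) : O.c x * O.c y * O.c ξ - O.c ξ * (O.c x * O.c y) =
    (2 : ℂ) • O.c (g y ξ • x - g x ξ • y) := by
  have h1 : O.c x * O.c y * O.c ξ - O.c ξ * (O.c x * O.c y) =
      O.c x * (O.c y * O.c ξ + O.c ξ * O.c y) - (O.c x * O.c ξ + O.c ξ * O.c x) * O.c y := by
    noncomm_ring
  rw [h1, O.cliff, O.cliff, O.c_sub, O.c_smul, O.c_smul, mul_smul_comm, smul_mul_assoc, ← O.m_comm,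
    smul_sub]

lemma spin_comm {τ : P → P} (hτ : ∀ ξ η, g (τ ξ) η = -g ξ (τ η)) (ξ : P) :
    (∑ i, O.c (τ (O.frames.e i)) * O.c (O.frames.e' i)) * O.c ξ -
      O.c ξ * ∑ i, O.c (τ (O.frames.e i)) * O.c (O.frames.e' i) = (4 : ℂ) • O.c (τ ξ) := by
  have h1 : ∑ i, g (O.frames.e' i) ξ • τ (O.frames.e i) = τ ξ := by
    refine O.frames.eq_of_pairing fun η => ?_
    conv_rhs => rw [hτ]
    conv_rhs => rw [← O.frames.sum_left ξ]
    simp only [map_sum, map_smul, lm_sum, lm_smul]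
    rw [← Finset.sum_neg_distrib]
    exact sum_ext fun i => by rw [hτ, smul_neg]
  have h2 : ∑ i, g (τ (O.frames.e i)) ξ • O.frames.e' i = -τ ξ := by
    conv_rhs => rw [← O.frames.sum_right (τ ξ)]
    rw [← Finset.sum_neg_distrib]
    exact sum_ext fun i => by rw [hτ, neg_smul]
  rw [sum_mul, mul_sum, ← sum_sub_distrib]
  simp only [c_mul_c_comm]
  rw [← smul_sum, ← O.c_sum, sum_sub_distrib, h1, h2, sub_neg_eq_add, O.c_add,
    ← two_smul ℂ, smul_smul]
  norm_num

variable {nab : Connection ℝ A P} {S : Derivation ℝ A A → B} (hS : O.IsSpinConn nab S)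

include hS in
lemma symbol_of_metricField {Φ : 𝓢 →ₐ[ℝ] O.filt.Gr} (h0 : ∀ f, Φ (sx (𝔞 f)) = O.filt.cl 0 (O.m f))
    (h1 : ∀ ξ, Φ (sx (ι A ξ)) = O.filt.cl 1 (nrm • O.c ξ))
    (h2 : ∀ X, Φ (sm X) = O.filt.cl 2 (S X)) {V : 𝔛 2} {T : P → P}
    (hV : IsMetricField g V T) {D : B} (hD : D ∈ O.par 0)
    (hDc : ∀ ξ, D * O.c ξ - O.c ξ * D = O.c (T ξ)) : Φ (O.frames.kap nab V.1) = O.filt.cl 2 D := by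
  set Fr := O.frames
  choose v hv using fun f => vf_two_algebraMap V f
  set w : P → P := fun ξ => T ξ - ∑ j, v (Fr.f j) • nab.toFun (Fr.X j) ξ with hw
  have hvert : ∀ i, Fr.vert nab i V.1 = ι A (w (Fr.e i)) := by
    intro i
    rw [Fr.vert_apply, hV.lin, hw, map_sub, map_sum]
    congr 1
    exact sum_ext fun j => by rw [hv, map_smul, smul_def]
  have hexp : ∀ h, v h = ∑ j, Fr.X j h * v (Fr.f j) := by
    intro h
    apply algebraMap_shift_injective (A := A) (P := P)
    rw [← hv, Fr.vf_expand V h, map_sum]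
    exact sum_ext fun j => by rw [hv, map_mul, smul_def]
  have hskew : ∀ ξ η, g (w ξ) η = -g ξ (w η) := by
    intro ξ η
    have e1 : v (g ξ η) = g (T ξ) η + g ξ (T η) := by
      apply algebraMap_shift_injective (A := A) (P := P)
      rw [← hv, hV.metric]
    rw [hexp] at e1
    simp only [hS.metric _ ξ η] at e1
    rw [hw]
    simp only [map_sub, map_sum, map_smul, lm_sub, lm_sum, lm_smul, smul_eq_mul]
    have e2 : ∑ j, (g (nab.toFun (Fr.X j) ξ) η + g ξ (nab.toFun (Fr.X j) η)) * v (Fr.f j) =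
        ∑ j, v (Fr.f j) * g (nab.toFun (Fr.X j) ξ) η +
          ∑ j, v (Fr.f j) * g ξ (nab.toFun (Fr.X j) η) := by
      rw [← sum_add_distrib]
      exact sum_ext fun j => by ring
    rw [e2] at e1
    linear_combination -e1
  have hSm : ∀ j, O.m (v (Fr.f j)) * S (Fr.X j) ∈ O.H (2 + 1) 0 := fun j => by
    have := O.H_mul (i := 0) (O.m_mem_H (v (Fr.f j))) (hS.mem_H (Fr.X j))
    rwa [zero_add, zero_add] at this
  have hcm : ∀ i, O.c (w (Fr.e i)) * O.c (Fr.e' i) ∈ O.H (2 + 1) 0 := fun i =>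
    O.H_mul (i := 1) (j := 1) (O.c_mem_H _) (O.c_mem_H _)
  have hQ : ∑ j, O.m (v (Fr.f j)) * S (Fr.X j) +
      (1 / 4 : ℂ) • ∑ i, O.c (w (Fr.e i)) * O.c (Fr.e' i) ∈ O.H (2 + 1) 0 :=
    add_mem (sum_mem fun j _ => hSm j)
      (smul_mem _ _ (sum_mem fun i _ => hcm i))
  have hlhs : Φ (Fr.kap nab V.1) = O.filt.cl 2 (∑ j, O.m (v (Fr.f j)) * S (Fr.X j) +
      (1 / 4 : ℂ) • ∑ i, O.c (w (Fr.e i)) * O.c (Fr.e' i)) := by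
    rw [Fr.kap_apply, map_add, map_sum, map_smul, map_sum,
      Filt.cl_add (O.mem_W (sum_mem fun j _ => hSm j))
        (O.mem_W (smul_mem _ _ (sum_mem fun i _ => hcm i))),
      Filt.cl_sum _ _ fun j => O.mem_W (hSm j),
      Filt.cl_smul _ (O.mem_W (sum_mem fun i _ => hcm i)),
      Filt.cl_sum _ _ fun i => O.mem_W (hcm i)]
    congr 1
    · refine sum_ext fun j => ?_
      rw [map_mul, hv, h0, h2, Filt.cl_mul (O.mem_W (O.m_mem_H _)) (O.mem_W (hS.mem_H _))]
    · have : ∀ i, Φ (sx (Fr.vert nab i V.1) *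
          sx (ι A (Fr.e' i))) =
          (1 / 2 : ℂ) • O.filt.cl 2 (O.c (w (Fr.e i)) * O.c (Fr.e' i)) := by
        intro i
        rw [map_mul, hvert, h1, h1, Filt.cl_mul (O.mem_W (O.nc_mem_H _)) (O.mem_W (O.nc_mem_H _)),
          smul_mul_smul_comm, nrm_mul_nrm, ← Filt.cl_smul _ (O.mem_W (hcm i))]
      rw [sum_ext fun i => this i, ← smul_sum]
      have hr : ∀ z : O.filt.Gr, (1 / 2 : ℝ) • z = ((1 / 2 : ℝ) : ℂ) • z := fun _ => rfl
      rw [hr, smul_smul]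
      norm_num
  rw [hlhs]
  refine (Filt.cl_eq (O.mem_W (p := 0) ⟨hD, fun ξ => ?_⟩) (O.mem_W hQ)
    (O.mem_W (p := 0) (O.H_mono (by norm_num : 1 ≤ 2) 0
      ⟨sub_mem hD (O.mem_par hQ), fun ξ => ?_⟩))).symm
  · rw [sc_zero_one, hDc]; exact O.c_mem_H _
  · rw [sc_zero_one]
    change _ = _
    have e1 : (∑ j, O.m (v (Fr.f j)) * S (Fr.X j)) * O.c ξ -
        O.c ξ * ∑ j, O.m (v (Fr.f j)) * S (Fr.X j) =
        O.c (∑ j, v (Fr.f j) • nab.toFun (Fr.X j) ξ) := by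
      rw [sum_mul, mul_sum, ← sum_sub_distrib, O.c_sum]
      refine sum_ext fun j => ?_
      rw [O.c_smul, ← hS.comm_c, mul_sub, ← mul_assoc (O.c ξ), ← O.m_comm]
      noncomm_ring
    have e2 := O.spin_comm hskew ξ
    have e3 : ∀ X Y Z C : B, (X - (Y + (1 / 4 : ℂ) • Z)) * C - C * (X - (Y + (1 / 4 : ℂ) • Z)) =
        (X * C - C * X) - (Y * C - C * Y) - (1 / 4 : ℂ) • (Z * C - C * Z) := by
      intro X Y Z C
      simp only [sub_mul, mul_sub, add_mul, mul_add, smul_mul_assoc, mul_smul_comm, smul_sub]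
      abel
    rw [e3, hDc, e1, e2, smul_smul, ← O.c_sub, show (1 / 4 * 4 : ℂ) = 1 by norm_num, one_smul]
    exact sub_self _

end CliffordOps

end MainIso

section MainIso

variable {g : LinearMap.BilinForm A P} {B : Type*} [Ring B] [Algebra ℂ B]

lemma mem_baseChange_iff {Q : Type*} [AddCommGroup Q] [Module ℝ Q] {p : Submodule ℝ Q}
    {x : ℂ ⊗[ℝ] Q} : x ∈ p.baseChange ℂ ↔ ∃ a ∈ p, ∃ b ∈ p, x = (1 : ℂ) ⊗ₜ[ℝ] a + I ⊗ₜ[ℝ] b := by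
  constructor
  · intro hx
    rw [Submodule.baseChange_eq_span] at hx
    induction hx using span_induction with
    | mem x hx =>
      obtain ⟨a, ha, rfl⟩ := hx
      exact ⟨a, ha, 0, p.zero_mem, by simp⟩
    | zero => exact ⟨0, p.zero_mem, 0, p.zero_mem, by simp⟩
    | add x y _ _ hx hy =>
      obtain ⟨a, ha, b, hb, rfl⟩ := hx
      obtain ⟨a', ha', b', hb', rfl⟩ := hy
      refine ⟨_, p.add_mem ha ha', _, p.add_mem hb hb', ?_⟩
      rw [tmul_add, tmul_add]
      abel
    | smul z x _ hx =>
      obtain ⟨a, ha, b, hb, rfl⟩ := hx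
      refine ⟨z.re • a - z.im • b, p.sub_mem (p.smul_mem _ ha) (p.smul_mem _ hb),
        z.im • a + z.re • b, p.add_mem (p.smul_mem _ ha) (p.smul_mem _ hb), ?_⟩
      have h1 : z • (1 : ℂ) = z.re • 1 + z.im • I := by
        apply Complex.ext <;> simp
      have h2 : z • I = z.re • I - z.im • 1 := by
        apply Complex.ext <;> simp
      rw [smul_add, smul_tmul', smul_tmul', h1, h2,
        TensorProduct.add_tmul, TensorProduct.sub_tmul, tmul_sub,
        tmul_add, smul_tmul, smul_tmul,
        smul_tmul, smul_tmul]
      abel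
  · rintro ⟨a, ha, b, hb, rfl⟩
    exact add_mem (tmul_mem_baseChange_of_mem _ ha)
      (tmul_mem_baseChange_of_mem _ hb)

namespace CliffordOps

variable (O : CliffordOps g B)

lemma W_zero {D : B} (h : D ∈ O.filt.W 0) : D = 0 := by
  change D ∈ stepFilt O.par O.c 0 at h
  rw [stepFilt_zero] at h
  exact (mem_bot ℂ).1 h

lemma grDeg_zero {Y : O.filt.Gr} (hY : Y ∈ O.filt.grDeg 0) :
    ∃ f h, Y = O.filt.cl 0 (O.m f) + I • O.filt.cl 0 (O.m h) := by
  obtain ⟨D, hD, rfl⟩ := O.mem_grDeg.1 hY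
  rw [Nat.cast_zero] at hD
  obtain ⟨f, h, e⟩ := O.H_one_zero hD
  have h1 := O.mem_W (O.m_mem_H f)
  have h2 := O.mem_W (O.m_mem_H h)
  refine ⟨f, h, ?_⟩
  rw [e, Filt.cl_add h1 (smul_mem _ I h2), Filt.cl_smul _ h2]

variable {nab : Connection ℝ A P} {S : Derivation ℝ A A → B} (hS : O.IsSpinConn nab S)
  {b : RoyFun g →ₗ[ℝ] RoyFun g →ₗ[ℝ] RoyFun g}
  (hb : IsRestrictedBracket g (CotFun.bracket A P) b)

/-- A homomorphism from functions on `𝓜` to graded operators which is given on generators by the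
spinor connection. -/
structure IsQuant (Ψ : RoyFun g →ₐ[ℝ] O.filt.Gr) : Prop where
  F : ∀ f, Ψ ((O.frames.royModel hS.metric hb).F f) = (O.grModel hS).F f
  c : ∀ ξ, Ψ ((O.frames.royModel hS.metric hb).c ξ) = (O.grModel hS).c ξ
  S : ∀ X, Ψ ((O.frames.royModel hS.metric hb).S X) = (O.grModel hS).S X
  field : ∀ (V : 𝔛 2) (T : P → P) (D : B), IsMetricField g V T → D ∈ O.par 0 →
    (∀ ξ, D * O.c ξ - O.c ξ * D = O.c (T ξ)) → Ψ (restrict g (mom V)) = O.filt.cl 2 D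

lemma exists_quant : ∃ Ψ, O.IsQuant hS hb Ψ := by
  obtain ⟨Φ, h0, h1, h2⟩ := O.exists_splitHom hS
  obtain ⟨Θ, t0, t1, t2⟩ := O.frames.exists_xiEquiv nab
  refine ⟨Φ.comp Θ.symm.toAlgHom, fun f => ?_, fun ξ => ?_, fun X => ?_, fun V T D hV hD hDc => ?_⟩
  · exact (congrArg Φ (t1 _)).trans (h0 f)
  · exact (congrArg Φ (t1 _)).trans (h1 ξ)
  · refine Eq.trans ?_ (h2 X)
    change Φ (Θ.symm (xi g nab (sm X))) = _
    rw [← t0, Θ.symm_apply_apply]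
  · change Φ (Θ.symm (restrict g (mom V))) = _
    rw [t2]
    exact O.symbol_of_metricField hS h0 h1 h2 hV hD hDc

variable {O hS hb} {Ψ : RoyFun g →ₐ[ℝ] O.filt.Gr} (hΨ : O.IsQuant hS hb Ψ)

namespace IsQuant

include hΨ

lemma mem {k : ℕ} {x : RoyFun g} (hx : x ∈ royDeg g k) : Ψ x ∈ O.filt.grDeg k :=
  O.frames.roy_hom_mem hS.metric hb (O.grModel hS) Ψ hΨ.F hΨ.c hΨ.S k x hx

lemma bracket_deg {k l : ℕ} {x y : RoyFun g} (hx : x ∈ royDeg g k) (hy : y ∈ royDeg g l) :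
    O.bracket (Ψ x) (Ψ y) = Ψ (b x y) := by
  refine O.frames.roy_hom_bracket hS.metric hb (O.grModel hS) Ψ hΨ.F hΨ.c hΨ.S (fun X Y => ?_)
    hx hy
  change O.bracket (O.filt.cl 2 (S X)) (O.filt.cl 2 (S Y)) =
    Ψ (b (xi g nab (sm X)) (xi g nab (sm Y)))
  have hX := isMetricField_horLift (g := g) hS.metric X
  have hY := isMetricField_horLift (g := g) hS.metric Y
  have hXY := O.bracket_mem (hS.mem_H X) (hS.mem_H Y)
  rw [sc_zero_zero] at hXY
  rw [xi_mom, xi_mom, hX.roy_mom hb hY, O.bracket_cl (hS.mem_H X) (hS.mem_H Y), sc_zero_zero]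
  refine (hΨ.field _ _ _ (hX.commutator hY) (O.mem_par hXY) fun ξ => ?_).symm
  have e : ∀ a b c : B, (a * b - b * a) * c - c * (a * b - b * a) =
      (a * (b * c - c * b) - (b * c - c * b) * a) - (b * (a * c - c * a) - (a * c - c * a) * b) := by
    intro a b c; noncomm_ring
  rw [e, hS.comm_c, hS.comm_c, hS.comm_c, hS.comm_c, ← O.c_sub]

lemma eq_zero (k : ℕ) : ∀ x ∈ royDeg g k, ∀ y ∈ royDeg g k, Ψ x + I • Ψ y = 0 → x = 0 ∧ y = 0 := by
  set M := O.frames.royModel hS.metric hb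
  set M' := O.grModel hS
  induction k using Nat.strong_induction_on with
  | _ k ih =>
  intro x hx y hy h
  cases k with
  | zero =>
    have hF : ∀ k, ∀ x ∈ royDeg g k, k = 0 → ∃ f, x = M.F f := by
      intro k
      refine O.frames.royDeg_induction hS.metric hb (p := fun k x => k = 0 → ∃ f, x = M.F f)
        ?_ ?_ ?_ ?_ ?_ k
      · exact fun _ _ => ⟨0, (map_zero _).symm⟩
      · exact fun f _ => ⟨f, rfl⟩
      · exact fun k _ _ _ _ h => absurd h k.succ_ne_zero
      · exact fun k _ _ _ _ h => absurd h (by omega)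
      · intro k y z _ _ h h' hk
        obtain ⟨f, rfl⟩ := h hk
        obtain ⟨f', rfl⟩ := h' hk
        exact ⟨f + f', (map_add _ _ _).symm⟩
    obtain ⟨f, rfl⟩ := hF 0 x hx rfl
    obtain ⟨f', rfl⟩ := hF 0 y hy rfl
    rw [hΨ.F, hΨ.F] at h
    replace h : O.filt.cl 0 (O.m f) + I • O.filt.cl 0 (O.m f') = 0 := h
    rw [← Filt.cl_smul _ (O.mem_W (O.m_mem_H f')), ← Filt.cl_add (O.mem_W (O.m_mem_H f))
      (smul_mem _ _ (O.mem_W (O.m_mem_H f')))] at h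
    obtain ⟨rfl, rfl⟩ := O.m_inj f f' (O.W_zero (Filt.mem_of_cl_eq_zero (Submodule.add_mem _
      (O.mem_W (O.m_mem_H f)) (smul_mem _ _ (O.mem_W (O.m_mem_H f')))) h))
    simp
  | succ k =>
    have hc : ∀ ξ, b x (M.c ξ) = 0 ∧ b y (M.c ξ) = 0 := by
      intro ξ
      refine ih k (Nat.lt_succ_self k) _ (M.bc_mem hx ξ) _ (M.bc_mem hy ξ) ?_
      rw [← hΨ.bracket_deg hx (M.c_mem ξ), ← hΨ.bracket_deg hy (M.c_mem ξ), ← lm_smul,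
        ← map_smul, ← lm_add, ← map_add, h, map_zero, LinearMap.zero_apply]
    have hF : ∀ f, b x (M.F f) = 0 ∧ b y (M.F f) = 0 := by
      intro f
      by_cases hk : k + 1 < 2
      · exact ⟨M.bF_eq_zero hx f hk, M.bF_eq_zero hy f hk⟩
      refine ih (k + 1 - 2) (by omega) _ (M.bF_mem hx f) _ (M.bF_mem hy f) ?_
      rw [← hΨ.bracket_deg hx (M.F_mem f), ← hΨ.bracket_deg hy (M.F_mem f), ← lm_smul,
        ← map_smul, ← lm_add, ← map_add, h, map_zero, LinearMap.zero_apply]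
    exact ⟨O.frames.roy_eq_zero hS.metric hb hx (fun ξ => (hc ξ).1) fun f => (hF f).1,
      O.frames.roy_eq_zero hS.metric hb hy (fun ξ => (hc ξ).2) fun f => (hF f).2⟩

lemma surj (k : ℕ) : ∀ Y ∈ O.filt.grDeg k, ∃ x ∈ royDeg g k, ∃ y ∈ royDeg g k,
    Y = Ψ x + I • Ψ y := by
  set M := O.frames.royModel hS.metric hb
  set M' := O.grModel hS
  let T : ℕ → Submodule ℂ O.filt.Gr := fun k => Submodule.span ℂ (Ψ '' royDeg g k)
  have hT : ∀ k, ∀ x ∈ royDeg g k, Ψ x ∈ T k := fun k x hx => subset_span ⟨x, hx, rfl⟩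
  have hmul : ∀ {k l : ℕ} {x y : O.filt.Gr}, x ∈ T k → y ∈ T l → x * y ∈ T (k + l) := by
    intro k l x y hx hy
    have h := mul_mem_mul hx hy
    rw [span_mul_span] at h
    refine span_mono ?_ h
    rintro _ ⟨_, ⟨x, hx, rfl⟩, _, ⟨y, hy, rfl⟩, rfl⟩
    exact ⟨x * y, royDeg_mul hx hy, map_mul Ψ x y⟩
  have hspan : ∀ {p : O.filt.Gr → Prop}, (∀ x ∈ royDeg g k, p (Ψ x)) → p 0 →
      (∀ x y, p x → p y → p (x + y)) → (∀ (z : ℂ) x, p x → p (z • x)) → ∀ Y ∈ T k, p Y := by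
    intro p h1 h2 h3 h4 Y hY
    induction hY using span_induction with
    | mem Y hY => obtain ⟨x, hx, rfl⟩ := hY; exact h1 x hx
    | zero => exact h2
    | add x y _ _ hx hy => exact h3 x y hx hy
    | smul z x _ hx => exact h4 z x hx
  clear_value T
  have key : ∀ Y ∈ O.filt.grDeg k, Y ∈ T k := by
    clear hspan
    induction k using Nat.strong_induction_on with
    | _ k ih =>
    intro Y hY
    rcases Nat.eq_zero_or_pos k with rfl | hk
    · obtain ⟨f, h, rfl⟩ := O.grDeg_zero hY
      have hF : ∀ f, O.filt.cl 0 (O.m f) ∈ T 0 := fun f => by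
        have e : Ψ (M.F f) = O.filt.cl 0 (O.m f) := hΨ.F f
        rw [← e]
        exact hT 0 _ (M.F_mem f)
      exact (T 0).add_mem (hF f) ((T 0).smul_mem _ (hF h))
    · have hc : ∀ ξ, M'.c ξ ∈ T 1 := fun ξ => by
        have := hT 1 _ (M.c_mem ξ); rwa [hΨ.c] at this
      have hSX : ∀ X, M'.S X ∈ T 2 := fun X => by
        have := hT 2 _ (M.S_mem X); rwa [hΨ.S] at this
      have hcc : ∀ ξ η, M'.c ξ * M'.c η ∈ T 2 := fun ξ η => hmul (k := 1) (l := 1) (hc ξ) (hc η)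
      have hR : ∀ j, M'.R O.frames j ∈ T 2 := fun j => by
        rw [Model.R]
        exact (T 2).sub_mem ((T 2).smul_mem _ (hSX _)) ((T 2).sum_mem fun i _ => hcc _ _)
      have h := M'.euler O.frames hS.metric (O.gr_eq_zero hS) (O.gr_expand hS) k Y hY
      have hk0 : (k : ℂ) ≠ 0 := Nat.cast_ne_zero.2 hk.ne'
      have h2 : Y = (k : ℂ)⁻¹ • M'.E O.frames Y := by rw [h, smul_smul, inv_mul_cancel₀ hk0, one_smul]
      rw [h2]
      refine (T k).smul_mem _ ((T k).add_mem ((T k).sum_mem fun i _ => ?_)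
        ((T k).sum_mem fun j _ => ?_))
      · have := hmul (ih (k - 1) (by omega) _ (M'.bc_mem hY (O.frames.e' i))) (hc (O.frames.e i))
        rwa [show k - 1 + 1 = k by omega] at this
      · by_cases hk2 : k < 2
        · rw [M'.bF_eq_zero hY _ hk2, zero_mul]
          exact zero_mem _
        · have := hmul (ih (k - 2) (by omega) _ (M'.bF_mem hY (O.frames.f j))) (hR j)
          rwa [show k - 2 + 2 = k by omega] at this
  intro Y hY
  refine hspan (p := fun Y => ∃ x ∈ royDeg g k, ∃ y ∈ royDeg g k, Y = Ψ x + I • Ψ y)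
    ?_ ?_ ?_ ?_ Y (key Y hY)
  · exact fun x hx => ⟨x, hx, 0, zero_mem _, by rw [map_zero, smul_zero, add_zero]⟩
  · exact ⟨0, zero_mem _, 0, zero_mem _, by simp⟩
  · rintro _ _ ⟨a, ha, b, hb, rfl⟩ ⟨a', ha', b', hb', rfl⟩
    refine ⟨_, add_mem ha ha', _, add_mem hb hb', ?_⟩
    rw [map_add, map_add, smul_add]
    abel
  · rintro z _ ⟨a, ha, b, hb, rfl⟩
    refine ⟨z.re • a - z.im • b,
      sub_mem (smul_mem _ _ ha) (smul_mem _ _ hb),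
      z.im • a + z.re • b,
      add_mem (smul_mem _ _ ha) (smul_mem _ _ hb), ?_⟩
    have hr : ∀ (r : ℝ) (u : O.filt.Gr), r • u = (r : ℂ) • u := fun _ _ => rfl
    rw [map_sub, map_add, map_smul, map_smul, map_smul, map_smul, hr, hr, hr, hr]
    conv_lhs => rw [← Complex.re_add_im z]
    simp only [smul_add, add_smul, smul_smul]
    rw [add_mul, add_smul, mul_assoc, Complex.I_mul_I, mul_comm I, mul_comm I, mul_neg_one, neg_smul]
    abel

end IsQuant

end CliffordOps

end MainIso

section MainIso

variable {g : LinearMap.BilinForm A P} {B : Type*} [Ring B] [Algebra ℂ B]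

lemma Frames.roy_iSup_induction (Fr : Frames g) (nab : Connection ℝ A P) {p : RoyFun g → Prop}
    (deg : ∀ k, ∀ x ∈ royDeg g k, p x) (add : ∀ x y, p x → p y → p (x + y)) (x : RoyFun g) : p x := by
  obtain ⟨Θ, h0, h1, h2⟩ := Fr.exists_xiEquiv nab
  have key : ∀ y : 𝓢, p (Θ y) := by
    intro y
    have hy := iSup_splitDeg y
    induction hy using Submodule.iSup_induction' with
    | mem k y hy =>
      refine deg k _ ?_
      rw [Fr.royDeg_eq nab k, h0]
      exact ⟨y, hy, rfl⟩
    | zero => rw [map_zero]; exact deg 0 _ (zero_mem _)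
    | add y z _ _ hy hz => rw [map_add]; exact add _ _ hy hz
  have := key (Θ.symm x)
  rwa [Θ.apply_symm_apply] at this

namespace CliffordOps

variable {O : CliffordOps g B} {nab : Connection ℝ A P} {S : Derivation ℝ A A → B}
  {hS : O.IsSpinConn nab S} {b : RoyFun g →ₗ[ℝ] RoyFun g →ₗ[ℝ] RoyFun g}
  {hb : IsRestrictedBracket g (CotFun.bracket A P) b}
  {Ψ : RoyFun g →ₐ[ℝ] O.filt.Gr} (hΨ : O.IsQuant hS hb Ψ)

/-- The complex-linear extension of a homomorphism to graded operators. -/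
def cplx (Ψ : RoyFun g →ₐ[ℝ] O.filt.Gr) : ℂ ⊗[ℝ] RoyFun g →ₐ[ℂ] O.filt.Gr :=
  Algebra.TensorProduct.lift (Algebra.ofId ℂ _) Ψ fun z x =>
    show Commute (Algebra.ofId ℂ O.filt.Gr z) (Ψ x) from commutes z (Ψ x)

lemma cplx_tmul (Ψ : RoyFun g →ₐ[ℝ] O.filt.Gr) (z : ℂ) (x : RoyFun g) :
    cplx Ψ (z ⊗ₜ x) = z • Ψ x := by
  rw [cplx, Algebra.TensorProduct.lift_tmul, smul_def]; rfl

namespace IsQuant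

include hΨ

lemma bracket_eq (x y : RoyFun g) : O.bracket (Ψ x) (Ψ y) = Ψ (b x y) := by
  induction x using O.frames.roy_iSup_induction nab with
  | deg k x hx =>
    induction y using O.frames.roy_iSup_induction nab with
    | deg l y hy => exact hΨ.bracket_deg hx hy
    | add y y' h h' => simp only [map_add, h, h']
  | add x x' h h' => simp only [map_add, lm_add, h, h']

lemma cplx_bracket (x y : ℂ ⊗[ℝ] RoyFun g) : O.bracket (cplx Ψ x) (cplx Ψ y) =
    cplx Ψ (LinearMap.BilinMap.baseChange ℂ b x y) := by
  induction x using TensorProduct.induction_on with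
  | zero => simp
  | add x x' h h' => simp only [map_add, lm_add, h, h']
  | tmul z x =>
    induction y using TensorProduct.induction_on with
    | zero => simp
    | add y y' h h' => simp only [map_add, h, h']
    | tmul w y =>
      rw [LinearMap.BilinMap.baseChange_tmul, cplx_tmul, cplx_tmul, cplx_tmul, map_smul, map_smul,
        lm_smul, hΨ.bracket_eq, smul_smul, mul_comm]

lemma cplx_eq_zero {k : ℕ} {x : ℂ ⊗[ℝ] RoyFun g} (hx : x ∈ (royDeg g k).baseChange ℂ)
    (h : cplx Ψ x = 0) : x = 0 := by
  obtain ⟨u, hu, v, hv, rfl⟩ := mem_baseChange_iff.1 hx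
  rw [map_add, cplx_tmul, cplx_tmul, one_smul] at h
  obtain ⟨rfl, rfl⟩ := hΨ.eq_zero k u hu v hv h
  simp

lemma cplx_surj {k : ℕ} {Y : O.filt.Gr} (hY : Y ∈ O.filt.grDeg k) :
    ∃ x ∈ (royDeg g k).baseChange ℂ, cplx Ψ x = Y := by
  obtain ⟨u, hu, v, hv, rfl⟩ := hΨ.surj k Y hY
  exact ⟨_, mem_baseChange_iff.2 ⟨u, hu, v, hv, rfl⟩, by
    rw [map_add, cplx_tmul, cplx_tmul, one_smul]⟩

lemma cplx_mem {k : ℕ} {x : ℂ ⊗[ℝ] RoyFun g} (hx : x ∈ (royDeg g k).baseChange ℂ) :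
    cplx Ψ x ∈ O.filt.grDeg k := by
  obtain ⟨u, hu, v, hv, rfl⟩ := mem_baseChange_iff.1 hx
  rw [map_add, cplx_tmul, cplx_tmul]
  exact add_mem (smul_mem _ _ (hΨ.mem hu))
    (smul_mem _ _ (hΨ.mem hv))

lemma exists_inverse : ∃ L : O.filt.Gr →ₗ[ℂ] ℂ ⊗[ℝ] RoyFun g, ∀ k,
    ∀ x ∈ (royDeg g k).baseChange ℂ, L (cplx Ψ x) = x := by
  have key : ∀ k, ∃ L : O.filt.Piece k →ₗ[ℂ] ℂ ⊗[ℝ] RoyFun g, ∀ Y,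
      L Y ∈ (royDeg g k).baseChange ℂ ∧ cplx Ψ (L Y) = DirectSum.lof ℂ ℕ O.filt.Piece k Y := by
    intro k
    refine exists_linearMap_of_rel (fun Y x => x ∈ (royDeg g k).baseChange ℂ ∧
      cplx Ψ x = DirectSum.lof ℂ ℕ O.filt.Piece k Y) (fun Y => ?_) ?_ ?_ ?_
    · obtain ⟨D, rfl⟩ := O.filt.pieceMk_surjective k Y
      exact hΨ.cplx_surj ⟨D, rfl⟩
    · rintro Y Y' x x' ⟨h1, h2⟩ ⟨h1', h2'⟩
      exact ⟨add_mem h1 h1', by rw [map_add, map_add, h2, h2']⟩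
    · rintro z Y x ⟨h1, h2⟩
      exact ⟨smul_mem _ z h1, by rw [map_smul, map_smul, h2]⟩
    · rintro Y x x' ⟨h1, h2⟩ ⟨h1', h2'⟩
      exact sub_eq_zero.1 (hΨ.cplx_eq_zero (sub_mem h1 h1') (by
        rw [map_sub, h2, h2', sub_self]))
  choose L hL using key
  refine ⟨DirectSum.toModule ℂ ℕ _ L, fun k x hx => ?_⟩
  obtain ⟨D, hD⟩ := hΨ.cplx_mem hx
  rw [← hD, Filt.grMk, lm_comp, DirectSum.toModule_lof]
  refine sub_eq_zero.1 (hΨ.cplx_eq_zero (sub_mem (hL k _).1 hx) ?_)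
  rw [map_sub, (hL k _).2, ← hD]
  exact sub_self _

lemma cplx_bijective : Function.Bijective (cplx Ψ) := by
  constructor
  · obtain ⟨L, hL⟩ := hΨ.exists_inverse
    refine Function.LeftInverse.injective (g := L) fun x => ?_
    induction x using TensorProduct.induction_on with
    | zero => simp
    | add x y hx hy => rw [map_add, map_add, hx, hy]
    | tmul z x =>
      induction x using O.frames.roy_iSup_induction nab with
      | deg k x hx => exact hL k _ (tmul_mem_baseChange_of_mem z hx)
      | add x y hx hy => rw [tmul_add, map_add, map_add, hx, hy]
  · intro Y
    induction Y using O.gr_induction with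
    | cl k a ha =>
      obtain ⟨x, _, hx⟩ := hΨ.cplx_surj (O.cl_mem_grDeg ha)
      exact ⟨x, hx⟩
    | add x y hx hy =>
      obtain ⟨x, rfl⟩ := hx
      obtain ⟨y, rfl⟩ := hy
      exact ⟨x + y, map_add _ _ _⟩

end IsQuant

variable (hS hb) in
include hS hb in
lemma exists_iso : ∃ ρ : O.filt.Gr ≃ₐ[ℂ] ℂ ⊗[ℝ] RoyFun g,
    (∀ k, (O.filt.grDeg k).map ρ.toLinearMap = (royDeg g k).baseChange ℂ) ∧
    (∀ x y, ρ (O.bracket x y) = LinearMap.BilinMap.baseChange ℂ b (ρ x) (ρ y)) ∧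
    (∀ f, ρ (O.filt.cl 0 (O.m f)) = complexify (restrict g (fn (𝔞 f)))) ∧
    (∀ ξ, ρ (O.filt.cl 1 (nrm • O.c ξ)) = complexify (restrict g (fn (ι A ξ)))) ∧
    ∀ nab' S', O.IsSpinConn nab' S' → ∀ X, ρ (O.filt.cl 2 (S' X)) =
      complexify (restrict g (mom (horLift nab' X))) := by
  obtain ⟨Ψ, hΨ⟩ := O.exists_quant hS hb
  let e : ℂ ⊗[ℝ] RoyFun g ≃ₐ[ℂ] O.filt.Gr := AlgEquiv.ofBijective (cplx Ψ) hΨ.cplx_bijective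
  have he : ∀ x, e x = cplx Ψ x := fun x => rfl
  have hc : ∀ x Y, Ψ x = Y → e.symm Y = complexify x := by
    rintro x _ rfl
    rw [AlgEquiv.symm_apply_eq, he, complexify, cplx_tmul, one_smul]
  refine ⟨e.symm, fun k => le_antisymm ?_ ?_, fun x y => ?_, fun f => hc _ _ (hΨ.F f),
    fun ξ => hc _ _ (hΨ.c ξ), fun nab' S' hS' X => hc _ _ ?_⟩
  · rintro _ ⟨Y, hY, rfl⟩
    obtain ⟨x, hx, rfl⟩ := hΨ.cplx_surj hY
    change e.symm (cplx Ψ x) ∈ _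
    rwa [← he, e.symm_apply_apply]
  · intro x hx
    exact ⟨cplx Ψ x, hΨ.cplx_mem hx, e.symm_apply_apply x⟩
  · rw [AlgEquiv.symm_apply_eq, he, ← hΨ.cplx_bracket, ← he, ← he, e.apply_symm_apply,
      e.apply_symm_apply]
  · exact hΨ.field _ _ _ (isMetricField_horLift hS'.metric X) (hS'.mem X) fun ξ => hS'.comm_c X ξ

lemma complexify_hom_ext {Q C : Type*} [Ring Q] [Algebra ℝ Q] [Ring C] [Algebra ℂ C]
    {Φ Φ' : ℂ ⊗[ℝ] Q →ₐ[ℂ] C} (h : ∀ x, Φ (complexify x) = Φ' (complexify x)) : Φ = Φ' := by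
  ext x
  exact h x

lemma shift_hom_ext {C : Type*} [Ring C] [Algebra ℝ C] {Φ Φ' : Λ →ₐ[ℝ] C}
    (h0 : ∀ f : A, Φ (𝔞 f) = Φ' (𝔞 f)) (h1 : ∀ ξ : P, Φ (ι A ξ) = Φ' (ι A ξ)) : Φ = Φ' := by
  ext r
  induction r using shift_induction with
  | fn f => exact h0 f
  | add r s hr hs => rw [map_add, map_add, hr, hs]
  | lin η r hr => rw [map_mul, map_mul, h1, hr]

variable (O) in
lemma exists_symbolIso {ρ : O.filt.Gr ≃ₐ[ℂ] ℂ ⊗[ℝ] RoyFun g}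
    (h0 : ∀ f, ρ (O.filt.cl 0 (O.m f)) = complexify (restrict g (fn (𝔞 f))))
    (h1 : ∀ ξ, ρ (O.filt.cl 1 (nrm • O.c ξ)) = complexify (restrict g (fn (ι A ξ))))
    (h2 : ∀ X, ρ (O.filt.cl 2 (S X)) = complexify (restrict g (mom (horLift nab X)))) :
    ∃ Φ : O.filt.Gr ≃ₐ[ℂ] ℂ ⊗[ℝ] 𝓢, (∀ Φ' : O.filt.Gr ≃ₐ[ℂ] ℂ ⊗[ℝ] 𝓢,
        ((∀ f, Φ' (O.filt.cl 0 (O.m f)) = complexify (sx (𝔞 f))) ∧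
        (∀ ξ, Φ' (O.filt.cl 1 (nrm • O.c ξ)) = complexify (sx (ι A ξ))) ∧
        ∀ X, Φ' (O.filt.cl 2 (S X)) = complexify (sm X)) ↔ Φ' = Φ) ∧
      ∀ x, ρ x = Algebra.TensorProduct.map (AlgHom.id ℂ ℂ) (xi g nab) (Φ x) := by
  obtain ⟨Θ, t0, t1, t2⟩ := O.frames.exists_xiEquiv nab
  let Θc : ℂ ⊗[ℝ] RoyFun g ≃ₐ[ℂ] ℂ ⊗[ℝ] 𝓢 :=
    Algebra.TensorProduct.congr AlgEquiv.refl Θ.symm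
  have hΘ : ∀ x, Θc (complexify x) = complexify (Θ.symm x) := fun x => rfl
  have v0 : ∀ f, (ρ.trans Θc) (O.filt.cl 0 (O.m f)) = complexify (sx (𝔞 f)) :=
    fun f => by rw [AlgEquiv.trans_apply, h0, hΘ, t1]
  have v1 : ∀ ξ, (ρ.trans Θc) (O.filt.cl 1 (nrm • O.c ξ)) =
      complexify (sx (ι A ξ)) :=
    fun ξ => by rw [AlgEquiv.trans_apply, h1, hΘ, t1]
  have v2 : ∀ X, (ρ.trans Θc) (O.filt.cl 2 (S X)) = complexify (sm X) :=
    fun X => by rw [AlgEquiv.trans_apply, h2, hΘ, t2, O.frames.kap_horLift]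
  refine ⟨ρ.trans Θc, fun Φ' => ⟨fun ⟨w0, w1, w2⟩ => ?_, ?_⟩, fun x => ?_⟩
  · have key : Φ'.symm.toAlgHom = (ρ.trans Θc).symm.toAlgHom := by
      refine complexify_hom_ext fun y => ?_
      let κ : 𝓢 →ₐ[ℝ] ℂ ⊗[ℝ] 𝓢 := Algebra.TensorProduct.includeRight
      let L : 𝓢 →ₐ[ℝ] O.filt.Gr := (Φ'.symm.toAlgHom.restrictScalars ℝ).comp κ
      let L' : 𝓢 →ₐ[ℝ] O.filt.Gr :=
        ((ρ.trans Θc).symm.toAlgHom.restrictScalars ℝ).comp κ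
      have e : L = L' := by
        refine SplitFun.hom_ext (fun r => ?_) fun X => ?_
        · refine DFunLike.congr_fun (shift_hom_ext (Φ := L.comp (SplitFun.extHom A P))
            (Φ' := L'.comp (SplitFun.extHom A P)) (fun f => ?_) fun ξ => ?_) r
          · change Φ'.symm (complexify (sx (𝔞 f))) =
              (ρ.trans Θc).symm (complexify (sx (𝔞 f)))
            rw [← w0, Φ'.symm_apply_apply, w0, ← v0, AlgEquiv.symm_apply_apply]
          · change Φ'.symm (complexify (sx (ι A ξ))) =
              (ρ.trans Θc).symm (complexify (sx (ι A ξ)))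
            rw [← w1, Φ'.symm_apply_apply, w1, ← v1, AlgEquiv.symm_apply_apply]
        · change Φ'.symm (complexify (sm X)) =
            (ρ.trans Θc).symm (complexify (sm X))
          rw [← w2, Φ'.symm_apply_apply, w2, ← v2, AlgEquiv.symm_apply_apply]
      exact DFunLike.congr_fun e y
    refine AlgEquiv.ext fun x => ?_
    have := DFunLike.congr_fun key (Φ' x)
    change Φ'.symm (Φ' x) = (ρ.trans Θc).symm (Φ' x) at this
    rw [Φ'.symm_apply_apply] at this
    rw [this, AlgEquiv.apply_symm_apply, ← this]
  · rintro rfl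
    exact ⟨v0, v1, v2⟩
  · rw [AlgEquiv.trans_apply]
    generalize ρ x = y
    induction y using TensorProduct.induction_on with
    | zero => simp
    | add x y hx hy => rw [map_add, map_add, ← hx, ← hy]
    | tmul z x =>
      change _ = z ⊗ₜ[ℝ] xi g nab (Θ.symm x)
      rw [← t0, Θ.apply_symm_apply]

end CliffordOps

end MainIso

end Algebraic

/-! ## Locally constant choices with finitely many colours -/

section Colour

open Set Filter Topology

variable {n : ℕ} {M : Type*} [TopologicalSpace M] [T2Space M] [SecondCountableTopology M]
  [ChartedSpace (EuclideanSpace ℝ (Fin n)) M] [IsManifold (𝓡 n) ∞ M]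

lemma exists_nhds_dense_compl_image {Φ : M → Fin (n + 1) → ℝ} {x : M} {V : Set M}
    (hV : V ∈ 𝓝 x) (hΦ : ContMDiffAt (𝓡 n) 𝓘(ℝ, Fin (n + 1) → ℝ) ∞ Φ x) :
    ∃ C ∈ 𝓝 x, C ⊆ V ∧ IsCompact (Φ '' C) ∧ Dense (Φ '' C)ᶜ := by
  set φ := chartAt (EuclideanSpace ℝ (Fin n)) x
  have hx : x ∈ φ.source := mem_chart_source _ x
  have h1 : ContDiffAt ℝ 1 (Φ ∘ φ.symm) (φ x) := by
    have := (contMDiffAt_iff.1 hΦ).2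
    simp only [mfld_simps, contDiffWithinAt_univ] at this
    exact this.of_le (by exact_mod_cast le_top)
  obtain ⟨K, t, ht, hK⟩ := h1.exists_lipschitzOnWith
  have hD : t ∩ φ.symm ⁻¹' V ∩ φ.target ∈ 𝓝 (φ x) := by
    refine inter_mem (inter_mem ht ?_) (φ.open_target.mem_nhds (φ.map_source hx))
    refine (φ.continuousAt_symm (φ.map_source hx)).preimage_mem_nhds ?_
    rwa [φ.left_inv hx]
  obtain ⟨K', hK', hsub, hcomp⟩ := local_compact_nhds hD
  have hL : LipschitzOnWith K (Φ ∘ φ.symm) K' := hK.mono fun y hy => (hsub hy).1.1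
  refine ⟨φ.symm '' K', ?_, ?_, ?_, ?_⟩
  · have := φ.symm.image_mem_nhds (φ.map_source hx) hK'
    rwa [φ.left_inv hx] at this
  · rintro _ ⟨y, hy, rfl⟩
    exact (hsub hy).1.2
  · rw [← image_comp]
    exact hcomp.image_of_continuousOn hL.continuousOn
  · rw [← image_comp]
    refine dense_compl_of_dimH_lt_finrank ?_
    refine hL.dimH_image_le.trans_lt ((dimH_mono (subset_univ _)).trans_lt ?_)
    rw [Real.dimH_univ_eq_finrank, finrank_euclideanSpace, Module.finrank_fin_fun]
    simp only [Fintype.card_fin]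
    exact_mod_cast Nat.lt_succ_self n

lemma exists_generic {ι : Type*} [Countable ι] (u : ι → M → ℝ)
    (hu : ∀ k, ContMDiff (𝓡 n) 𝓘(ℝ, ℝ) ∞ (u k)) :
    ∃ c : ι → ℝ, ∀ K : Fin (n + 2) → ι, Function.Injective K → ∀ x, (∀ i, 0 < u (K i) x) →
      ∃ i, Real.log (u (K i) x) + c (K i) ≠ Real.log (u (K 0) x) + c (K 0) := by
  classical
  suffices H : ∀ K : Fin (n + 2) → ι, Function.Injective K →
      ∀ᶠ c : ι → ℝ in residual (ι → ℝ), ∀ x, (∀ i, 0 < u (K i) x) →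
        ∃ i, Real.log (u (K i) x) + c (K i) ≠ Real.log (u (K 0) x) + c (K 0) by
    have h2 : ∀ᶠ c : ι → ℝ in residual (ι → ℝ), ∀ K : Fin (n + 2) → ι, Function.Injective K →
        ∀ x, (∀ i, 0 < u (K i) x) →
        ∃ i, Real.log (u (K i) x) + c (K i) ≠ Real.log (u (K 0) x) + c (K 0) := by
      rw [eventually_countable_forall]
      intro K
      by_cases hK : Function.Injective K
      · filter_upwards [H K hK] with c hc _ using hc
      · exact Eventually.of_forall fun c h => absurd h hK
    exact (dense_of_mem_residual h2).nonempty
  intro K hK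
  set V : Set M := {x | ∀ i, 0 < u (K i) x}
  have hVo : IsOpen V := by
    simp only [V, ofPred_forall]
    exact isOpen_iInter_of_finite fun i => isOpen_lt continuous_const (hu (K i)).continuous
  set Φ : M → Fin (n + 1) → ℝ := fun x i => Real.log (u (K i.succ) x) - Real.log (u (K 0) x)
  have hΦ : ∀ x ∈ V, ContMDiffAt (𝓡 n) 𝓘(ℝ, Fin (n + 1) → ℝ) ∞ Φ x := by
    intro x hx
    have hlog : ∀ i, ContMDiffAt (𝓡 n) 𝓘(ℝ, ℝ) ∞ (fun y => Real.log (u (K i) y)) x := fun i =>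
      (Real.contDiffAt_log.2 (hx i).ne').contMDiffAt.comp x (hu (K i) x)
    rw [contMDiffAt_pi_space]
    exact fun i => (hlog i.succ).sub (hlog 0)
  choose! C hC hCV hCc hCd using fun x (hx : x ∈ V) =>
    exists_nhds_dense_compl_image (hVo.mem_nhds hx) (hΦ x hx)
  obtain ⟨t, htV, htc, hcov⟩ := TopologicalSpace.countable_cover_nhdsWithin
    fun x hx => mem_nhdsWithin_of_mem_nhds (hC x hx)
  set D : (ι → ℝ) → Fin (n + 1) → ℝ := fun c i => c (K 0) - c (K i.succ)
  have hDc : Continuous D := by fun_prop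
  have hDo : IsOpenMap D := by
    refine IsOpenMap.of_sections fun c => ⟨fun y k =>
      if h : ∃ i : Fin (n + 1), k = K i.succ then c (K 0) - y h.choose else c k, ?_, ?_, ?_⟩
    · refine (continuous_pi fun k => ?_).continuousAt
      by_cases h : ∃ i : Fin (n + 1), k = K i.succ
      · simp only [h, dif_pos]; fun_prop
      · simp only [h, dif_neg, not_false_iff]; fun_prop
    · ext k
      by_cases h : ∃ i : Fin (n + 1), k = K i.succ
      · simp only [h, dif_pos, D]
        rw [← h.choose_spec]; ring
      · simp only [h, dif_neg, not_false_iff]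
    · intro y
      ext i
      have h0 : ¬ ∃ i : Fin (n + 1), K 0 = K i.succ := by
        rintro ⟨i, hi⟩
        exact Fin.succ_ne_zero i (hK hi).symm
      have h1 : ∃ j : Fin (n + 1), K i.succ = K j.succ := ⟨i, rfl⟩
      have h2 : h1.choose = i := (Fin.succ_injective _ (hK h1.choose_spec)).symm
      simp only [D, h0, h1, dif_pos, dif_neg, not_false_iff, h2]
      ring
  have hres : ∀ x ∈ t, ∀ᶠ c in residual (ι → ℝ), D c ∉ Φ '' C x := fun x hx =>
    residual_of_dense_open (s := D ⁻¹' (Φ '' C x)ᶜ)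
      ((hCc x (htV hx)).isClosed.isOpen_compl.preimage hDc) ((hCd x (htV hx)).preimage hDo)
  have hall := (eventually_countable_ball htc).2 hres
  filter_upwards [hall] with c hc x hx
  by_contra! hcon
  obtain ⟨y, hy, hxy⟩ := mem_iUnion₂.1 (hcov hx)
  refine hc y hy ⟨x, hxy, ?_⟩
  ext i
  have := hcon i.succ
  simp only [Φ, D]
  linarith

/-- The points at which the functions `μ k`, `k ∈ T`, are positive and dominate all others. -/
def dominated {ι : Type*} (μ : ι → M → ℝ) (T : Finset ι) : Set M :=
  {x | ∀ k ∈ T, 0 < μ k x ∧ ∀ j ∉ T, μ j x < μ k x}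

omit [T2Space M] [SecondCountableTopology M] [IsManifold (𝓡 n) ∞ M]
  [ChartedSpace (EuclideanSpace ℝ (Fin n)) M] in
lemma dominated_unique {ι : Type*} {μ : ι → M → ℝ} {T T' : Finset ι} {x : M}
    (h : x ∈ dominated μ T) (h' : x ∈ dominated μ T') (hc : T.card = T'.card) : T = T' := by
  by_contra hne
  obtain ⟨k, hk, hk'⟩ := Finset.not_subset.1 fun hs => hne (Finset.eq_of_subset_of_card_le hs hc.ge)
  obtain ⟨j, hj, hj'⟩ := Finset.not_subset.1 fun hs =>
    hne (Finset.eq_of_subset_of_card_le hs hc.le).symm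
  exact lt_asymm ((h k hk).2 j hj') ((h' j hj).2 k hk')

omit [T2Space M] [SecondCountableTopology M] [IsManifold (𝓡 n) ∞ M]
  [ChartedSpace (EuclideanSpace ℝ (Fin n)) M] in
lemma isOpen_dominated {ι : Type*} {μ : ι → M → ℝ} (hμ : ∀ k, Continuous (μ k))
    (hfin : LocallyFinite fun k => Function.support (μ k)) (T : Finset ι) :
    IsOpen (dominated μ T) := by
  classical
  rw [isOpen_iff_mem_nhds]
  intro x hx
  obtain ⟨N, hN, hNf⟩ := hfin x
  have h1 : ∀ᶠ y in 𝓝 x, ∀ k ∈ T, 0 < μ k y := (Finset.eventually_all T).2 fun k hk =>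
    (isOpen_lt continuous_const (hμ k)).mem_nhds (hx k hk).1
  have h2 : ∀ᶠ y in 𝓝 x, ∀ k ∈ T, ∀ j ∈ hNf.toFinset \ T, μ j y < μ k y :=
    (Finset.eventually_all T).2 fun k hk => (Finset.eventually_all _).2 fun j hj =>
      (isOpen_lt (hμ j) (hμ k)).mem_nhds ((hx k hk).2 j (Finset.mem_sdiff.1 hj).2)
  filter_upwards [h1, h2, hN] with y hy1 hy2 hyN k hk
  refine ⟨hy1 k hk, fun j hj => ?_⟩
  by_cases hjy : μ j y = 0
  · rw [hjy]; exact hy1 k hk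
  · exact hy2 k hk j (Finset.mem_sdiff.2 ⟨hNf.mem_toFinset.2 ⟨y, hjy, hyN⟩, hj⟩)

lemma exists_colouring (W : M → Set M) (hW : ∀ x, W x ∈ 𝓝 x) :
    ∃ (χ : Fin (n + 1) → C^∞⟮𝓡 n, M; ℝ⟯) (q : Fin (n + 1) → M → M),
      (∀ c, ∀ x ∈ tsupport (χ c), ∀ᶠ y in 𝓝 x, q c y = q c x ∧ y ∈ W (q c x)) ∧
      ∀ x, ∑ c, χ c x = 1 := by
  classical
  have : LocallyCompactSpace M := ChartedSpace.locallyCompactSpace (EuclideanSpace ℝ (Fin n)) M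
  obtain ⟨t, htc, hcov⟩ := TopologicalSpace.countable_cover_nhds fun x => interior_mem_nhds.2 (hW x)
  have : Countable t := htc
  obtain ⟨u, hu⟩ := SmoothPartitionOfUnity.exists_isSubordinate (𝓡 n) isClosed_univ
    (fun k : t => interior (W k)) (fun k => isOpen_interior) (by
      rw [← hcov, biUnion_eq_iUnion])
  obtain ⟨c, hc⟩ := exists_generic (n := n) (fun k x => u k x) fun k => (u k).contMDiff
  set μ : t → M → ℝ := fun k x => Real.exp (c k) * u k x
  have hμc : ∀ k, Continuous (μ k) := fun k => continuous_const.mul (u k).contMDiff.continuous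
  have hpos : ∀ k x, 0 < μ k x ↔ 0 < u k x := fun k x => mul_pos_iff_of_pos_left (Real.exp_pos _)
  have hμf : LocallyFinite fun k => Function.support (μ k) := u.locallyFinite.subset fun k x hx h =>
    hx (by change Real.exp (c k) * u k x = 0; rw [h, mul_zero])
  let U : Fin (n + 1) → Set M := fun i => ⋃ T : {T : Finset t // T.card = i + 1}, dominated μ T.1
  have hUo : ∀ i, IsOpen (U i) := fun i => isOpen_iUnion fun T => isOpen_dominated hμc hμf T.1
  have hUcov : univ ⊆ ⋃ i, U i := by
    intro x _
    have hfinx := u.locallyFinite.point_finite x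
    set s := hfinx.toFinset
    have hs : ∀ k, k ∈ s ↔ 0 < μ k x := fun k => by
      rw [hpos, Finite.mem_toFinset]
      exact ⟨fun h => lt_of_le_of_ne (u.nonneg k x) (Ne.symm h), fun h => h.ne'⟩
    have hne : s.Nonempty := by
      obtain ⟨k, hk⟩ := u.exists_pos_of_mem (mem_univ x)
      exact ⟨k, (hs k).2 ((hpos k x).2 hk)⟩
    obtain ⟨k₀, hk₀, hmax⟩ := s.exists_max_image (fun k => μ k x) hne
    set T := s.filter fun k => μ k x = μ k₀ x
    have hT0 : k₀ ∈ T := Finset.mem_filter.2 ⟨hk₀, rfl⟩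
    have hTd : x ∈ dominated μ T := by
      intro k hk
      obtain ⟨hk1, hk2⟩ := Finset.mem_filter.1 hk
      refine ⟨(hs k).1 hk1, fun j hj => ?_⟩
      rw [hk2]
      by_cases hjs : j ∈ s
      · exact lt_of_le_of_ne (hmax j hjs) fun h => hj (Finset.mem_filter.2 ⟨hjs, h⟩)
      · exact (not_lt.1 fun h => hjs ((hs j).2 h)).trans_lt ((hs k₀).1 hk₀)
    have hcard : T.card ≤ n + 1 := by
      by_contra hlt
      obtain ⟨T', hT', hc'⟩ := Finset.exists_subset_card_eq (by omega : n + 2 ≤ T.card)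
      let K : Fin (n + 2) → t := fun i => (T'.equivFinOfCardEq hc').symm i
      have hK : ∀ i, K i ∈ T := fun i => hT' ((T'.equivFinOfCardEq hc').symm i).2
      have hKp : ∀ i, 0 < u (K i) x := fun i =>
        (hpos _ x).1 ((hs _).1 (Finset.mem_filter.1 (hK i)).1)
      obtain ⟨i, hi⟩ := hc K (fun i j hij => (T'.equivFinOfCardEq hc').symm.injective
        (Subtype.ext hij)) x hKp
      have hlog : ∀ i, Real.log (u (K i) x) + c (K i) = Real.log (μ k₀ x) := fun i => by
        rw [← (Finset.mem_filter.1 (hK i)).2, Real.log_mul (Real.exp_pos _).ne' (hKp i).ne',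
          Real.log_exp, add_comm]
      exact hi ((hlog i).trans (hlog 0).symm)
    have hpc : 0 < T.card := Finset.card_pos.2 ⟨k₀, hT0⟩
    exact mem_iUnion.2 ⟨⟨T.card - 1, by omega⟩, mem_iUnion.2 ⟨⟨T, (Nat.sub_add_cancel hpc).symm⟩, hTd⟩⟩
  obtain ⟨χ, hχ⟩ := SmoothPartitionOfUnity.exists_isSubordinate (𝓡 n) isClosed_univ U hUo hUcov
  have hTne : ∀ i : Fin (n + 1), ∀ T : {T : Finset t // T.card = i + 1}, T.1.Nonempty := fun i T =>
    Finset.card_pos.1 (by rw [T.2]; omega)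
  refine ⟨χ, fun i x => if h : x ∈ U i then
    ((hTne i (mem_iUnion.1 h).choose).choose : M) else x, fun i x hx => ?_, fun x => ?_⟩
  · have hxU : x ∈ U i := hχ i hx
    have hd := (mem_iUnion.1 hxU).choose_spec
    have hk := (hTne i (mem_iUnion.1 hxU).choose).choose_spec
    filter_upwards [(isOpen_dominated hμc hμf _).mem_nhds hd] with y hy
    have hyU : y ∈ U i := mem_iUnion.2 ⟨_, hy⟩
    have heq : (mem_iUnion.1 hyU).choose = (mem_iUnion.1 hxU).choose := Subtype.ext
      (dominated_unique (mem_iUnion.1 hyU).choose_spec hy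
        ((mem_iUnion.1 hyU).choose.2.trans (mem_iUnion.1 hxU).choose.2.symm))
    rw [dif_pos hxU, dif_pos hyU]
    have h2 : (hTne i (mem_iUnion.1 hyU).choose).choose =
        (hTne i (mem_iUnion.1 hxU).choose).choose :=
      congrArg (fun T => (hTne i T).choose) heq
    refine ⟨congrArg Subtype.val h2, interior_subset (hu _ (subset_tsupport _ ?_))⟩
    exact ((hpos _ y).1 (hy _ hk).1).ne'
  · rw [← finsum_eq_sum_of_fintype]
    exact χ.sum_eq_one (mem_univ x)

end Colour

/-! ## Finite frames of vector bundles -/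

section FiniteFrames

open Set Filter Topology

variable {n : ℕ} {M : Type*} [TopologicalSpace M] [ChartedSpace (EuclideanSpace ℝ (Fin n)) M]

local notation "𝔼" => EuclideanSpace ℝ (Fin n)
local notation "𝓒" => C^∞⟮𝓡 n, M; ℝ⟯

lemma contMDiff_mul_of_tsupport (χ : 𝓒) {h : M → ℝ}
    (hh : ∀ x ∈ tsupport χ, ContMDiffAt (𝓡 n) 𝓘(ℝ, ℝ) ∞ h x) :
    ContMDiff (𝓡 n) 𝓘(ℝ, ℝ) ∞ (fun x => χ x * h x) := by
  intro x
  by_cases hx : x ∈ tsupport χ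
  · exact (χ.contMDiff x).mul (hh x hx)
  · refine (contMDiffAt_const (c := (0 : ℝ))).congr_of_eventuallyEq ?_
    filter_upwards [(isClosed_tsupport _).isOpen_compl.mem_nhds hx] with y hy
    rw [image_eq_zero_of_notMem_tsupport hy, zero_mul]

variable {F : Type*} [NormedAddCommGroup F] [NormedSpace ℝ F]
  {V : M → Type*} [∀ x, AddCommGroup (V x)] [∀ x, Module ℝ (V x)] [∀ x, TopologicalSpace (V x)]
  [TopologicalSpace (TotalSpace F V)] [FiberBundle F V] [VectorBundle ℝ F V]
  [IsManifold (𝓡 n) ∞ M] [ContMDiffVectorBundle ∞ F V (𝓡 n)]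

lemma contMDiff_section_smul_of_tsupport (χ : 𝓒) {s : ∀ x, V x} (hs : ∀ x ∈ tsupport χ,
      ContMDiffAt (𝓡 n) ((𝓡 n).prod 𝓘(ℝ, F)) ∞ (fun x => TotalSpace.mk' F x (s x)) x) :
    ContMDiff (𝓡 n) ((𝓡 n).prod 𝓘(ℝ, F)) ∞ (fun x => TotalSpace.mk' F x (χ x • s x)) := by
  intro x
  by_cases hx : x ∈ tsupport χ
  · exact (χ.contMDiff x).smul_section (hs x hx)
  · refine ((0 : Cₛ^∞⟮𝓡 n; F, V⟯).contMDiff x).congr_of_eventuallyEq ?_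
    filter_upwards [(isClosed_tsupport _).isOpen_compl.mem_nhds hx] with y hy
    rw [image_eq_zero_of_notMem_tsupport hy, zero_smul]
    rfl

variable [T2Space M] [SecondCountableTopology M]

lemma exists_sum_sq_eq_one {N : ℕ} (χ : Fin N → 𝓒) (h : ∀ x, ∑ c, χ c x = 1) :
    ∃ η : 𝓒, ∀ x, ∑ c, η x * χ c x * χ c x = 1 := by
  have hsm : ContMDiff (𝓡 n) 𝓘(ℝ, ℝ) ∞ fun x => ∑ c, χ c x * χ c x :=
    contMDiff_finsetSum fun c _ => (χ c).contMDiff.mul (χ c).contMDiff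
  have hne : ∀ x, ∑ c, χ c x * χ c x ≠ 0 := fun x h0 => by
    have := (Finset.sum_eq_zero_iff_of_nonneg fun c _ => mul_self_nonneg (χ c x)).1 h0
    have h1 := h x
    rw [Finset.sum_eq_zero fun c hc => mul_self_eq_zero.1 (this c hc)] at h1
    exact zero_ne_one h1
  refine ⟨⟨_, hsm.inv₀ hne⟩, fun x => ?_⟩
  simp only [mul_assoc]
  rw [← mul_sum]
  exact inv_mul_cancel₀ (hne x)

variable (n F V) in
lemma exists_frame [FiniteDimensional ℝ F] :
    ∃ (m : ℕ) (s : Fin m → Cₛ^∞⟮𝓡 n; F, V⟯) (φ : Fin m → ∀ x, V x →ₗ[ℝ] ℝ),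
      (∀ a (τ : Cₛ^∞⟮𝓡 n; F, V⟯), ContMDiff (𝓡 n) 𝓘(ℝ, ℝ) ∞ fun x => φ a x (τ x)) ∧
      ∀ x v, ∑ a, φ a x v • s a x = v := by
  obtain ⟨χ, q, hq, hχ⟩ := exists_colouring (n := n) (M := M)
    (fun x => (trivializationAt F V x).baseSet)
    fun x => (trivializationAt F V x).open_baseSet.mem_nhds (mem_baseSet_trivializationAt F V x)
  obtain ⟨η, hη⟩ := exists_sum_sq_eq_one χ hχ
  set b := Module.finBasis ℝ F
  set e : Fin (n + 1) → M → Trivialization F (TotalSpace.proj : TotalSpace F V → M) :=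
    fun c x => trivializationAt F V (q c x)
  have hts : ∀ c x, χ c x ≠ 0 → x ∈ tsupport (χ c) := fun c x h => subset_tsupport _ h
  have hs : ∀ (c : Fin (n + 1)) l, ContMDiff (𝓡 n) ((𝓡 n).prod 𝓘(ℝ, F)) ∞
      (fun x => TotalSpace.mk' F x ((η * χ c) x • (e c x).symmₗ ℝ x (b l))) := by
    intro c l
    refine contMDiff_section_smul_of_tsupport _ fun x hx => ?_
    have hx' : x ∈ tsupport (χ c) := tsupport_mul_subset_right hx
    have hev := hq c x hx'
    have h0 : ContMDiffAt (𝓡 n) ((𝓡 n).prod 𝓘(ℝ, F)) ∞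
        (fun y => TotalSpace.mk' F y ((e c x).symmₗ ℝ y (b l))) x := by
      rw [Trivialization.contMDiffAt_section_iff (e c x) hev.self_of_nhds.2]
      refine (contMDiffAt_const (c := b l)).congr_of_eventuallyEq ?_
      filter_upwards [hev] with y hy
      rw [Trivialization.coe_symmₗ _ hy.2, (e c x).apply_mk_symm hy.2]
    refine h0.congr_of_eventuallyEq ?_
    filter_upwards [hev] with y hy
    simp only [e, hy.1]
  have hφ : ∀ (c : Fin (n + 1)) l (τ : Cₛ^∞⟮𝓡 n; F, V⟯), ContMDiff (𝓡 n) 𝓘(ℝ, ℝ) ∞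
      fun x => χ c x * b.coord l ((e c x).linearMapAt ℝ x (τ x)) := by
    intro c l τ
    refine contMDiff_mul_of_tsupport _ fun x hx => ?_
    have hev := hq c x hx
    have h0 := (Trivialization.contMDiffAt_section_iff (e c x) hev.self_of_nhds.2).1 (τ.contMDiff x)
    have h1 : ContMDiffAt (𝓡 n) 𝓘(ℝ, ℝ) ∞ (fun y => b.coord l (e c x ⟨y, τ y⟩).2) x :=
      (LinearMap.toContinuousLinearMap (b.coord l)).contMDiff.contMDiffAt.comp x h0
    refine h1.congr_of_eventuallyEq ?_
    filter_upwards [hev] with y hy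
    simp only [e, hy.1]
    rw [Trivialization.coe_linearMapAt_of_mem _ hy.2]
  refine ⟨_, fun a => ⟨_, hs (finProdFinEquiv.symm a).1 (finProdFinEquiv.symm a).2⟩,
    fun a x => χ (finProdFinEquiv.symm a).1 x • (b.coord (finProdFinEquiv.symm a).2 ∘ₗ
      (e (finProdFinEquiv.symm a).1 x).linearMapAt ℝ x), fun a τ => hφ _ _ τ, fun x v => ?_⟩
  refine (finProdFinEquiv.symm.sum_comp (fun p => (χ p.1 x • (b.coord p.2 ∘ₗ
    (e p.1 x).linearMapAt ℝ x)) v • (η * χ p.1) x • (e p.1 x).symmₗ ℝ x (b p.2))).trans ?_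
  rw [Fintype.sum_prod_type]
  have key : ∀ c, ∑ l, (χ c x • (b.coord l ∘ₗ (e c x).linearMapAt ℝ x)) v •
      (η * χ c) x • (e c x).symmₗ ℝ x (b l) = (η x * χ c x * χ c x) • v := by
    intro c
    by_cases hc : χ c x = 0
    · simp [hc]
    · have hx := (hq c x (hts c x hc)).self_of_nhds.2
      have h1 : ∀ l, (χ c x • (b.coord l ∘ₗ (e c x).linearMapAt ℝ x)) v •
          (η * χ c) x • (e c x).symmₗ ℝ x (b l) = (η x * χ c x * χ c x) •
          (e c x).symmₗ ℝ x (b.repr ((e c x).linearMapAt ℝ x v) l • b l) := by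
        intro l
        rw [map_smul, smul_smul, smul_smul]
        congr 1
        change χ c x * b.repr ((e c x).linearMapAt ℝ x v) l * (η x * χ c x) = _
        ring
      rw [sum_ext fun l => h1 l, ← smul_sum, ← map_sum, b.sum_repr, (e c x).symmₗ_linearMapAt hx]
  rw [sum_ext fun c => key c, ← Finset.sum_smul, hη x, one_smul]

end FiniteFrames

/-! ## Dual frames -/

section DualFrames

variable {n : ℕ} {M : Type*} [TopologicalSpace M] [ChartedSpace (EuclideanSpace ℝ (Fin n)) M]
  {F : Type*} [NormedAddCommGroup F] [NormedSpace ℝ F]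
  {E : M → Type*} [∀ x, AddCommGroup (E x)] [∀ x, Module ℝ (E x)] [∀ x, TopologicalSpace (E x)]
  [TopologicalSpace (TotalSpace F E)] [FiberBundle F E] [VectorBundle ℝ F E]

local notation "𝔼" => EuclideanSpace ℝ (Fin n)
local notation "𝓒" => C^∞⟮𝓡 n, M; ℝ⟯

lemma section_sum_apply {κ : Type*} (t : Finset κ) (s : κ → Cₛ^∞⟮𝓡 n; F, E⟯) (x : M) :
    (∑ i ∈ t, s i) x = ∑ i ∈ t, s i x :=
  map_sum (⟨⟨fun s : Cₛ^∞⟮𝓡 n; F, E⟯ => s x, rfl⟩, fun _ _ => rfl⟩ : Cₛ^∞⟮𝓡 n; F, E⟯ →+ E x) s t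

lemma function_sum_apply {κ : Type*} (t : Finset κ) (f : κ → 𝓒) (x : M) :
    (∑ i ∈ t, f i) x = ∑ i ∈ t, f i x :=
  map_sum (⟨⟨fun s : 𝓒 => s x, rfl⟩, fun _ _ => rfl⟩ : 𝓒 →+ ℝ) f t

omit [∀ x, TopologicalSpace (E x)] [TopologicalSpace (TotalSpace F E)] [FiberBundle F E] [VectorBundle ℝ F E]
  [TopologicalSpace M] [ChartedSpace 𝔼 M] in
lemma isUnit_of_ne_zero [TopologicalSpace M] [ChartedSpace 𝔼 M]
    {f : 𝓒} (hf : ∀ x, f x ≠ 0) : IsUnit f :=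
  IsUnit.of_mul_eq_one ⟨_, f.contMDiff.inv₀ hf⟩ (by ext x; exact mul_inv_cancel₀ (hf x))

/-- Finite frames of a bundle, with coefficient functionals. -/
structure BundleFrame (n : ℕ) {M : Type*} [TopologicalSpace M]
    [ChartedSpace (EuclideanSpace ℝ (Fin n)) M]
    (F : Type*) [NormedAddCommGroup F] [NormedSpace ℝ F]
    (E : M → Type*) [∀ x, AddCommGroup (E x)] [∀ x, Module ℝ (E x)] [∀ x, TopologicalSpace (E x)]
    [TopologicalSpace (TotalSpace F E)] [FiberBundle F E] where
  m : ℕ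
  s : Fin m → Cₛ^∞⟮𝓡 n; F, E⟯
  φ : Fin m → ∀ x, E x →ₗ[ℝ] ℝ
  smooth : ∀ a (τ : Cₛ^∞⟮𝓡 n; F, E⟯), ContMDiff (𝓡 n) 𝓘(ℝ, ℝ) ∞ fun x => φ a x (τ x)
  sum_smul : ∀ x v, ∑ a, φ a x v • s a x = v

namespace BundleFrame

variable (B : BundleFrame n F E)

/-- The coefficient functionals on sections. -/
def coord (a : Fin B.m) : Cₛ^∞⟮𝓡 n; F, E⟯ →ₗ[𝓒] 𝓒 where
  toFun τ := ⟨fun x => B.φ a x (τ x), B.smooth a τ⟩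
  map_add' τ τ' := by ext x; exact map_add (B.φ a x) (τ x) (τ' x)
  map_smul' f τ := by ext x; exact map_smul (B.φ a x) (f x) (τ x)

lemma sum_coord (τ : Cₛ^∞⟮𝓡 n; F, E⟯) : ∑ a, B.coord a τ • B.s a = τ := by
  ext x
  rw [section_sum_apply]
  exact B.sum_smul x (τ x)

include B in
lemma exists_section (x : M) (v : E x) : ∃ τ : Cₛ^∞⟮𝓡 n; F, E⟯, τ x = v :=
  ⟨∑ a, B.φ a x v • B.s a, by rw [section_sum_apply]; exact B.sum_smul x v⟩

lemma sum_coord_self [FiniteDimensional ℝ F] (x : M) :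
    ∑ a, B.φ a x (B.s a x) = Module.finrank ℝ F := by
  have e : E x ≃ₗ[ℝ] F := (trivializationAt F E x).linearEquivAt (R := ℝ) x
    (mem_baseSet_trivializationAt F E x)
  have : FiniteDimensional ℝ (E x) := e.symm.finiteDimensional
  rw [← e.finrank_eq, ← LinearMap.trace_id ℝ (E x)]
  have h : (LinearMap.id : E x →ₗ[ℝ] E x) = ∑ a, (B.φ a x).smulRight (B.s a x) := by
    ext v
    rw [lm_sum]
    exact (B.sum_smul x v).symm
  rw [h, map_sum]
  exact sum_ext fun a => (LinearMap.trace_smulRight _ _).symm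

open Matrix in
lemma exists_dual (g : PseudoMetric n F E) :
    ∃ t : Fin B.m → Cₛ^∞⟮𝓡 n; F, E⟯, ∀ a ξ, g.onSections (t a) ξ = B.coord a ξ := by
  let Gm : Matrix (Fin B.m) (Fin B.m) 𝓒 := .of fun b c => g.onSections (B.s b) (B.s c)
  let p : Matrix (Fin B.m) (Fin B.m) 𝓒 := .of fun c b => B.coord c (B.s b)
  have hsum : ∀ b ξ, ∑ c, g.onSections (B.s b) (B.s c) * B.coord c ξ = g.onSections (B.s b) ξ := by
    intro b ξ
    conv_rhs => rw [← B.sum_coord ξ, map_sum]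
    exact sum_ext fun c => by rw [map_smul, smul_eq_mul, mul_comm]
  have hGp : Gm * p = Gm := by
    ext1 b c
    exact hsum b (B.s c)
  have hpp : p * p = p := by
    ext1 b c
    change ∑ d, B.coord b (B.s d) * B.coord d (B.s c) = B.coord b (B.s c)
    conv_rhs => rw [← B.sum_coord (B.s c), map_sum]
    exact sum_ext fun d => by rw [map_smul, smul_eq_mul, mul_comm]
  have hGt : Gmᵀ = Gm := by
    ext1 b c
    ext x
    exact g.symm x _ _
  let H := Gm + (1 - p)ᵀ * (1 - p)
  have hHp : H * p = Gm := by
    rw [add_mul, hGp, mul_assoc, sub_mul, one_mul, hpp, sub_self, mul_zero, add_zero]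
  have hpH : pᵀ * H = Gm := by
    have : Hᵀ = H := by
      simp only [H, transpose_add, transpose_mul, hGt, transpose_transpose]
    rw [← transpose_inj, transpose_mul, transpose_transpose, this, hHp, hGt]
  have hdet : IsUnit H.det := by
    refine isUnit_of_ne_zero fun x h0 => ?_
    let ev : 𝓒 →+* ℝ := ContMDiffMap.evalRingHom x
    have h1 : (ev.mapMatrix H).det = 0 := by rw [← RingHom.map_det]; exact h0
    obtain ⟨w, hw0, hw⟩ := exists_mulVec_eq_zero_iff.2 h1
    have hG : ev.mapMatrix Gm *ᵥ w = 0 := by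
      rw [← hpH, map_mul, ← mulVec_mulVec, hw, mulVec_zero]
    set v : E x := ∑ b, w b • B.s b x
    have hv : v = 0 := by
      refine g.nondegenerate x v fun u => ?_
      rw [g.symm, ← B.sum_smul x u, LinearMap.BilinForm.sum_left]
      refine Finset.sum_eq_zero fun b _ => ?_
      rw [LinearMap.BilinForm.smul_left]
      have h2 := congrFun hG b
      have h3 : g.form x (B.s b x) v = 0 := by
        rw [LinearMap.BilinForm.sum_right]
        refine Eq.trans (sum_ext fun c => ?_) h2
        rw [LinearMap.BilinForm.smul_right, mul_comm]
        rfl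
      rw [h3, mul_zero]
    have hp : ev.mapMatrix p *ᵥ w = 0 := by
      ext c
      have : B.φ c x v = 0 := by rw [hv, map_zero]
      rw [map_sum] at this
      rw [Pi.zero_apply, ← this, mulVec, dotProduct]
      refine sum_ext fun b => ?_
      rw [map_smul, smul_eq_mul, mul_comm]
      rfl
    have hw' : w ⬝ᵥ w = 0 := by
      have h2 : ev.mapMatrix (1 - p) *ᵥ w = w := by
        rw [map_sub, map_one, sub_mulVec, one_mulVec, hp, sub_zero]
      have h3 : ev.mapMatrix H *ᵥ w = (ev.mapMatrix (1 - p))ᵀ *ᵥ w := by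
        rw [map_add, add_mulVec, hG, zero_add, map_mul, ← mulVec_mulVec, h2]
        rfl
      rw [hw] at h3
      have h4 : w ⬝ᵥ (ev.mapMatrix (1 - p))ᵀ *ᵥ w = w ⬝ᵥ w := by
        rw [dotProduct_mulVec, vecMul_transpose, h2]
      rw [← h4, ← h3, dotProduct_zero]
    exact hw0 (dotProduct_self_eq_zero.1 hw')
  refine ⟨fun a => ∑ b, H⁻¹ a b • B.s b, fun a ξ => ?_⟩
  have h1 : H⁻¹ * Gm = p := by rw [← hHp, ← mul_assoc, nonsing_inv_mul _ hdet, one_mul]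
  have h2 : ∀ c, g.onSections (∑ b, H⁻¹ a b • B.s b) (B.s c) = B.coord a (B.s c) := by
    intro c
    rw [LinearMap.BilinForm.sum_left]
    refine Eq.trans (sum_ext fun b => ?_) (congrFun (congrFun h1 a) c)
    rw [LinearMap.BilinForm.smul_left]
    rfl
  conv_lhs => rw [← B.sum_coord ξ, map_sum]
  conv_rhs => rw [← B.sum_coord ξ, map_sum]
  exact sum_ext fun c => by rw [map_smul, map_smul, h2]

end BundleFrame

variable (n F E) in
lemma nonempty_bundleFrame [FiniteDimensional ℝ F] [T2Space M] [SecondCountableTopology M]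
    [IsManifold (𝓡 n) ∞ M] [ContMDiffVectorBundle ∞ F E (𝓡 n)] : Nonempty (BundleFrame n F E) :=
  let ⟨m, s, φ, h1, h2⟩ := exists_frame n F E
  ⟨⟨m, s, φ, h1, h2⟩⟩

end DualFrames

/-! ## Hadamard's lemma -/

section Hadamard

open MeasureTheory Set

lemma exists_hadamard {E : Type*} [NormedAddCommGroup E] [NormedSpace ℝ E] {H : E → ℝ}
    (hH : ContDiff ℝ ∞ H) (a : E) : ∃ K : E → E →L[ℝ] ℝ, ContDiff ℝ ∞ K ∧ K a = fderiv ℝ H a ∧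
      ∀ y, H y - H a = K y (y - a) := by
  let f : E → ℝ → E →L[ℝ] ℝ := fun y t => fderiv ℝ H (a + t • (y - a))
  have hd : ContDiff ℝ ∞ (fderiv ℝ H) := hH.fderiv_right (m := ∞) (by simp)
  have hf : ContDiff ℝ ∞ (fun p : E × ℝ => f p.1 p.2) := by
    refine hd.comp ?_
    fun_prop
  let β : ContDiffBump (0 : ℝ) := ⟨2, 3, by norm_num, by norm_num⟩
  let u : E → ℝ → E →L[ℝ] ℝ := fun y t => β t • f y (-t)
  let K : E → E →L[ℝ] ℝ := fun y => convolution (indicator (Icc 0 1) (fun _ => (1 : ℝ))) (u y)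
    (ContinuousLinearMap.lsmul ℝ ℝ) volume 0
  have hK : ∀ y, K y = ∫ t in (0 : ℝ)..1, f y t := by
    intro y
    rw [intervalIntegral.integral_of_le zero_le_one, ← integral_Icc_eq_integral_Ioc,
      ← integral_indicator measurableSet_Icc]
    refine integral_congr_ae (Filter.Eventually.of_forall fun t => ?_)
    by_cases ht : t ∈ Icc (0 : ℝ) 1
    · have hβ : β (-t) = 1 := β.one_of_mem_closedBall (by
        rw [mem_closedBall_zero_iff, norm_neg, Real.norm_of_nonneg ht.1]
        exact ht.2.trans one_le_two)
      simp only [indicator_of_mem ht, u, ContinuousLinearMap.lsmul_apply, zero_sub, neg_neg, hβ,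
        one_smul]
    · simp only [indicator_of_notMem ht, map_zero, zero_apply]
  refine ⟨K, ?_, ?_, fun y => ?_⟩
  · rw [← contDiffOn_univ]
    refine contDiffOn_convolution_right_with_param_comp _ contDiffOn_const isOpen_univ
      β.hasCompactSupport.isCompact (fun p t _ ht => ?_) ?_ ?_
    · simp only [u, image_eq_zero_of_notMem_tsupport ht, zero_smul]
    · exact ((integrable_indicator_iff measurableSet_Icc).2
        (integrableOn_const (by simp))).locallyIntegrable
    · refine ContDiff.contDiffOn ?_
      have h1 : ContDiff ℝ ∞ (fun p : E × ℝ => f p.1 (-p.2)) :=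
        hf.comp (contDiff_fst.prodMk contDiff_snd.neg)
      exact (β.contDiff.comp contDiff_snd).smul h1
  · rw [hK]
    simp [f]
  · have hc : Continuous (f y) := hf.continuous.comp (by fun_prop : Continuous fun t : ℝ => (y, t))
    rw [hK, ContinuousLinearMap.intervalIntegral_apply (hc.intervalIntegrable _ _)]
    rw [intervalIntegral.integral_eq_sub_of_hasDerivAt (f := fun t => H (a + t • (y - a)))]
    · simp
    · intro t _
      have h1 := (hH.differentiable (by simp) (a + t • (y - a))).hasFDerivAt
      have h2 : HasDerivAt (fun t : ℝ => a + t • (y - a)) (y - a) t := by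
        simpa using ((hasDerivAt_id t).smul_const (y - a)).const_add a
      exact h1.comp_hasDerivAt t h2
    · exact (hc.clm_apply continuous_const).intervalIntegrable _ _

end Hadamard

/-! ## Finite frames of vector fields -/

section VectorFields

open Set Filter Topology

variable {n : ℕ} {M : Type*} [TopologicalSpace M] [T2Space M]
  [ChartedSpace (EuclideanSpace ℝ (Fin n)) M] [IsManifold (𝓡 n) ∞ M]

local notation "𝔼" => EuclideanSpace ℝ (Fin n)
local notation "𝓒" => C^∞⟮𝓡 n, M; ℝ⟯

/-- The partial derivative in a chart. -/
def chartDeriv (p : M) (i : Fin n) (h : M → ℝ) (x : M) : ℝ :=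
  fderiv ℝ (h ∘ (extChartAt (𝓡 n) p).symm) (extChartAt (𝓡 n) p x) (EuclideanSpace.single i 1)

lemma contDiffAt_comp_symm {p x : M} {h : M → ℝ} (hh : ContMDiff (𝓡 n) 𝓘(ℝ, ℝ) ∞ h)
    (hx : x ∈ (chartAt 𝔼 p).source) :
    ContDiffAt ℝ ∞ (h ∘ (extChartAt (𝓡 n) p).symm) (extChartAt (𝓡 n) p x) := by
  have := contMDiffWithinAt_iff_contDiffWithinAt.1
    ((contMDiffAt_iff_source_of_mem_source hx).1 (hh x))
  rwa [ModelWithCorners.range_eq_univ, contDiffWithinAt_univ] at this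

lemma contMDiffAt_chartDeriv {p x : M} {h : M → ℝ} (hh : ContMDiff (𝓡 n) 𝓘(ℝ, ℝ) ∞ h)
    (hx : x ∈ (chartAt 𝔼 p).source) (i : Fin n) :
    ContMDiffAt (𝓡 n) 𝓘(ℝ, ℝ) ∞ (chartDeriv p i h) x := by
  have h1 : ContDiffAt ℝ ∞ (fun z => fderiv ℝ (h ∘ (extChartAt (𝓡 n) p).symm) z
      (EuclideanSpace.single i 1)) (extChartAt (𝓡 n) p x) :=
    ((contDiffAt_comp_symm hh hx).fderiv_right (m := ∞) (by simp)).clm_apply contDiffAt_const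
  exact h1.contMDiffAt.comp x (contMDiffAt_extChartAt' (by simpa using hx))

lemma derivation_congr (D : Derivation ℝ 𝓒 𝓒)
    {u v : 𝓒} {x : M} (h : u =ᶠ[𝓝 x] v) : D u x = D v x := by
  obtain ⟨f, -, hf⟩ := (SmoothBumpFunction.nhds_basis_support (I := 𝓡 n) h).mem_iff.1 h
  let B : 𝓒 := ⟨f, f.contMDiff⟩
  have h1 : B * u = B * v := by
    ext y
    change f y * u y = f y * v y
    by_cases hy : y ∈ Function.support f
    · rw [show u y = v y from hf hy]
    · rw [Function.notMem_support.1 hy, zero_mul, zero_mul]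
  have h2 := congrArg (fun w => D w x) h1
  simp only [Derivation.leibniz] at h2
  change f x * D u x + u x * D B x = f x * D v x + v x * D B x at h2
  rw [f.eq_one, h.self_of_nhds] at h2
  linarith

lemma derivation_eq_of_chart (D : Derivation ℝ 𝓒 𝓒) {p x : M}
    (f : SmoothBumpFunction (𝓡 n) p) (hx : x ∈ (chartAt 𝔼 p).source)
    (hf : f =ᶠ[𝓝 x] 1) (χ : 𝓒) (χu : Fin n → 𝓒)
    (hχ : ∀ᶠ y in 𝓝 x, ∀ i, χu i y = χ y * chartAt 𝔼 p y i) (h : 𝓒) :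
    χ x * D h x = ∑ i, chartDeriv p i h x * (D (χu i) x - chartAt 𝔼 p x i * D χ x) := by
  set φ := extChartAt (𝓡 n) p
  set a := φ x
  have hxs : x ∈ φ.source := by simpa [φ] using hx
  have hfx : f x = 1 := hf.self_of_nhds
  let B : 𝓒 := ⟨f, f.contMDiff⟩
  have hU : ∀ i : Fin n, ContMDiff (𝓡 n) 𝓘(ℝ, ℝ) ∞ fun y => f y * φ y i := by
    intro i
    refine contMDiff_mul_of_tsupport B fun y hy => ?_
    have h1 : ContMDiffAt (𝓡 n) 𝓘(ℝ, 𝔼) ∞ φ y :=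
      contMDiffAt_extChartAt' (f.tsupport_subset_chartAt_source hy)
    exact (EuclideanSpace.proj (𝕜 := ℝ) i).contMDiff.contMDiffAt.comp y h1
  let U : Fin n → 𝓒 := fun i => ⟨_, hU i⟩
  have key : ∀ h : 𝓒,
      D h x + h x * D B x = ∑ i, chartDeriv p i h x * (D (U i) x - a i * D B x) := by
    intro h
    let H : 𝔼 → ℝ := fun z => f.toContDiffBump z * h (φ.symm z)
    have hH : ContDiff ℝ ∞ H := by
      rw [contDiff_iff_contDiffAt]
      intro z
      by_cases hz : z ∈ φ.target
      · refine f.toContDiffBump.contDiffAt.mul ?_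
        have := contDiffAt_comp_symm h.contMDiff (p := p) (x := φ.symm z)
          (by simpa [φ] using φ.map_target hz)
        rwa [φ.right_inv hz] at this
      · have hz' : z ∉ Metric.closedBall (φ p) f.rOut := fun hb =>
          hz (f.closedBall_subset ⟨hb, by simp⟩)
        refine (contDiffAt_const (c := (0 : ℝ))).congr_of_eventuallyEq ?_
        filter_upwards [Metric.isClosed_closedBall.isOpen_compl.mem_nhds hz'] with w hw
        have : f.toContDiffBump w = 0 := f.toContDiffBump.zero_of_le_dist
          (le_of_lt (not_le.1 hw))
        simp only [H, this, zero_mul]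
    obtain ⟨K, hK, hKa, hKH⟩ := exists_hadamard hH a
    have hHφ : ∀ y ∈ φ.source, H (φ y) = f y * h y := by
      intro y hy
      have := f.eqOn_source (by simpa [φ] using hy : y ∈ (chartAt 𝔼 p).source)
      simp only [H, φ.left_inv hy, this, Function.comp_apply, φ]
    have hKi : ∀ i : Fin n, ContMDiff (𝓡 n) 𝓘(ℝ, ℝ) ∞
        fun y => f y * K (φ y) (EuclideanSpace.single i 1) := by
      intro i
      refine contMDiff_mul_of_tsupport B fun y hy => ?_
      have h1 : ContMDiffAt (𝓡 n) 𝓘(ℝ, 𝔼) ∞ φ y :=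
        contMDiffAt_extChartAt' (f.tsupport_subset_chartAt_source hy)
      exact (hK.clm_apply contDiff_const).contMDiff.contMDiffAt.comp y h1
    let Ki : Fin n → 𝓒 := fun i => ⟨_, hKi i⟩
    have hKx : ∀ i, Ki i x = chartDeriv p i h x := by
      intro i
      have he : H =ᶠ[𝓝 a] h ∘ φ.symm := by
        have hc : ContinuousAt φ.symm a := continuousAt_extChartAt_symm' hxs
        rw [ContinuousAt, φ.left_inv hxs] at hc
        have ht : φ.target ∈ 𝓝 a := extChartAt_target_mem_nhds' (φ.map_source hxs)
        filter_upwards [hc.eventually hf, ht] with z hz hzt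
        rw [← φ.right_inv hzt, hHφ _ (φ.map_target hzt), hz]
        simp [φ.left_inv (φ.map_target hzt)]
      change f x * K a (EuclideanSpace.single i 1) = _
      rw [hfx, one_mul, hKa, he.fderiv_eq]
      rfl
    have hid : B * (B * (B * h)) - (h x) • (B * B) = ∑ i, Ki i * (U i - a i • B) := by
      ext y
      rw [function_sum_apply]
      change f y * (f y * (f y * h y)) - h x * (f y * f y) =
        ∑ i, f y * K (φ y) (EuclideanSpace.single i 1) * (f y * φ y i - a i * f y)
      by_cases hy : y ∈ φ.source
      · have hsum : K (φ y) (φ y - a) = ∑ i, K (φ y) (EuclideanSpace.single i 1) * (φ y i - a i) := by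
          conv_lhs => rw [← (EuclideanSpace.basisFun (Fin n) ℝ).sum_repr (φ y - a)]
          rw [map_sum]
          refine sum_ext fun i => ?_
          rw [map_smul, smul_eq_mul, mul_comm, EuclideanSpace.basisFun_apply,
            EuclideanSpace.basisFun_repr, PiLp.sub_apply]
        have h2 : ∑ i, f y * K (φ y) (EuclideanSpace.single i 1) * (f y * φ y i - a i * f y) =
            f y * f y * K (φ y) (φ y - a) := by
          rw [hsum, mul_sum]
          exact sum_ext fun i => by ring
        rw [h2, ← hKH, hHφ y hy, hHφ x hxs, hfx]
        ring
      · have : f y = 0 := by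
          by_contra h0
          exact hy (by simpa [φ] using f.support_subset_source h0)
        simp [this]
    have hDid := congrArg (fun u => D u x) hid
    have e1 : D (B * (B * (B * h)) - (h x) • (B * B)) x = D h x + h x * D B x := by
      rw [map_sub, Derivation.map_smul, Derivation.leibniz, Derivation.leibniz, Derivation.leibniz,
        Derivation.leibniz]
      change f x * (f x * (f x * D h x + h x * D B x) + (f x * h x) * D B x) +
        (f x * (f x * h x)) * D B x - h x * (f x * D B x + f x * D B x) = _
      rw [hfx]; ring
    have e2 : D (∑ i, Ki i * (U i - a i • B)) x =
        ∑ i, chartDeriv p i h x * (D (U i) x - a i * D B x) := by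
      rw [map_sum, function_sum_apply]
      refine sum_ext fun i => ?_
      rw [Derivation.leibniz, map_sub, Derivation.map_smul]
      change Ki i x * (D (U i) x - a i * D B x) + (f x * a i - a i * f x) * D (Ki i) x = _
      rw [hKx, mul_comm (f x) (a i), sub_self, zero_mul, add_zero]
    exact e1.symm.trans (hDid.trans e2)
  have hB : D B x = 0 := by
    rw [derivation_congr D (u := B) (v := 1) hf, Derivation.map_one_eq_zero]
    rfl
  have hmul : ∀ i, D (χu i) x = χ x * D (U i) x + a i * D χ x := by
    intro i
    have h2 : D (B * χu i) x = D (χ * U i) x := by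
      refine derivation_congr D ?_
      filter_upwards [hχ] with y hy
      change f y * χu i y = χ y * (f y * φ y i)
      rw [hy i]; simp only [φ, mfld_simps]; ring
    simp only [Derivation.leibniz] at h2
    change f x * D (χu i) x + χu i x * D B x = χ x * D (U i) x + (f x * a i) * D χ x at h2
    rwa [hB, hfx, mul_zero, add_zero, one_mul, one_mul] at h2
  have hk := key h
  rw [hB, mul_zero, add_zero] at hk
  rw [hk, mul_sum]
  refine sum_ext fun i => ?_
  rw [hmul i, show chartAt 𝔼 p x i = a i by simp [a, φ]]
  ring

lemma exists_chart_derivation (χ : 𝓒) (q : M → M) (hq : ∀ x ∈ tsupport χ, ∀ᶠ y in 𝓝 x,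
      q y = q x ∧ y ∈ (chartAt 𝔼 (q x)).source)
    (w : M → ℝ) (hw : ∀ x ∈ tsupport χ, ContMDiffAt (𝓡 n) 𝓘(ℝ, ℝ) ∞ w x) (i : Fin n) :
    ∃ X : Derivation ℝ 𝓒 𝓒, ∀ h x, X h x = χ x * (w x * chartDeriv (q x) i h x) := by
  have hsm : ∀ h : 𝓒,
      ContMDiff (𝓡 n) 𝓘(ℝ, ℝ) ∞ fun x => χ x * (w x * chartDeriv (q x) i h x) := by
    intro h
    refine contMDiff_mul_of_tsupport χ fun x hx => (hw x hx).mul ?_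
    refine (contMDiffAt_chartDeriv h.contMDiff (hq x hx).self_of_nhds.2 i).congr_of_eventuallyEq ?_
    filter_upwards [hq x hx] with y hy
    rw [hy.1]
  have hd : ∀ (h : 𝓒) x, χ x ≠ 0 → DifferentiableAt ℝ
      (h ∘ (extChartAt (𝓡 n) (q x)).symm) (extChartAt (𝓡 n) (q x) x) := fun h x hx =>
    (contDiffAt_comp_symm h.contMDiff
      (hq x (subset_tsupport _ hx)).self_of_nhds.2).differentiableAt (by simp)
  refine ⟨Derivation.mk'
    { toFun := fun h => ⟨_, hsm h⟩, map_add' := fun h k => ?_, map_smul' := fun r h => ?_ }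
    fun h k => ?_, fun h x => rfl⟩
  · ext x
    change χ x * (w x * chartDeriv (q x) i (h + k) x) =
      χ x * (w x * chartDeriv (q x) i h x) + χ x * (w x * chartDeriv (q x) i k x)
    by_cases hx : χ x = 0
    · simp [hx]
    · have : chartDeriv (q x) i (h + k) x = chartDeriv (q x) i h x + chartDeriv (q x) i k x :=
        congrArg (fun T => T (EuclideanSpace.single i 1)) (fderiv_add (hd h x hx) (hd k x hx))
      rw [this]; ring
  · ext x
    change χ x * (w x * chartDeriv (q x) i (r • h) x) = r * (χ x * (w x * chartDeriv (q x) i h x))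
    by_cases hx : χ x = 0
    · simp [hx]
    · have : chartDeriv (q x) i (r • h) x = r * chartDeriv (q x) i h x :=
        congrArg (fun T => T (EuclideanSpace.single i 1)) (fderiv_const_smul (hd h x hx) r)
      rw [this]; ring
  · ext x
    change χ x * (w x * chartDeriv (q x) i (h * k) x) =
      h x * (χ x * (w x * chartDeriv (q x) i k x)) + k x * (χ x * (w x * chartDeriv (q x) i h x))
    by_cases hx : χ x = 0
    · simp [hx]
    · have : chartDeriv (q x) i (h * k) x =
          h x * chartDeriv (q x) i k x + k x * chartDeriv (q x) i h x := by
        have h1 := congrArg (fun T => T (EuclideanSpace.single i (1 : ℝ)))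
          (fderiv_mul (hd h x hx) (hd k x hx))
        have hl : (extChartAt (𝓡 n) (q x)).symm (extChartAt (𝓡 n) (q x) x) = x :=
          (extChartAt (𝓡 n) (q x)).left_inv
            (by simpa using (hq x (subset_tsupport _ hx)).self_of_nhds.2)
        refine h1.trans ?_
        simp only [Function.comp_apply, hl]
        rfl
      rw [this]; ring

variable (n M) in
lemma exists_vectorField_frame [SecondCountableTopology M] : ∃ (l : ℕ) (f : Fin l → 𝓒)
      (X : Fin l → Derivation ℝ 𝓒 𝓒), ∀ D : Derivation ℝ 𝓒 𝓒, ∑ j, D (f j) • X j = D := by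
  let β : ∀ p : M, SmoothBumpFunction (𝓡 n) p := fun p => Classical.arbitrary _
  obtain ⟨χ, q, hq, hχ⟩ := exists_colouring (n := n) (M := M)
    (fun p => (chartAt 𝔼 p).source ∩ {y | β p =ᶠ[𝓝 y] 1})
    fun p => inter_mem ((chartAt _ p).open_source.mem_nhds (mem_chart_source _ p))
      (β p).eventuallyEq_one.eventually_nhds
  obtain ⟨η, hη⟩ := exists_sum_sq_eq_one χ hχ
  have hq' : ∀ c, ∀ x ∈ tsupport (χ c), ∀ᶠ y in 𝓝 x,
      q c y = q c x ∧ y ∈ (chartAt 𝔼 (q c x)).source := fun c x hx =>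
    (hq c x hx).mono fun y hy => ⟨hy.1, hy.2.1⟩
  have hu : ∀ c (i : Fin n), ∀ x ∈ tsupport (χ c), ContMDiffAt (𝓡 n) 𝓘(ℝ, ℝ) ∞
      (fun y => chartAt 𝔼 (q c y) y i) x := by
    intro c i x hx
    have h1 : ContMDiffAt (𝓡 n) 𝓘(ℝ, 𝔼) ∞ (extChartAt (𝓡 n) (q c x)) x :=
      contMDiffAt_extChartAt' (hq' c x hx).self_of_nhds.2
    refine ((EuclideanSpace.proj (𝕜 := ℝ) i).contMDiff.contMDiffAt.comp x h1).congr_of_eventuallyEq ?_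
    filter_upwards [hq' c x hx] with y hy
    rw [hy.1]
    simp
  choose X hX using fun c (i : Fin n) => exists_chart_derivation (χ c) (q c) (hq' c) η
    (fun x _ => η.contMDiff x) i
  choose Y hY using fun c (i : Fin n) => exists_chart_derivation (χ c) (q c) (hq' c)
    (fun y => η y * chartAt 𝔼 (q c y) y i)
    (fun x hx => (η.contMDiff x).mul (hu c i x hx)) i
  let χu : Fin (n + 1) → Fin n → 𝓒 := fun c i =>
    ⟨_, contMDiff_mul_of_tsupport (χ c) (hu c i)⟩
  let f : Fin (n + 1) × Option (Fin n) → 𝓒 := fun p => p.2.elim (χ p.1) (χu p.1)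
  let Z : Fin (n + 1) × Option (Fin n) → Derivation ℝ 𝓒 𝓒 := fun p =>
    p.2.elim (-∑ i, Y p.1 i) (X p.1)
  let e := (Fintype.equivFin (Fin (n + 1) × Option (Fin n))).symm
  refine ⟨_, fun j => f (e j), fun j => Z (e j), fun D => ?_⟩
  rw [e.sum_comp (fun p => D (f p) • Z p), Fintype.sum_prod_type]
  ext h x
  rw [derivation_sum_apply, function_sum_apply]
  have key : ∀ c, (∑ o, D (f (c, o)) • Z (c, o)) h x = η x * χ c x * χ c x * D h x := by
    intro c
    rw [Fintype.sum_option]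
    have h1 : ((D (f (c, none)) • Z (c, none) + ∑ i, D (f (c, some i)) • Z (c, some i)) h) x =
        η x * χ c x * ∑ i, chartDeriv (q c x) i h x *
          (D (χu c i) x - chartAt 𝔼 (q c x) x i * D (χ c) x) := by
      change D (χ c) x * (-∑ i, Y c i) h x + (∑ i, D (χu c i) • X c i) h x = _
      rw [Derivation.neg_apply, derivation_sum_apply, derivation_sum_apply, function_sum_apply]
      change D (χ c) x * -(∑ i, Y c i h) x + ∑ i, D (χu c i) x * X c i h x = _
      rw [function_sum_apply, ← Finset.sum_neg_distrib, mul_sum, ← sum_add_distrib, mul_sum]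
      refine sum_ext fun i => ?_
      rw [hX, hY]; ring
    rw [h1]
    by_cases hc : χ c x = 0
    · simp [hc]
    · have hx := hq c x (subset_tsupport _ hc)
      rw [← derivation_eq_of_chart D (β (q c x)) hx.self_of_nhds.2.1 hx.self_of_nhds.2.2 (χ c)
        (χu c) (hx.mono fun y hy i => by rw [← hy.1]; rfl) h]
      ring
  rw [sum_ext fun c => key c, ← sum_mul, hη, one_mul]

end VectorFields

/-! ## The operator `T ↦ ∑ c(eᵢ) T c(e'ᵢ)` -/

section Sandwich

open Polynomial

/-- Clifford multiplication in a complex algebra, with dual frames. -/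
structure CliffordAct {A P : Type*} [CommRing A] [Algebra ℝ A] [AddCommGroup P] [Module A P]
    (g : LinearMap.BilinForm A P) (B : Type*) [Ring B] [Algebra ℂ B] where
  m : A →ₐ[ℝ] B
  c : P →+ B
  c_smul : ∀ f ξ, c (f • ξ) = m f * c ξ
  m_comm : ∀ f ξ, m f * c ξ = c ξ * m f
  cliff : ∀ ξ η, c ξ * c η + c η * c ξ = (2 : ℂ) • m (g ξ η)
  k : ℕ
  e : Fin k → P
  e' : Fin k → P
  sum_left : ∀ ξ, ∑ i, g (e' i) ξ • e i = ξ
  sum_right : ∀ ξ, ∑ i, g (e i) ξ • e' i = ξ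
  symm : ∀ ξ η, g ξ η = g η ξ
  rank : ℝ
  sum_rank : ∑ i, g (e' i) (e i) = algebraMap ℝ A rank

namespace CliffordAct

section General

variable {A P : Type*} [CommRing A] [Algebra ℝ A] [AddCommGroup P] [Module A P]
  {g : LinearMap.BilinForm A P} {B : Type*} [Ring B] [Algebra ℂ B] (K : CliffordAct g B)

/-- The operator `T ↦ ∑ c(eᵢ) T c(e'ᵢ)`. -/
def C : Module.End ℂ B :=
  ∑ i, mulLeft ℂ (K.c (K.e i)) ∘ₗ LinearMap.mulRight ℂ (K.c (K.e' i))

lemma C_apply (T : B) : K.C T = ∑ i, K.c (K.e i) * T * K.c (K.e' i) := by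
  simp only [C, lm_sum, lm_comp, mulLeft_apply, LinearMap.mulRight_apply, mul_assoc]

lemma sum_m_mul_c (ξ : P) : ∑ i, K.m (g (K.e' i) ξ) * K.c (K.e i) = K.c ξ := by
  conv_rhs => rw [← K.sum_left ξ, map_sum]
  simp only [K.c_smul]

lemma sum_m_mul_c' (ξ : P) : ∑ i, K.m (g (K.e i) ξ) * K.c (K.e' i) = K.c ξ := by
  conv_rhs => rw [← K.sum_right ξ, map_sum]
  simp only [K.c_smul]

lemma m_rank : K.m (algebraMap ℝ A K.rank) = (K.rank : ℂ) • (1 : B) := by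
  rw [AlgHom.commutes]
  exact algebraMap_eq_smul_one (A := B) (K.rank : ℂ)

lemma sum_c_mul_c : ∑ i, K.c (K.e i) * K.c (K.e' i) = (K.rank : ℂ) • (1 : B) := by
  have h1 : ∑ i, K.c (K.e i) * K.c (K.e' i) = ∑ i, K.c (K.e' i) * K.c (K.e i) := by
    have h : ∀ i, K.c (K.e i) * K.c (K.e' i) = ∑ j, K.m (g (K.e' i) (K.e' j)) * K.c (K.e i) *
        K.c (K.e j) := fun i => by
      rw [← K.sum_m_mul_c (K.e' i), mul_sum]
      exact sum_ext fun j => by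
        rw [← mul_assoc, ← K.m_comm, K.symm]
    rw [sum_ext fun i => h i, sum_comm]
    exact sum_ext fun j => by rw [← sum_mul, K.sum_m_mul_c]
  have h2 : (2 : ℂ) • ∑ i, K.c (K.e i) * K.c (K.e' i) = (2 : ℂ) • (K.rank : ℂ) • (1 : B) := by
    conv_lhs => rw [two_smul]
    conv_lhs => enter [2]; rw [h1]
    rw [← sum_add_distrib, ← K.m_rank, ← K.sum_rank, map_sum, smul_sum]
    exact sum_ext fun i => by rw [K.cliff, K.symm]
  exact smul_right_injective B (two_ne_zero' ℂ) h2

lemma C_c_mul {T : B} (hT : ∀ f, K.m f * T = T * K.m f) (v : P) :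
    K.C (K.c v * T) = (2 : ℂ) • (T * K.c v) - K.c v * K.C T := by
  rw [C_apply, C_apply, mul_sum, ← K.sum_m_mul_c' v, mul_sum, smul_sum, ← sum_sub_distrib]
  refine sum_ext fun i => ?_
  rw [K.sum_m_mul_c', ← mul_assoc (K.c (K.e i)), eq_sub_of_add_eq (K.cliff (K.e i) v), sub_mul,
    sub_mul, smul_mul_assoc, smul_mul_assoc, hT]
  noncomm_ring

lemma C_comm {T : B} (hT : ∀ f, K.m f * T = T * K.m f) (v : P) : K.C T * K.c v - K.c v * K.C T =
      -((2 : ℂ) • (T * K.c v - K.c v * T)) - K.C (T * K.c v - K.c v * T) := by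
  have h1 : K.C (T * K.c v) = (2 : ℂ) • (K.c v * T) - K.C T * K.c v := by
    rw [C_apply, C_apply, sum_mul, ← K.sum_m_mul_c v, sum_mul, smul_sum, ← sum_sub_distrib]
    refine sum_ext fun i => ?_
    have h : ∀ f, K.c (K.e i) * T * K.m f = K.m f * K.c (K.e i) * T := fun f => by
      rw [mul_assoc, ← hT, ← mul_assoc, ← K.m_comm]
    rw [K.sum_m_mul_c, show K.c (K.e i) * (T * K.c v) * K.c (K.e' i) =
      K.c (K.e i) * T * (K.c v * K.c (K.e' i)) by simp only [mul_assoc],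
      eq_sub_of_add_eq (K.cliff v (K.e' i)), K.symm v, mul_sub, mul_smul_comm, h,
      mul_assoc _ (K.c (K.e' i))]
  rw [map_sub, h1, K.C_c_mul hT]
  simp only [smul_sub]
  abel

lemma C_m_comm {T : B} (hT : ∀ f, K.m f * T = T * K.m f) (f : A) :
    K.m f * K.C T = K.C T * K.m f := by
  rw [C_apply, mul_sum, sum_mul]
  refine sum_ext fun i => ?_
  exact (Commute.mul_right (Commute.mul_right (K.m_comm f _) (hT f)) (K.m_comm f _) :
    Commute (K.m f) _)

lemma aeval_comm (q : ℂ[X]) {T : B} (hT : ∀ f, K.m f * T = T * K.m f) :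
    (∀ f, K.m f * aeval (-2 - K.C) q T = aeval (-2 - K.C) q T * K.m f) ∧
    ∀ v, aeval (-2 - K.C) q T * K.c v - K.c v * aeval (-2 - K.C) q T =
      aeval K.C q (T * K.c v - K.c v * T) := by
  induction q using Polynomial.induction_on' with
  | add p q hp hq =>
    refine ⟨fun f => ?_, fun v => ?_⟩
    · simp only [map_add, lm_add, mul_add, add_mul, hp.1, hq.1]
    · rw [map_add, map_add, lm_add, lm_add, ← hp.2, ← hq.2]
      noncomm_ring
  | monomial j z =>
    induction j with
    | zero =>
      simp only [monomial_zero_left, aeval_C, Module.algebraMap_end_apply, mul_smul_comm,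
        smul_mul_assoc, hT, smul_sub, implies_true, and_self]
    | succ j ih =>
      have h1 : ∀ D : Module.End ℂ B, aeval D (monomial (j + 1) z) = D * aeval D (monomial j z) := by
        intro D
        rw [← X_mul_monomial, map_mul, aeval_X]
      have h2 : ∀ U : B, (-2 - K.C) U = -((2 : ℂ) • U) - K.C U := fun U => by
        rw [lm_sub, LinearMap.neg_apply, two_smul]
        congr 2
        exact two_smul ℕ U
      rw [h1, h1, mul_apply, h2]
      refine ⟨fun f => ?_, fun v => ?_⟩
      · rw [mul_sub, sub_mul, K.C_m_comm ih.1, mul_neg, neg_mul, mul_smul_comm, smul_mul_assoc,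
          ih.1]
      · rw [mul_apply, ← ih.2]
        have h3 := K.C_comm ih.1 v
        rw [sub_mul, mul_sub, neg_mul, mul_neg, smul_mul_assoc, mul_smul_comm,
          sub_sub_sub_comm, h3, smul_sub]
        abel

end General

section Fibre

variable {V : Type*} [AddCommGroup V] [Module ℝ V] {g : LinearMap.BilinForm ℝ V}
  {B : Type*} [Ring B] [Algebra ℂ B] (K : CliffordAct g B)

lemma m_eq (r : ℝ) : K.m r = (r : ℂ) • (1 : B) := by
  rw [show K.m r = algebraMap ℝ B r from K.m.commutes r]
  exact algebraMap_eq_smul_one (A := B) (r : ℂ)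

lemma m_mul_comm (r : ℝ) (T : B) : K.m r * T = T * K.m r := by
  rw [m_eq, smul_mul_assoc, mul_smul_comm, one_mul, mul_one]

/-- Products of frame elements. -/
def word (l : List (Fin K.k)) : B := (l.map fun a => K.c (K.e a)).prod

lemma word_cons (a : Fin K.k) (l : List (Fin K.k)) : K.word (a :: l) = K.c (K.e a) * K.word l := rfl

/-- The span of the words whose length is at most `k - 2` and congruent to `k` modulo `2`. -/
def wordSpan (k : ℕ) : Submodule ℂ B :=
  Submodule.span ℂ {T | ∃ l j, l.length + 2 + 2 * j = k ∧ K.word l = T}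

lemma word_mem {l : List (Fin K.k)} (j : ℕ) {k : ℕ} (h : l.length + 2 + 2 * j = k) :
    K.word l ∈ K.wordSpan k := subset_span ⟨l, j, h, rfl⟩

lemma c_mul_mem {k : ℕ} {T : B} (hT : T ∈ K.wordSpan k) (v : V) :
    K.c v * T ∈ K.wordSpan (k + 1) := by
  rw [← K.sum_m_mul_c v, sum_mul]
  refine sum_mem fun a _ => ?_
  rw [m_eq, smul_mul_assoc, smul_mul_assoc, one_mul]
  refine smul_mem _ _ ?_
  induction hT using span_induction with
  | mem T h =>
    obtain ⟨l, j, h, rfl⟩ := h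
    exact K.word_mem (l := a :: l) j (by simp only [List.length_cons]; omega)
  | zero => rw [mul_zero]; exact zero_mem _
  | add T U _ _ h1 h2 => rw [mul_add]; exact add_mem h1 h2
  | smul z T _ h => rw [mul_smul_comm]; exact smul_mem _ z h

/-- The eigenvalue of `C` on words of length `k`. -/
def eig (r : ℝ) (k : ℕ) : ℂ := (-1) ^ k * (r - 2 * k)

lemma word_comm (l : List (Fin K.k)) (v : V) :
    K.word l * K.c v - (-1 : ℂ) ^ l.length • (K.c v * K.word l) ∈ K.wordSpan (l.length + 1) := by
  induction l with
  | nil => simp [word]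
  | cons a l ih =>
    have h1 := K.c_mul_mem ih (K.e a)
    have h2 : K.word l ∈ K.wordSpan (l.length + 1 + 1) := K.word_mem 0 (by omega)
    have h3 := add_mem h1
      (smul_mem _ ((-1 : ℂ) ^ l.length * 2 * (g (K.e a) v : ℝ)) h2)
    refine (congrArg (· ∈ K.wordSpan (l.length + 1 + 1)) ?_).mp h3
    have h4 : K.c v * (K.c (K.e a) * K.word l) = (2 * (g (K.e a) v : ℝ) : ℂ) • K.word l -
        K.c (K.e a) * (K.c v * K.word l) := by
      rw [← mul_assoc, eq_sub_of_add_eq' (K.cliff (K.e a) v), m_eq, sub_mul, smul_smul,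
        smul_mul_assoc, one_mul, mul_assoc]
    rw [word_cons, List.length_cons, h4, mul_sub, mul_smul_comm, mul_assoc (K.c _), smul_sub, pow_succ]
    module

lemma C_word (l : List (Fin K.k)) :
    K.C (K.word l) - eig K.rank l.length • K.word l ∈ K.wordSpan l.length := by
  induction l with
  | nil =>
    have : K.C (K.word []) = eig K.rank 0 • K.word [] := by
      simp only [C_apply, word, List.map_nil, List.prod_nil, mul_one, sum_c_mul_c, eig]
      simp
    rw [List.length_nil, this, sub_self]
    exact zero_mem _
  | cons a l ih =>
    have h1 := sub_mem (smul_mem _ (2 : ℂ) (K.word_comm l (K.e a)))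
      (K.c_mul_mem ih (K.e a))
    refine (congrArg (· ∈ K.wordSpan (l.length + 1)) ?_).mp h1
    rw [word_cons, List.length_cons, K.C_c_mul fun r => K.m_mul_comm r _, mul_sub, mul_smul_comm,
      eig, eig, pow_succ]
    push_cast
    module

/-- The polynomial which kills the words of parity `p` and length less than `2 j + p`. -/
def killer (r : ℝ) (p j : ℕ) : ℂ[X] := ∏ i ∈ Finset.range j, (X - Polynomial.C (eig r (2 * i + p)))

lemma killer_kills {p : ℕ} (hp : p < 2) (j : ℕ) {T : B} (hT : T ∈ K.wordSpan (2 * j + p)) :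
    aeval K.C (killer K.rank p j) T = 0 := by
  induction j generalizing T with
  | zero =>
    have : K.wordSpan (2 * 0 + p) = ⊥ :=
      Submodule.span_eq_bot.2 (by rintro _ ⟨l, j, h, rfl⟩; omega)
    rw [this, mem_bot] at hT
    rw [hT, map_zero]
  | succ j ih =>
    rw [killer, Finset.prod_range_succ, map_mul, mul_apply]
    refine ih ?_
    rw [map_sub, aeval_X, aeval_C, lm_sub, Module.algebraMap_end_apply]
    induction hT using span_induction with
    | mem T h =>
      obtain ⟨l, i, h, rfl⟩ := h
      rcases Nat.eq_zero_or_pos i with rfl | hi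
      · have := K.C_word l
        rwa [show l.length = 2 * j + p by omega] at this
      · have h1 : K.word l ∈ K.wordSpan (2 * j + p) := K.word_mem (i - 1) (by omega)
        have h2 : K.wordSpan l.length ≤ K.wordSpan (2 * j + p) := by
          refine span_le.2 ?_
          rintro _ ⟨l', j', h', rfl⟩
          exact K.word_mem (j' + i) (by omega)
        have h3 := add_mem (h2 (K.C_word l)) (smul_mem _ (eig K.rank l.length) h1)
        rw [sub_add_cancel] at h3
        exact sub_mem h3 (smul_mem _ _ h1)
    | zero => simp
    | add T U _ _ h1 h2 =>
      rw [map_add, smul_add, add_sub_add_comm]; exact add_mem h1 h2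
    | smul z T _ h => rw [map_smul, smul_comm, ← smul_sub]; exact smul_mem _ z h

lemma c_mul_word_mem (a : Fin K.k) (l : List (Fin K.k)) (ha : a ∈ l) :
    K.c (K.e a) * K.word l ∈ K.wordSpan (l.length + 1) := by
  induction l with
  | nil => simp at ha
  | cons b l ih =>
    have hw : K.word l ∈ K.wordSpan (l.length + 2) := K.word_mem 0 (by omega)
    have h := K.cliff (K.e a) (K.e b)
    rw [word_cons, ← mul_assoc, List.length_cons]
    rcases List.mem_cons.1 ha with rfl | ha
    · rw [← two_smul ℂ] at h
      rw [smul_right_injective B (two_ne_zero' ℂ) h, m_eq, smul_mul_assoc, one_mul]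
      exact smul_mem _ _ hw
    · rw [eq_sub_of_add_eq h, m_eq, sub_mul, smul_smul, smul_mul_assoc, one_mul, mul_assoc]
      exact sub_mem (smul_mem _ _ hw) (K.c_mul_mem (ih ha) _)

lemma word_mem_of_not_nodup (l : List (Fin K.k)) (hl : ¬ l.Nodup) :
    K.word l ∈ K.wordSpan l.length := by
  induction l with
  | nil => simp at hl
  | cons b l ih =>
    by_cases hb : b ∈ l
    · exact K.c_mul_word_mem b l hb
    · exact K.c_mul_mem (ih fun h => hl (List.nodup_cons.2 ⟨hb, h⟩)) _

lemma wordSpan_stable (p i : ℕ) : K.wordSpan (2 * i + p) ≤ K.wordSpan (2 * (K.k + 2) + p) := by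
  induction i with
  | zero =>
    refine span_le.2 ?_
    rintro _ ⟨l, j, h, rfl⟩
    exact K.word_mem (j + (K.k + 2)) (by omega)
  | succ i ih =>
    refine span_le.2 ?_
    rintro _ ⟨l, j, h, rfl⟩
    by_cases hj : i + 1 ≤ K.k + 2
    · exact K.word_mem (j + (K.k + 2 - (i + 1))) (by omega)
    · rcases Nat.eq_zero_or_pos j with rfl | hj'
      · refine ih ?_
        have := K.word_mem_of_not_nodup l fun hn => by
          have := hn.length_le_card
          rw [Fintype.card_fin] at this
          omega
        rwa [show l.length = 2 * i + p by omega] at this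
      · exact ih (K.word_mem (j - 1) (by omega))

end Fibre

end CliffordAct

end Sandwich

/-! ## Coprimality -/

section Coprime

open Polynomial

lemma eig_even (s i : ℕ) : CliffordAct.eig ((2 * s : ℕ) : ℝ) (2 * i + 0) = ((2 * s - 4 * i : ℤ) : ℂ) := by
  rw [CliffordAct.eig, add_zero, pow_mul]; push_cast; ring

lemma eig_odd (s i : ℕ) :
    CliffordAct.eig ((2 * s : ℕ) : ℝ) (2 * i + 1) = ((4 * i + 2 - 2 * s : ℤ) : ℂ) := by
  rw [CliffordAct.eig, pow_succ, pow_mul]; push_cast; ring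

lemma isCoprime_X_sub_C_intCast {a b : ℤ} (h : a ≠ b) :
    IsCoprime (X - C ((a : ℤ) : ℂ)) (X - C ((b : ℤ) : ℂ)) :=
  isCoprime_X_sub_C_of_isUnit_sub (sub_ne_zero.2 (by exact_mod_cast h)).isUnit

lemma killer_coprime (s j : ℕ) :
    IsCoprime (CliffordAct.killer ((2 * s : ℕ) : ℝ) 0 j) (CliffordAct.killer ((2 * s : ℕ) : ℝ) 1 j) := by
  refine IsCoprime.prod_left fun a _ => IsCoprime.prod_right fun b _ => ?_
  rw [eig_even, eig_odd]
  exact isCoprime_X_sub_C_intCast (by omega)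

lemma killer_coprime_add_two (s j : ℕ) : IsCoprime (X - C ((-2 * s - 2 : ℤ) : ℂ))
    (CliffordAct.killer ((2 * s : ℕ) : ℝ) 0 j * CliffordAct.killer ((2 * s : ℕ) : ℝ) 1 j) := by
  refine IsCoprime.mul_right (IsCoprime.prod_right fun b _ => ?_) (IsCoprime.prod_right fun b _ => ?_)
  · rw [eig_even]; exact isCoprime_X_sub_C_intCast (by omega)
  · rw [eig_odd]; exact isCoprime_X_sub_C_intCast (by omega)

lemma killer_one_coprime (s j : ℕ) : IsCoprime (X - C ((-2 * s : ℤ) : ℂ))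
    (CliffordAct.killer ((2 * s : ℕ) : ℝ) 1 j) := by
  refine IsCoprime.prod_right fun b _ => ?_
  rw [eig_odd]; exact isCoprime_X_sub_C_intCast (by omega)

lemma eq_zero_of_isCoprime {V : Type*} [AddCommGroup V] [Module ℂ V] {f : Module.End ℂ V}
    {p q : ℂ[X]} (h : IsCoprime p q) {v : V} (hp : aeval f p v = 0) (hq : aeval f q v = 0) :
    v = 0 := by
  obtain ⟨a, b, hab⟩ := h
  have := congrArg (fun u => aeval f u v) hab
  simpa [hp, hq] using this.symm

lemma aeval_monomial_succ {V : Type*} [AddCommGroup V] [Module ℂ V] (f : Module.End ℂ V)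
    (j : ℕ) (z : ℂ) (v : V) : aeval f (monomial (j + 1) z) v = f (aeval f (monomial j z) v) := by
  rw [← X_mul_monomial, map_mul, aeval_X, mul_apply]

namespace CliffordAct

variable {A P : Type*} [CommRing A] [Algebra ℝ A] [AddCommGroup P] [Module A P]
  {g : LinearMap.BilinForm A P} {B : Type*} [Ring B] [Algebra ℂ B] (K : CliffordAct g B)

lemma comm_C {D : B} {X : Derivation ℝ A A} {nab : P → P}
    (hg : ∀ ξ η, X (g ξ η) = g (nab ξ) η + g ξ (nab η))
    (hD : ∀ ξ, D * K.c ξ - K.c ξ * D = K.c (nab ξ)) {T : B} (hT : ∀ f, K.m f * T = T * K.m f) :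
    D * K.C T - K.C T * D = K.C (D * T - T * D) := by
  have hD : ∀ ξ, D * K.c ξ = K.c ξ * D + K.c (nab ξ) := fun ξ => eq_add_of_sub_eq' (hD ξ)
  let h : Fin K.k → Fin K.k → A := fun i j => g (K.e i) (K.e' j)
  let t := ∑ i, ∑ j, K.m (X (h i j)) * K.c (K.e j) * T * K.c (K.e' i)
  have h1 : ∑ i, K.c (nab (K.e i)) * T * K.c (K.e' i) +
      ∑ i, K.c (K.e i) * T * K.c (nab (K.e' i)) = t := by
    have e1 : ∀ i, K.c (nab (K.e i)) * T * K.c (K.e' i) =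
        ∑ j, K.m (g (nab (K.e i)) (K.e' j)) * K.c (K.e j) * T * K.c (K.e' i) :=
      fun i => by
        rw [← sum_mul, ← sum_mul, ← K.sum_m_mul_c (nab (K.e i))]
        simp only [K.symm (K.e' _)]
    have e2 : ∑ i, K.c (K.e i) * T * K.c (nab (K.e' i)) = ∑ i, ∑ j,
        K.m (g (K.e i) (nab (K.e' j))) * K.c (K.e j) * T * K.c (K.e' i) := by
      rw [sum_comm]
      refine sum_ext fun j => ?_
      rw [← K.sum_m_mul_c' (nab (K.e' j)), mul_sum]
      exact sum_ext fun i => by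
        rw [← mul_assoc, mul_assoc _ T, ← hT, ← mul_assoc, ← K.m_comm]
    rw [sum_ext fun i => e1 i, e2, ← sum_add_distrib]
    refine sum_ext fun i => ?_
    rw [← sum_add_distrib]
    refine sum_ext fun j => ?_
    rw [hg, map_add, add_mul, add_mul, add_mul]
  have hh : ∀ i j, h i j = ∑ l, h i l * h l j := fun i j => by
    have := K.sum_left (K.e i)
    conv_lhs => rw [show h i j = g (K.e i) (K.e' j) from rfl, ← this]
    rw [LinearMap.BilinForm.sum_left]
    exact sum_ext fun l => by rw [LinearMap.BilinForm.smul_left, K.symm (K.e' l)]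
  have ht : t = t + t := by
    have e0 : ∀ i j, K.m (X (h i j)) * K.c (K.e j) * T * K.c (K.e' i) =
        ∑ l, (K.m (X (h i l)) * (K.m (h l j) * K.c (K.e j)) * T * K.c (K.e' i) +
          K.m (X (h l j)) * K.c (K.e j) * T * (K.m (h i l) * K.c (K.e' i))) := fun i j => by
      conv_lhs => rw [hh i j, map_sum, map_sum, sum_mul, sum_mul, sum_mul]
      refine sum_ext fun l => ?_
      have e3 : K.m (X (h l j)) * K.c (K.e j) * T * (K.m (h i l) * K.c (K.e' i)) =
          K.m (h i l) * K.m (X (h l j)) * K.c (K.e j) * T * K.c (K.e' i) := by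
        rw [← mul_assoc, mul_assoc _ T, ← hT, ← mul_assoc, mul_assoc (K.m _) _ (K.m _), ← K.m_comm,
          ← mul_assoc, ← map_mul, mul_comm, map_mul]
      rw [e3, Derivation.leibniz, map_add, smul_eq_mul, smul_eq_mul, map_mul, map_mul,
        show K.m (h l j) * K.m (X (h i l)) = K.m (X (h i l)) * K.m (h l j) by
          rw [← map_mul, mul_comm, map_mul]]
      noncomm_ring
    have e4 : t = ∑ i, ∑ l, K.m (X (h i l)) * K.c (K.e l) * T * K.c (K.e' i) +
        ∑ l, ∑ j, K.m (X (h l j)) * K.c (K.e j) * T * K.c (K.e' l) := by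
      have e5 : ∀ l, ∑ j, K.m (h l j) * K.c (K.e j) = K.c (K.e l) := fun l => by
        simp only [h, K.symm (K.e l), K.sum_m_mul_c]
      have e6 : ∀ l, ∑ i, K.m (h i l) * K.c (K.e' i) = K.c (K.e' l) := fun l => K.sum_m_mul_c' _
      rw [show t = _ from sum_ext fun i => sum_ext fun j => e0 i j]
      simp only [sum_add_distrib]
      congr 1
      · refine sum_ext fun i => ?_
        rw [sum_comm]
        refine sum_ext fun l => ?_
        rw [← sum_mul, ← sum_mul, ← mul_sum, e5]
      · rw [sum_comm]
        rw [sum_ext fun j => sum_comm, sum_comm]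
        refine sum_ext fun l => sum_ext fun j => ?_
        rw [← mul_sum, e6]
    exact e4
  rw [CliffordAct.C_apply, CliffordAct.C_apply, mul_sum, sum_mul,
    ← sum_sub_distrib, ← add_zero (∑ i, K.c (K.e i) * (D * T - T * D) * K.c (K.e' i)),
    ← left_eq_add.1 ht, ← h1, ← sum_add_distrib, ← sum_add_distrib]
  refine sum_ext fun i => ?_
  rw [← mul_assoc, ← mul_assoc, hD, mul_assoc _ _ D, eq_sub_of_add_eq (hD (K.e' i)).symm]
  noncomm_ring

/-- Submodules to which the recursion on the length of words in `Y` applies. -/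
structure Stable (Y : Submodule ℂ B) (cop : ZMod 2 → Submodule ℂ B) : Prop where
  one_mem : 1 ∈ Y
  comm_mem : ∀ y ∈ Y, ∀ p, ∀ T ∈ cop p, y * T - T * y ∈ cop p
  mul_mem : ∀ p q T U, T ∈ cop p → U ∈ cop q → T * U ∈ cop (p + q)
  c_mem : ∀ ξ, K.c ξ ∈ cop 1

/-- `D` is a combination of products of elements of `cop p` and of elements of `Y`. -/
def Reach (Y : Submodule ℂ B) (cop : ZMod 2 → Submodule ℂ B) (p : ZMod 2) (D : B) : Prop :=
  ∃ m, D ∈ cop p * Y ^ m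

lemma Reach.of_mem {Y : Submodule ℂ B} {cop : ZMod 2 → Submodule ℂ B} {p : ZMod 2} {T : B}
    (hT : T ∈ cop p) : Reach Y cop p T :=
  ⟨0, by rwa [pow_zero, mul_one]⟩

lemma Reach.of_one_mem {Y : Submodule ℂ B} {cop : ZMod 2 → Submodule ℂ B} (h : 1 ∈ cop 0) {y : B}
    (hy : y ∈ Y) : Reach Y cop 0 y :=
  ⟨1, by simpa using mul_mem_mul h hy⟩

namespace Stable

variable {K} {Y : Submodule ℂ B} {cop : ZMod 2 → Submodule ℂ B} (h : K.Stable Y cop)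

include h in
lemma pow_mul_le (p : ZMod 2) (m : ℕ) : Y ^ m * cop p ≤ cop p * Y ^ m := by
  have h2 : Y * cop p ≤ cop p * Y := mul_le.2 fun y hy T hT => by
    rw [← sub_add_cancel (y * T) (T * y), ← mul_one (y * T - T * y)]
    exact add_mem (mul_mem_mul (h.comm_mem y hy p T hT) h.one_mem)
      (mul_mem_mul hT hy)
  induction m with
  | zero => rw [pow_zero, one_mul, mul_one]
  | succ m ih =>
    calc Y ^ (m + 1) * cop p = Y ^ m * (Y * cop p) := by rw [pow_succ, mul_assoc]
      _ ≤ Y ^ m * (cop p * Y) := mul_le_mul' le_rfl h2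
      _ = Y ^ m * cop p * Y := (mul_assoc _ _ _).symm
      _ ≤ cop p * Y ^ m * Y := mul_le_mul' ih le_rfl
      _ = cop p * Y ^ (m + 1) := by rw [pow_succ, mul_assoc]

include h in
lemma pow_comm_mem (m : ℕ) {w : B} (hw : w ∈ Y ^ (m + 1)) (ξ : P) :
    w * K.c ξ - K.c ξ * w ∈ cop 1 * Y ^ m := by
  induction m generalizing w with
  | zero =>
    rw [pow_zero, mul_one]
    exact h.comm_mem _ (by simpa using hw) _ _ (h.c_mem ξ)
  | succ m ih =>
    rw [pow_succ'] at hw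
    refine mul_induction_on hw (fun y hy w hw => ?_) (fun a b ha hb => ?_)
    · have h2 : Y * (cop 1 * Y ^ m) ≤ cop 1 * Y ^ (m + 1) := by
        rw [← mul_assoc, pow_succ', ← mul_assoc]
        exact mul_le_mul' (by simpa using h.pow_mul_le 1 1) le_rfl
      have h3 := add_mem (h2 (mul_mem_mul hy (ih hw)))
        (mul_mem_mul (h.comm_mem y hy _ _ (h.c_mem ξ)) hw)
      refine (congrArg (· ∈ cop 1 * Y ^ (m + 1)) ?_).mp h3
      noncomm_ring
    · rw [add_mul, mul_add, add_sub_add_comm]; exact add_mem ha hb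

include h in
lemma sandwich_mem {p : ZMod 2} {T : B} (hT : T ∈ cop p) (ξ η : P) : K.c ξ * T * K.c η ∈ cop p := by
  have := h.mul_mem _ _ _ _ (h.mul_mem _ _ _ _ (h.c_mem ξ) hT) (h.c_mem η)
  rwa [add_right_comm, one_add_one_zmod, zero_add] at this

include h in
lemma C_mem {p : ZMod 2} {T : B} (hT : T ∈ cop p) : K.C T ∈ cop p := by
  rw [C_apply]
  exact sum_mem fun i _ => h.sandwich_mem hT _ _

include h in
lemma C_mul_sub_mem {p : ZMod 2} {m : ℕ} {T w : B} (hT : T ∈ cop p) (hw : w ∈ Y ^ (m + 1)) :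
    K.C (T * w) - K.C T * w ∈ cop p * Y ^ m := by
  rw [C_apply, C_apply, sum_mul, ← sum_sub_distrib]
  refine sum_mem fun i _ => ?_
  have h2 : ∀ v ∈ cop 1 * Y ^ m, K.c (K.e i) * T * v ∈ cop p * Y ^ m := fun v hv => by
    refine mul_induction_on hv (fun U hU y hy => ?_) fun a b ha hb => by
      rw [mul_add]; exact add_mem ha hb
    rw [← mul_assoc]
    have := h.mul_mem _ _ _ _ (h.mul_mem _ _ _ _ (h.c_mem (K.e i)) hT) hU
    rw [add_right_comm, one_add_one_zmod, zero_add] at this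
    exact mul_mem_mul this hy
  refine (congrArg (· ∈ cop p * Y ^ m) ?_).mp (h2 _ (h.pow_comm_mem m hw (K.e' i)))
  noncomm_ring

include h in
lemma C_mul_mem {p : ZMod 2} {m : ℕ} {D : B} (hD : D ∈ cop p * Y ^ m) : K.C D ∈ cop p * Y ^ m := by
  refine mul_induction_on hD (fun T hT w hw => ?_) fun a b ha hb => by
    rw [map_add]; exact add_mem ha hb
  cases m with
  | zero =>
    rw [pow_zero, mul_one] at hD ⊢
    obtain ⟨z, rfl⟩ := Submodule.mem_one.1 (by simpa using hw)
    rw [← commutes, ← smul_def, map_smul]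
    exact smul_mem _ _ (h.C_mem hT)
  | succ m =>
    have h2 := mul_mem_mul (h.C_mul_sub_mem hT hw) h.one_mem
    rw [mul_one, mul_assoc, ← pow_succ] at h2
    rw [← sub_add_cancel (K.C (T * w)) (K.C T * w)]
    exact add_mem h2 (mul_mem_mul (h.C_mem hT) hw)

include h in
lemma aeval_mul_sub_mem {p : ZMod 2} {m : ℕ} {T w : B} (hT : T ∈ cop p) (hw : w ∈ Y ^ (m + 1))
    (q : ℂ[X]) : aeval K.C q (T * w) - aeval K.C q T * w ∈ cop p * Y ^ m := by
  suffices aeval K.C q T ∈ cop p ∧ aeval K.C q (T * w) - aeval K.C q T * w ∈ cop p * Y ^ m from this.2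
  induction q using Polynomial.induction_on' with
  | add q q' hq hq' =>
    simp only [map_add, lm_add, add_mul, add_sub_add_comm]
    exact ⟨add_mem hq.1 hq'.1, add_mem hq.2 hq'.2⟩
  | monomial j z =>
    induction j with
    | zero =>
      simp only [monomial_zero_left, aeval_C, Module.algebraMap_end_apply, smul_mul_assoc, sub_self]
      exact ⟨smul_mem _ _ hT, zero_mem _⟩
    | succ j ih =>
      simp only [aeval_monomial_succ]
      refine ⟨h.C_mem ih.1, ?_⟩
      have h2 := add_mem (h.C_mul_mem ih.2)
        (h.C_mul_sub_mem ih.1 hw)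
      rwa [map_sub, sub_add_sub_cancel] at h2

include h in
lemma aeval_pow_eq_zero {p : ZMod 2} {q : ℂ[X]} (hq : ∀ T ∈ cop p, aeval K.C q T = 0) (m : ℕ)
    {D : B} (hD : D ∈ cop p * Y ^ m) : aeval K.C (q ^ (m + 1)) D = 0 := by
  induction m generalizing D with
  | zero =>
    rw [pow_zero, mul_one] at hD
    rw [zero_add, pow_one, hq D hD]
  | succ m ih =>
    rw [pow_succ, map_mul, mul_apply]
    refine ih (mul_induction_on hD (fun T hT w hw => ?_) fun a b ha hb => by
      rw [map_add]; exact add_mem ha hb)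
    have h2 := h.aeval_mul_sub_mem hT hw q
    rwa [hq T hT, zero_mul, sub_zero] at h2

include h in
lemma mul_mem_mul_pow {p q : ZMod 2} {m l : ℕ} {D D' : B} (hD : D ∈ cop p * Y ^ m)
    (hD' : D' ∈ cop q * Y ^ l) : D * D' ∈ cop (p + q) * Y ^ (m + l) := by
  have h2 : cop p * Y ^ m * (cop q * Y ^ l) ≤ cop (p + q) * Y ^ (m + l) :=
    calc cop p * Y ^ m * (cop q * Y ^ l) = cop p * (Y ^ m * cop q) * Y ^ l := by simp only [mul_assoc]
      _ ≤ cop p * (cop q * Y ^ m) * Y ^ l :=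
        mul_le_mul' (mul_le_mul' le_rfl (h.pow_mul_le q m)) le_rfl
      _ = cop p * cop q * Y ^ (m + l) := by simp only [mul_assoc, pow_add]
      _ ≤ _ := mul_le_mul' (mul_le.2 fun T hT U hU => h.mul_mem _ _ T U hT hU) le_rfl
  exact h2 (mul_mem_mul hD hD')

include h in
lemma killed {p : ZMod 2} {q : ℂ[X]} (hq : ∀ T ∈ cop p, aeval K.C q T = 0) {D : B} :
    Reach Y cop p D → ∃ N, aeval K.C (q ^ N) D = 0 :=
  fun ⟨m, hD⟩ => ⟨m + 1, h.aeval_pow_eq_zero hq m hD⟩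

include h in
lemma reach_mul {p q : ZMod 2} {D D' : B} : Reach Y cop p D → Reach Y cop q D' →
    Reach Y cop (p + q) (D * D') :=
  fun ⟨m, hD⟩ ⟨l, hD'⟩ => ⟨m + l, h.mul_mem_mul_pow hD hD'⟩

end Stable

end CliffordAct

/-! ## Compatible pairs of connections -/

namespace CliffordAct

variable {A P : Type*} [CommRing A] [Algebra ℝ A] [AddCommGroup P] [Module A P]
  {g : LinearMap.BilinForm A P} {B : Type*} [Ring B] [Algebra ℂ B] (K : CliffordAct g B)

lemma exists_corrected {q : ℂ[X]} (hq : IsCoprime (X - Polynomial.C (-2 - K.rank : ℂ)) q)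
    (hkill : ∀ T, (∀ f, K.m f * T = T * K.m f) → aeval K.C q T = 0) {V : Derivation ℝ A A} {D : B}
    (hD : ∀ f, D * K.m f - K.m f * D = K.m (V f)) {nab : P → P}
    (hadd : ∀ ξ η, nab (ξ + η) = nab ξ + nab η)
    (hnab : ∀ (f : A) ξ, nab (f • ξ) = V f • ξ + f • nab ξ)
    (hg : ∀ ξ η, V (g ξ η) = g (nab ξ) η + g ξ (nab η)) :
    ∃ D', (∀ f, D' * K.m f - K.m f * D' = K.m (V f)) ∧
      ∀ ξ, D' * K.c ξ - K.c ξ * D' = K.c (nab ξ) := by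
  have hDm : ∀ f, D * K.m f = K.m (V f) + K.m f * D := fun f => eq_add_of_sub_eq (hD f)
  let θ : P →+ B :=
    { toFun := fun ξ => K.c (nab ξ) - (D * K.c ξ - K.c ξ * D)
      map_zero' := by
        have := hnab 0 0
        rw [smul_zero, smul_zero, zero_smul, add_zero] at this
        rw [this, map_zero, mul_zero, zero_mul, sub_zero, sub_zero]
      map_add' := fun ξ η => by rw [hadd, map_add, map_add, mul_add, add_mul]; abel }
  have hθ : ∀ ξ, θ ξ = K.c (nab ξ) - (D * K.c ξ - K.c ξ * D) := fun ξ => rfl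
  have hθm : ∀ ξ f, K.m f * θ ξ = θ ξ * K.m f := fun ξ f => by
    simp only [hθ, mul_sub, sub_mul]
    rw [K.m_comm, mul_assoc D, ← K.m_comm f ξ, ← mul_assoc D, mul_assoc _ D, hDm, mul_add, add_mul,
      K.m_comm, ← mul_assoc, ← mul_assoc, K.m_comm, mul_assoc (K.m f) D]
    noncomm_ring
  have hθs : ∀ (f : A) ξ, θ (f • ξ) = K.m f * θ ξ := fun f ξ => by
    simp only [hθ, hnab, map_add, K.c_smul, mul_sub]
    rw [← mul_assoc D, hDm, add_mul, mul_assoc (K.m f) D, mul_assoc (K.m f) (K.c ξ)]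
    abel
  have hθc : ∀ ξ η, θ ξ * K.c η + K.c ξ * θ η + (θ η * K.c ξ + K.c η * θ ξ) = 0 := fun ξ η => by
    have e1 := K.cliff (nab ξ) η
    have e2 := K.cliff ξ (nab η)
    have e3 : D * (K.c ξ * K.c η + K.c η * K.c ξ) - (K.c ξ * K.c η + K.c η * K.c ξ) * D =
        (K.c (nab ξ) * K.c η + K.c η * K.c (nab ξ)) + (K.c ξ * K.c (nab η) + K.c (nab η) * K.c ξ) := by
      rw [e1, e2, ← smul_add, ← map_add, ← hg, K.cliff, mul_smul_comm, smul_mul_assoc, ← smul_sub, hD]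
    simp only [hθ]
    rw [← sub_eq_zero] at e3
    rw [← neg_eq_zero, ← e3]
    noncomm_ring
  have hsum : ∀ ξ, ∑ i, K.m (g (K.e' i) ξ) * θ (K.e i) = θ ξ := fun ξ => by
    conv_rhs => rw [← K.sum_left ξ, map_sum]
    simp only [hθs]
  let B' := ∑ i, θ (K.e i) * K.c (K.e' i)
  have hB'm : ∀ f, K.m f * B' = B' * K.m f := fun f => by
    rw [mul_sum, sum_mul]
    exact sum_ext fun i =>
      (Commute.mul_right (hθm _ f) (K.m_comm f _) : Commute (K.m f) _)
  have hB' : ∀ ξ, B' * K.c ξ - K.c ξ * B' =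
      aeval K.C (X - Polynomial.C (-2 - K.rank : ℂ)) (θ ξ) := fun ξ => by
    rw [map_sub, aeval_X, aeval_C, lm_sub, Module.algebraMap_end_apply, sub_smul,
      neg_smul, show (K.rank : ℂ) • θ ξ = θ ξ * ((K.rank : ℂ) • 1) by rw [mul_smul_comm, mul_one],
      ← K.sum_c_mul_c, ← hsum ξ, smul_sum, hsum, mul_sum, K.C_apply, sum_mul,
      mul_sum, ← sum_sub_distrib, sub_sub_eq_add_sub, sub_neg_eq_add,
      ← sum_add_distrib, ← sum_add_distrib]
    refine sum_ext fun i => ?_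
    rw [mul_assoc, eq_sub_of_add_eq (K.cliff (K.e' i) ξ), mul_sub, mul_smul_comm, ← hθm]
    have e : K.c (K.e i) * θ ξ + θ ξ * K.c (K.e i) =
        -(θ (K.e i) * K.c ξ + K.c ξ * θ (K.e i)) := by
      rw [eq_neg_iff_add_eq_zero, ← hθc (K.e i) ξ]; abel
    have e' := congrArg (· * K.c (K.e' i)) e
    simp only [add_mul, neg_mul] at e'
    rw [← mul_assoc (θ ξ), ← mul_assoc (θ _), ← mul_assoc (K.c ξ)]
    rw [← sub_eq_zero] at e' ⊢
    rw [← neg_eq_zero, ← e']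
    abel
  obtain ⟨a, b, hab⟩ := hq
  obtain ⟨h1, h2⟩ := K.aeval_comm a hB'm
  refine ⟨D + aeval (-2 - K.C) a B', fun f => ?_, fun ξ => ?_⟩
  · rw [add_mul, mul_add, h1, add_sub_add_right_eq_sub, hD]
  · have e : aeval K.C a (aeval K.C (X - Polynomial.C (-2 - K.rank : ℂ)) (θ ξ)) = θ ξ := by
      have := congrArg (fun t => aeval K.C t (θ ξ)) hab
      simp only [map_add, map_mul, map_one, lm_add, mul_apply, Module.End.one_apply] at this
      rwa [hkill _ (hθm ξ), map_zero, add_zero] at this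
    rw [add_mul, mul_add, add_sub_add_comm, h2, hB', e, hθ, add_sub_cancel]

variable [Module ℝ P] [IsScalarTower ℝ A P]

/-- The metric connection given by dual frames, along a vector field. -/
def connFun (V : Derivation ℝ A A) (ξ : P) : P :=
  (1 / 2 : ℝ) • ∑ i, (V (g (K.e i) ξ) • K.e' i + V (g (K.e' i) ξ) • K.e i)

lemma connFun_add (V : Derivation ℝ A A) (ξ η : P) :
    K.connFun V (ξ + η) = K.connFun V ξ + K.connFun V η := by
  rw [connFun, connFun, connFun, ← smul_add, ← sum_add_distrib]
  congr 1
  refine sum_ext fun i => ?_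
  rw [map_add, map_add, map_add, map_add, add_smul, add_smul, add_add_add_comm]

lemma connFun_smul (V : Derivation ℝ A A) (f : A) (ξ : P) :
    K.connFun V (f • ξ) = V f • ξ + f • K.connFun V ξ := by
  have e : V f • ξ =
      (1 / 2 : ℝ) • ∑ i, ((V f * g (K.e i) ξ) • K.e' i + (V f * g (K.e' i) ξ) • K.e i) := by
    simp only [mul_smul]
    rw [sum_add_distrib, ← smul_sum, ← smul_sum, K.sum_left, K.sum_right,
      ← two_smul ℝ, smul_smul, one_div, inv_mul_cancel₀ two_ne_zero, one_smul]
  rw [e, connFun, connFun, smul_comm f, ← smul_add, smul_sum (r := f), ← sum_add_distrib]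
  congr 1
  refine sum_ext fun i => ?_
  rw [(g _).map_smul, (g _).map_smul, smul_eq_mul, smul_eq_mul, Derivation.leibniz,
    Derivation.leibniz, smul_eq_mul, smul_eq_mul, smul_eq_mul, smul_eq_mul, smul_add, smul_smul, smul_smul, add_smul, add_smul,
    mul_comm (V f), mul_comm (V f)]
  abel

/-- The metric connection given by dual frames. -/
def conn : Connection ℝ A P where
  toFun V :=
    { toFun := K.connFun V
      map_add' := K.connFun_add V
      map_smul' := fun r ξ => by
        have := K.connFun_smul V (algebraMap ℝ A r) ξ
        rwa [Derivation.map_algebraMap, zero_smul, zero_add, algebraMap_smul, algebraMap_smul] at this }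
  map_add V W := LinearMap.ext fun ξ => by
    change K.connFun _ ξ = K.connFun V ξ + K.connFun W ξ
    rw [connFun, connFun, connFun, ← smul_add, ← sum_add_distrib]
    congr 1
    refine sum_ext fun i => ?_
    rw [Derivation.add_apply, Derivation.add_apply, add_smul, add_smul, add_add_add_comm]
  map_smul f V ξ := by
    change K.connFun _ ξ = f • K.connFun V ξ
    rw [connFun, connFun, smul_comm f, smul_sum (r := f)]
    congr 1
    refine sum_ext fun i => ?_
    rw [Derivation.smul_apply, Derivation.smul_apply, smul_assoc, smul_assoc, smul_add]
  leibniz := K.connFun_smul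

lemma conn_isMetric : K.conn.IsMetric g := by
  intro V ξ η
  have h : ∀ ξ η, g (K.conn.toFun V ξ) η = (1 / 2 : ℝ) • ∑ i, (V (g (K.e i) ξ) * g (K.e' i) η +
      V (g (K.e' i) ξ) * g (K.e i) η) := fun ξ η => by
    change g ((1 / 2 : ℝ) • _) η = _
    rw [← algebraMap_smul A, LinearMap.BilinForm.smul_left, LinearMap.BilinForm.sum_left,
      ← smul_def]
    simp only [LinearMap.BilinForm.add_left, LinearMap.BilinForm.smul_left]
  have h1 : g ξ η = ∑ i, g (K.e i) ξ * g (K.e' i) η := by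
    conv_lhs => rw [← K.sum_right ξ, LinearMap.BilinForm.sum_left]
    simp only [LinearMap.BilinForm.smul_left]
  have h2 : g ξ η = ∑ i, g (K.e' i) ξ * g (K.e i) η := by
    conv_lhs => rw [← K.sum_left ξ, LinearMap.BilinForm.sum_left]
    simp only [LinearMap.BilinForm.smul_left]
  have h3 : V (g ξ η) = (1 / 2 : ℝ) • (V (g ξ η) + V (g ξ η)) := by
    rw [← two_smul ℝ, smul_smul]; norm_num
  rw [K.symm ξ (K.conn.toFun V η), h, h, h3]
  conv_lhs => enter [2, 1]; rw [h1]
  conv_lhs => enter [2, 2]; rw [h2]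
  rw [← smul_add, map_sum, map_sum, ← sum_add_distrib, ← sum_add_distrib]
  congr 1
  refine sum_ext fun i => ?_
  simp only [Derivation.leibniz, smul_eq_mul]
  ring

lemma exists_spinConn {q : ℂ[X]} (hq : IsCoprime (X - Polynomial.C (-2 - K.rank : ℂ)) q)
    (hkill : ∀ T, (∀ f, K.m f * T = T * K.m f) → aeval K.C q T = 0) {l : ℕ} {f : Fin l → A}
    {V : Fin l → Derivation ℝ A A} (hV : ∀ D : Derivation ℝ A A, ∑ j, D (f j) • V j = D)
    {D : Derivation ℝ A A → B} (hD : ∀ V f, D V * K.m f - K.m f * D V = K.m (V f)) :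
    ∃ S : Derivation ℝ A A → B, (∀ V W, S (V + W) = S V + S W) ∧
      (∀ (f : A) V, S (f • V) = K.m f * S V) ∧ (∀ V f, S V * K.m f - K.m f * S V = K.m (V f)) ∧
      ∀ V ξ, S V * K.c ξ - K.c ξ * S V = K.c (K.conn.toFun V ξ) := by
  choose D' h1 h2 using fun V => K.exists_corrected hq hkill (hD V) (nab := K.conn.toFun V)
    (map_add _) (K.conn.leibniz V) (K.conn_isMetric V)
  refine ⟨fun W => ∑ j, K.m (W (f j)) * D' (V j), fun W W' => ?_, fun h W => ?_, fun W h => ?_,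
    fun W ξ => ?_⟩
  · rw [← sum_add_distrib]
    exact sum_ext fun j => by rw [Derivation.add_apply, map_add, add_mul]
  · rw [mul_sum]
    exact sum_ext fun j => by
      rw [Derivation.smul_apply, smul_eq_mul, map_mul, mul_assoc]
  · conv_rhs => rw [← hV W, derivation_sum_apply, map_sum]
    rw [sum_mul, mul_sum, ← sum_sub_distrib]
    refine sum_ext fun j => ?_
    rw [Derivation.smul_apply, smul_eq_mul, map_mul, ← h1 (V j), mul_sub, mul_assoc, ← mul_assoc (K.m h),
      ← map_mul, mul_comm h, map_mul, mul_assoc (K.m _) (K.m h)]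
  · have e : K.conn.toFun W ξ = ∑ j, W (f j) • K.conn.toFun (V j) ξ := by
      conv_lhs => rw [← hV W]
      have : ∀ t : Finset (Fin l), K.conn.toFun (∑ j ∈ t, W (f j) • V j) ξ =
          ∑ j ∈ t, W (f j) • K.conn.toFun (V j) ξ := fun t => by
        rw [← sum_ext fun j => K.conn.map_smul (W (f j)) (V j) ξ]
        exact map_sum (⟨⟨fun U => K.conn.toFun U ξ, by
          have := K.conn.map_smul 0 0 ξ
          rwa [zero_smul, zero_smul] at this⟩,
          fun U U' => LinearMap.congr_fun (K.conn.map_add U U') ξ⟩ : Derivation ℝ A A →+ P) _ _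
      exact this _
    rw [e, map_sum, sum_mul, mul_sum, ← sum_sub_distrib]
    refine sum_ext fun j => ?_
    rw [K.c_smul, ← h2, mul_sub, mul_assoc, ← mul_assoc (K.c ξ), ← K.m_comm, mul_assoc (K.m _) (K.c ξ)]

end CliffordAct

lemma Filt.exists_grMk_iff {B C : Type*} [Ring B] [Algebra ℂ B] {D : Filt ℂ B} {k : ℕ} {a : B}
    (h : a ∈ D.W (k + 1)) {Φ : D.Gr → C} {y : C} :
    (∃ h : a ∈ D.W (k + 1), Φ (D.grMk k ⟨a, h⟩) = y) ↔ Φ (D.cl k a) = y := by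
  rw [cl_of_mem h]
  exact ⟨fun ⟨_, h⟩ => h, fun e => ⟨h, e⟩⟩

end Coprime

/-! ## Clifford operators -/

section Operators

open Polynomial

lemma baseChange_induction {V : Type*} [AddCommGroup V] [Module ℝ V] {p : Submodule ℝ V}
    {motive : ℂ ⊗[ℝ] V → Prop} (tmul : ∀ z, ∀ v ∈ p, motive (z ⊗ₜ v))
    (add : ∀ a b, motive a → motive b → motive (a + b)) {u : ℂ ⊗[ℝ] V}
    (hu : u ∈ p.baseChange ℂ) : motive u := by
  obtain ⟨t, rfl⟩ := hu
  induction t with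
  | zero => rw [map_zero]; simpa using tmul 0 0 p.zero_mem
  | tmul z v => exact tmul z v v.2
  | add a b ha hb => rw [map_add]; exact add _ _ ha hb

variable {n : ℕ} {M : Type*} [TopologicalSpace M] [ChartedSpace (EuclideanSpace ℝ (Fin n)) M]
  {F : Type*} [NormedAddCommGroup F] [NormedSpace ℝ F] [FiniteDimensional ℝ F]
  {E : M → Type*} [∀ x, AddCommGroup (E x)] [∀ x, Module ℝ (E x)] [∀ x, TopologicalSpace (E x)]
  [TopologicalSpace (TotalSpace F E)] [FiberBundle F E] [VectorBundle ℝ F E]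
  {G : Type*} [NormedAddCommGroup G] [NormedSpace ℝ G] [NormedSpace ℂ G] [IsScalarTower ℝ ℂ G]
  {S : M → Type*} [∀ x, AddCommGroup (S x)] [∀ x, Module ℝ (S x)] [∀ x, Module ℂ (S x)]
  [∀ x, IsScalarTower ℝ ℂ (S x)] [∀ x, TopologicalSpace (S x)]
  [TopologicalSpace (TotalSpace G S)] [FiberBundle G S] [VectorBundle ℝ G S] [VectorBundle ℂ G S]

local notation "𝔼" => EuclideanSpace ℝ (Fin n)
local notation "𝓒" => C^∞⟮𝓡 n, M; ℝ⟯
local notation "𝔖" => Cₛ^∞⟮𝓡 n; G, S⟯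
local notation "𝔅" => Module.End ℂ 𝔖

lemma cliff_mul_add {g : PseudoMetric n F E} (x : M) (v w : E x) :
    cι (g.quad x) v * cι (g.quad x) w + cι (g.quad x) w * cι (g.quad x) v =
      algebraMap ℝ _ (2 * g.form x v w) := by
  rw [CliffordAlgebra.ι_mul_ι_add_swap]
  congr 1
  change g.form x (v + w) (v + w) - g.form x v v - g.form x w w = _
  simp only [map_add, lm_add, g.symm x w v]
  ring

lemma baseChange_mul {g : PseudoMetric n F E} {x : M} {p q : ZMod 2}
    {a b : ℂ ⊗[ℝ] CliffordAlgebra (g.quad x)} (ha : a ∈ (evenOdd (g.quad x) p).baseChange ℂ)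
    (hb : b ∈ (evenOdd (g.quad x) q).baseChange ℂ) :
    a * b ∈ (evenOdd (g.quad x) (p + q)).baseChange ℂ := by
  refine baseChange_induction (motive := fun a => a * b ∈ _) (fun z v hv => ?_)
    (fun a b h h' => by rw [add_mul]; exact add_mem h h') ha
  refine baseChange_induction (motive := fun b => z ⊗ₜ v * b ∈ _) (fun z' w hw => ?_)
    (fun a b h h' => by rw [mul_add]; exact add_mem h h') hb
  rw [tmul_mul_tmul]
  exact tmul_mem_baseChange_of_mem _
    (CliffordAlgebra.evenOdd_mul_le _ p q (mul_mem_mul hv hw))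

namespace SpinorStructure

variable {g : PseudoMetric n F E} (σ : SpinorStructure g G S) (BE : BundleFrame n F E)

lemma mulOp_add (f h : 𝓒) : (mulOp (f + h) : 𝔅) = mulOp f + mulOp h := by
  ext s : 1; exact add_smul f h s

variable (n G S) in
/-- Multiplication by functions. -/
def mulHom : 𝓒 →ₐ[ℝ] 𝔅 where
  toFun := mulOp
  map_one' := by ext s : 1; exact one_smul _ s
  map_mul' f h := by ext s : 1; exact mul_smul f h s
  map_zero' := by ext s : 1; exact zero_smul _ s
  map_add' := mulOp_add
  commutes' r := by
    ext s x
    change r • s x = ((r : ℂ)) • s x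
    exact (algebraMap_smul ℂ r (s x)).symm

local notation "μ" => mulHom n G S

/-- Clifford multiplication on sections. -/
def act : CliffordAct g.onSections (𝔅) where
  m := mulHom n G S
  c :=
    { toFun := σ.gam
      map_zero' := by
        ext s x
        change σ.rep x (1 ⊗ₜ cι (g.quad x) 0) (s x) = 0
        rw [map_zero, tmul_zero, map_zero]; rfl
      map_add' := fun ξ η => by
        ext s x
        change σ.rep x (1 ⊗ₜ cι (g.quad x) (ξ x + η x)) (s x) = _
        rw [map_add, tmul_add, map_add]; rfl }
  c_smul f ξ := by
    ext s x
    change σ.rep x (1 ⊗ₜ cι (g.quad x) (f x • ξ x)) (s x) =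
      f x • σ.rep x (1 ⊗ₜ cι (g.quad x) (ξ x)) (s x)
    rw [map_smul, tmul_smul, ← algebraMap_smul ℂ (f x) (_ ⊗ₜ _), map_smul,
      ← algebraMap_smul ℂ (f x) (_ : S x)]
    rfl
  m_comm f ξ := by
    ext s x
    change f x • σ.rep x _ (s x) = σ.rep x _ (f x • s x)
    rw [← algebraMap_smul ℂ, ← algebraMap_smul ℂ (f x) (s x), map_smul]
  cliff ξ η := by
    ext s x
    change σ.rep x _ (σ.rep x _ (s x)) + σ.rep x _ (σ.rep x _ (s x)) =
      (2 : ℂ) • (g.form x (ξ x) (η x) • s x)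
    rw [← mul_apply, ← mul_apply, ← map_mul, ← map_mul, ← lm_add,
      ← map_add, tmul_mul_tmul, tmul_mul_tmul,
      ← tmul_add, cliff_mul_add, mul_one, algebraMap_eq_smul_one,
      tmul_smul, ← algebraMap_smul ℂ, map_smul, ← Algebra.TensorProduct.one_def,
      map_one, ← algebraMap_smul ℂ (g.form x _ _) (s x), smul_smul]
    simp
  k := BE.m
  e := BE.s
  e' := (BE.exists_dual g).choose
  sum_left ξ := by
    rw [← BE.sum_coord ξ]
    simp only [(BE.exists_dual g).choose_spec, BE.sum_coord]
  sum_right ξ := by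
    ext x
    rw [← sub_eq_zero]
    refine g.nondegenerate x _ fun w => ?_
    obtain ⟨η, rfl⟩ := BE.exists_section x w
    change g.onSections (_ - ξ) η x = 0
    refine congrArg (fun f : 𝓒 => f x) (?_ : g.onSections (_ - ξ) η = 0)
    rw [map_sub, lm_sub, sub_eq_zero, LinearMap.BilinForm.sum_left]
    have h : ∀ ξ η, g.onSections ξ η = g.onSections η ξ := fun ξ η => by ext x; exact g.symm x _ _
    conv_rhs => rw [h, ← BE.sum_coord η, LinearMap.BilinForm.sum_left]
    refine sum_ext fun a => ?_
    rw [LinearMap.BilinForm.smul_left, LinearMap.BilinForm.smul_left,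
      (BE.exists_dual g).choose_spec, mul_comm]
  symm ξ η := by ext x; exact g.symm x _ _
  rank := Module.finrank ℝ F
  sum_rank := by
    ext x
    rw [function_sum_apply]
    simp only [(BE.exists_dual g).choose_spec]
    exact BE.sum_coord_self x

/-- Clifford multiplication on a fibre. -/
def fibreAct (x : M) : CliffordAct (g.form x) (ℂ ⊗[ℝ] CliffordAlgebra (g.quad x)) where
  m := Algebra.TensorProduct.includeRight.comp (Algebra.ofId ℝ _)
  c := (TensorProduct.mk ℝ ℂ (CliffordAlgebra (g.quad x)) 1 ∘ₗ cι (g.quad x)).toAddMonoidHom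
  c_smul f ξ := by
    change (1 : ℂ) ⊗ₜ[ℝ] _ = (1 ⊗ₜ algebraMap ℝ _ f) * (1 ⊗ₜ _)
    rw [map_smul, tmul_mul_tmul, mul_one, smul_def]
  m_comm f ξ := by
    change (1 ⊗ₜ algebraMap ℝ _ f) * (1 ⊗ₜ[ℝ] _) = (1 ⊗ₜ _) * ((1 : ℂ) ⊗ₜ _)
    rw [tmul_mul_tmul, tmul_mul_tmul, commutes]
    rfl
  cliff ξ η := by
    change (1 ⊗ₜ _) * ((1 : ℂ) ⊗ₜ[ℝ] _) + (1 ⊗ₜ _) * (1 ⊗ₜ _) = (2 : ℂ) • (1 ⊗ₜ algebraMap ℝ _ _)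
    rw [tmul_mul_tmul, tmul_mul_tmul, ←
      tmul_add, cliff_mul_add, mul_one, two_smul, ← tmul_add, ← map_add,
      two_mul]
  k := BE.m
  e i := BE.s i x
  e' i := (BE.exists_dual g).choose i x
  sum_left v := by
    obtain ⟨ξ, rfl⟩ := BE.exists_section x v
    have := congrArg (fun s : Cₛ^∞⟮𝓡 n; F, E⟯ => s x) ((σ.act BE).sum_left ξ)
    rwa [section_sum_apply] at this
  sum_right v := by
    obtain ⟨ξ, rfl⟩ := BE.exists_section x v
    have := congrArg (fun s : Cₛ^∞⟮𝓡 n; F, E⟯ => s x) ((σ.act BE).sum_right ξ)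
    rwa [section_sum_apply] at this
  symm := g.symm x
  rank := Module.finrank ℝ F
  sum_rank := by
    have := congrArg (fun s : 𝓒 => s x) (σ.act BE).sum_rank
    rwa [function_sum_apply] at this

/-- `T` acts fibrewise by the sections `u` of the Clifford bundle. -/
def IsPt (T : 𝔅) (u : ∀ x, ℂ ⊗[ℝ] CliffordAlgebra (g.quad x)) : Prop :=
  ∀ s x, T s x = σ.rep x (u x) (s x)

variable {σ}

lemma IsPt.unique (BS : BundleFrame n G S) {T : 𝔅} {u u'}
    (h : σ.IsPt T u) (h' : σ.IsPt T u') : u = u' := by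
  funext x
  refine (σ.rep x).injective (LinearMap.ext fun v => ?_)
  obtain ⟨s, rfl⟩ := BS.exists_section x v
  rw [← h, ← h']

lemma IsPt.comm {T : 𝔅} {u} (h : σ.IsPt T u) (f : 𝓒) : μ f * T = T * μ f := by
  ext s x
  change f x • T s x = T (f • s) x
  rw [h, h, section_smul_apply, ← algebraMap_smul ℂ, ← algebraMap_smul ℂ (f x) (s x), map_smul]

lemma IsPt.aeval {T : 𝔅} {u} (h : σ.IsPt T u) (q : ℂ[X]) :
    σ.IsPt (Polynomial.aeval (σ.act BE).C q T)
      fun x => Polynomial.aeval (σ.fibreAct BE x).C q (u x) := by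
  have hC : ∀ {T u}, σ.IsPt T u → σ.IsPt ((σ.act BE).C T) fun x => (σ.fibreAct BE x).C (u x) := by
    intro T u h s x
    change _ = σ.rep x ((σ.fibreAct BE x).C (u x)) (s x)
    rw [CliffordAct.C_apply, CliffordAct.C_apply, lm_sum, section_sum_apply, map_sum, lm_sum]
    refine sum_ext fun i => ?_
    rw [map_mul, map_mul, mul_apply, mul_apply, mul_apply, mul_apply]
    exact congrArg (σ.rep x _) (h _ x)
  induction q using Polynomial.induction_on' with
  | add p q hp hq =>
    intro s x
    simp only [map_add, lm_add]
    exact congrArg₂ (· + ·) (hp s x) (hq s x)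
  | monomial j z =>
    induction j with
    | zero =>
      intro s x
      simp only [monomial_zero_left, aeval_C, Module.algebraMap_end_apply, map_smul]
      exact congrArg (z • ·) (h s x)
    | succ j ih =>
      intro s x
      change _ = σ.rep x (Polynomial.aeval (σ.fibreAct BE x).C _ (u x)) (s x)
      rw [aeval_monomial_succ, aeval_monomial_succ]
      exact hC ih s x

/-- The polynomial which kills the Clifford operators of parity `p`. -/
def kp (BE : BundleFrame n F E) (p : ZMod 2) : ℂ[X] :=
  CliffordAct.killer (Module.finrank ℝ F : ℝ) p.val (BE.m + 2)

lemma fibre_killed {p : ZMod 2} {x : M} {u : ℂ ⊗[ℝ] CliffordAlgebra (g.quad x)}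
    (hu : u ∈ (evenOdd (g.quad x) p).baseChange ℂ) :
    Polynomial.aeval (σ.fibreAct BE x).C (kp BE p) u = 0 := by
  set K := σ.fibreAct BE x
  refine K.killer_kills (ZMod.val_lt p) _ ?_
  refine baseChange_induction (motive := fun u => u ∈ _) (fun z v hv => ?_)
    (fun a b ha hb => add_mem ha hb) hu
  rw [show z ⊗ₜ[ℝ] v = z • ((1 : ℂ) ⊗ₜ[ℝ] v) by rw [smul_tmul', smul_eq_mul, mul_one]]
  refine smul_mem _ z ?_
  have hpow : ∀ i : ℕ, LinearMap.range (cι (g.quad x)) ^ i ≤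
      ((K.wordSpan (i + 2)).restrictScalars ℝ).comap (TensorProduct.mk ℝ ℂ _ 1) := by
    intro i w hw
    induction hw using Submodule.pow_induction_on_left' with
    | algebraMap r =>
      change (1 : ℂ) ⊗ₜ[ℝ] _ ∈ K.wordSpan (0 + 2)
      rw [algebraMap_eq_smul_one, tmul_smul, ← algebraMap_smul ℂ]
      exact smul_mem _ _ (K.word_mem (l := []) 0 rfl)
    | add a b i _ _ ha hb => exact add_mem ha hb
    | mem_mul v hv i w _ hw =>
      obtain ⟨v, rfl⟩ := hv
      have := K.c_mul_mem hw v
      change (1 : ℂ) ⊗ₜ[ℝ] (cι (g.quad x) v * w) ∈ K.wordSpan _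
      rw [← mul_one (1 : ℂ), ← tmul_mul_tmul]
      rwa [show i + 2 + 1 = i + 1 + 2 by ring] at this
  rw [evenOdd] at hv
  refine (iSup_le (fun i => ?_) : (⨆ j : {n : ℕ // (n : ZMod 2) = p}, _) ≤
    ((K.wordSpan (2 * (K.k + 2) + p.val)).restrictScalars ℝ).comap (TensorProduct.mk ℝ ℂ _ 1)) hv
  refine (hpow i).trans fun w hw => ?_
  have h2 : (i : ℕ) + 2 = 2 * ((i : ℕ) / 2 + 1) + p.val := by
    have : p.val = (i : ℕ) % 2 :=
      (congrArg ZMod.val i.2).symm.trans (ZMod.val_natCast 2 _)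
    omega
  rw [Submodule.mem_comap, h2] at hw
  exact K.wordSpan_stable _ _ hw

/-- The complex coefficient functionals of a frame of a complex bundle. -/
def cphi (BS : BundleFrame n G S) (a : Fin BS.m) (x : M) : S x →ₗ[ℂ] ℂ :=
  (1 / 2 : ℂ) • Module.Dual.extendRCLike (BS.φ a x)

lemma sum_cphi (BS : BundleFrame n G S) {x : M} (v : S x) (w : Fin BS.m → S x) :
    ∑ a, cphi BS a x v • w a = (1 / 2 : ℂ) •
      (∑ a, BS.φ a x v • w a - I • ∑ a, BS.φ a x (I • v) • w a) := by
  rw [smul_sum, ← sum_sub_distrib, smul_sum]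
  refine sum_ext fun a => ?_
  rw [← algebraMap_smul ℂ (BS.φ a x v), ← algebraMap_smul ℂ (BS.φ a x _) (w a), smul_smul,
    ← sub_smul, smul_smul]
  rfl

lemma half_sub_I {V : Type*} [AddCommGroup V] [Module ℂ V] (v : V) :
    (1 / 2 : ℂ) • (v - I • I • v) = v := by
  rw [smul_smul, Complex.I_mul_I, neg_one_smul, sub_neg_eq_add, ← two_smul ℂ, smul_smul]
  norm_num

lemma sum_cphi_smul (BS : BundleFrame n G S) {T : 𝔅} (hT : ∀ f, μ f * T = T * μ f)
    (s : 𝔖) (x : M) : ∑ a, cphi BS a x (s x) • T (BS.s a) x = T s x := by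
  have h : ∀ s : 𝔖, ∑ a, BS.φ a x (s x) • T (BS.s a) x = T s x := by
    intro s
    conv_rhs => rw [← BS.sum_coord s, map_sum, section_sum_apply]
    exact sum_ext fun a =>
      congrArg (fun u : 𝔖 => u x) (LinearMap.congr_fun (hT (BS.coord a s)) (BS.s a))
  rw [sum_cphi, h]
  have h2 := h (I • s)
  rw [map_smul] at h2
  exact (congrArg (fun v => (1 / 2 : ℂ) • (T s x - I • v)) h2).trans (half_sub_I _)

lemma exists_isPt (BS : BundleFrame n G S) {T : 𝔅} (hT : ∀ f, μ f * T = T * μ f) :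
    ∃ u, σ.IsPt T u := by
  refine ⟨fun x => (σ.rep x).symm (∑ a, (cphi BS a x).smulRight (T (BS.s a) x)), fun s x => ?_⟩
  rw [AlgEquiv.apply_symm_apply, lm_sum]
  exact (sum_cphi_smul BS hT s x).symm

variable (BS : BundleFrame n G S) {r : ℕ} (hr : Module.finrank ℝ F = 2 * r)

include hr in
lemma kp_coprime (p : ZMod 2) : IsCoprime (kp BE p) (kp BE (p + 1)) := by
  rcases zmod2 p with rfl | rfl
  · rw [kp, kp, hr]; exact killer_coprime _ _
  · rw [one_add_one_zmod, kp, kp, hr]; exact (killer_coprime _ _).symm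

lemma exists_decomposition (p : ZMod 2) {x : M} (t : ℂ ⊗[ℝ] CliffordAlgebra (g.quad x)) :
    ∃ a ∈ (evenOdd (g.quad x) p).baseChange ℂ,
      ∃ b ∈ (evenOdd (g.quad x) (p + 1)).baseChange ℂ, a + b = t := by
  rw [← mem_sup]
  have h := (CliffordAlgebra.evenOdd_isCompl (g.quad x)).sup_eq_top
  have h : evenOdd (g.quad x) p ⊔ evenOdd (g.quad x) (p + 1) = ⊤ := by
    rcases zmod2 p with rfl | rfl
    · exact h
    · rw [one_add_one_zmod, sup_comm]; exact h
  induction t with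
  | zero => exact zero_mem _
  | tmul z w =>
    obtain ⟨a, ha, b, hb, rfl⟩ := mem_sup.1 (h ▸ Submodule.mem_top : w ∈ _)
    rw [tmul_add]
    exact Submodule.add_mem_sup (tmul_mem_baseChange_of_mem z ha)
      (tmul_mem_baseChange_of_mem z hb)
  | add a b ha hb => exact add_mem ha hb

include BS hr in
lemma isCliffordOp_iff {p : ZMod 2} {T : 𝔅} : σ.IsCliffordOp p T ↔
    (∀ f, μ f * T = T * μ f) ∧ aeval (σ.act BE).C (kp BE p) T = 0 := by
  constructor
  · rintro ⟨u, hu, h⟩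
    refine ⟨IsPt.comm h, ?_⟩
    ext s x
    refine (IsPt.aeval BE h _ s x).trans ?_
    exact congrFun (congrArg DFunLike.coe ((congrArg (σ.rep x) (fibre_killed BE (hu x))).trans
      (map_zero _))) _
  · rintro ⟨hT, hk⟩
    obtain ⟨u, h⟩ := exists_isPt (σ := σ) BS hT
    refine ⟨u, fun x => ?_, h⟩
    have h0 : (aeval (σ.fibreAct BE x).C (kp BE p)) (u x) = 0 :=
      congrFun (IsPt.unique BS (IsPt.aeval BE h (kp BE p)) (u' := 0) fun s x => by
        rw [hk, Pi.zero_apply, map_zero]; rfl) x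
    obtain ⟨a, ha, b, hb, hab⟩ := exists_decomposition p (u x)
    rw [← hab, map_add, fibre_killed BE ha, zero_add] at h0
    rw [← hab, eq_zero_of_isCoprime (kp_coprime BE hr p) h0 (fibre_killed BE hb), add_zero]
    exact ha

include hr BS in
lemma killed_of_comm {T : 𝔅} (hT : ∀ f, μ f * T = T * μ f) :
    aeval (σ.act BE).C (kp BE 0 * kp BE 1) T = 0 := by
  obtain ⟨u, h⟩ := exists_isPt (σ := σ) BS hT
  ext s x
  refine (IsPt.aeval BE h _ s x).trans ?_
  suffices h0 : aeval (σ.fibreAct BE x).C (kp BE 0 * kp BE 1) (u x) = 0 from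
    congrFun (congrArg DFunLike.coe ((congrArg (σ.rep x) h0).trans (map_zero _))) _
  obtain ⟨a, ha, b, hb, hab⟩ := exists_decomposition 0 (u x)
  have h1 : aeval (σ.fibreAct BE x).C (kp BE 1) b = 0 := fibre_killed BE (by simpa using hb)
  have h2 : aeval (σ.fibreAct BE x).C (kp BE 0 * kp BE 1) a = 0 := by
    rw [mul_comm, map_mul, mul_apply, fibre_killed BE ha, map_zero]
  rw [← hab, map_add, h2, map_mul, mul_apply, h1, map_zero, add_zero]

/-- Submodules of a complex algebra. -/
abbrev CSub (B : Type*) [Ring B] [Algebra ℂ B] := Submodule ℂ B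

/-- The Clifford operators of parity `p`. -/
def cop (σ : SpinorStructure g G S) (p : ZMod 2) : CSub 𝔅 where
  carrier := {T | σ.IsCliffordOp p T}
  zero_mem' := ⟨0, fun x => zero_mem _, fun s x => by rw [Pi.zero_apply, map_zero]; rfl⟩
  add_mem' := fun ⟨u, hu, h⟩ ⟨u', hu', h'⟩ => ⟨u + u', fun x => add_mem (hu x) (hu' x),
    fun s x => by rw [Pi.add_apply, map_add, lm_add, lm_add, ← h, ← h']; rfl⟩
  smul_mem' := fun z _ ⟨u, hu, h⟩ => ⟨z • u, fun x => smul_mem _ z (hu x),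
    fun s x => by rw [Pi.smul_apply, map_smul, lm_smul, lm_smul, ← h]; rfl⟩

lemma cop_mul {p q : ZMod 2} {T U : 𝔅} (hT : T ∈ cop σ p) (hU : U ∈ cop σ q) :
    T * U ∈ cop σ (p + q) := by
  obtain ⟨u, hu, h⟩ := hT
  obtain ⟨v, hv, h'⟩ := hU
  refine ⟨fun x => u x * v x, fun x => baseChange_mul (hu x) (hv x), fun s x => ?_⟩
  rw [map_mul, mul_apply, mul_apply, h, h']

lemma gam_mem_cop (ξ : Cₛ^∞⟮𝓡 n; F, E⟯) : σ.gam ξ ∈ cop σ 1 := by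
  refine ⟨fun x => 1 ⊗ₜ cι (g.quad x) (ξ x), fun x =>
    tmul_mem_baseChange_of_mem _ (CliffordAlgebra.ι_mem_evenOdd_one _ _), fun s x => rfl⟩

lemma nabla_mu (nS : Connection ℂ 𝓒 𝔖) (X) (f : 𝓒) :
    nS.toFun X * μ f - μ f * nS.toFun X = μ (X f) :=
  LinearMap.ext fun s => sub_eq_of_eq_add (nS.leibniz X f s)

include BS BE hr in
lemma nabla_cop {nE nS} (hc : σ.Compatible nE nS) (X) {p : ZMod 2} {T : 𝔅} (hT : T ∈ cop σ p) :
    nS.toFun X * T - T * nS.toFun X ∈ cop σ p := by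
  obtain ⟨h1, h2⟩ := (isCliffordOp_iff BE BS hr).1 hT
  have hcm : ∀ {T : 𝔅}, (∀ f, μ f * T = T * μ f) → ∀ f,
      μ f * (nS.toFun X * T - T * nS.toFun X) = (nS.toFun X * T - T * nS.toFun X) * μ f := by
    intro T h1 f
    rw [mul_sub, sub_mul, mul_assoc (nS.toFun X), ← h1, ← mul_assoc (nS.toFun X),
      mul_assoc T (nS.toFun X), eq_add_of_sub_eq (nabla_mu nS X f), mul_add, add_mul, ← h1,
      ← mul_assoc T, ← h1]
    noncomm_ring
  have key : ∀ q : ℂ[X], (∀ f, μ f * aeval (σ.act BE).C q T = aeval (σ.act BE).C q T * μ f) ∧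
      nS.toFun X * aeval (σ.act BE).C q T - aeval (σ.act BE).C q T * nS.toFun X =
        aeval (σ.act BE).C q (nS.toFun X * T - T * nS.toFun X) := by
    intro q
    induction q using Polynomial.induction_on' with
    | add p q hp hq =>
      simp only [map_add, lm_add]
      rw [← hp.2, ← hq.2]
      exact ⟨fun f => by rw [mul_add, add_mul, hp.1, hq.1], by noncomm_ring⟩
    | monomial j z =>
      induction j with
      | zero =>
        simp only [monomial_zero_left, aeval_C, Module.algebraMap_end_apply, mul_smul_comm,
          smul_mul_assoc, h1, smul_sub, implies_true, and_self]
      | succ j ih =>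
        simp only [aeval_monomial_succ]
        exact ⟨(σ.act BE).C_m_comm ih.1, by
          rw [(σ.act BE).comm_C (hc.1 X) (hc.2 X) ih.1, ih.2]⟩
  exact (isCliffordOp_iff BE BS hr).2 ⟨hcm h1, by
    rw [← (key _).2, h2, mul_zero, zero_mul, sub_zero]⟩

/-- The span of the identity and of the covariant derivatives of compatible pairs. -/
def spn (σ : SpinorStructure g G S) : CSub 𝔅 :=
  Submodule.span ℂ (insert 1 {T | ∃ nE nS X, σ.Compatible nE nS ∧ T = nS.toFun X})

lemma one_mem_spn : (1 : 𝔅) ∈ spn σ := subset_span (Set.mem_insert _ _)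

include BS BE hr in
lemma spn_comm {y T : 𝔅} (hy : y ∈ spn σ) {p : ZMod 2} (hT : T ∈ cop σ p) :
    y * T - T * y ∈ cop σ p := by
  induction hy using span_induction with
  | mem y h =>
    rcases h with rfl | ⟨nE, nS, X, hc, rfl⟩
    · rw [one_mul, mul_one, sub_self]; exact zero_mem _
    · exact nabla_cop BE BS hr hc X hT
  | zero => rw [zero_mul, mul_zero, sub_zero]; exact zero_mem _
  | add a b _ _ ha hb => rw [add_mul, mul_add, add_sub_add_comm]; exact add_mem ha hb
  | smul z a _ ha => rw [smul_mul_assoc, mul_smul_comm, ← smul_sub]; exact smul_mem _ z ha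

lemma one_mem_cop : (1 : 𝔅) ∈ cop σ 0 :=
  ⟨fun _ => 1, fun x => tmul_mem_baseChange_of_mem (1 : ℂ)
    (Submodule.one_le.1 (CliffordAlgebra.one_le_evenOdd_zero (g.quad x))),
    fun s x => by rw [map_one]; rfl⟩

include BE BS hr in
lemma stable : (σ.act BE).Stable (spn σ) (cop σ) where
  one_mem := one_mem_spn
  comm_mem := by intro y hy p T hT; exact spn_comm BE BS hr hy hT
  mul_mem := by intro p q T U hT hU; exact cop_mul hT hU
  c_mem := gam_mem_cop

include BS hr in
lemma parity_killed {p : ZMod 2} {D : 𝔅} (hD : D ∈ σ.parity p) :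
    ∃ N, aeval (σ.act BE).C (kp BE p ^ N) D = 0 := by
  have key : ∀ p D, σ.IsParityMonomial p D → CliffordAct.Reach (B := 𝔅) (spn σ) (cop σ) p D := by
    intro p D hD
    induction hD with
    | clifford p T hT => exact .of_mem hT
    | nabla nE nS X h => exact .of_one_mem one_mem_cop (subset_span (Or.inr ⟨nE, nS, X, h, rfl⟩))
    | mul p q T U _ _ hT hU => exact (stable BE BS hr).reach_mul hT hU
  replace hD := hD.2
  induction hD using span_induction with
  | mem D h =>
    refine (stable BE BS hr).killed ?_ (key p D h)
    intro T hT
    exact ((isCliffordOp_iff BE BS hr).1 hT).2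
  | zero => exact ⟨0, map_zero _⟩
  | add a b _ _ ha hb =>
    obtain ⟨N, ha⟩ := ha
    obtain ⟨N', hb⟩ := hb
    refine ⟨N + N', ?_⟩
    rw [map_add, pow_add, map_mul, mul_apply, mul_apply, hb, map_zero, add_zero,
      ← mul_apply, ← map_mul, mul_comm, map_mul, mul_apply, ha, map_zero]
  | smul z a _ ha =>
    obtain ⟨N, ha⟩ := ha
    exact ⟨N, by rw [map_smul, ha, smul_zero]⟩

include BE BS hr in
lemma parity_disjoint {D : 𝔅} (h0 : D ∈ σ.parity 0) (h1 : D ∈ σ.parity 1) : D = 0 := by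
  obtain ⟨N, h0⟩ := parity_killed BE BS hr h0
  obtain ⟨N', h1⟩ := parity_killed BE BS hr h1
  exact eq_zero_of_isCoprime ((kp_coprime BE hr 0).pow (m := N) (n := N')) h0 (by rwa [zero_add])

include BE BS hr in
lemma eq_zero_of_odd {D : 𝔅} (hD : D ∈ σ.parity 1) (h : ∀ ξ, D * σ.gam ξ = -(σ.gam ξ * D)) :
    D = 0 := by
  obtain ⟨N, h1⟩ := parity_killed BE BS hr hD
  set K := σ.act BE
  have hK : K.rank = Module.finrank ℝ F := rfl
  have h2 : K.C D = -((K.rank : ℂ) • D) := by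
    rw [← one_mul D, ← smul_mul_assoc, ← K.sum_c_mul_c, sum_mul, ← Finset.sum_neg_distrib,
      one_mul, K.C_apply]
    refine sum_ext fun i => ?_
    rw [mul_assoc, show D * K.c (K.e' i) = -(K.c (K.e' i) * D) from h _, mul_neg, mul_assoc]
  refine eq_zero_of_isCoprime (p := X - C ((-2 * r : ℤ) : ℂ)) (q := kp BE 1 ^ N) ?_ ?_ h1
  · rw [kp, hr]; exact (killer_one_coprime r _).pow_right
  · rw [map_sub, aeval_X, aeval_C, lm_sub, h2, Module.algebraMap_end_apply, hK, hr,
      ← neg_smul, ← sub_smul]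
    push_cast
    rw [show -(2 * (r : ℂ)) - -2 * r = 0 by ring, zero_smul]

lemma nontrivial_fibre (σ : SpinorStructure g G S) (x : M) : Nontrivial (S x) := by
  by_contra h
  rw [not_nontrivial_iff_subsingleton] at h
  have : Nontrivial (ℂ ⊗[ℝ] CliffordAlgebra (g.quad x)) := inferInstance
  exact zero_ne_one ((σ.rep x).injective (Subsingleton.elim (σ.rep x 0) (σ.rep x 1)))

include BS in
lemma mulHom_injective (σ : SpinorStructure g G S) {f h : 𝓒}
    (H : μ f + I • μ h = 0) : f = 0 ∧ h = 0 := by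
  have key : ∀ x, f x = 0 ∧ h x = 0 := by
    intro x
    have := nontrivial_fibre σ x
    obtain ⟨v, hv⟩ := exists_ne (0 : S x)
    obtain ⟨s, rfl⟩ := BS.exists_section x v
    have e : f x • s x + I • h x • s x = 0 :=
      congrArg (fun T : 𝔅 => T s x) H
    rw [← algebraMap_smul ℂ (f x), ← algebraMap_smul ℂ (h x) (s x), smul_smul, ← add_smul] at e
    have e := (smul_eq_zero.1 e).resolve_right hv
    rw [mul_comm] at e
    exact ⟨by simpa using congrArg Complex.re e, by simpa using congrArg Complex.im e⟩
  exact ⟨by ext x; exact (key x).1, by ext x; exact (key x).2⟩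

section

variable [FiniteDimensional ℂ G]

lemma sum_cphi_self (x : M) : ∑ a, cphi BS a x (BS.s a x) = Module.finrank ℂ G := by
  have e : S x ≃ₗ[ℂ] G := (trivializationAt G S x).linearEquivAt (R := ℂ) x
    (mem_baseSet_trivializationAt G S x)
  have : FiniteDimensional ℂ (S x) := e.symm.finiteDimensional
  rw [← e.finrank_eq, ← LinearMap.trace_id ℂ (S x)]
  have h : (LinearMap.id : S x →ₗ[ℂ] S x) = ∑ a, (cphi BS a x).smulRight (BS.s a x) := by
    ext v
    obtain ⟨s, rfl⟩ := BS.exists_section x v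
    rw [lm_sum]
    exact (sum_cphi_smul BS (T := 1) (fun f => by rw [mul_one, one_mul]) s x).symm
  rw [h, map_sum]
  exact sum_ext fun a => (LinearMap.trace_smulRight _ _).symm

include BE BS in
lemma eq_mulHom_of_even (hF : Module.finrank ℝ F ≠ 0) {D : 𝔅}
    (hD : ∀ ξ, D * σ.gam ξ = σ.gam ξ * D) : ∃ f h, D = μ f + I • μ h := by
  set K := σ.act BE
  have hm : ∀ f, μ f * D = D * μ f := by
    intro f
    have e : (K.rank : ℂ) • K.m f = ∑ i, K.c (f • K.e i) * K.c (K.e' i) := by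
      rw [← mul_one (K.m f), ← mul_smul_comm, ← K.sum_c_mul_c, mul_sum]
      exact sum_ext fun i => by rw [K.c_smul, mul_assoc]
    have h : ∀ ξ, D * K.c ξ = K.c ξ * D := hD
    have hr : (K.rank : ℂ) ≠ 0 := by
      rw [show K.rank = Module.finrank ℝ F from rfl]; exact_mod_cast hF
    refine smul_right_injective 𝔅 hr ?_
    change (K.rank : ℂ) • (K.m f * D) = (K.rank : ℂ) • (D * K.m f)
    rw [← smul_mul_assoc, ← mul_smul_comm, e, mul_sum, sum_mul]
    exact sum_ext fun i => by rw [← mul_assoc, h, mul_assoc, mul_assoc, h]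
  obtain ⟨u, hu⟩ := exists_isPt (σ := σ) BS hm
  have hz : ∀ x, ∃ z : ℂ, ∀ s : 𝔖, D s x = z • s x := by
    intro x
    have hc : σ.rep x (u x) ∈ Subalgebra.center ℂ (Module.End ℂ (S x)) := by
      have hι : ∀ v, (1 ⊗ₜ cι (g.quad x) v) * u x = u x * (1 ⊗ₜ cι (g.quad x) v) := by
        intro v
        obtain ⟨ξ, rfl⟩ := BE.exists_section x v
        refine (σ.rep x).injective (LinearMap.ext fun w => ?_)
        obtain ⟨s, rfl⟩ := BS.exists_section x w
        rw [map_mul, map_mul, mul_apply, mul_apply, ← hu s x]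
        have := congrArg (fun T : 𝔅 => T s x) (hD ξ)
        exact this.symm.trans (hu _ x)
      have hcl : ∀ a : CliffordAlgebra (g.quad x), (1 ⊗ₜ a) * u x = u x * (1 ⊗ₜ a) := by
        intro a
        induction a using CliffordAlgebra.induction with
        | algebraMap c =>
          rw [algebraMap_eq_smul_one, tmul_smul, ← Algebra.TensorProduct.one_def,
            smul_mul_assoc, mul_smul_comm, one_mul, mul_one]
        | ι v => exact hι v
        | mul a b ha hb =>
          rw [← mul_one (1 : ℂ), ← tmul_mul_tmul, mul_assoc, hb, ← mul_assoc, ha, mul_assoc]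
        | add a b ha hb => rw [tmul_add, add_mul, mul_add, ha, hb]
      refine Subalgebra.mem_center_iff.2 fun T => ?_
      obtain ⟨t, rfl⟩ := (σ.rep x).surjective T
      rw [← map_mul, ← map_mul]
      congr 1
      induction t with
      | zero => rw [zero_mul, mul_zero]
      | tmul z a =>
        rw [show z ⊗ₜ[ℝ] a = z • ((1 : ℂ) ⊗ₜ[ℝ] a) by
          rw [smul_tmul', smul_eq_mul, mul_one], smul_mul_assoc, mul_smul_comm, hcl]
      | add a b ha hb => rw [add_mul, mul_add, ha, hb]
    obtain ⟨z, hz⟩ := Algebra.IsCentral.mem_center_iff ℂ |>.1 hc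
    exact ⟨z, fun s => by rw [hu, hz]; rfl⟩
  choose z hz using hz
  let d : ℝ := Module.finrank ℂ G
  refine ⟨(1 / (2 * d)) • ∑ a, BS.coord a (D (BS.s a)),
    -((1 / (2 * d)) • ∑ a, BS.coord a (I • D (BS.s a))), ?_⟩
  ext s x
  have e := sum_cphi_self BS x
  have e1 : z x * d = (1 / 2 : ℂ) * ((∑ a, BS.φ a x (D (BS.s a) x) : ℝ) -
      I * (∑ a, BS.φ a x (I • D (BS.s a) x) : ℝ)) := by
    rw [show ((d : ℝ) : ℂ) = Module.finrank ℂ G by simp [d], ← e, mul_sum]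
    push_cast
    rw [mul_sum, ← sum_sub_distrib, mul_sum]
    refine sum_ext fun a => ?_
    rw [← smul_eq_mul (z x), ← map_smul, ← hz x]
    rfl
  have := nontrivial_fibre σ x
  have eq : S x ≃ₗ[ℂ] G := (trivializationAt G S x).linearEquivAt (R := ℂ) x
    (mem_baseSet_trivializationAt G S x)
  have : Nontrivial G := eq.symm.toEquiv.nontrivial
  have hd : (d : ℂ) ≠ 0 := by
    simpa [d] using (Module.finrank_pos (R := ℂ) (M := G)).ne'
  have e2 : D s x = (((1 / (2 * d)) * ∑ a, BS.φ a x (D (BS.s a) x) : ℝ) : ℂ) • s x +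
      I • ((-((1 / (2 * d)) * ∑ a, BS.φ a x (I • D (BS.s a) x)) : ℝ) : ℂ) • s x := by
    rw [hz, smul_smul, ← add_smul]
    congr 1
    rw [eq_div_of_mul_eq hd e1]
    push_cast
    field_simp
    ring
  rw [e2]
  have e3 : ∀ t : Fin BS.m → 𝔖, ∑ a, BS.φ a x (t a x) = (∑ a, BS.coord a (t a)) x :=
    fun t => (function_sum_apply Finset.univ (fun a => BS.coord a (t a)) x).symm
  have e4 := e3 fun a => D (BS.s a)
  have e5 := e3 fun a => I • D (BS.s a)
  change _ = (1 / (2 * d) * (∑ a, BS.coord a (D (BS.s a))) x) • s x +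
    I • (-(1 / (2 * d) * (∑ a, BS.coord a (I • D (BS.s a))) x)) • s x
  rw [← e4, ← e5]
  refine congrArg₂ (· + ·) ?_ (congrArg (I • ·) ?_)
  all_goals exact algebraMap_smul (R := ℝ) ℂ _ (s x)

end

lemma exists_covDer (BS : BundleFrame n G S)
    (X : Derivation ℝ 𝓒 𝓒) : ∃ D : 𝔅, ∀ f, D * μ f - μ f * D = μ (X f) := by
  let L : 𝔖 →+ 𝔖 :=
    { toFun := fun s => ∑ a, X (BS.coord a s) • BS.s a
      map_zero' := by simp only [map_zero, zero_smul, sum_const_zero]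
      map_add' := fun s t => by simp only [map_add, add_smul, sum_add_distrib] }
  have hL : ∀ (f : 𝓒) s, L (f • s) = f • L s + X f • s := fun f s => by
    have e : X f • s = ∑ a, (X f * BS.coord a s) • BS.s a := by
      conv_lhs => rw [← BS.sum_coord s, smul_sum]
      simp only [smul_smul]
    rw [e, show f • L s = ∑ a, f • X (BS.coord a s) • BS.s a from
      smul_sum (s := Finset.univ) (f := fun a => X (BS.coord a s) • BS.s a), ← sum_add_distrib]
    change ∑ a, X (BS.coord a (f • s)) • BS.s a = _
    refine sum_ext fun a => ?_
    rw [map_smul, smul_eq_mul, Derivation.leibniz, add_smul, smul_smul, smul_eq_mul, smul_eq_mul,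
      mul_comm (X f)]
  have hc : ∀ (z : ℂ) (f : 𝓒) (s : 𝔖), z • f • s = f • z • s :=
    fun z f s => ((μ f).map_smul z s).symm
  let D : 𝔖 → 𝔖 :=
    fun s => (1 / 2 : ℂ) • (L s - I • L (I • s))
  have hadd : ∀ s t, D (s + t) = D s + D t := fun s t => by
    simp only [D]
    rw [smul_add, map_add, map_add, ← smul_add (1 / 2 : ℂ), smul_add]
    congr 1
    abel
  have hleib : ∀ (f : 𝓒) s, D (f • s) = X f • s + f • D s := fun f s => by
    conv_rhs => rw [← half_sub_I (X f • s)]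
    simp only [D]
    rw [hc, hL, hL, hc, smul_add, hc, ← hc (1 / 2), ← smul_add, hc, smul_sub f]
    congr 1
    abel
  have hI : ∀ s, D (I • s) = I • D s := fun s => by
    simp only [D]
    rw [smul_comm I (1 / 2 : ℂ), smul_sub I, smul_smul, smul_smul, Complex.I_mul_I,
      neg_one_smul, neg_one_smul, map_neg, smul_neg, sub_neg_eq_add, sub_neg_eq_add, add_comm]
  have hz : ∀ (z : ℂ) (s : 𝔖), z • s =
      algebraMap ℝ 𝓒 z.re • s + algebraMap ℝ 𝓒 z.im • I • s := by
    intro z s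
    ext x
    change z • s x = z.re • s x + z.im • I • s x
    conv_lhs => rw [← Complex.re_add_im z, add_smul, mul_smul]
    exact congrArg₂ (· + ·) (algebraMap_smul (R := ℝ) ℂ _ (s x))
      (algebraMap_smul (R := ℝ) ℂ _ (I • s x))
  refine ⟨{ toFun := D, map_add' := hadd, map_smul' := fun z s => ?_ }, fun f => ?_⟩
  · rw [hz, hadd, hleib, hleib, hI, Derivation.map_algebraMap, Derivation.map_algebraMap, zero_smul,
      zero_smul, zero_add, zero_add, RingHom.id_apply, hz z (D s)]
  · exact LinearMap.ext fun s => sub_eq_of_eq_add (hleib f s)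

lemma exists_compatible (σ : SpinorStructure g G S) (BE : BundleFrame n F E)
    (BS : BundleFrame n G S) {r : ℕ} (hr : Module.finrank ℝ F = 2 * r) {l : ℕ}
    {f : Fin l → 𝓒} {V : Fin l → Derivation ℝ 𝓒 𝓒}
    (hV : ∀ D : Derivation ℝ 𝓒 𝓒, ∑ j, D (f j) • V j = D) : ∃ nE nS, σ.Compatible nE nS := by
  choose D hD using exists_covDer (S := S) BS
  obtain ⟨N, h1, h2, h3, h4⟩ := (σ.act BE).exists_spinConn (q := kp BE 0 * kp BE 1) (by
      have := killer_coprime_add_two r (BE.m + 2)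
      rw [show (-2 - ((σ.act BE).rank : ℂ)) = ((-2 * r - 2 : ℤ) : ℂ) by
        rw [show (σ.act BE).rank = Module.finrank ℝ F from rfl, hr]; push_cast; ring, kp, kp, hr]
      exact this)
    (fun T hT => killed_of_comm BE BS hr hT) hV hD
  exact ⟨(σ.act BE).conn, ⟨N, h1, fun f X s => LinearMap.congr_fun (h2 f X) s,
    fun X f s => eq_add_of_sub_eq (LinearMap.congr_fun (h3 X f) s)⟩, (σ.act BE).conn_isMetric, h4⟩

lemma cop_le_parity {p : ZMod 2} {T : 𝔅} : T ∈ cop σ p → T ∈ σ.parity p :=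
  fun ⟨u, hu, h⟩ => ⟨Algebra.subset_adjoin (Or.inl ⟨fun x => σ.rep x (u x), h⟩),
    subset_span (.clifford p T ⟨u, hu, h⟩)⟩

lemma mulHom_mem_cop (f : 𝓒) : μ f ∈ cop σ 0 :=
  ⟨fun x => ((f x : ℝ) : ℂ) • 1, fun x => smul_mem _ _
    (tmul_mem_baseChange_of_mem (1 : ℂ)
      (Submodule.one_le.1 (CliffordAlgebra.one_le_evenOdd_zero (g.quad x)))),
    fun s x => by
      rw [map_smul, map_one]
      exact (algebraMap_smul (R := ℝ) ℂ (f x) (s x)).symm⟩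

/-- The operators on the spinor bundle. -/
def ops [FiniteDimensional ℂ G] (σ : SpinorStructure g G S) (BE : BundleFrame n F E)
    (BS : BundleFrame n G S) {r : ℕ} (hr : Module.finrank ℝ F = 2 * r)
    (hF : Module.finrank ℝ F ≠ 0) {l : ℕ} {f : Fin l → 𝓒} {V : Fin l → Derivation ℝ 𝓒 𝓒}
    (hV : ∀ D : Derivation ℝ 𝓒 𝓒, ∑ j, D (f j) • V j = D) : CliffordOps g.onSections 𝔅 where
  par := σ.parity
  one_mem := σ.one_mem_parity
  mul_mem := σ.mul_mem_parity
  m := μ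
  c := σ.gam
  c_add := map_add (σ.act BE).c
  c_smul := (σ.act BE).c_smul
  m_comm := (σ.act BE).m_comm
  cliff := (σ.act BE).cliff
  m_mem f := cop_le_parity (mulHom_mem_cop f)
  c_mem ξ := cop_le_parity (gam_mem_cop ξ)
  disj _ := parity_disjoint BE BS hr
  even_eq _ _ := eq_mulHom_of_even BE BS hF
  odd_eq _ := eq_zero_of_odd BE BS hr
  m_inj _ _ := mulHom_injective BS σ
  frames := ⟨BE.m, (σ.act BE).e, (σ.act BE).e', (σ.act BE).sum_left, (σ.act BE).sum_right, l, f, V, hV,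
    (σ.act BE).symm⟩
  rank := Module.finrank ℝ F
  rank_ne := by exact_mod_cast hF
  sum_rank := (σ.act BE).sum_rank

lemma Compatible.isSpinConn [FiniteDimensional ℂ G] {hF : Module.finrank ℝ F ≠ 0} {l : ℕ}
    {f : Fin l → 𝓒} {V : Fin l → Derivation ℝ 𝓒 𝓒}
    {hV : ∀ D : Derivation ℝ 𝓒 𝓒, ∑ j, D (f j) • V j = D} {nE nS} (h : σ.Compatible nE nS) :
    (σ.ops BE BS hr hF hV).IsSpinConn nE nS.toFun where
  metric := h.1
  mem X := ⟨Algebra.subset_adjoin (Or.inr ⟨nS, X, rfl⟩), subset_span (.nabla nE nS X h)⟩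
  comm_c := h.2
  comm_m := nabla_mu nS
  add := nS.map_add
  smul f X := LinearMap.ext (nS.map_smul f X)

end SpinorStructure

end Operators

end SpinGr

end

set_option maxHeartbeats 1000000 in
theorem mainTheorem6
    {n : ℕ} {M : Type*} [TopologicalSpace M] [T2Space M] [SecondCountableTopology M]
    [ChartedSpace (EuclideanSpace ℝ (Fin n)) M] [IsManifold (𝓡 n) ∞ M]
    {F : Type*} [NormedAddCommGroup F] [NormedSpace ℝ F] [FiniteDimensional ℝ F]
    {E : M → Type*} [∀ x, AddCommGroup (E x)] [∀ x, Module ℝ (E x)] [∀ x, TopologicalSpace (E x)]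
    [TopologicalSpace (TotalSpace F E)] [FiberBundle F E] [VectorBundle ℝ F E]
    [ContMDiffVectorBundle ∞ F E (𝓡 n)]
    {G : Type*} [NormedAddCommGroup G] [NormedSpace ℝ G] [NormedSpace ℂ G] [IsScalarTower ℝ ℂ G]
    [FiniteDimensional ℂ G]
    {S : M → Type*} [∀ x, AddCommGroup (S x)] [∀ x, Module ℝ (S x)] [∀ x, Module ℂ (S x)]
    [∀ x, IsScalarTower ℝ ℂ (S x)] [∀ x, TopologicalSpace (S x)]
    [TopologicalSpace (TotalSpace G S)] [FiberBundle G S] [VectorBundle ℝ G S]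
    [VectorBundle ℂ G S] [ContMDiffVectorBundle ∞ G S (𝓡 n)]
    (hrank : Even (Module.finrank ℝ F)) (hpos : 0 < Module.finrank ℝ F)
    (g : PseudoMetric n F E) (σ : SpinorStructure g G S) :
    -- the Poisson brackets of the graded algebra of operators, of `T*[2]E[1]`, and of `𝓜`
    ∃ (bGr : σ.GrOp →ₗ[ℂ] σ.GrOp →ₗ[ℂ] σ.GrOp)
      (bT : CotFun C^∞⟮𝓡 n, M; ℝ⟯ Cₛ^∞⟮𝓡 n; F, E⟯ →ₗ[ℝ]
        CotFun C^∞⟮𝓡 n, M; ℝ⟯ Cₛ^∞⟮𝓡 n; F, E⟯ →ₗ[ℝ] CotFun C^∞⟮𝓡 n, M; ℝ⟯ Cₛ^∞⟮𝓡 n; F, E⟯)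
      (bM : RoyFun g.onSections →ₗ[ℝ] RoyFun g.onSections →ₗ[ℝ] RoyFun g.onSections)
      (ρ : σ.GrOp ≃ₐ[ℂ] ℂ ⊗[ℝ] RoyFun g.onSections),
      (∀ b, σ.IsCommutatorBracket b ↔ b = bGr) ∧
      IsPoissonBracket σ.filt.grDeg bGr ∧
      (∀ b, IsCanonicalBracket b ↔ b = bT) ∧
      (∀ b, IsRestrictedBracket g.onSections bT b ↔ b = bM) ∧
      IsPoissonBracket (royDeg g.onSections) bM ∧
      -- `ρ` is an isomorphism of graded Poisson algebras
      (∀ k, (σ.filt.grDeg k).map ρ.toLinearMap = (royDeg g.onSections k).baseChange ℂ) ∧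
      (∀ x y, ρ (bGr x y) = LinearMap.BilinMap.baseChange ℂ bM (ρ x) (ρ y)) ∧
      -- compatible pairs of connections exist, and for all of them `ρ` is the composition of the
      -- symbol isomorphism with the pullback by `Ξ_∇`
      (∃ nE nS, σ.Compatible nE nS) ∧
      ∀ nE nS, σ.Compatible nE nS →
        ∃ (Φ : σ.GrOp ≃ₐ[ℂ] ℂ ⊗[ℝ] SplitFun C^∞⟮𝓡 n, M; ℝ⟯ Cₛ^∞⟮𝓡 n; F, E⟯)
          (Ξ : SplitFun C^∞⟮𝓡 n, M; ℝ⟯ Cₛ^∞⟮𝓡 n; F, E⟯ →ₐ[ℝ] RoyFun g.onSections),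
          (∀ Φ', σ.IsSymbolIso nS Φ' ↔ Φ' = Φ) ∧
          (∀ Ξ', IsXiPullback g.onSections nE Ξ' ↔ Ξ' = Ξ) ∧
          ∀ x, ρ x = Algebra.TensorProduct.map (AlgHom.id ℂ ℂ) Ξ (Φ x) := by
  obtain ⟨r, hr⟩ := hrank
  rw [← two_mul] at hr
  have : FiniteDimensional ℝ G := Module.Finite.trans ℂ G
  obtain ⟨BE⟩ := nonempty_bundleFrame n F E
  obtain ⟨BS⟩ := nonempty_bundleFrame n G S
  obtain ⟨l, f, V, hV⟩ := exists_vectorField_frame n M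
  obtain ⟨nE, nS, hc⟩ := SpinorStructure.exists_compatible σ BE BS hr hV
  let O := σ.ops BE BS hr hpos.ne' hV
  have hO : ∀ {nE nS}, σ.Compatible nE nS → O.IsSpinConn nE nS.toFun := fun h => h.isSpinConn BE BS hr
  obtain ⟨bM, hM⟩ := O.frames.exists_royBracket hc.1
  obtain ⟨ρ, h1, h2, h3, h4, h5⟩ := O.exists_iso (hO hc) hM
  refine ⟨O.bracket, CotFun.bracket _ _, bM, ρ, O.bracket_iff, O.isPoissonBracket_bracket,
    isCanonicalBracket_iff, fun b => ⟨fun h => O.frames.isRestrictedBracket_unique hc.1 h hM, ?_⟩,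
    O.frames.isPoissonBracket_roy hc.1 hM, h1, h2, ⟨nE, nS, hc⟩, fun nE nS h => ?_⟩
  · rintro rfl; exact hM
  · obtain ⟨Φ, h6, h7⟩ := O.exists_symbolIso h3 h4 (h5 nE nS.toFun (hO h))
    refine ⟨Φ, xi g.onSections nE, fun Φ' => ?_, isXiPullback_iff nE, h7⟩
    refine Iff.trans ?_ (h6 Φ')
    exact and_congr (forall_congr' fun f => Filt.exists_grMk_iff (O.mem_W (O.m_mem_H f)))
      (and_congr (forall_congr' fun ξ => Filt.exists_grMk_iff (O.mem_W (O.nc_mem_H ξ)))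
        (forall_congr' fun X => Filt.exists_grMk_iff (O.mem_W ((hO h).mem_H X))))
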